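/- Let $F$ be a nonarchimedean local field of characteristic $0$ with ring of integers $\mathcal O$, maximal ideal $\mathfrak p$, residue field of cardinality $q$ and normalized valuation $\mathrm{ord}$. Let $E$ be a quadratic étale $F$-algebra (so $E$ is an unramified quadratic field extension of $F$, "inert", or a ramified quadratic field extension, or $E\cong F\oplus F$, "split"), with nontrivial $F$-automorphism $x\mapsto\bar x$. Let $\mathcal O_E$ be the integral closure of $\mathcal O$ in $E$, let $\mathfrak q$ be its maximal ideal ($\mathfrak q=\mathfrak p\oplus\mathfrak p$ if $E$ is split), and put $q_E=\#(\mathcal O_E/\mathfrak q)$. Let $\mathfrak D$ be the discriminant ideal of $E/F$, $\mathfrak f=\mathrm{ord}(\mathfrak D)$, and let $\mathfrak d^{-1}=\{x\in E: \mathrm{tr}_{E/F}(x\mathcal O_E)\subset\mathcal O\}$ be the inverse different. Choose a prime element $\varpi$ of $F$ and $\varpi_E\in E^\times$ with $N_{E/F}(\varpi_E)=\varpi$ if $E$ is ramified and $\varpi_E=\varpi$ otherwise. Put $\xi=1,-1,0$ according as $E$ is split, inert or ramified, and $\hat\xi=\sqrt{-1}$ if $E$ is inert, $\hat\xi=1$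 otherwise. Fix an additive character $\psi$ of $F$ which is trivial on $\mathcal O$ and on no larger fractional ideal. For $A,X\in\mathrm{Mat}_n(E)$ put $X^*={}^t\bar X$ and $A[X]=X^*AX$. Let $\mathrm{Her}_n(F)=\{A\in \mathrm{Mat}_n(E):A^*=A\}$, $\mathrm{Her}_n(\mathcal O_E)=\mathrm{Her}_n(F)\cap\mathrm{Mat}_n(\mathcal O_E)$, and let $\widehat{\mathrm{Her}}_n$ be the set of $A\in\mathrm{Her}_n(F)$ with $\mathrm{tr}(AC)\in\mathcal O$ for all $C\in\mathrm{Her}_n(\mathcal O_E)$. For $B\in\widehat{\mathrm{Her}}_n$ the Siegel series is $$b(B;s)=\sum_{z\in\mathrm{Her}_n(F)/\mathrm{Her}_n(\mathcal O_E)}\psi(\mathrm{tr}(Bz))\,\mu(z)^{-s},\qquad \mu(z)=[z\mathcal O_E^n+\mathcal O_E^n:\mathcal O_E^n]^{1/2},\quad \mathrm{Re}(s)\gg0,$$ and $F(B;X)$ is the polynomial with $$b(B;s)=F(B;q^{-s})\prod_{i=0}^{[(n-1)/2]}(1-q^{2i-s})\prod_{i=1}^{[n/2]}(1-\xi q^{2i-1-s}).$$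 Put $F(B;X)=0$ if $B\notin\widehat{\mathrm{Her}}_n$. For $B\in\mathrm{Her}_n(F)$ with $\det B\neq0$ put $$\widetilde F(B;X)=X^{-e(B)}F(B;q^{-n}X^2),\qquad e(B)=\mathrm{ord}(\mathfrak D^{[n/2]}\det B).$$ Let $\mathcal K_n=\mathrm{GL}_n(\mathcal O_E)$, let $\pi$ be one of $\varpi,\varpi_E$ (they differ only if $E$ is ramified; the result holds for both choices), let $\mathcal D_{n,i}=\mathcal K_n(1_{n-i}\perp\pi 1_i)\mathcal K_n$ for $0\le i\le n$, and put $$\widetilde G(A;X,t)=\sum_{i=0}^n\ \sum_{W\in\mathcal K_n\backslash\mathcal D_{n,i}}(-1)^iq_E^{i(i-1)/2}\,t^{\mathrm{ord}(N_{E/F}(\det W))}\,\widetilde F(A[W^{-1}];X).$$ If $E$ is not ramified put $\Theta_k=1_k$ for $k\ge0$; if $E$ is ramified and $k$ is even, let $\Theta_k$ be the orthogonal sum of $k/2$ copies of $\begin{pmatrix}0&\varpi_E^{-\mathfrak f}\\ \bar\varpi_E^{-\mathfrak f}&0\end{pmatrix}$. If $E$ is not ramified let $\mathrm{Her}_{r,*}=\mathfrak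 p\widehat{\mathrm{Her}}_r$; if $E$ is ramified let $\mathrm{Her}_{r,*}$ be the set of $(a_{ij})\in\mathrm{Her}_r(F)$ with $a_{ij}\in\mathfrak q\mathfrak d^{-1}$ for $i\ne j$ and $a_{ii}\in\mathcal O$. **Lemma.** Let $1\le r\le m$ be integers and let $B'\in\mathrm{Her}_{r,*}$ with $\det B'\ne0$. Assume either that $E/F$ is ramified and $m-r$ is even, or that $E/F$ is not ramified. Then for all $X\in\mathbb C^\times$ and $t\in\mathbb C$ $$\widetilde G(\Theta_{m-r}\perp B';X,t)=\widetilde G(B';\hat\xi^{\,m-r}X,\hat\xi^{\,m-r}t)\,\hat\xi^{\,(m-r)\,\mathrm{ord}(\det B')}.$$ -/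

import Mathlib

namespace HermSiegel

open ValuativeRel Polynomial

noncomputable section

/-! ## The local quadratic algebra `E / F` -/

section ToBase

variable (F : Type*) [Field F] {E : Type*} [CommRing E] [Algebra F E]

/-- For an element `x` of `E` that lies in `F`, this is `x` as an element of `F`. It is applied only
to determinants of Hermitian matrices and traces of products of two Hermitian matrices. -/
def toBase (x : E) : F := Function.invFun (algebraMap F E) x

theorem algebraMap_toBase {x : E} (hx : ∃ a : F, algebraMap F E a = x) :
    algebraMap F E (toBase F x) = x :=
  Function.invFun_eq hx

end ToBase

section Base

variable (F : Type*) [Field F] [ValuativeRel F] [TopologicalSpace F] [IsNonarchimedeanLocalField F]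

/-- The normalized additive valuation `ord` of the local field `F` (with junk value `0` at `0`). -/
def ord (x : F) : ℤ :=
  -WithZero.log (IsNonarchimedeanLocalField.valueGroupWithZeroIsoInt F (valuation F x))

/-- The cardinality `q` of the residue field of `F`. -/
def q : ℕ := Nat.card 𝓀[F]

variable (E : Type*) [CommRing E] [Algebra F E]

/-- `O_E`, the integral closure in `E` of the ring of integers of `F`
(so `O_E = O × O` if `E = F × F`). -/
abbrev OE : Subalgebra 𝒪[F] E := integralClosure 𝒪[F] E

/-- The Jacobson radical of `O_E`: this is the maximal ideal if `E` is a field, and it is `𝔭 × 𝔭`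
if `E = F × F`. -/
def 𝔮 : Ideal (OE F E) := (⊥ : Ideal (OE F E)).jacobson

/-- `q_E`, the cardinality of `O_E / 𝔮`. -/
def qE : ℕ := Nat.card (OE F E ⧸ 𝔮 F E)

/-- `E` is isomorphic to `F × F`. -/
def IsSplit : Prop := Nonempty (E ≃ₐ[F] F × F)

/-- `E` is a field in which the maximal ideal of `O_F` remains prime. -/
def IsInert : Prop := IsField E ∧ (Ideal.map (algebraMap 𝒪[F] (OE F E)) 𝓂[F]).IsPrime

/-- `E` is a field in which the maximal ideal of `O_F` does not remain prime. For a quadratic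
extension of local fields this means that the extension is ramified. -/
def IsRamified : Prop := IsField E ∧ ¬ (Ideal.map (algebraMap 𝒪[F] (OE F E)) 𝓂[F]).IsPrime

open Classical in
/-- `ξ = 1, -1, 0` according as `E` is split, inert or ramified. -/
def xi : ℂ := if IsSplit F E then 1 else if IsInert F E then -1 else 0

open Classical in
/-- `ξ̂ = √-1` if `E` is inert, and `ξ̂ = 1` otherwise. -/
def xiHat : ℂ := if IsInert F E then Complex.I else 1

/-- The discriminant ideal of `E / F`: the ideal of `O_F` generated by the discriminants of all
pairs of elements of `O_E`. -/
def discIdeal : Ideal 𝒪[F] :=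
  Ideal.span {d | ∃ x y : OE F E, (d : F) = Algebra.discr F ![(x : E), (y : E)]}

/-- The exponent `𝔣` of the discriminant ideal: the least order of its nonzero elements. -/
def 𝔣 : ℕ := sInf {k : ℕ | ∃ d ∈ discIdeal F E, d ≠ 0 ∧ ord F (d : F) = k}

/-- The inverse different `{x ∈ E | Tr(x O_E) ⊆ O_F}` as an `O_E`-submodule of `E`. -/
def invDifferent : Submodule (OE F E) E where
  carrier := {x | ∀ y ∈ OE F E, Algebra.trace F E (x * y) ∈ 𝒪[F]}
  add_mem' := by
    intro a b ha hb y hy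
    rw [add_mul, map_add]
    exact add_mem (ha y hy) (hb y hy)
  zero_mem' := by
    intro y _
    simp
  smul_mem' := by
    intro c x hx y hy
    have h : c • x * y = x * ((c : E) * y) := by
      rw [Algebra.smul_def]
      change (c : E) * x * y = _
      ring
    rw [h]
    exact hx _ (mul_mem c.2 hy)

variable {F}

/-- The additive character `ψ` of `F` is unramified: `O_F` is the largest fractional ideal on which
it is trivial. -/
def IsUnramifiedChar (ψ : AddChar F Circle) : Prop :=
  ∀ y : F, (∀ x ∈ 𝒪[F], ψ (y * x) = 1) ↔ y ∈ 𝒪[F]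

end Base

/-! ## Hermitian matrices -/

section Hermitian

variable {F : Type*} [Field F] [ValuativeRel F] [TopologicalSpace F] [IsNonarchimedeanLocalField F]
variable {E : Type*} [CommRing E] [Algebra F E] (σ : E ≃ₐ[F] E)
variable {ι : Type*} [Fintype ι] [DecidableEq ι]

/-- `X^*`, the conjugate transpose with respect to the involution `σ`. -/
def adj (X : Matrix ι ι E) : Matrix ι ι E := (X.map σ).transpose

/-- `A[X] = X^* A X`. -/
def act (A X : Matrix ι ι E) : Matrix ι ι E := adj σ X * A * X

variable (ι)

/-- The additive group `Her(F)` of Hermitian matrices with entries in `E`. -/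
def Her : AddSubgroup (Matrix ι ι E) where
  carrier := {A | adj σ A = A}
  add_mem' := by
    intro a b ha hb
    change adj σ (a + b) = a + b
    have ha : adj σ a = a := ha
    have hb : adj σ b = b := hb
    conv_rhs => rw [← ha, ← hb]
    ext i j
    simp [adj]
  zero_mem' := by
    ext i j
    simp [adj]
  neg_mem' := by
    intro a ha
    change adj σ (-a) = -a
    have ha : adj σ a = a := ha
    conv_rhs => rw [← ha]
    ext i j
    simp [adj]

/-- The subgroup of `Her(F)` of the Hermitian matrices with entries in `O_E`. -/
def HerInt : AddSubgroup (Her σ ι) where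
  carrier := {A | ∀ i j, (A : Matrix ι ι E) i j ∈ OE F E}
  add_mem' := by
    intro a b ha hb i j
    exact add_mem (ha i j) (hb i j)
  zero_mem' := by
    intro i j
    exact zero_mem _
  neg_mem' := by
    intro a ha i j
    exact neg_mem (ha i j)

variable {ι}

/-- Semi-integral Hermitian matrices: `tr(AC) ∈ O_F` for all Hermitian `C` with entries
in `O_E`. -/
def IsSemiIntegral (A : Matrix ι ι E) : Prop :=
  A ∈ Her σ ι ∧
    ∀ C : HerInt σ ι, ∃ a : 𝒪[F], (A * ((C : Her σ ι) : Matrix ι ι E)).trace = algebraMap F E a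

/-- The set `Her_*`. If `E` is not ramified it is `𝔭` times the set of semi-integral matrices; if `E`
is ramified it consists of the Hermitian matrices with off-diagonal entries in `𝔮` times the inverse
different, and with diagonal entries in `O_F`. -/
def IsStar (A : Matrix ι ι E) : Prop :=
  (¬ IsRamified F E ∧
    ∃ a : 𝒪[F], a ∈ 𝓂[F] ∧ ∃ A' : Matrix ι ι E, IsSemiIntegral σ A' ∧ A = (a : F) • A') ∨
  (IsRamified F E ∧ A ∈ Her σ ι ∧
    (∀ i j, i ≠ j → A i j ∈ 𝔮 F E • invDifferent F E) ∧
    ∀ i, ∃ a : 𝒪[F], A i i = algebraMap F E a)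

/-! ## Siegel series -/

variable (F E ι) in
/-- The lattice `O_E^n`. -/
def stdLattice : AddSubgroup (ι → E) where
  carrier := {x | ∀ i, x i ∈ OE F E}
  add_mem' := by
    intro a b ha hb i
    exact add_mem (ha i) (hb i)
  zero_mem' := by
    intro i
    exact zero_mem _
  neg_mem' := by
    intro a ha i
    exact neg_mem (ha i)

variable (F) in
/-- `μ(z) = [z O_E^n + O_E^n : O_E^n]^{1/2}`. -/
def mu (z : Matrix ι ι E) : ℝ :=
  Real.sqrt ((stdLattice F E ι).relIndex
    ((stdLattice F E ι).map (Matrix.mulVecLin z).toAddMonoidHom ⊔ stdLattice F E ι))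

/-- The summand `ψ(tr(Bz)) μ(z)^{-s}` of the Siegel series. If `B` is semi-integral, it depends only
on the class of `z` modulo the Hermitian matrices with entries in `O_E`. -/
def siegelTerm (ψ : AddChar F Circle) (B : Matrix ι ι E) (s : ℂ) (z : Her σ ι ⧸ HerInt σ ι) : ℂ :=
  (ψ (toBase F (B * ((Quotient.out z : Her σ ι) : Matrix ι ι E)).trace) : ℂ) *
    (mu F ((Quotient.out z : Her σ ι) : Matrix ι ι E) : ℂ) ^ (-s)

/-- The Siegel series `b(B; s)`. -/
def siegelSeries (ψ : AddChar F Circle) (B : Matrix ι ι E) (s : ℂ) : ℂ :=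
  ∑' z, siegelTerm σ ψ B s z

variable (F E) in
/-- `∏_{i=0}^{[(n-1)/2]} (1 - q^{2i-s}) ∏_{i=1}^{[n/2]} (1 - ξ q^{2i-1-s})`. -/
def eulerFactor (n : ℕ) (s : ℂ) : ℂ :=
  (∏ i ∈ Finset.range ((n + 1) / 2), (1 - (q F : ℂ) ^ (2 * (i : ℂ) - s))) *
    ∏ i ∈ Finset.Icc 1 (n / 2), (1 - xi F E * (q F : ℂ) ^ (2 * (i : ℂ) - 1 - s))

/-- `P` is the polynomial part of the Siegel series of `B`: for all `s` with sufficiently large real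
part the series converges absolutely, and its value is `P(q^{-s})` times the Euler factor. This
determines `P`. -/
def IsSiegelPolynomial (ψ : AddChar F Circle) (B : Matrix ι ι E) (P : ℂ[X]) : Prop :=
  ∃ s₀ : ℝ, ∀ s : ℂ, s₀ < s.re → Summable (siegelTerm σ ψ B s) ∧
    siegelSeries σ ψ B s = P.eval ((q F : ℂ) ^ (-s)) * eulerFactor F E (Fintype.card ι) s

open Classical in
/-- The polynomial `F(B; X)`, which is `0` if `B` is not semi-integral. -/
def siegelPoly (ψ : AddChar F Circle) (B : Matrix ι ι E) : ℂ[X] :=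
  if h : IsSemiIntegral σ B ∧ ∃ P, IsSiegelPolynomial σ ψ B P then h.2.choose else 0

variable (F) in
/-- `e(B) = ord(𝔇^{[n/2]} det B)`, where `𝔇` is the discriminant ideal. -/
def eB (B : Matrix ι ι E) : ℤ :=
  (𝔣 F E : ℤ) * ((Fintype.card ι / 2 : ℕ) : ℤ) + ord F (toBase F B.det)

/-- `F̃(B; X) = X^{-e(B)} F(B; q^{-n} X^2)`. -/
def Ftilde (ψ : AddChar F Circle) (B : Matrix ι ι E) (X : ℂ) : ℂ :=
  X ^ (-eB F B) * (siegelPoly σ ψ B).eval ((q F : ℂ) ^ (-(Fintype.card ι : ℤ)) * X ^ 2)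

/-! ## The series `G̃` -/

variable (F E ι) in
/-- `K = GL_n(O_E)` as a subgroup of `GL_n(E)`. -/
def K : Subgroup (Matrix.GeneralLinearGroup ι E) :=
  (Matrix.GeneralLinearGroup.map (n := ι) (algebraMap (OE F E) E)).range

variable (F ι) in
/-- The double coset `𝒟_i = K (1_{n-i} ⊥ π 1_i) K`. The positions `s` of the `i` diagonal entries `π`
do not matter, because `K` contains the permutation matrices. -/
def D (π : Eˣ) (i : ℕ) : Set (Matrix.GeneralLinearGroup ι E) :=
  {W | ∃ s : Finset ι, s.card = i ∧ ∃ U ∈ K F E ι, ∃ V ∈ K F E ι,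
    (W : Matrix ι ι E) =
      (U : Matrix ι ι E) * Matrix.diagonal (fun j => if j ∈ s then (π : E) else 1) *
        (V : Matrix ι ι E)}

variable (F ι) in
/-- The set `K \ 𝒟_i` of the cosets `K W` contained in `𝒟_i`. -/
def cosets (π : Eˣ) (i : ℕ) : Set (Quotient (QuotientGroup.rightRel (K F E ι))) :=
  Quotient.mk _ '' D F ι π i

/-- `G̃(A; X, t) = ∑_{i=0}^n ∑_{W ∈ K \ 𝒟_i} 𝔪(W) t^{ord N(det W)} F̃(A[W⁻¹]; X)`, where
`𝔪(W) = (-1)^i q_E^{i(i-1)/2}` for `W ∈ 𝒟_i`. -/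
def Gtilde (ψ : AddChar F Circle) (π : Eˣ) (A : Matrix ι ι E) (X t : ℂ) : ℂ :=
  ∑ i ∈ Finset.range (Fintype.card ι + 1), ∑ᶠ c ∈ cosets F ι π i,
    (-1) ^ i * (qE F E : ℂ) ^ (i * (i - 1) / 2) *
      t ^ ord F (Algebra.norm F ((Quotient.out c : Matrix.GeneralLinearGroup ι E) :
        Matrix ι ι E).det) *
      Ftilde σ ψ (act σ A (((Quotient.out c)⁻¹ : Matrix.GeneralLinearGroup ι E) :
        Matrix ι ι E)) X

open Classical in
/-- The matrix `Θ_k`. If `E` is not ramified it is `1_k`. If `E` is ramified and `k` is even (the only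
case in which it is used), it is the orthogonal sum of `k/2` copies of the matrix with rows
`(0, ϖ_E^{-𝔣})` and `(σ(ϖ_E)^{-𝔣}, 0)`. -/
def Theta (ϖE : Eˣ) (k : ℕ) : Matrix (Fin k) (Fin k) E :=
  if IsRamified F E then
    Matrix.of fun i j =>
      if (i : ℕ) % 2 = 0 ∧ (j : ℕ) = i + 1 then ((ϖE⁻¹ ^ 𝔣 F E : Eˣ) : E)
      else if (j : ℕ) % 2 = 0 ∧ (i : ℕ) = j + 1 then σ ((ϖE⁻¹ ^ 𝔣 F E : Eˣ) : E)
      else 0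
  else 1

variable {κ : Type*} [Fintype κ] [DecidableEq κ]

/-- The orthogonal sum `A ⊥ B`. -/
def perp (A : Matrix ι ι E) (B : Matrix κ κ E) : Matrix (ι ⊕ κ) (ι ⊕ κ) E :=
  Matrix.fromBlocks A 0 0 B

variable (F) in
/-- `ϖ` is a prime element of `F`, and `ϖ_E` is a compatible element of `E`: `N(ϖ_E) = ϖ` if `E` is
ramified, and `ϖ_E = ϖ` otherwise (in particular `ϖ_E = (ϖ, ϖ)` if `E = F × F`). -/
def ArePrimeElements (ϖ : F) (ϖE : Eˣ) : Prop :=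
  ord F ϖ = 1 ∧ (IsRamified F E → Algebra.norm F (ϖE : E) = ϖ) ∧
    (¬ IsRamified F E → (ϖE : E) = algebraMap F E ϖ)

end Hermitian

end

end HermSiegel

/-!
The proof splits `Θ = Θ_k`, `k = m - r`, off from the polynomials `F̃` and from the sum over
cosets.

*The Siegel series.* `Θ` is semi-integral and modular: `O_E^k` is its own dual for the trace form
attached to `Θ` (`IsSelfDual`, `isSelfDual_Theta`). In the Siegel series of `Θ ⊥ B` a Hermitian
matrix `z` is written in blocks `a`, `b`, `d`. Conjugation by the unipotent matrix with block `y`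
leaves `μ(z)` unchanged and carries `b` to `b + y d`, which multiplies the sum over `a` by a value
of an additive character (`innerSum_translate`). By modularity the sum over `a` vanishes unless
`b` is congruent to some `y d` with `y` integral, and the sum over `b` is the quadratic Gauss sum
of `Θ` and `d` (`tsum_innerSum`). Multiplying `μ(d) ^ (-s)` by these Gauss sums amounts to a shift
of `s`:

* if `Θ` is a sum of two isotropic subspaces that are split by an integral idempotent, as in the
  split case and for the hyperbolic planes of the ramified case, they are positive square roots of
  the order of a finite group (`IsGaussFun.sum_eq_of_idempotent`);
* in the inert case they are real, because `-1` is the norm of a unit, and congruent to `1` modulo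
  `q + 1`, because a unit of norm close to `1` acts on the nonzero elements with orbits of length
  `q + 1`; this makes them powers of `-q` (`IsGaussFun.sum_eq_of_perm`).

Thus the series of `Θ ⊥ B` at `s` is the series of `Θ` at `s` times the series of `B` at a shifted
argument (`siegelSeries_perp`). The series of the modular lines and planes themselves are
`1 - q ^ (-s)` by a translation argument (`siegelSeries_one`, `siegelSeries_plane`). Comparison of the
Euler factors shows that the polynomial of `Θ_k ⊥ B` is that of `B` in the variable scaled by
`(ξ̂² q) ^ k` (`isScaled_perp_Theta`), so that `F̃(Θ_k ⊥ B; X)` is `F̃(B; ξ̂ ^ k X)` up to a power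
of `ξ̂ ^ k` (`Ftilde_perp`).

*The cosets.* If the coset of `W` contributes to `G̃(Θ ⊥ B)`, then `(Θ ⊥ B)[W⁻¹]` is
semi-integral, and modularity makes the rows of `W⁻¹` that belong to `Θ` integral (`row_mem`).
They are unimodular because `W` is integral. Over the semilocal ring `O_E` unimodular rows can be
completed to an invertible matrix (`exists_completion`), so that the coset contains some `1 ⊥ W'`
(`exists_mul_eq_onePerp`). Moreover `1 ⊥ W'` and `W'` belong to double cosets with the same index
`i` (`onePerp_mem_D`), by a cancellation property of elementary divisors that are `1` or lie in
the radical (`exists_diagonal_of_perp`). The sum for `Θ ⊥ B` therefore reduces to the cosets for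
`B` (`finsum_cosets_perp`), and the factors agree because `ξ̂ ^ 4 = 1` and `ord N(det W') = 2 i`
in the unramified cases (`gTerm_onePerp`).
-/

namespace HermSiegel

open ValuativeRel Polynomial

noncomputable section

set_option linter.unusedSectionVars false

/-! ### The normalized valuation of the base field -/

section Ord

variable {F : Type*} [Field F] [ValuativeRel F] [TopologicalSpace F] [IsNonarchimedeanLocalField F]

theorem ord_zero : ord F 0 = 0 := by simp [ord]

theorem ord_one : ord F 1 = 0 := by simp [ord]

theorem ord_mul {x y : F} (hx : x ≠ 0) (hy : y ≠ 0) : ord F (x * y) = ord F x + ord F y := by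
  unfold ord
  rw [map_mul, map_mul, WithZero.log_mul (by simpa using hx) (by simpa using hy)]
  ring

theorem ord_inv (x : F) : ord F x⁻¹ = -ord F x := by
  by_cases hx : x = 0
  · simp [hx, ord_zero]
  · have := ord_mul hx (inv_ne_zero hx)
    rw [mul_inv_cancel₀ hx, ord_one] at this
    omega

theorem ord_div {x y : F} (hx : x ≠ 0) (hy : y ≠ 0) : ord F (x / y) = ord F x - ord F y := by
  rw [div_eq_mul_inv, ord_mul hx (inv_ne_zero hy), ord_inv]; ring

theorem ord_pow {x : F} (hx : x ≠ 0) (n : ℕ) : ord F (x ^ n) = n * ord F x := by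
  induction n with
  | zero => simp [ord_one]
  | succ n ih => rw [pow_succ, ord_mul (pow_ne_zero _ hx) hx, ih]; push_cast; ring

theorem ord_neg_one : ord F (-1) = 0 := by
  have := ord_mul (F := F) (x := -1) (y := -1) (by simp) (by simp)
  simp only [mul_neg, mul_one, neg_neg, ord_one] at this
  omega

theorem ord_neg (x : F) : ord F (-x) = ord F x := by
  by_cases hx : x = 0
  · simp [hx]
  · rw [neg_eq_neg_one_mul, ord_mul (by simp) hx, ord_neg_one, zero_add]

theorem ord_nonneg_iff {x : F} (hx : x ≠ 0) : 0 ≤ ord F x ↔ x ∈ 𝒪[F] := by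
  rw [Valuation.mem_integer_iff, ord, Left.nonneg_neg_iff,
    WithZero.log_le_iff_le_exp (by simpa using hx), WithZero.exp_zero,
    ← map_one (IsNonarchimedeanLocalField.valueGroupWithZeroIsoInt F), map_le_map_iff]

theorem ord_nonneg (x : 𝒪[F]) : 0 ≤ ord F (x : F) := by
  by_cases hx : (x : F) = 0
  · simp [hx, ord_zero]
  · exact (ord_nonneg_iff hx).2 x.2

theorem ord_eq_zero_of_isUnit {x : 𝒪[F]} (hx : IsUnit x) : ord F (x : F) = 0 := by
  obtain ⟨u, rfl⟩ := hx
  have h1 : ((u : 𝒪[F]) : F) * ((u⁻¹ : (𝒪[F])ˣ) : 𝒪[F]) = 1 := by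
    rw [← Subring.coe_mul, u.mul_inv]; rfl
  have h2 := ord_mul (left_ne_zero_of_mul_eq_one h1) (right_ne_zero_of_mul_eq_one h1)
  rw [h1, ord_one] at h2
  have := ord_nonneg (u : 𝒪[F])
  have := ord_nonneg ((u⁻¹ : (𝒪[F])ˣ) : 𝒪[F])
  omega

theorem isUnit_iff_ord {x : 𝒪[F]} (hx : x ≠ 0) : IsUnit x ↔ ord F (x : F) = 0 := by
  refine ⟨ord_eq_zero_of_isUnit, fun h => ?_⟩
  have hx' : (x : F) ≠ 0 := by simpa using hx
  have : (x : F)⁻¹ ∈ 𝒪[F] := (ord_nonneg_iff (inv_ne_zero hx')).1 (by rw [ord_inv]; omega)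
  exact IsUnit.of_mul_eq_one ⟨_, this⟩ (Subtype.ext (mul_inv_cancel₀ hx'))

theorem mem_max_iff {x : 𝒪[F]} (hx : x ≠ 0) : x ∈ 𝓂[F] ↔ 0 < ord F (x : F) := by
  rw [IsLocalRing.mem_maximalIdeal, mem_nonunits_iff, isUnit_iff_ord hx]
  have := ord_nonneg x
  omega

theorem ord_eq_one_ne_zero {ϖ : F} (h : ord F ϖ = 1) : ϖ ≠ 0 := by
  rintro rfl
  simp [ord_zero] at h

theorem mem_max_iff_exists {ϖ : F} (h : ord F ϖ = 1) (x : 𝒪[F]) :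
    x ∈ 𝓂[F] ↔ ∃ y : 𝒪[F], (x : F) = ϖ * y := by
  have h0 := ord_eq_one_ne_zero h
  by_cases hx : x = 0
  · subst hx
    simp only [zero_mem, true_iff]
    exact ⟨0, by simp⟩
  have hx' : (x : F) ≠ 0 := by simpa using hx
  rw [mem_max_iff hx]
  constructor
  · intro h1
    refine ⟨⟨x / ϖ, (ord_nonneg_iff (div_ne_zero hx' h0)).1 ?_⟩, ?_⟩
    · rw [ord_div hx' h0, h]; omega
    · field_simp
  · rintro ⟨y, hy⟩
    have hy0 : (y : F) ≠ 0 := by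
      intro hy0; exact hx' (by rw [hy, hy0, mul_zero])
    rw [hy, ord_mul h0 hy0, h]
    have := ord_nonneg y
    omega

/-- For `c` in the maximal ideal, Hensel's lemma lifts the root `1` of `ρ² - ρ` to a unit root of
`ρ² - ρ + c`. -/
theorem exists_isUnit_sq_sub_self {c : 𝒪[F]} (hc : c ∈ 𝓂[F]) :
    ∃ ρ : 𝒪[F], IsUnit ρ ∧ ρ ^ 2 - ρ + c = 0 := by
  let _ := IsTopologicalAddGroup.rightUniformSpace F
  have := isUniformAddGroup_of_addCommGroup (G := F)
  have hm : (X ^ 2 - X + C c : 𝒪[F][X]).Monic := by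
    monicity!
  obtain ⟨a, ha, ha1⟩ := HenselianRing.is_henselian (I := 𝓂[F]) (X ^ 2 - X + C c) hm 1
    (by simpa using hc) (by
      simp only [derivative_add, derivative_sub, derivative_X_pow, derivative_X, derivative_C]
      norm_num)
  refine ⟨a, ?_, by simpa [IsRoot] using ha⟩
  by_contra hu
  have h1 : a ∈ 𝓂[F] := hu
  have h2 : (1 : 𝒪[F]) ∈ 𝓂[F] := by
    have := Ideal.sub_mem _ h1 ha1
    rwa [sub_sub_cancel] at this
  exact (Ideal.ne_top_iff_one _).1 (IsLocalRing.maximalIdeal.isMaximal _).ne_top h2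

theorem exists_pow_mul_mem {ϖ : F} (h : ord F ϖ = 1) (x : F) :
    ∃ n : ℕ, ϖ ^ n * x ∈ 𝒪[F] := by
  by_cases hx : x = 0
  · exact ⟨0, by simp [hx]⟩
  have h0 := ord_eq_one_ne_zero h
  refine ⟨(-ord F x).toNat, (ord_nonneg_iff (mul_ne_zero (pow_ne_zero _ h0) hx)).1 ?_⟩
  rw [ord_mul (pow_ne_zero _ h0) hx, ord_pow h0, h]
  have := Int.self_le_toNat (-ord F x)
  omega

end Ord

/-! ### Quadratic étale algebras -/

section Quadratic

variable {F : Type*} [Field F] {E : Type*} [CommRing E] [Algebra F E]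

/-- `E` is a quadratic `F`-algebra and `σ` is a nontrivial `F`-automorphism of it. -/
structure IsQuadConj (σ : E ≃ₐ[F] E) : Prop where
  finrank_eq : Module.finrank F E = 2
  ne_refl : σ ≠ AlgEquiv.refl

theorem IsQuadConj.nontrivial {σ : E ≃ₐ[F] E} (h : IsQuadConj σ) : Nontrivial E :=
  Module.nontrivial_of_finrank_pos (R := F) (by rw [h.finrank_eq]; norm_num)

theorem IsQuadConj.algebraMap_injective {σ : E ≃ₐ[F] E} (h : IsQuadConj σ) :
    Function.Injective (algebraMap F E) :=
  have := h.nontrivial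
  FaithfulSMul.algebraMap_injective F E

theorem IsQuadConj.toBase_algebraMap {σ : E ≃ₐ[F] E} (h : IsQuadConj σ) (a : F) :
    toBase F (algebraMap F E a) = a :=
  Function.leftInverse_invFun h.algebraMap_injective a

theorem IsQuadConj.norm_algebraMap {σ : E ≃ₐ[F] E} (h : IsQuadConj σ) (a : F) :
    Algebra.norm F (algebraMap F E a) = a ^ 2 := by
  rw [Algebra.norm_algebraMap, h.finrank_eq]

theorem IsQuadConj.trace_algebraMap {σ : E ≃ₐ[F] E} (h : IsQuadConj σ) (a : F) :
    Algebra.trace F E (algebraMap F E a) = 2 * a := by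
  rw [Algebra.trace_algebraMap, h.finrank_eq]; simp

theorem norm_ne_zero_of_isUnit {x : E} (hx : IsUnit x) :
    Algebra.norm F x ≠ 0 :=
  (hx.map (Algebra.norm F)).ne_zero

/-- In characteristic zero, a reduced quadratic algebra with involution has the form `F ⊕ F τ` with
`τ² ∈ F` nonzero and `σ τ = -τ`. -/
theorem IsQuadConj.exists_sqrt [CharZero F] [IsReduced E] {σ : E ≃ₐ[F] E} (h : IsQuadConj σ) :
    ∃ (τ : E) (D : F), D ≠ 0 ∧ τ ^ 2 = algebraMap F E D ∧ σ τ = -τ ∧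
      LinearIndependent F ![1, τ] ∧ Submodule.span F (Set.range ![1, τ]) = ⊤ := by
  have hnt := h.nontrivial
  have hinj := h.algebraMap_injective
  have hfin : Module.Finite F E := Module.finite_of_finrank_pos (by rw [h.finrank_eq]; norm_num)
  obtain ⟨z, hz⟩ : ∃ z : E, ∀ a : F, algebraMap F E a ≠ z := by
    by_contra! hc
    apply h.ne_refl
    ext x
    obtain ⟨a, rfl⟩ := hc x
    simp
  have key : ∀ w : E, (∀ a : F, algebraMap F E a ≠ w) →
      LinearIndependent F ![1, w] ∧ Submodule.span F (Set.range ![1, w]) = ⊤ := by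
    intro w hw
    have hli : LinearIndependent F ![1, w] := by
      rw [LinearIndependent.pair_iff]
      intro s t hst
      have ht : t = 0 := by
        by_contra ht
        apply hw (-(t⁻¹ * s))
        have : t⁻¹ • (s • (1 : E) + t • w) = 0 := by rw [hst, smul_zero]
        rw [smul_add, smul_smul, smul_smul, inv_mul_cancel₀ ht, one_smul] at this
        rw [map_neg, Algebra.algebraMap_eq_smul_one]
        exact neg_eq_of_add_eq_zero_right this
      subst ht
      refine ⟨?_, rfl⟩
      rw [zero_smul, add_zero, ← Algebra.algebraMap_eq_smul_one] at hst
      exact hinj (by rw [hst, map_zero])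
    exact ⟨hli, hli.span_eq_top_of_card_eq_finrank' (by simp [h.finrank_eq])⟩
  have rep : ∀ w : E, (∀ a : F, algebraMap F E a ≠ w) → ∀ x : E, ∃ a b : F,
      x = algebraMap F E a + algebraMap F E b * w := by
    intro w hw x
    have hx : x ∈ Submodule.span F (Set.range ![1, w]) := by rw [(key w hw).2]; trivial
    rw [Matrix.range_cons, Matrix.range_cons, Matrix.range_empty, Set.union_empty,
      Set.singleton_union, Submodule.mem_span_pair] at hx
    obtain ⟨a, b, hab⟩ := hx
    exact ⟨a, b, by rw [← hab, Algebra.smul_def, Algebra.smul_def, mul_one]⟩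
  obtain ⟨a, b, hab⟩ := rep z hz (z ^ 2)
  -- completing the square
  set τ : E := z - algebraMap F E (b / 2) with hτ
  have hτF : ∀ c : F, algebraMap F E c ≠ τ := by
    intro c hc
    exact hz (c + b / 2) (by rw [map_add, hc, hτ]; ring)
  have hb : algebraMap F E b = 2 * algebraMap F E (b / 2) := by
    rw [← map_ofNat (algebraMap F E) 2, ← map_mul]
    congr 1
    field_simp
  have hτ2 : τ ^ 2 = algebraMap F E (a + (b / 2) ^ 2) := by
    rw [hτ, map_add, map_pow]
    linear_combination hab + hb * z
  set D := a + (b / 2) ^ 2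
  have hD : D ≠ 0 := by
    intro hD
    rw [hD, map_zero] at hτ2
    exact hτF 0 (by rw [map_zero, eq_zero_of_pow_eq_zero hτ2])
  refine ⟨τ, D, hD, hτ2, ?_, key τ hτF⟩
  -- From `(σ τ)² = D = τ²` and `σ ≠ id` it follows that `σ τ = -τ`.
  obtain ⟨u, v, huv⟩ := rep τ hτF (σ τ)
  have h1 : σ τ ^ 2 = algebraMap F E D := by rw [← map_pow, hτ2, AlgEquiv.commutes]
  have h2 : (u ^ 2 + v ^ 2 * D - D) • (1 : E) + (2 * u * v) • τ = 0 := by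
    rw [Algebra.smul_def, Algebra.smul_def, mul_one]
    rw [huv] at h1
    simp only [map_add, map_sub, map_mul, map_pow, map_ofNat]
    linear_combination h1 - (algebraMap F E v) ^ 2 * hτ2
  obtain ⟨h3, h4⟩ := LinearIndependent.pair_iff.1 (key τ hτF).1 _ _ h2
  have hv : v ≠ 0 := by
    rintro rfl
    refine hτF u (σ.injective ?_)
    rw [huv, map_zero, zero_mul, add_zero, AlgEquiv.commutes]
  have hu : u = 0 := by
    simpa [hv] using h4
  subst hu
  have hv2 : v ^ 2 = 1 := by
    have : (v ^ 2 - 1) * D = 0 := by linear_combination h3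
    rcases mul_eq_zero.1 this with h | h
    · linear_combination h
    · exact absurd h hD
  rw [sq] at hv2
  rcases mul_self_eq_one_iff.1 hv2 with rfl | rfl
  · exfalso
    apply h.ne_refl
    ext x
    obtain ⟨c, d, rfl⟩ := rep τ hτF x
    rw [map_add, map_mul, AlgEquiv.commutes, AlgEquiv.commutes, huv]
    simp
  · rw [huv]; simp

variable [CharZero F] [IsReduced E] {σ : E ≃ₐ[F] E}

/-- Coordinates with respect to `1, τ`, in which the trace of `a + b τ` is `2 a` and its norm is
`a² - D b²`. -/
theorem IsQuadConj.exists_rep (h : IsQuadConj σ) : ∃ (τ : E) (D : F), D ≠ 0 ∧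
    τ ^ 2 = algebraMap F E D ∧ σ τ = -τ ∧
    (∀ x : E, ∃ a b : F, x = algebraMap F E a + algebraMap F E b * τ) ∧
    ∀ a b : F, algebraMap F E (Algebra.trace F E (algebraMap F E a + algebraMap F E b * τ)) =
        2 * algebraMap F E a ∧
      Algebra.norm F (algebraMap F E a + algebraMap F E b * τ) = a ^ 2 - D * b ^ 2 := by
  obtain ⟨τ, D, hD, hτ, hσ, hli, hsp⟩ := h.exists_sqrt
  have rep : ∀ x : E, ∃ a b : F, x = algebraMap F E a + algebraMap F E b * τ := by
    intro x
    have hx : x ∈ Submodule.span F (Set.range ![1, τ]) := by rw [hsp]; trivial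
    rw [Matrix.range_cons, Matrix.range_cons, Matrix.range_empty, Set.union_empty,
      Set.singleton_union, Submodule.mem_span_pair] at hx
    obtain ⟨a, b, hab⟩ := hx
    exact ⟨a, b, by rw [← hab, Algebra.smul_def, Algebra.smul_def, mul_one]⟩
  refine ⟨τ, D, hD, hτ, hσ, rep, fun a b => ?_⟩
  let bas : Module.Basis (Fin 2) F E := Module.Basis.mk hli hsp.ge
  have hb0 : bas 0 = 1 := by simp [bas]
  have hb1 : bas 1 = τ := by simp [bas]
  have hmul : Algebra.leftMulMatrix bas (algebraMap F E a + algebraMap F E b * τ) =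
      !![a, D * b; b, a] := by
    ext i j
    rw [Algebra.leftMulMatrix_eq_repr_mul]
    have e0 : (algebraMap F E a + algebraMap F E b * τ) * bas 0 = a • bas 0 + b • bas 1 := by
      rw [hb0, hb1, Algebra.smul_def, Algebra.smul_def]; ring
    have e1 : (algebraMap F E a + algebraMap F E b * τ) * bas 1 = (D * b) • bas 0 + a • bas 1 := by
      rw [hb0, hb1, Algebra.smul_def, Algebra.smul_def, map_mul]
      linear_combination algebraMap F E b * hτ
    fin_cases j
    · change bas.repr (_ * bas 0) i = _
      rw [e0]
      fin_cases i <;> simp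
    · change bas.repr (_ * bas 1) i = _
      rw [e1]
      fin_cases i <;> simp
  constructor
  · rw [Algebra.trace_eq_matrix_trace bas, hmul, Matrix.trace_fin_two]
    simp only [Matrix.of_apply, Matrix.cons_val', Matrix.cons_val_zero, Matrix.cons_val_one,
      Matrix.cons_val_fin_one]
    rw [map_add]; ring
  · rw [Algebra.norm_eq_matrix_det bas, hmul, Matrix.det_fin_two]
    simp only [Matrix.of_apply, Matrix.cons_val', Matrix.cons_val_zero, Matrix.cons_val_one,
      Matrix.cons_val_fin_one]
    ring

theorem IsQuadConj.algebraMap_trace (h : IsQuadConj σ) (x : E) :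
    algebraMap F E (Algebra.trace F E x) = x + σ x := by
  obtain ⟨τ, D, hD, hτ, hσ, rep, hf⟩ := h.exists_rep
  obtain ⟨a, b, rfl⟩ := rep x
  rw [(hf a b).1, map_add, map_mul, hσ, AlgEquiv.commutes, AlgEquiv.commutes]
  ring

theorem IsQuadConj.algebraMap_norm (h : IsQuadConj σ) (x : E) :
    algebraMap F E (Algebra.norm F x) = x * σ x := by
  obtain ⟨τ, D, hD, hτ, hσ, rep, hf⟩ := h.exists_rep
  obtain ⟨a, b, rfl⟩ := rep x
  rw [(hf a b).2, map_add, map_mul, hσ, AlgEquiv.commutes, AlgEquiv.commutes]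
  simp only [map_sub, map_mul, map_pow]
  linear_combination algebraMap F E b ^ 2 * hτ

theorem IsQuadConj.conj_conj (h : IsQuadConj σ) (x : E) : σ (σ x) = x := by
  obtain ⟨τ, D, hD, hτ, hσ, rep, hf⟩ := h.exists_rep
  obtain ⟨a, b, rfl⟩ := rep x
  simp [hσ]

theorem IsQuadConj.exists_of_conj_eq (h : IsQuadConj σ) {x : E} (hx : σ x = x) :
    ∃ a : F, algebraMap F E a = x := by
  refine ⟨Algebra.trace F E x / 2, ?_⟩
  have h1 : algebraMap F E (Algebra.trace F E x / 2) * 2 = x * 2 := by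
    rw [← map_ofNat (algebraMap F E) 2, ← map_mul, div_mul_cancel₀ _ two_ne_zero,
      h.algebraMap_trace, hx, map_ofNat]; ring
  have h2 : IsUnit (2 : E) := by
    rw [← map_ofNat (algebraMap F E) 2]
    exact (IsUnit.mk0 (2 : F) two_ne_zero).map _
  exact h2.mul_right_cancel h1

theorem IsQuadConj.algebraMap_toBase (h : IsQuadConj σ) {x : E} (hx : σ x = x) :
    algebraMap F E (toBase F x) = x :=
  HermSiegel.algebraMap_toBase F (h.exists_of_conj_eq hx)

theorem IsQuadConj.toBase_add (h : IsQuadConj σ) {x y : E} (hx : σ x = x) (hy : σ y = y) :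
    toBase F (x + y) = toBase F x + toBase F y :=
  h.algebraMap_injective (by
    rw [map_add, h.algebraMap_toBase hx, h.algebraMap_toBase hy,
      h.algebraMap_toBase (by rw [map_add, hx, hy])])

theorem IsQuadConj.toBase_add_conj (h : IsQuadConj σ) (x : E) :
    toBase F (x + σ x) = Algebra.trace F E x := by
  rw [← h.algebraMap_trace, h.toBase_algebraMap]

theorem IsQuadConj.trace_conj (h : IsQuadConj σ) (x : E) :
    Algebra.trace F E (σ x) = Algebra.trace F E x :=
  h.algebraMap_injective (by rw [h.algebraMap_trace, h.algebraMap_trace, h.conj_conj, add_comm])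

theorem IsQuadConj.norm_conj (h : IsQuadConj σ) (x : E) :
    Algebra.norm F (σ x) = Algebra.norm F x :=
  h.algebraMap_injective (by rw [h.algebraMap_norm, h.algebraMap_norm, h.conj_conj, mul_comm])

theorem IsQuadConj.isUnit_iff (h : IsQuadConj σ) {x : E} :
    IsUnit x ↔ Algebra.norm F x ≠ 0 := by
  refine ⟨norm_ne_zero_of_isUnit, fun h0 => ?_⟩
  refine isUnit_of_mul_isUnit_left (y := σ x) ?_
  rw [← h.algebraMap_norm]
  exact (IsUnit.mk0 _ h0).map _

/-- A quadratic algebra that is not a field contains a nontrivial idempotent, and the involution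
exchanges it with its complement. -/
theorem IsQuadConj.exists_idempotent (h : IsQuadConj σ) (hE : ¬ IsField E) :
    ∃ e : E, e * e = e ∧ σ e = 1 - e := by
  have hnt := h.nontrivial
  obtain ⟨τ, D, hD, hτ, hσ, rep, hf⟩ := h.exists_rep
  obtain ⟨x, hx0, hx⟩ : ∃ x : E, x ≠ 0 ∧ Algebra.norm F x = 0 := by
    by_contra! hc
    apply hE
    refine ⟨⟨0, 1, zero_ne_one⟩, mul_comm, fun {x} hx => ?_⟩
    obtain ⟨u, hu⟩ := h.isUnit_iff.2 (hc x hx)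
    exact ⟨((u⁻¹ : Eˣ) : E), by rw [← hu, u.mul_inv]⟩
  obtain ⟨a, b, rfl⟩ := rep x
  rw [(hf a b).2] at hx
  have hb : b ≠ 0 := by
    rintro rfl
    have ha : a = 0 := by simpa using hx
    apply hx0; rw [ha]; simp
  set u := a / b with hu
  have hu2 : u ^ 2 = D := by
    rw [hu, div_pow]; field_simp; linear_combination hx
  have hu0 : u ≠ 0 := by rintro h0; rw [h0] at hu2; exact hD (by rw [← hu2]; ring)
  have e1 : algebraMap F E (2⁻¹) * 2 = 1 := by
    rw [← map_ofNat (algebraMap F E) 2, ← map_mul, inv_mul_cancel₀ two_ne_zero, map_one]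
  have e2 : (algebraMap F E u⁻¹) ^ 2 * algebraMap F E D = 1 := by
    rw [← map_pow, ← map_mul, ← hu2, ← mul_pow, inv_mul_cancel₀ hu0, one_pow, map_one]
  refine ⟨algebraMap F E (2⁻¹) * (1 + algebraMap F E u⁻¹ * τ), ?_, ?_⟩
  · linear_combination (algebraMap F E 2⁻¹) ^ 2 * ((algebraMap F E u⁻¹) ^ 2 * hτ + e2) +
      algebraMap F E 2⁻¹ * (1 + algebraMap F E u⁻¹ * τ) * e1
  · simp only [map_mul, map_add, map_one, AlgEquiv.commutes, hσ]
    linear_combination e1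

end Quadratic

/-! ### The ring of integers of the quadratic algebra -/

section Integers

variable {F : Type*} [Field F] [ValuativeRel F] [TopologicalSpace F] [IsNonarchimedeanLocalField F]
  [CharZero F] {E : Type*} [CommRing E] [Algebra F E]

theorem algebraMap_mem_OE {a : F} (ha : a ∈ 𝒪[F]) : algebraMap F E a ∈ OE F E :=
  (OE F E).algebraMap_mem ⟨a, ha⟩

theorem IsQuadConj.algebraMap_mem_OE_iff {σ : E ≃ₐ[F] E} (h : IsQuadConj σ) {a : F} :
    algebraMap F E a ∈ OE F E ↔ a ∈ 𝒪[F] := by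
  refine ⟨fun ha => ?_, algebraMap_mem_OE⟩
  have h1 : IsIntegral 𝒪[F] a := (isIntegral_algebraMap_iff h.algebraMap_injective).1 ha
  obtain ⟨y, rfl⟩ := IsIntegrallyClosed.isIntegral_iff.1 h1
  exact y.2

theorem conj_mem_OE (σ : E ≃ₐ[F] E) {x : E} (hx : x ∈ OE F E) : σ x ∈ OE F E :=
  IsIntegral.map ((σ : E →ₐ[F] E).restrictScalars 𝒪[F]) hx

variable [IsReduced E] {σ : E ≃ₐ[F] E}

/-- Since `x` is a root of `X² - Tr(x) X + N(x)` and `O_F` is integrally closed, integrality is read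
off from the trace and the norm. -/
theorem IsQuadConj.mem_OE_iff (h : IsQuadConj σ) {x : E} :
    x ∈ OE F E ↔ Algebra.trace F E x ∈ 𝒪[F] ∧ Algebra.norm F x ∈ 𝒪[F] := by
  constructor
  · intro hx
    rw [← h.algebraMap_mem_OE_iff, ← h.algebraMap_mem_OE_iff, h.algebraMap_trace,
      h.algebraMap_norm]
    exact ⟨add_mem hx (conj_mem_OE σ hx), mul_mem hx (conj_mem_OE σ hx)⟩
  · rintro ⟨hT, hN⟩
    refine ⟨X ^ 2 - C ⟨_, hT⟩ * X + C ⟨_, hN⟩, by monicity!, ?_⟩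
    simp only [eval₂_add, eval₂_sub, eval₂_mul, eval₂_X_pow, eval₂_C, eval₂_X]
    change x ^ 2 - algebraMap F E (Algebra.trace F E x) * x +
      algebraMap F E (Algebra.norm F x) = 0
    rw [h.algebraMap_trace, h.algebraMap_norm]
    ring

theorem IsQuadConj.trace_mem (h : IsQuadConj σ) {x : E} (hx : x ∈ OE F E) :
    Algebra.trace F E x ∈ 𝒪[F] := (h.mem_OE_iff.1 hx).1

theorem IsQuadConj.norm_mem (h : IsQuadConj σ) {x : E} (hx : x ∈ OE F E) :
    Algebra.norm F x ∈ 𝒪[F] := (h.mem_OE_iff.1 hx).2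

theorem IsQuadConj.conj_mem_OE_iff (h : IsQuadConj σ) {x : E} : σ x ∈ OE F E ↔ x ∈ OE F E :=
  ⟨fun hx => by simpa [h.conj_conj] using conj_mem_OE σ hx, conj_mem_OE σ⟩

theorem exists_uniformizer (F : Type*) [Field F] [ValuativeRel F] [TopologicalSpace F]
    [IsNonarchimedeanLocalField F] : ∃ ϖ : F, ord F ϖ = 1 := by
  obtain ⟨v, hv⟩ := valuation_surjective
    ((IsNonarchimedeanLocalField.valueGroupWithZeroIsoInt F).symm (WithZero.exp (-1)))
  exact ⟨v, by simp [ord, hv]⟩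

theorem IsQuadConj.exists_pow_mul_mem_OE (h : IsQuadConj σ) {ϖ : F} (hϖ : ord F ϖ = 1) (x : E) :
    ∃ n : ℕ, ∀ m, n ≤ m → algebraMap F E (ϖ ^ m) * x ∈ OE F E := by
  obtain ⟨n₁, h₁⟩ := exists_pow_mul_mem hϖ (Algebra.trace F E x)
  obtain ⟨n₂, h₂⟩ := exists_pow_mul_mem hϖ (Algebra.norm F x)
  have h0 : ϖ ∈ 𝒪[F] := (ord_nonneg_iff (ord_eq_one_ne_zero hϖ)).1 (by omega)
  refine ⟨n₁ + n₂, fun m hm => ?_⟩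
  obtain ⟨k, rfl⟩ := Nat.exists_eq_add_of_le hm
  have key : algebraMap F E (ϖ ^ (n₁ + n₂)) * x ∈ OE F E := by
    rw [h.mem_OE_iff]
    constructor
    · rw [← Algebra.smul_def, map_smul, smul_eq_mul, pow_add, mul_comm (ϖ ^ n₁), mul_assoc]
      exact mul_mem (pow_mem h0 _) h₁
    · rw [map_mul, h.norm_algebraMap]
      have : (ϖ ^ (n₁ + n₂)) ^ 2 * Algebra.norm F x =
          (ϖ ^ n₁) ^ 2 * ϖ ^ n₂ * (ϖ ^ n₂ * Algebra.norm F x) := by ring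
      rw [this]
      exact mul_mem (mul_mem (pow_mem (pow_mem h0 _) _) (pow_mem h0 _)) h₂
  rw [pow_add, map_mul, mul_comm (algebraMap F E _), mul_assoc]
  exact mul_mem (algebraMap_mem_OE (pow_mem h0 _)) key

/-- `O_E` has a basis `1, ω` over `O_F`. -/
theorem IsQuadConj.exists_integral_basis (h : IsQuadConj σ) :
    ∃ ω ∈ OE F E, IsUnit (ω - σ ω) ∧
      (∀ x : E, ∃ a b : F, x = algebraMap F E a + algebraMap F E b * ω) ∧
      ∀ a b : F, algebraMap F E a + algebraMap F E b * ω ∈ OE F E ↔ a ∈ 𝒪[F] ∧ b ∈ 𝒪[F] := by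
  obtain ⟨τ, D, hD, hτ, hσ, rep, hf⟩ := h.exists_rep
  obtain ⟨ϖ, hϖ⟩ := exists_uniformizer F
  have hϖ0 := ord_eq_one_ne_zero hϖ
  have h2 : (2 : F) ≠ 0 := two_ne_zero
  -- the possible `τ`-coordinates of integral elements have bounded denominators
  have hbdd : ∀ a b : F, b ≠ 0 → algebraMap F E a + algebraMap F E b * τ ∈ OE F E →
      0 ≤ ord F (4 * D) + 2 * ord F b := by
    intro a b hb hab
    obtain ⟨h3, h4⟩ := h.mem_OE_iff.1 hab
    have h5 : Algebra.trace F E (algebraMap F E a + algebraMap F E b * τ) = 2 * a :=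
      h.algebraMap_injective (by rw [(hf a b).1, map_mul, map_ofNat])
    rw [h5] at h3
    rw [(hf a b).2] at h4
    have h6 : (4 * D) * b ^ 2 ∈ 𝒪[F] := by
      have : (4 * D) * b ^ 2 = (2 * a) ^ 2 - 4 * (a ^ 2 - D * b ^ 2) := by ring
      rw [this]
      exact sub_mem (pow_mem h3 _) (mul_mem (ofNat_mem _ 4) h4)
    have h7 : (4 * D) ≠ 0 := mul_ne_zero (by norm_num) hD
    rw [← ord_nonneg_iff (mul_ne_zero h7 (pow_ne_zero _ hb)), ord_mul h7 (pow_ne_zero _ hb),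
      ord_pow hb] at h6
    simpa using h6
  -- `ω = a₀ + b₀ τ` is chosen so that the order of its `τ`-coordinate is minimal
  obtain ⟨n, ⟨a₀, b₀, hb₀, hab₀, rfl⟩, hmin⟩ := Int.exists_least_of_bdd
    (P := fun n => ∃ a b : F, b ≠ 0 ∧ algebraMap F E a + algebraMap F E b * τ ∈ OE F E ∧
      ord F b = n)
    ⟨-((ord F (4 * D)).natAbs : ℤ), by
      rintro z ⟨a, b, hb, hab, rfl⟩
      have h3 := hbdd a b hb hab
      omega⟩
    (by
      obtain ⟨n, hn⟩ := h.exists_pow_mul_mem_OE hϖ τ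
      exact ⟨_, 0, ϖ ^ n, pow_ne_zero _ hϖ0, by simpa using hn n le_rfl, rfl⟩)
  have hττ : IsUnit τ := by
    refine isUnit_of_mul_isUnit_left (y := τ) ?_
    rw [← sq, hτ]
    exact (IsUnit.mk0 D hD).map _
  refine ⟨_, hab₀, ?_, ?_, ?_⟩
  · have : algebraMap F E a₀ + algebraMap F E b₀ * τ -
        σ (algebraMap F E a₀ + algebraMap F E b₀ * τ) = algebraMap F E (2 * b₀) * τ := by
      rw [map_add, map_mul, AlgEquiv.commutes, AlgEquiv.commutes, hσ, map_mul, map_ofNat]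
      ring
    rw [this]
    exact ((IsUnit.mk0 _ (mul_ne_zero h2 hb₀)).map _).mul hττ
  · intro x
    obtain ⟨p, q, rfl⟩ := rep x
    refine ⟨p - q / b₀ * a₀, q / b₀, ?_⟩
    have e : algebraMap F E (q / b₀) * algebraMap F E b₀ = algebraMap F E q := by
      rw [← map_mul, div_mul_cancel₀ _ hb₀]
    rw [map_sub, map_mul]
    linear_combination -τ * e
  · intro a b
    constructor
    · intro hab
      have hb : b ∈ 𝒪[F] := by
        by_cases hb : b = 0
        · rw [hb]; exact zero_mem _
        rw [← ord_nonneg_iff hb]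
        have h3 := hmin (ord F (b * b₀)) ⟨a + b * a₀, b * b₀, mul_ne_zero hb hb₀, by
          convert hab using 1
          simp only [map_add, map_mul]
          ring, rfl⟩
        rw [ord_mul hb hb₀] at h3
        omega
      refine ⟨?_, hb⟩
      rw [← h.algebraMap_mem_OE_iff]
      have := sub_mem hab (mul_mem (algebraMap_mem_OE (E := E) hb) hab₀)
      simpa using this
    · rintro ⟨ha, hb⟩
      exact add_mem (algebraMap_mem_OE ha) (mul_mem (algebraMap_mem_OE hb) hab₀)

/-- If `1, ω` is an integral basis, then `(ω - σ ω)⁻¹` generates the inverse different. -/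
theorem IsQuadConj.trace_mul_mem_iff (h : IsQuadConj σ) {ω : E} (hω : ω ∈ OE F E)
    (hΔ : IsUnit (ω - σ ω))
    (rep : ∀ x : E, ∃ a b : F, x = algebraMap F E a + algebraMap F E b * ω)
    (hint : ∀ a b : F, algebraMap F E a + algebraMap F E b * ω ∈ OE F E ↔ a ∈ 𝒪[F] ∧ b ∈ 𝒪[F])
    (x : E) : (∀ y ∈ OE F E, Algebra.trace F E (x * y) ∈ 𝒪[F]) ↔ (ω - σ ω) * x ∈ OE F E := by
  obtain ⟨a, b, hab⟩ := rep ((ω - σ ω) * x)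
  have key : ∀ c d : F, Algebra.trace F E (x * (algebraMap F E c + algebraMap F E d * ω)) =
      a * d + b * c + b * d * Algebra.trace F E ω := by
    intro c d
    apply h.algebraMap_injective
    apply hΔ.mul_left_cancel
    have hab' : -((ω - σ ω) * σ x) = algebraMap F E a + algebraMap F E b * σ ω := by
      have := congrArg σ hab
      simp only [map_mul, map_sub, map_add, AlgEquiv.commutes, h.conj_conj] at this
      rw [← this]; ring
    rw [h.algebraMap_trace]
    simp only [map_mul, map_add, AlgEquiv.commutes, h.algebraMap_trace]
    linear_combination (algebraMap F E c + algebraMap F E d * ω) * hab -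
      (algebraMap F E c + algebraMap F E d * σ ω) * hab'
  constructor
  · intro hx
    rw [hab, hint]
    have hb : b ∈ 𝒪[F] := by
      have := hx _ (one_mem _)
      have h1 := key 1 0
      rw [map_one, map_zero, zero_mul, add_zero] at h1
      rw [h1] at this
      simpa using this
    refine ⟨?_, hb⟩
    have := hx _ hω
    have h1 := key 0 1
    rw [map_one, map_zero, zero_add, one_mul] at h1
    rw [h1] at this
    simpa using sub_mem this (mul_mem hb (h.trace_mem hω))
  · intro hx y hy
    rw [hab, hint] at hx
    obtain ⟨c, d, rfl⟩ := rep y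
    rw [hint] at hy
    rw [key]
    exact add_mem (add_mem (mul_mem hx.1 hy.2) (mul_mem hx.2 hy.1))
      (mul_mem (mul_mem hx.2 hy.2) (h.trace_mem hω))

/-- The discriminant of a pair, from its coordinates with respect to `1, ω`. -/
theorem IsQuadConj.discr_eq (h : IsQuadConj σ) (ω : E) (a b c d : F) :
    Algebra.discr F ![algebraMap F E a + algebraMap F E b * ω,
      algebraMap F E c + algebraMap F E d * ω] =
    (a * d - b * c) ^ 2 * -Algebra.norm F (ω - σ ω) := by
  apply h.algebraMap_injective
  rw [Algebra.discr_def, Matrix.det_fin_two]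
  simp only [Algebra.traceMatrix_apply, Algebra.traceForm_apply, Matrix.cons_val_zero,
    Matrix.cons_val_one]
  simp only [map_sub, map_mul, map_neg, map_pow, h.algebraMap_trace, h.algebraMap_norm,
    map_add, AlgEquiv.commutes, h.conj_conj]
  ring

/-- The exponent `𝔣` is the order of the discriminant `-N(ω - σ ω)` of an integral basis. -/
theorem IsQuadConj.f_eq (h : IsQuadConj σ) {ω : E} (hω : ω ∈ OE F E)
    (hΔ : IsUnit (ω - σ ω))
    (rep : ∀ x : E, ∃ a b : F, x = algebraMap F E a + algebraMap F E b * ω)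
    (hint : ∀ a b : F, algebraMap F E a + algebraMap F E b * ω ∈ OE F E ↔ a ∈ 𝒪[F] ∧ b ∈ 𝒪[F]) :
    (𝔣 F E : ℤ) = ord F (Algebra.norm F (ω - σ ω)) := by
  set d₀ : F := -Algebra.norm F (ω - σ ω) with hd₀
  have hd₀' : d₀ ≠ 0 := neg_ne_zero.2 (norm_ne_zero_of_isUnit hΔ)
  have hd₀m : d₀ ∈ 𝒪[F] := neg_mem (h.norm_mem (sub_mem hω (conj_mem_OE σ hω)))
  -- every discriminant is a multiple of that of the basis `1, ω`
  have hspan : discIdeal F E = Ideal.span {(⟨d₀, hd₀m⟩ : 𝒪[F])} := by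
    apply le_antisymm
    · rw [discIdeal, Ideal.span_le]
      rintro d ⟨⟨x, hx⟩, ⟨y, hy⟩, hd⟩
      obtain ⟨a, b, rfl⟩ := rep x
      obtain ⟨a', b', rfl⟩ := rep y
      rw [h.discr_eq] at hd
      rw [hint] at hx hy
      rw [SetLike.mem_coe, Ideal.mem_span_singleton']
      exact ⟨⟨_, pow_mem (sub_mem (mul_mem hx.1 hy.2) (mul_mem hx.2 hy.1)) 2⟩,
        Subtype.ext hd.symm⟩
    · rw [Ideal.span_singleton_le_iff_mem]
      refine Ideal.subset_span ⟨1, ⟨ω, hω⟩, ?_⟩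
      have := h.discr_eq ω 1 0 0 1
      simp only [map_one, map_zero, zero_mul, add_zero, one_mul, zero_add] at this
      change d₀ = Algebra.discr F ![1, ω]
      rw [this]
      simp [hd₀]
  have hord : ord F (Algebra.norm F (ω - σ ω)) = ord F d₀ := by rw [hd₀, ord_neg]
  rw [hord]
  have h0 : 0 ≤ ord F d₀ := (ord_nonneg_iff hd₀').2 hd₀m
  obtain ⟨k, hk⟩ := Int.eq_ofNat_of_zero_le h0
  rw [hk]
  congr 1
  apply le_antisymm
  · apply Nat.sInf_le
    refine ⟨⟨d₀, hd₀m⟩, ?_, ?_, hk⟩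
    · rw [hspan]; exact Ideal.mem_span_singleton_self _
    · intro h1; exact hd₀' (congrArg Subtype.val h1)
  · apply le_csInf
    · refine ⟨k, ⟨d₀, hd₀m⟩, ?_, ?_, hk⟩
      · rw [hspan]; exact Ideal.mem_span_singleton_self _
      · intro h1; exact hd₀' (congrArg Subtype.val h1)
    · rintro n ⟨d, hd, hd0, hdn⟩
      rw [hspan, Ideal.mem_span_singleton'] at hd
      obtain ⟨c, rfl⟩ := hd
      have hc : (c : F) ≠ 0 := by
        rintro h1
        apply hd0
        rw [show c = 0 from Subtype.ext h1, zero_mul]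
      have h2 : ord F ((c * ⟨d₀, hd₀m⟩ : 𝒪[F]) : F) = ord F (c : F) + ord F d₀ := ord_mul hc hd₀'
      rw [h2, hk] at hdn
      have := ord_nonneg c
      omega

end Integers

/-! ### Norms and discriminants in the inert, ramified and split cases -/

section Cases

variable {F : Type*} [Field F] [ValuativeRel F] [TopologicalSpace F] [IsNonarchimedeanLocalField F]
  [CharZero F] {E : Type*} [CommRing E] [Algebra F E] [IsReduced E] {σ : E ≃ₐ[F] E}

theorem IsQuadConj.exists_inv_mem (h : IsQuadConj σ) {x : E} (hx : x ∈ OE F E)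
    (h0 : Algebra.norm F x ≠ 0) (h1 : ord F (Algebra.norm F x) = 0) :
    ∃ y ∈ OE F E, x * y = 1 := by
  have hi : (Algebra.norm F x)⁻¹ ∈ 𝒪[F] :=
    (ord_nonneg_iff (inv_ne_zero h0)).1 (by rw [ord_inv, h1, neg_zero])
  refine ⟨algebraMap F E (Algebra.norm F x)⁻¹ * σ x,
    mul_mem (algebraMap_mem_OE hi) (conj_mem_OE σ hx), ?_⟩
  rw [mul_left_comm, ← h.algebraMap_norm, ← map_mul, inv_mul_cancel₀ h0, map_one]

theorem IsQuadConj.ord_norm_eq_zero (h : IsQuadConj σ) {x y : E} (hx : x ∈ OE F E)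
    (hy : y ∈ OE F E) (hxy : x * y = 1) : ord F (Algebra.norm F x) = 0 := by
  have h1 : Algebra.norm F x * Algebra.norm F y = 1 := by rw [← map_mul, hxy, map_one]
  have h2 := left_ne_zero_of_mul_eq_one h1
  have h3 := right_ne_zero_of_mul_eq_one h1
  have h4 := ord_mul h2 h3
  rw [h1, ord_one] at h4
  have := (ord_nonneg_iff h2).2 (h.norm_mem hx)
  have := (ord_nonneg_iff h3).2 (h.norm_mem hy)
  omega

/-- If `E` is a field, integrality over the complete ring `O_F` is detected by the norm. -/
theorem IsQuadConj.mem_OE_of_norm (h : IsQuadConj σ) (hE : IsField E) {x : E}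
    (hx : Algebra.norm F x ∈ 𝒪[F]) : x ∈ OE F E := by
  have := hE.isDomain
  rw [h.mem_OE_iff]
  refine ⟨?_, hx⟩
  set T := Algebra.trace F E x with hT
  by_contra hTm
  have hT0 : T ≠ 0 := by rintro h0; rw [h0] at hTm; exact hTm (zero_mem _)
  have hord : ord F T < 0 := by
    by_contra hc
    exact hTm ((ord_nonneg_iff hT0).1 (not_lt.1 hc))
  have hTi : T⁻¹ ∈ 𝒪[F] := (ord_nonneg_iff (inv_ne_zero hT0)).1 (by rw [ord_inv]; omega)
  have hTi' : (⟨T⁻¹, hTi⟩ : 𝒪[F]) ∈ 𝓂[F] := by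
    rw [mem_max_iff (fun h0 => inv_ne_zero hT0 (congrArg Subtype.val h0))]
    change 0 < ord F T⁻¹
    rw [ord_inv]; omega
  -- If the trace `T` were not integral, then `X² - T X + N(x)`, rescaled by `T`, would reduce to
  -- `X² - X` and split over `F`, so that `x ∈ F`.
  obtain ⟨ρ, -, hρ⟩ := exists_isUnit_sq_sub_self
    (c := ⟨T⁻¹, hTi⟩ * (⟨T⁻¹, hTi⟩ * ⟨_, hx⟩)) (Ideal.mul_mem_right _ _ hTi')
  have hρ' : (ρ : F) ^ 2 - ρ + T⁻¹ * (T⁻¹ * Algebra.norm F x) = 0 := congrArg Subtype.val hρ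
  have hρT : (T * ρ) ^ 2 - T * (T * ρ) + Algebra.norm F x = 0 := by
    field_simp at hρ'
    linear_combination hρ'
  have key : (x - algebraMap F E (T * ρ)) * (x - algebraMap F E (T - T * ρ)) = 0 := by
    have e := congrArg (algebraMap F E) hρT
    simp only [map_add, map_sub, map_mul, map_pow, map_zero, hT, h.algebraMap_trace,
      h.algebraMap_norm] at e ⊢
    linear_combination -e
  have hxF : ∃ a : F, x = algebraMap F E a := by
    rcases mul_eq_zero.1 key with h1 | h1
    · exact ⟨_, sub_eq_zero.1 h1⟩
    · exact ⟨_, sub_eq_zero.1 h1⟩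
  obtain ⟨a, rfl⟩ := hxF
  rw [h.norm_algebraMap] at hx
  have ha : a ∈ 𝒪[F] := by
    by_cases ha : a = 0
    · rw [ha]; exact zero_mem _
    rw [← ord_nonneg_iff (pow_ne_zero _ ha), ord_pow ha] at hx
    rw [← ord_nonneg_iff ha]
    push_cast at hx; omega
  apply hTm
  rw [hT, h.trace_algebraMap]
  exact mul_mem (ofNat_mem _ 2) ha

theorem max_eq_span {ϖ : F} (hϖ : ord F ϖ = 1) (hm : ϖ ∈ 𝒪[F]) :
    𝓂[F] = Ideal.span {(⟨ϖ, hm⟩ : 𝒪[F])} := by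
  ext x
  rw [mem_max_iff_exists hϖ, Ideal.mem_span_singleton']
  constructor
  · rintro ⟨y, hy⟩
    exact ⟨y, Subtype.ext (by rw [hy, mul_comm]; rfl)⟩
  · rintro ⟨y, rfl⟩
    exact ⟨y, mul_comm _ _⟩

theorem uniformizer_mem {ϖ : F} (hϖ : ord F ϖ = 1) : ϖ ∈ 𝒪[F] :=
  (ord_nonneg_iff (ord_eq_one_ne_zero hϖ)).1 (by omega)

theorem mem_map_max_iff {ϖ : F} (hϖ : ord F ϖ = 1) (x : OE F E) :
    x ∈ Ideal.map (algebraMap 𝒪[F] (OE F E)) 𝓂[F] ↔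
      ∃ y : OE F E, (x : E) = algebraMap F E ϖ * y := by
  rw [max_eq_span hϖ (uniformizer_mem hϖ), Ideal.map_span, Set.image_singleton,
    Ideal.mem_span_singleton']
  constructor
  · rintro ⟨y, rfl⟩
    exact ⟨y, mul_comm _ _⟩
  · rintro ⟨y, hy⟩
    exact ⟨y, Subtype.ext (by rw [hy, mul_comm]; rfl)⟩

/-- `1, ω` is an `O_F`-basis of `O_E`, and an `F`-basis of `E`. -/
structure IsIntBasis (σ : E ≃ₐ[F] E) (ω : E) : Prop where
  mem : ω ∈ OE F E
  isUnit : IsUnit (ω - σ ω)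
  rep : ∀ x : E, ∃ a b : F, x = algebraMap F E a + algebraMap F E b * ω
  mem_iff : ∀ a b : F, algebraMap F E a + algebraMap F E b * ω ∈ OE F E ↔ a ∈ 𝒪[F] ∧ b ∈ 𝒪[F]

theorem IsQuadConj.exists_isIntBasis (h : IsQuadConj σ) : ∃ ω, IsIntBasis σ ω := by
  obtain ⟨ω, h1, h2, h3, h4⟩ := h.exists_integral_basis
  exact ⟨ω, h1, h2, h3, h4⟩

theorem IsIntBasis.coeff_unique (h : IsQuadConj σ) {ω : E} (hω : IsIntBasis σ ω) {a b c d : F}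
    (he : algebraMap F E a + algebraMap F E b * ω = algebraMap F E c + algebraMap F E d * ω) :
    a = c ∧ b = d := by
  have h1 := congrArg σ he
  simp only [map_add, map_mul, AlgEquiv.commutes] at h1
  have h2 : b = d := by
    apply h.algebraMap_injective
    apply hω.isUnit.mul_right_cancel
    linear_combination he - h1
  subst h2
  exact ⟨h.algebraMap_injective (add_right_cancel he), rfl⟩

theorem norm_sub_conj_eq (h : IsQuadConj σ) (x : E) :
    algebraMap F E (Algebra.norm F (x - σ x)) = -(x - σ x) ^ 2 := by
  rw [h.algebraMap_norm, map_sub, h.conj_conj]; ring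

/-- In the unramified cases the discriminant of `O_E` is a unit. -/
theorem IsIntBasis.ord_norm_eq_zero_of_not_isRamified (h : IsQuadConj σ)
    (hram : ¬ IsRamified F E) {ω : E} (hω : IsIntBasis σ ω) :
    ord F (Algebra.norm F (ω - σ ω)) = 0 := by
  have hN0 : Algebra.norm F (ω - σ ω) ≠ 0 := norm_ne_zero_of_isUnit hω.isUnit
  have hΔm : ω - σ ω ∈ OE F E := sub_mem hω.mem (conj_mem_OE σ hω.mem)
  have hNm := h.norm_mem hΔm
  have hN := (ord_nonneg_iff hN0).2 hNm
  by_cases hE : IsField E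
  · have hprime : (Ideal.map (algebraMap 𝒪[F] (OE F E)) 𝓂[F]).IsPrime := by
      by_contra hc; exact hram ⟨hE, hc⟩
    obtain ⟨ϖ, hϖ⟩ := exists_uniformizer F
    by_contra hne
    have hNmax : (⟨_, hNm⟩ : 𝒪[F]) ∈ 𝓂[F] := by
      rw [mem_max_iff (fun h0 => hN0 (congrArg Subtype.val h0))]
      exact lt_of_le_of_ne hN (Ne.symm hne)
    -- In the inert case `𝔭 O_E` is prime; if the discriminant `-N(ω - σ ω) = (ω - σ ω)²` is not a
    -- unit, then `ω - σ ω = 2 ω - Tr(ω)` is divisible by `ϖ`, hence so are `2` and `Tr(ω)`.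
    have hΔsq : (⟨_, hΔm⟩ : OE F E) ∈ Ideal.map (algebraMap 𝒪[F] (OE F E)) 𝓂[F] := by
      apply hprime.mem_of_pow_mem 2
      have := neg_mem (Ideal.mem_map_of_mem (algebraMap 𝒪[F] (OE F E)) hNmax)
      convert this using 1
      apply Subtype.ext
      change (ω - σ ω) ^ 2 = -algebraMap F E (Algebra.norm F (ω - σ ω))
      rw [norm_sub_conj_eq h, neg_neg]
    obtain ⟨⟨y, hy⟩, hy'⟩ := (mem_map_max_iff hϖ _).1 hΔsq
    obtain ⟨c, d, rfl⟩ := hω.rep y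
    rw [hω.mem_iff] at hy
    have h2 : 2 = ϖ * d := by
      refine (hω.coeff_unique h (a := -Algebra.trace F E ω) (b := 2) (c := ϖ * c) ?_).2
      simp only [map_neg, map_mul, map_ofNat, h.algebraMap_trace]
      change ω - σ ω = _ at hy'
      linear_combination hy'
    have hT : -Algebra.trace F E ω = ϖ * c := by
      refine (hω.coeff_unique h (b := 2) (d := ϖ * d) ?_).1
      simp only [map_neg, map_mul, map_ofNat, h.algebraMap_trace]
      change ω - σ ω = _ at hy'
      linear_combination hy'
    have h2m : (2 : 𝒪[F]) ∈ 𝓂[F] := (mem_max_iff_exists hϖ _).2 ⟨⟨d, hy.2⟩, h2⟩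
    -- the residue field is perfect of characteristic two
    have hchar : ringChar 𝓀[F] = 2 := by
      have : CharP 𝓀[F] 2 := by
        apply CharTwo.of_one_ne_zero_of_two_eq_zero one_ne_zero
        have := (IsLocalRing.residue_eq_zero_iff (R := 𝒪[F]) 2).2 h2m
        rwa [map_ofNat] at this
      exact ringChar.eq _ 2
    -- For `n` with `n² ≡ -N(ω)`, the square of `ω - n` is divisible by `ϖ`, hence so is `ω - n`,
    -- which contradicts the independence of `1, ω` modulo `ϖ`.
    obtain ⟨nb, hnb⟩ := FiniteField.isSquare_of_char_two hchar
      (IsLocalRing.residue 𝒪[F] (-⟨_, h.norm_mem hω.mem⟩))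
    obtain ⟨n, rfl⟩ := IsLocalRing.residue_surjective nb
    rw [← map_mul, ← sub_eq_zero, ← map_sub, IsLocalRing.residue_eq_zero_iff,
      mem_max_iff_exists hϖ] at hnb
    obtain ⟨z, hz⟩ := hnb
    have hz' : -Algebra.norm F ω - (n : F) * n = ϖ * z := hz
    have hωn : ω - algebraMap F E n ∈ OE F E := sub_mem hω.mem (algebraMap_mem_OE n.2)
    have hmem : (⟨_, hωn⟩ : OE F E) ∈ Ideal.map (algebraMap 𝒪[F] (OE F E)) 𝓂[F] := by
      apply hprime.mem_of_pow_mem 2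
      rw [mem_map_max_iff hϖ]
      refine ⟨⟨-algebraMap F E c * ω + algebraMap F E z + algebraMap F E d *
        algebraMap F E (n * n) - algebraMap F E d * algebraMap F E n * ω, ?_⟩, ?_⟩
      · have hd := algebraMap_mem_OE (E := E) hy.2
        have hc := algebraMap_mem_OE (E := E) hy.1
        exact sub_mem (add_mem (add_mem (mul_mem (neg_mem hc) hω.mem) (algebraMap_mem_OE z.2))
          (mul_mem hd (algebraMap_mem_OE (mul_mem n.2 n.2))))
          (mul_mem (mul_mem hd (algebraMap_mem_OE n.2)) hω.mem)
      · change (ω - algebraMap F E n) ^ 2 = _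
        have e1 := congrArg (algebraMap F E) h2
        have e2 := congrArg (algebraMap F E) hT
        have e3 := congrArg (algebraMap F E) hz'
        simp only [map_neg, map_mul, map_sub, map_ofNat, h.algebraMap_trace,
          h.algebraMap_norm] at e1 e2 e3 ⊢
        linear_combination e3 - ω * e2 + ((algebraMap F E n) ^ 2 - algebraMap F E n * ω) * e1
    obtain ⟨⟨y', hy'm⟩, hy''⟩ := (mem_map_max_iff hϖ _).1 hmem
    obtain ⟨c', d', rfl⟩ := hω.rep y'
    rw [hω.mem_iff] at hy'm
    have h1 : 1 = ϖ * d' := by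
      refine (hω.coeff_unique h (a := -n) (b := 1) (c := ϖ * c') ?_).2
      simp only [map_neg, map_mul, map_one]
      change ω - algebraMap F E n = _ at hy''
      linear_combination hy''
    have := (mem_max_iff_exists hϖ 1).2 ⟨⟨d', hy'm.2⟩, h1⟩
    exact (Ideal.ne_top_iff_one _).1 (IsLocalRing.maximalIdeal.isMaximal _).ne_top this
  · obtain ⟨e, he, hσe⟩ := h.exists_idempotent hE
    have hem : e ∈ OE F E := by
      rw [h.mem_OE_iff]
      have h1 : Algebra.trace F E e = 1 := h.algebraMap_injective (by
        rw [h.algebraMap_trace, hσe, map_one]; ring)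
      have h2 : Algebra.norm F e = 0 := h.algebraMap_injective (by
        rw [h.algebraMap_norm, hσe, map_zero]; linear_combination -he)
      rw [h1, h2]
      exact ⟨one_mem _, zero_mem _⟩
    obtain ⟨a, b, rfl⟩ := hω.rep e
    rw [hω.mem_iff] at hem
    set e := algebraMap F E a + algebraMap F E b * ω
    -- In the split case the idempotent `e = a + b ω` has `(e - σ e)² = 1`.
    have h3 : b ^ 2 * -Algebra.norm F (ω - σ ω) = 1 := by
      apply h.algebraMap_injective
      rw [map_mul, map_pow, map_neg, norm_sub_conj_eq h, map_one]
      have h4 : algebraMap F E b * (ω - σ ω) = e - σ e := by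
        simp only [e, map_add, map_mul, AlgEquiv.commutes]; ring
      have h5 : (e - σ e) ^ 2 = 1 := by rw [hσe]; linear_combination 4 * he
      rw [← h4] at h5
      linear_combination h5
    have hb0 : b ≠ 0 := by rintro rfl; simp at h3
    have h6 := ord_mul (pow_ne_zero 2 hb0) (neg_ne_zero.2 hN0)
    rw [h3, ord_one, ord_neg, ord_pow hb0] at h6
    have := (ord_nonneg_iff hb0).2 hem.2
    push_cast at h6
    omega

end Cases

/-! ### Generators of the inverse different -/

section Duality

variable {F : Type*} [Field F] [ValuativeRel F] [TopologicalSpace F] [IsNonarchimedeanLocalField F]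
  [CharZero F] {E : Type*} [CommRing E] [Algebra F E] [IsReduced E] {σ : E ≃ₐ[F] E}

variable (F) in
/-- `θ` generates the inverse different: the lattice dual to `O_E` under `(x, y) ↦ Tr(θ x y)` is
`O_E` itself. -/
def IsDualGen (θ : E) : Prop :=
  ∀ x : E, (∀ y ∈ OE F E, Algebra.trace F E (θ * x * y) ∈ 𝒪[F]) ↔ x ∈ OE F E

/-- The inverse different is generated by `(ω - σ ω)⁻¹`, hence by each `θ` that differs from it by a
unit. -/
theorem isDualGen_of_inv (h : IsQuadConj σ) {ω : E} (hω : IsIntBasis σ ω) {θ u v : E}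
    (hu : u ∈ OE F E) (hv : v ∈ OE F E) (huv : u * v = 1) (hθ : (ω - σ ω) * θ = u) :
    IsDualGen F θ := by
  intro x
  rw [h.trace_mul_mem_iff hω.mem hω.isUnit hω.rep hω.mem_iff, ← mul_assoc, hθ]
  refine ⟨fun h1 => ?_, fun h1 => mul_mem hu h1⟩
  have := mul_mem hv h1
  rwa [← mul_assoc, mul_comm v, huv, one_mul] at this

theorem isDualGen_one (h : IsQuadConj σ) (hram : ¬ IsRamified F E) : IsDualGen F (1 : E) := by
  obtain ⟨ω, hω⟩ := h.exists_isIntBasis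
  have hm := sub_mem hω.mem (conj_mem_OE σ hω.mem)
  obtain ⟨v, hv, huv⟩ := h.exists_inv_mem hm (norm_ne_zero_of_isUnit hω.isUnit)
    (hω.ord_norm_eq_zero_of_not_isRamified h hram)
  exact isDualGen_of_inv h hω hm hv huv (mul_one _)

theorem f_eq_zero (h : IsQuadConj σ) (hram : ¬ IsRamified F E) : 𝔣 F E = 0 := by
  obtain ⟨ω, hω⟩ := h.exists_isIntBasis
  have h1 := h.f_eq hω.mem hω.isUnit hω.rep hω.mem_iff
  rw [hω.ord_norm_eq_zero_of_not_isRamified h hram] at h1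
  exact_mod_cast h1

/-- In the ramified case `𝔡⁻¹` is generated by `ϖ_E ^ (-𝔣)`, because the norm of `ω - σ ω` has order
`𝔣`. -/
theorem isDualGen_ramified (h : IsQuadConj σ) (hram : IsRamified F E) {ϖE : Eˣ}
    (hϖE : ord F (Algebra.norm F (ϖE : E)) = 1) :
    IsDualGen F ((ϖE⁻¹ ^ 𝔣 F E : Eˣ) : E) := by
  obtain ⟨ω, hω⟩ := h.exists_isIntBasis
  have hf := h.f_eq hω.mem hω.isUnit hω.rep hω.mem_iff
  obtain ⟨δ, hδ⟩ := hω.isUnit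
  have hN : Algebra.norm F (δ : E) ≠ 0 := norm_ne_zero_of_isUnit δ.isUnit
  have hϖ0 : Algebra.norm F (ϖE : E) ≠ 0 := ord_eq_one_ne_zero hϖE
  have e1 : ord F (Algebra.norm F ((δ * ϖE⁻¹ ^ 𝔣 F E : Eˣ) : E)) = 0 := by
    have e : Algebra.norm F ((ϖE⁻¹ : Eˣ) : E) = (Algebra.norm F (ϖE : E))⁻¹ := by
      exact eq_inv_of_mul_eq_one_left (by rw [← map_mul, Units.inv_mul, map_one])
    rw [Units.val_mul, map_mul, Units.val_pow_eq_pow_val, map_pow, e,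
      ord_mul hN (pow_ne_zero _ (inv_ne_zero hϖ0)), ord_pow (inv_ne_zero hϖ0), ord_inv, hϖE, hf, hδ]
    ring
  have hm : ((δ * ϖE⁻¹ ^ 𝔣 F E : Eˣ) : E) ∈ OE F E :=
    h.mem_OE_of_norm hram.1 ((ord_nonneg_iff (norm_ne_zero_of_isUnit (Units.isUnit _))).1 e1.ge)
  obtain ⟨v, hv, huv⟩ := h.exists_inv_mem hm (norm_ne_zero_of_isUnit (Units.isUnit _)) e1
  exact isDualGen_of_inv h hω hm hv huv (by rw [← hδ, Units.val_mul])

end Duality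

/-! ### Elements of norm minus one in the unramified cases -/

section Unramified

variable {F : Type*} [Field F] [ValuativeRel F] [TopologicalSpace F] [IsNonarchimedeanLocalField F]
  [CharZero F] {E : Type*} [CommRing E] [Algebra F E] [IsReduced E] {σ : E ≃ₐ[F] E}

theorem IsQuadConj.mem_OE_idempotent (h : IsQuadConj σ) {e : E} (he : e * e = e)
    (hσe : σ e = 1 - e) : e ∈ OE F E := by
  rw [h.mem_OE_iff]
  have h1 : Algebra.trace F E e = 1 := h.algebraMap_injective (by
    rw [h.algebraMap_trace, hσe, map_one]; ring)
  have h2 : Algebra.norm F e = 0 := h.algebraMap_injective (by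
    rw [h.algebraMap_norm, hσe, map_zero]; linear_combination -he)
  rw [h1, h2]
  exact ⟨one_mem _, zero_mem _⟩

/-- In residue characteristic two `α = 1` works; otherwise the norm form `a² + N(ω - σ ω) b²` is
nondegenerate over the finite residue field and represents `-1`. -/
theorem IsQuadConj.exists_norm_eq_neg_one_mod (h : IsQuadConj σ) (hram : ¬ IsRamified F E) :
    ∃ α ∈ OE F E, ∃ c : 𝒪[F], c ∈ 𝓂[F] ∧ Algebra.norm F α + 1 = c := by
  obtain ⟨ω, hω⟩ := h.exists_isIntBasis
  by_cases h2 : (2 : 𝒪[F]) ∈ 𝓂[F]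
  · exact ⟨1, one_mem _, 2, h2, by rw [map_one]; exact one_add_one_eq_two⟩
  have hm := sub_mem hω.mem (conj_mem_OE σ hω.mem)
  have hNm := h.norm_mem hm
  have hN0 : Algebra.norm F (ω - σ ω) ≠ 0 := norm_ne_zero_of_isUnit hω.isUnit
  have hNu : IsUnit (⟨_, hNm⟩ : 𝒪[F]) :=
    (isUnit_iff_ord (fun h0 => hN0 (congrArg Subtype.val h0))).2
      (hω.ord_norm_eq_zero_of_not_isRamified h hram)
  let _ : Fintype 𝓀[F] := Fintype.ofFinite _
  have hchar : ringChar 𝓀[F] ≠ 2 := by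
    intro hc
    apply h2
    rw [← IsLocalRing.residue_eq_zero_iff, map_ofNat]
    have := ringChar.Nat.cast_ringChar (R := 𝓀[F])
    rw [hc] at this
    exact_mod_cast this
  set n : 𝓀[F] := IsLocalRing.residue 𝒪[F] ⟨_, hNm⟩ with hn
  have hn0 : n ≠ 0 := by
    rw [hn, Ne, IsLocalRing.residue_eq_zero_iff]
    exact fun hc => hc hNu
  obtain ⟨a, b, hab⟩ := FiniteField.exists_root_sum_quadratic (R := 𝓀[F]) (f := X ^ 2)
    (g := C n * X ^ 2 + 1) (degree_X_pow 2) (by compute_degree!)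
    (FiniteField.odd_card_of_char_ne_two hchar)
  obtain ⟨a, rfl⟩ := IsLocalRing.residue_surjective a
  obtain ⟨b, rfl⟩ := IsLocalRing.residue_surjective b
  refine ⟨algebraMap F E a + algebraMap F E b * (ω - σ ω),
    add_mem (algebraMap_mem_OE a.2) (mul_mem (algebraMap_mem_OE b.2) hm),
    a ^ 2 + ⟨_, hNm⟩ * b ^ 2 + 1, ?_, ?_⟩
  · rw [← IsLocalRing.residue_eq_zero_iff]
    simp only [eval_add, eval_mul, eval_C, eval_pow, eval_X, eval_one] at hab
    simp only [map_add, map_mul, map_pow, map_one, ← hn]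
    linear_combination hab
  · apply h.algebraMap_injective
    have e : (((a ^ 2 + ⟨_, hNm⟩ * b ^ 2 + 1 : 𝒪[F])) : F) =
      (a : F) ^ 2 + Algebra.norm F (ω - σ ω) * (b : F) ^ 2 + 1 := rfl
    rw [e]
    simp only [map_add, map_mul, map_pow, map_one, h.algebraMap_norm, AlgEquiv.commutes, map_sub,
      h.conj_conj]
    ring

/-- A solution modulo `𝔭` lifts by Hensel's lemma along a direction `w` with `Tr(α σ(w)) = 1`. -/
theorem IsQuadConj.exists_norm_eq_neg_one (h : IsQuadConj σ) (hram : ¬ IsRamified F E) :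
    ∃ α ∈ OE F E, α * σ α = -1 := by
  obtain ⟨α, hα, c, hc, hαc⟩ := h.exists_norm_eq_neg_one_mod hram
  obtain ⟨ω, hω⟩ := h.exists_isIntBasis
  have hm := sub_mem hω.mem (conj_mem_OE σ hω.mem)
  obtain ⟨v, hv, huv⟩ := h.exists_inv_mem hm (norm_ne_zero_of_isUnit hω.isUnit)
    (hω.ord_norm_eq_zero_of_not_isRamified h hram)
  have hNu : IsUnit (⟨_, h.norm_mem hα⟩ : 𝒪[F]) := by
    by_contra hc'
    have : (1 : 𝒪[F]) ∈ 𝓂[F] := by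
      have h1 := sub_mem hc (show (⟨_, h.norm_mem hα⟩ : 𝒪[F]) ∈ 𝓂[F] from hc')
      convert h1 using 1
      apply Subtype.ext
      change (1 : F) = c - Algebra.norm F α
      linear_combination hαc
    exact (Ideal.ne_top_iff_one _).1 (IsLocalRing.maximalIdeal.isMaximal _).ne_top this
  have hα0 : Algebra.norm F α ≠ 0 := by
    intro h0
    exact hNu.ne_zero (Subtype.ext h0)
  obtain ⟨β, hβ, hαβ⟩ := h.exists_inv_mem hα hα0 (ord_eq_zero_of_isUnit hNu)
  -- an integral element `w` with `Tr(α σ(w)) = 1`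
  set w := σ (β * (ω * v)) with hw
  have hwm : w ∈ OE F E := conj_mem_OE σ (mul_mem hβ (mul_mem hω.mem hv))
  have hσv : σ v = -v := by
    have h1 := congrArg σ huv
    simp only [map_mul, map_sub, h.conj_conj, map_one] at h1
    have : (ω - σ ω) * (σ v + v) = 0 := by linear_combination huv - h1
    have h2 := hω.isUnit.mul_right_eq_zero.1 this
    exact eq_neg_of_add_eq_zero_left h2
  have htr : α * σ w + σ α * w = 1 := by
    have h1 := congrArg σ hαβ
    simp only [map_mul, map_one] at h1
    rw [hw, h.conj_conj, map_mul, map_mul, hσv]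
    linear_combination (ω * v) * hαβ - σ ω * v * h1 + huv
  obtain ⟨ρ, hρu, hρ⟩ := exists_isUnit_sq_sub_self (c := ⟨_, h.norm_mem hwm⟩ * c)
    (Ideal.mul_mem_left _ _ hc)
  obtain ⟨ρ, rfl⟩ := hρu
  set ρi : 𝒪[F] := ((ρ⁻¹ : (𝒪[F])ˣ) : 𝒪[F])
  have hρi : ((ρ : 𝒪[F]) : F) * (ρi : F) = 1 := congrArg Subtype.val ρ.mul_inv
  have hρ' : ((ρ : 𝒪[F]) : F) ^ 2 - ((ρ : 𝒪[F]) : F) + Algebra.norm F w * (c : F) = 0 :=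
    congrArg Subtype.val hρ
  have e1 := congrArg (algebraMap F E) hρi
  have e2 := congrArg (algebraMap F E) hρ'
  have e3 := congrArg (algebraMap F E) hαc
  simp only [map_add, map_sub, map_mul, map_pow, map_zero, map_one, h.algebraMap_norm] at e1 e2 e3
  -- With `ρ` a root of `ρ² - ρ + N(w) c = 0`, subtracting `(c / ρ) w` from `α` changes the norm by
  -- exactly `-c`.
  refine ⟨α - algebraMap F E c * algebraMap F E ρi * w,
    sub_mem hα (mul_mem (mul_mem (algebraMap_mem_OE c.2) (algebraMap_mem_OE ρi.2)) hwm), ?_⟩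
  simp only [map_sub, map_mul, AlgEquiv.commutes]
  set r := algebraMap F E ((ρ : 𝒪[F]) : F)
  set s := algebraMap F E (ρi : F)
  set c' := algebraMap F E (c : F)
  linear_combination e3 - c' * s * htr + c' * s ^ 2 * e2 - c' * (r * s + 1 - s) * e1

end Unramified

/-! ### Units of norm close to one in the inert case -/

/-- If `x ≡ 1` modulo `p` and `p ∣ n`, each `n`-th power gains a factor `p` in `x - 1`. -/
theorem pow_dvd_pow_pow_sub_one {R : Type*} [CommRing R] {p x : R} {n : ℕ} (hn : p ∣ (n : R))
    (hx : p ∣ x - 1) (i : ℕ) : p ^ (i + 1) ∣ x ^ n ^ i - 1 := by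
  induction i with
  | zero => simpa using hx
  | succ i ih =>
    set z := x ^ n ^ i
    have h1 : x ^ n ^ (i + 1) - 1 = (∑ j ∈ Finset.range n, z ^ j) * (z - 1) := by
      rw [geom_sum_mul, ← pow_mul, pow_succ]
    rw [h1, pow_succ' p]
    refine mul_dvd_mul ?_ ih
    have h2 : p ∣ z - 1 := (dvd_pow_self p (Nat.succ_ne_zero i)).trans ih
    have h3 : (∑ j ∈ Finset.range n, z ^ j) = (∑ j ∈ Finset.range n, (z ^ j - 1)) + n := by
      rw [Finset.sum_sub_distrib]; simp
    rw [h3]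
    exact dvd_add (Finset.dvd_sum fun j _ => h2.trans (sub_one_dvd_pow_sub_one z j)) hn
where
  sub_one_dvd_pow_sub_one {R : Type _} [CommRing R] (z : R) (j : ℕ) : z - 1 ∣ z ^ j - 1 := by
    simpa using sub_dvd_pow_sub_pow z 1 j

section Inert

variable {F : Type*} [Field F] [ValuativeRel F] [TopologicalSpace F] [IsNonarchimedeanLocalField F]
  [CharZero F] {E : Type*} [CommRing E] [Algebra F E] [IsReduced E] {σ : E ≃ₐ[F] E}

theorem one_lt_q : 1 < q F := by
  rw [q]
  exact Finite.one_lt_card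

theorem q_mem_max : ((q F : ℕ) : 𝒪[F]) ∈ 𝓂[F] := by
  let _ : Fintype 𝓀[F] := Fintype.ofFinite _
  rw [← IsLocalRing.residue_eq_zero_iff, map_natCast, q, Nat.card_eq_fintype_card]
  exact FiniteField.cast_card_eq_zero _

/-- `O_E / 𝔭 O_E` has `q²` elements. -/
theorem IsQuadConj.card_quotient (h : IsQuadConj σ) :
    Nat.card (OE F E ⧸ Ideal.map (algebraMap 𝒪[F] (OE F E)) 𝓂[F]) = q F ^ 2 := by
  obtain ⟨ω, hω⟩ := h.exists_isIntBasis
  obtain ⟨ϖ, hϖ⟩ := exists_uniformizer F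
  set I := Ideal.map (algebraMap 𝒪[F] (OE F E)) 𝓂[F]
  let f : 𝒪[F] × 𝒪[F] →+ OE F E ⧸ I :=
    { toFun := fun x => Ideal.Quotient.mk I (algebraMap _ _ x.1 + algebraMap _ _ x.2 * ⟨ω, hω.mem⟩)
      map_zero' := by simp
      map_add' := by
        intro x y
        rw [← map_add]
        congr 1
        simp only [Prod.fst_add, Prod.snd_add, map_add]
        ring }
  have hker : ∀ x : 𝒪[F] × 𝒪[F], f x = 0 ↔ x.1 ∈ 𝓂[F] ∧ x.2 ∈ 𝓂[F] := by
    intro x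
    change Ideal.Quotient.mk I _ = 0 ↔ _
    rw [Ideal.Quotient.eq_zero_iff_mem, mem_map_max_iff hϖ, mem_max_iff_exists hϖ,
      mem_max_iff_exists hϖ]
    change (∃ y : OE F E, algebraMap F E x.1 + algebraMap F E x.2 * ω = algebraMap F E ϖ * y) ↔ _
    constructor
    · rintro ⟨⟨y, hy⟩, hy'⟩
      obtain ⟨c, d, rfl⟩ := hω.rep y
      rw [hω.mem_iff] at hy
      have := hω.coeff_unique h (a := x.1) (b := x.2) (c := ϖ * c) (d := ϖ * d) (by
        rw [hy']; simp only [map_mul]; ring)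
      exact ⟨⟨⟨c, hy.1⟩, this.1⟩, ⟨⟨d, hy.2⟩, this.2⟩⟩
    · rintro ⟨⟨c, hc⟩, ⟨d, hd⟩⟩
      refine ⟨⟨_, (hω.mem_iff c d).2 ⟨c.2, d.2⟩⟩, ?_⟩
      rw [hc, hd]; simp only [map_mul]; ring
  have hsurj : Function.Surjective f := by
    intro x
    obtain ⟨⟨y, hy⟩, rfl⟩ := Ideal.Quotient.mk_surjective x
    obtain ⟨c, d, rfl⟩ := hω.rep y
    have hy' := (hω.mem_iff c d).1 hy
    exact ⟨(⟨c, hy'.1⟩, ⟨d, hy'.2⟩), rfl⟩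
  let g : 𝒪[F] × 𝒪[F] →+ 𝓀[F] × 𝓀[F] :=
    (IsLocalRing.residue 𝒪[F]).toAddMonoidHom.prodMap (IsLocalRing.residue 𝒪[F]).toAddMonoidHom
  have hg : Function.Surjective g := by
    rintro ⟨a, b⟩
    obtain ⟨a, rfl⟩ := IsLocalRing.residue_surjective a
    obtain ⟨b, rfl⟩ := IsLocalRing.residue_surjective b
    exact ⟨(a, b), rfl⟩
  have hk : f.ker = g.ker := by
    ext x
    rw [AddMonoidHom.mem_ker, AddMonoidHom.mem_ker, hker]
    change _ ↔ (IsLocalRing.residue 𝒪[F] x.1, IsLocalRing.residue 𝒪[F] x.2) = 0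
    rw [Prod.mk_eq_zero, IsLocalRing.residue_eq_zero_iff, IsLocalRing.residue_eq_zero_iff]
  have e1 := Nat.card_congr (QuotientAddGroup.quotientKerEquivOfSurjective f hsurj).toEquiv
  have e2 := Nat.card_congr (QuotientAddGroup.quotientKerEquivOfSurjective g hg).toEquiv
  rw [hk] at e1
  rw [← e1, e2, Nat.card_prod, q, sq]

theorem IsQuadConj.finite_quotient (h : IsQuadConj σ) :
    Finite (OE F E ⧸ Ideal.map (algebraMap 𝒪[F] (OE F E)) 𝓂[F]) :=
  Nat.finite_of_card_ne_zero (by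
    rw [h.card_quotient]
    exact pow_ne_zero _ (by have := one_lt_q (F := F); omega))

/-- In the inert case there are units `ζ`, with norm as close to `1` as desired, whose residue class
has order exactly `q + 1`. -/
theorem IsQuadConj.exists_norm_one_unit (h : IsQuadConj σ) (hin : IsInert F E) {ϖ : F}
    (hϖ : ord F ϖ = 1) (M : ℕ) :
    ∃ ζ ∈ OE F E, (∃ c ∈ 𝒪[F], Algebra.norm F ζ - 1 = ϖ ^ M * c) ∧
      (∃ c ∈ OE F E, ζ ^ (q F + 1) - 1 = algebraMap F E (ϖ ^ M) * c) ∧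
      ∀ i, 0 < i → i < q F + 1 → ∃ v ∈ OE F E, (ζ ^ i - 1) * v = 1 := by
  set I := Ideal.map (algebraMap 𝒪[F] (OE F E)) 𝓂[F] with hI
  have hprime : I.IsPrime := hin.2
  have hfin : Finite (OE F E ⧸ I) := h.finite_quotient
  have hdom : IsDomain (OE F E ⧸ I) := Ideal.Quotient.isDomain I
  have hnt : Nontrivial (OE F E ⧸ I) := hdom.toNontrivial
  have hfinu : Finite (OE F E ⧸ I)ˣ := Finite.of_injective _ Units.val_injective
  have hq := one_lt_q (F := F)
  have hϖm := uniformizer_mem hϖ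
  have hcard : Nat.card (OE F E ⧸ I)ˣ = (q F - 1) * (q F + 1) := by
    classical
    let _ : Fintype (OE F E ⧸ I) := Fintype.ofFinite _
    let _ : Field (OE F E ⧸ I) := Fintype.fieldOfDomain _
    rw [Nat.card_units, h.card_quotient]
    obtain ⟨k, hk⟩ : ∃ k, q F = k + 1 := ⟨q F - 1, by omega⟩
    rw [hk]
    have : (k + 1) ^ 2 = k * (k + 1 + 1) + 1 := by ring
    simp [this]
  have hcyc : IsCyclic (OE F E ⧸ I)ˣ :=
    have hinj : Function.Injective (Units.coeHom (OE F E ⧸ I)) := fun a b hab => Units.ext hab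
    isCyclic_of_injective_ringHom _ hinj
  obtain ⟨γu, hγu⟩ := IsCyclic.exists_generator (α := (OE F E ⧸ I)ˣ)
  have horder : orderOf (γu : OE F E ⧸ I) = (q F - 1) * (q F + 1) := by
    rw [orderOf_units, orderOf_eq_card_of_forall_mem_zpowers hγu, hcard]
  obtain ⟨γ, hγ⟩ := Ideal.Quotient.mk_surjective (γu : OE F E ⧸ I)
  have hmemI : ∀ x : OE F E, x ∈ I ↔ algebraMap 𝒪[F] (OE F E) ⟨ϖ, hϖm⟩ ∣ x := by
    intro x
    rw [hI, mem_map_max_iff hϖ]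
    exact ⟨fun ⟨y, hy⟩ => ⟨y, Subtype.ext hy⟩, fun ⟨y, hy⟩ => ⟨y, congrArg Subtype.val hy⟩⟩
  have hmem𝓂 : ∀ x : 𝒪[F], x ∈ 𝓂[F] ↔ (⟨ϖ, hϖm⟩ : 𝒪[F]) ∣ x := by
    intro x
    rw [mem_max_iff_exists hϖ]
    exact ⟨fun ⟨y, hy⟩ => ⟨y, Subtype.ext hy⟩, fun ⟨y, hy⟩ => ⟨y, congrArg Subtype.val hy⟩⟩
  -- elements outside the maximal ideal are units
  have hunit : ∀ x : OE F E, x ∉ I → Algebra.norm F (x : E) ≠ 0 ∧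
      IsUnit (⟨_, h.norm_mem x.2⟩ : 𝒪[F]) := by
    intro x hx
    have hσx : (⟨σ x, conj_mem_OE σ x.2⟩ : OE F E) ∉ I := by
      rw [hI, mem_map_max_iff hϖ] at hx ⊢
      rintro ⟨y, hy⟩
      refine hx ⟨⟨σ y, conj_mem_OE σ y.2⟩, ?_⟩
      have := congrArg σ hy
      change σ (σ x) = _ at this
      rwa [h.conj_conj, map_mul, AlgEquiv.commutes] at this
    have hu : IsUnit (⟨_, h.norm_mem x.2⟩ : 𝒪[F]) := by
      by_contra hc
      have h1 := Ideal.mem_map_of_mem (algebraMap 𝒪[F] (OE F E))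
        (show (⟨_, h.norm_mem x.2⟩ : 𝒪[F]) ∈ 𝓂[F] from hc)
      have h2 : algebraMap 𝒪[F] (OE F E) ⟨_, h.norm_mem x.2⟩ =
          x * ⟨σ x, conj_mem_OE σ x.2⟩ := Subtype.ext (h.algebraMap_norm x)
      rw [h2] at h1
      rcases hprime.mem_or_mem h1 with h3 | h3
      · exact hx h3
      · exact hσx h3
    exact ⟨fun h0 => hu.ne_zero (Subtype.ext h0), hu⟩
  have hγI : γ ∉ I := by
    rw [← Ideal.Quotient.eq_zero_iff_mem, hγ]
    exact γu.ne_zero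
  -- `γ` generates the residue units; its power with exponent `q - 1` has a residue class of order
  -- `q + 1`, and the factor `q ^ M` brings the norm and the `(q + 1)`-th power close to `1`
  refine ⟨((γ ^ ((q F - 1) * q F ^ M) : OE F E) : E), Subtype.property _, ?_, ?_, ?_⟩
  · have hN := (hunit γ hγI).2
    set N : 𝒪[F] := ⟨_, h.norm_mem γ.2⟩ with hNdef
    have h1 : (⟨ϖ, hϖm⟩ : 𝒪[F]) ∣ N ^ (q F - 1) - 1 := by
      rw [← hmem𝓂, ← IsLocalRing.residue_eq_zero_iff, map_sub, map_pow, map_one, sub_eq_zero]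
      let _ : Fintype 𝓀[F] := Fintype.ofFinite _
      rw [q, Nat.card_eq_fintype_card]
      exact FiniteField.pow_card_sub_one_eq_one _ (hN.map _).ne_zero
    have h2 := pow_dvd_pow_pow_sub_one ((hmem𝓂 _).1 q_mem_max) h1 M
    obtain ⟨c, hc⟩ := (pow_dvd_pow _ (Nat.le_succ M)).trans h2
    refine ⟨c, c.2, ?_⟩
    have h3 := congrArg Subtype.val hc
    rw [← pow_mul] at h3
    rw [SubmonoidClass.coe_pow, map_pow]
    exact h3
  · have h1 : algebraMap 𝒪[F] (OE F E) ⟨ϖ, hϖm⟩ ∣ γ ^ ((q F - 1) * (q F + 1)) - 1 := by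
      rw [← hmemI, ← Ideal.Quotient.eq_zero_iff_mem, map_sub, map_pow, map_one, hγ, ← horder,
        pow_orderOf_eq_one, sub_self]
    have h0 : algebraMap 𝒪[F] (OE F E) ⟨ϖ, hϖm⟩ ∣ ((q F : ℕ) : OE F E) := by
      have := map_dvd (algebraMap 𝒪[F] (OE F E)) ((hmem𝓂 _).1 (q_mem_max (F := F)))
      rwa [map_natCast] at this
    have h2 := pow_dvd_pow_pow_sub_one h0 h1 M
    obtain ⟨c, hc⟩ := (pow_dvd_pow _ (Nat.le_succ M)).trans h2
    refine ⟨c, c.2, ?_⟩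
    have h3 := congrArg Subtype.val hc
    rw [map_pow, ← SubmonoidClass.coe_pow, ← pow_mul, mul_right_comm, pow_mul, pow_mul]
    rw [pow_mul] at h3
    exact h3
  · intro i hi0 hi
    have hnot : (γ ^ ((q F - 1) * q F ^ M)) ^ i - 1 ∉ I := by
      rw [← Ideal.Quotient.eq_zero_iff_mem, map_sub, map_pow, map_pow, map_one, hγ, sub_eq_zero,
        ← pow_mul, ← orderOf_dvd_iff_pow_eq_one, horder, mul_assoc]
      intro hd
      have h1 := Nat.dvd_of_mul_dvd_mul_left (by omega) hd
      have hcop : Nat.Coprime (q F + 1) (q F ^ M) := by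
        apply Nat.Coprime.pow_right
        simp
      exact absurd (Nat.le_of_dvd hi0 (hcop.dvd_of_dvd_mul_left h1)) (by omega)
    obtain ⟨h1, h2⟩ := hunit _ hnot
    obtain ⟨v, hv, hv'⟩ := h.exists_inv_mem (Subtype.property _) h1 (ord_eq_zero_of_isUnit h2)
    exact ⟨v, hv, hv'⟩

end Inert

/-! ### The split case -/

section Trichotomy

variable {F : Type*} [Field F] {E : Type*} [CommRing E] [Algebra F E] {σ : E ≃ₐ[F] E}

theorem IsSplit.not_isField (h : IsSplit F E) : ¬ IsField E := by
  obtain ⟨e⟩ := h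
  intro hE
  have := hE.isDomain
  have h1 : e.symm (1, 0) * e.symm (0, 1) = 0 := by rw [← map_mul]; simp
  rcases mul_eq_zero.1 h1 with h2 | h2 <;> simp at h2

/-- A nontrivial idempotent `e` gives the isomorphism `(a, b) ↦ a e + b (1 - e)` of `F × F` with
`E`. -/
theorem IsQuadConj.isSplit [CharZero F] [IsReduced E] (h : IsQuadConj σ) (hE : ¬ IsField E) :
    IsSplit F E := by
  have := h.nontrivial
  obtain ⟨e, he, hσe⟩ := h.exists_idempotent hE
  have hfin : Module.Finite F E := Module.finite_of_finrank_pos (by rw [h.finrank_eq]; norm_num)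
  let f : F × F →ₐ[F] E :=
    { toFun := fun x => algebraMap F E x.1 * e + algebraMap F E x.2 * (1 - e)
      map_one' := by simp
      map_zero' := by simp
      map_mul' := by
        intro x y
        simp only [Prod.fst_mul, Prod.snd_mul, map_mul]
        linear_combination (algebraMap F E x.1 * algebraMap F E y.2 +
          algebraMap F E x.2 * algebraMap F E y.1 - algebraMap F E x.1 * algebraMap F E y.1 -
          algebraMap F E x.2 * algebraMap F E y.2) * he
      map_add' := by
        intro x y
        simp only [Prod.fst_add, Prod.snd_add, map_add]; ring
      commutes' := by
        intro r
        simp only [Prod.algebraMap_apply, Algebra.algebraMap_self, RingHom.id_apply]; ring }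
  have he0 : e ≠ 0 := by rintro rfl; simp at hσe
  have he1 : 1 - e ≠ 0 := by
    intro h0
    have : e = 1 := (sub_eq_zero.1 h0).symm
    rw [this] at hσe; simp at hσe
  have hunit : ∀ (a : F) (x : E), algebraMap F E a * x = 0 → x ≠ 0 → a = 0 := by
    intro a x hax hx
    by_contra ha
    exact hx (((IsUnit.mk0 a ha).map (algebraMap F E)).mul_right_eq_zero.1 hax)
  have hinj : Function.Injective f := by
    rw [injective_iff_map_eq_zero]
    rintro ⟨a, b⟩ hab
    change algebraMap F E a * e + algebraMap F E b * (1 - e) = 0 at hab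
    have h1 : algebraMap F E a * e = 0 := by
      linear_combination e * hab + (algebraMap F E b - algebraMap F E a) * he
    have h2 : algebraMap F E b * (1 - e) = 0 := by linear_combination hab - h1
    rw [hunit a e h1 he0, hunit b _ h2 he1]; rfl
  have hbij : Function.Bijective f := ⟨hinj,
    (LinearMap.injective_iff_surjective_of_finrank_eq_finrank (f := f.toLinearMap)
      (by rw [h.finrank_eq]; simp)).1 hinj⟩
  exact ⟨(AlgEquiv.ofBijective f hbij).symm⟩

end Trichotomy

/-! ### The signs `ξ` and `ξ̂` -/

section Signs

variable {F : Type*} [Field F] [ValuativeRel F] [TopologicalSpace F] [IsNonarchimedeanLocalField F]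
  [CharZero F] {E : Type*} [CommRing E] [Algebra F E] [IsReduced E] {σ : E ≃ₐ[F] E}

theorem xi_of_isInert (hin : IsInert F E) : xi F E = -1 := by
  rw [xi, if_neg (fun hs => hs.not_isField hin.1), if_pos hin]

theorem IsQuadConj.xi_of_not_isField (h : IsQuadConj σ) (hE : ¬ IsField E) : xi F E = 1 := by
  rw [xi, if_pos (h.isSplit hE)]

theorem xi_of_isRamified (hram : IsRamified F E) : xi F E = 0 := by
  rw [xi, if_neg (fun hs => hs.not_isField hram.1), if_neg (fun hi => hram.2 hi.2)]

theorem not_isInert_of_isRamified (hram : IsRamified F E) : ¬ IsInert F E :=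
  fun hi => hram.2 hi.2

theorem isInert_or_not_isField (hram : ¬ IsRamified F E) : IsInert F E ∨ ¬ IsField E := by
  by_cases hE : IsField E
  · left
    refine ⟨hE, ?_⟩
    by_contra hc
    exact hram ⟨hE, hc⟩
  · exact Or.inr hE

theorem IsQuadConj.xi_eq_xiHat_sq (h : IsQuadConj σ) (hram : ¬ IsRamified F E) :
    xi F E = xiHat F E ^ 2 := by
  rcases isInert_or_not_isField hram with hin | hE
  · rw [xi_of_isInert hin, xiHat, if_pos hin, Complex.I_sq]
  · rw [h.xi_of_not_isField hE, xiHat, if_neg (fun hin => hE hin.1), one_pow]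

theorem xiHat_of_isRamified (hram : IsRamified F E) : xiHat F E = 1 := by
  rw [xiHat, if_neg (not_isInert_of_isRamified hram)]

theorem xiHat_ne_zero : xiHat F E ≠ 0 := by
  rw [xiHat]; split_ifs <;> simp

end Signs

/-! ### The ring `O_E` is semilocal -/

section Radical

variable {F : Type*} [Field F] [ValuativeRel F] [TopologicalSpace F] [IsNonarchimedeanLocalField F]
  [CharZero F] {E : Type*} [CommRing E] [Algebra F E] [IsReduced E] {σ : E ≃ₐ[F] E}

/-- The norm of `1 + ϖ x` is congruent to `1` modulo `𝔭`. -/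
theorem IsQuadConj.exists_inv_one_add (h : IsQuadConj σ) {ϖ : F} (hϖ : ord F ϖ = 1) {x : E}
    (hx : x ∈ OE F E) : ∃ v ∈ OE F E, (1 + algebraMap F E ϖ * x) * v = 1 := by
  have hϖm := uniformizer_mem hϖ
  have hmem : 1 + algebraMap F E ϖ * x ∈ OE F E :=
    add_mem (one_mem _) (mul_mem (algebraMap_mem_OE hϖm) hx)
  set n : 𝒪[F] := ⟨_, h.norm_mem hmem⟩ with hn
  have hn1 : n - 1 ∈ 𝓂[F] := by
    rw [mem_max_iff_exists hϖ]
    refine ⟨⟨Algebra.trace F E x + ϖ * Algebra.norm F x,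
      add_mem (h.trace_mem hx) (mul_mem hϖm (h.norm_mem hx))⟩, ?_⟩
    change Algebra.norm F (1 + algebraMap F E ϖ * x) - 1 =
      ϖ * (Algebra.trace F E x + ϖ * Algebra.norm F x)
    apply h.algebraMap_injective
    simp only [map_sub, map_mul, map_add, map_one, h.algebraMap_norm, h.algebraMap_trace,
      AlgEquiv.commutes]
    ring
  have hnu : IsUnit n := by
    by_contra hc
    have h1 := sub_mem (show n ∈ 𝓂[F] from hc) hn1
    rw [sub_sub_cancel] at h1
    exact (Ideal.ne_top_iff_one _).1 (IsLocalRing.maximalIdeal.isMaximal _).ne_top h1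
  exact h.exists_inv_mem hmem (fun h0 => hnu.ne_zero (Subtype.ext h0)) (ord_eq_zero_of_isUnit hnu)

/-- The prime elements of `E` in question lie in the Jacobson radical of `O_E`. -/
theorem IsQuadConj.prime_mem_radical (h : IsQuadConj σ) {ϖ : F} {ϖE : Eˣ}
    (hϖ : ArePrimeElements F ϖ ϖE) {π : Eˣ} (hπ : π = ϖE ∨ (π : E) = algebraMap F E ϖ) :
    (π : E) ∈ OE F E ∧ ∀ x ∈ OE F E, ∃ v ∈ OE F E, (1 + π * x) * v = 1 := by
  obtain ⟨h1, h2, h3⟩ := hϖ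
  have hϖm := uniformizer_mem h1
  have hbase : (π : E) = algebraMap F E ϖ → (π : E) ∈ OE F E ∧
      ∀ x ∈ OE F E, ∃ v ∈ OE F E, (1 + π * x) * v = 1 := by
    intro hp
    rw [hp]
    exact ⟨algebraMap_mem_OE hϖm, fun x hx => h.exists_inv_one_add h1 hx⟩
  rcases hπ with rfl | hp
  · by_cases hram : IsRamified F E
    · have hN := h2 hram
      have hm : (π : E) ∈ OE F E := h.mem_OE_of_norm hram.1 (by rw [hN]; exact hϖm)
      refine ⟨hm, fun x hx => ?_⟩
      set u : E := (π : E) * σ ((π⁻¹ : Eˣ) : E) with hu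
      have hinv : σ (π : E) * σ ((π⁻¹ : Eˣ) : E) = 1 := by rw [← map_mul, Units.mul_inv, map_one]
      have hum : u ∈ OE F E := by
        apply h.mem_OE_of_norm hram.1
        rw [hu, map_mul, h.norm_conj, ← map_mul, Units.mul_inv, map_one]
        exact one_mem _
      have hsq : (π : E) ^ 2 = algebraMap F E ϖ * u := by
        rw [← hN, h.algebraMap_norm, hu]
        linear_combination -(π : E) ^ 2 * hinv
      -- with `π² = ϖ u`, the product of `1 + π x` and `1 - π x` is `1 - ϖ u x²`
      obtain ⟨v, hv, hv'⟩ := h.exists_inv_one_add h1 (x := -(u * x ^ 2))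
        (neg_mem (mul_mem hum (pow_mem hx 2)))
      refine ⟨(1 - π * x) * v, mul_mem (sub_mem (one_mem _) (mul_mem hm hx)) hv, ?_⟩
      linear_combination hv' - x ^ 2 * v * hsq
    · exact hbase (h3 hram)
  · exact hbase hp

/-- Every maximal ideal contains `𝔭 O_E`, and `O_E / 𝔭 O_E` is finite. -/
theorem IsQuadConj.finite_maximalSpectrum (h : IsQuadConj σ) :
    Finite (MaximalSpectrum (OE F E)) := by
  obtain ⟨ϖ, hϖ⟩ := exists_uniformizer F
  have hϖm := uniformizer_mem hϖ
  set I := Ideal.map (algebraMap 𝒪[F] (OE F E)) 𝓂[F] with hI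
  have hfin : Finite (OE F E ⧸ I) := h.finite_quotient
  have hle : ∀ M : MaximalSpectrum (OE F E), I ≤ M.asIdeal := by
    intro M x hx
    obtain ⟨y, hy⟩ := (mem_map_max_iff hϖ x).1 hx
    have hj : x ∈ (⊥ : Ideal (OE F E)).jacobson := by
      rw [Ideal.mem_jacobson_bot]
      intro z
      obtain ⟨v, hv, hv'⟩ := h.exists_inv_one_add hϖ (mul_mem y.2 z.2)
      refine IsUnit.of_mul_eq_one ⟨v, hv⟩ (Subtype.ext ?_)
      change ((x : E) * z + 1) * v = 1
      rw [hy]; linear_combination hv'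
    rw [Ideal.jacobson, Ideal.mem_sInf] at hj
    exact hj ⟨bot_le, M.isMaximal⟩
  refine Finite.of_injective
    (fun M : MaximalSpectrum (OE F E) => Ideal.map (Ideal.Quotient.mk I) M.asIdeal) ?_
  intro M M' hMM
  have := congrArg (Ideal.comap (Ideal.Quotient.mk I)) hMM
  simp only [Ideal.comap_map_of_surjective _ Ideal.Quotient.mk_surjective] at this
  have hk : Ideal.comap (Ideal.Quotient.mk I) ⊥ = I := by
    rw [← RingHom.ker_eq_comap_bot, Ideal.mk_ker]
  rw [hk, sup_eq_left.2 (hle M), sup_eq_left.2 (hle M')] at this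
  exact MaximalSpectrum.ext this

end Radical

/-! ### Indices of principal ideals -/

section Index

variable {F : Type*} [Field F] [ValuativeRel F] [TopologicalSpace F] [IsNonarchimedeanLocalField F]
  [CharZero F] {E : Type*} [CommRing E] [Algebra F E] [IsReduced E] {σ : E ≃ₐ[F] E}

variable (F E) in
/-- `O_E` as an additive subgroup of `E`. -/
def OEadd : AddSubgroup E := (OE F E).toSubring.toAddSubgroup

theorem IsQuadConj.relIndex_uniformizer (h : IsQuadConj σ) {ϖ : F} (hϖ : ord F ϖ = 1) :
    ((OEadd F E).map (AddMonoidHom.mulLeft (algebraMap F E ϖ))).relIndex (OEadd F E) =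
      q F ^ 2 := by
  rw [← h.card_quotient]
  change AddSubgroup.index _ = (Submodule.toAddSubgroup _).index
  congr 1
  ext x
  rw [AddSubgroup.mem_addSubgroupOf, AddSubgroup.mem_map]
  refine Iff.trans ?_ (mem_map_max_iff hϖ x).symm
  constructor
  · rintro ⟨y, hy, hyx⟩
    exact ⟨⟨y, hy⟩, hyx.symm⟩
  · rintro ⟨y, hy⟩
    exact ⟨y, y.2, hy.symm⟩

/-- A ramified prime element has residue degree one. -/
theorem IsQuadConj.relIndex_ramified (h : IsQuadConj σ) (hram : IsRamified F E) {ϖE : Eˣ}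
    (hϖE : ord F (Algebra.norm F (ϖE : E)) = 1) :
    ((OEadd F E).map (AddMonoidHom.mulLeft (ϖE : E))).relIndex (OEadd F E) = q F := by
  have hm : (ϖE : E) ∈ OE F E := h.mem_OE_of_norm hram.1 (uniformizer_mem hϖE)
  have h1 := h.relIndex_uniformizer hϖE
  set A := (OEadd F E).map (AddMonoidHom.mulLeft (ϖE : E)) with hA
  set A' := (OEadd F E).map (AddMonoidHom.mulLeft (σ (ϖE : E))) with hA'
  have hinj : Function.Injective (AddMonoidHom.mulLeft (ϖE : E)) := by
    intro x y hxy
    exact ϖE.isUnit.mul_left_cancel hxy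
  -- `N(ϖ_E) = ϖ_E σ(ϖ_E)` has index `q²`, and both factors have the same index
  have hB : (OEadd F E).map (AddMonoidHom.mulLeft (algebraMap F E (Algebra.norm F (ϖE : E)))) =
      A'.map (AddMonoidHom.mulLeft (ϖE : E)) := by
    rw [hA', AddSubgroup.map_map]
    congr 1
    ext x
    simp [h.algebraMap_norm, mul_assoc]
  have hle : A ≤ OEadd F E := by
    rintro _ ⟨x, hx, rfl⟩
    exact (OE F E).mul_mem hm hx
  have hle' : A' ≤ OEadd F E := by
    rintro _ ⟨x, hx, rfl⟩
    exact (OE F E).mul_mem (conj_mem_OE σ hm) hx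
  have hconj : A'.relIndex (OEadd F E) = A.relIndex (OEadd F E) := by
    let s : E →+ E := (σ : E →+* E).toAddMonoidHom
    have hs : Function.Injective s := σ.injective
    have hO : (OEadd F E).map s = OEadd F E := by
      ext x
      constructor
      · rintro ⟨y, hy, rfl⟩
        exact conj_mem_OE σ hy
      · intro hx
        exact ⟨σ x, conj_mem_OE σ hx, h.conj_conj x⟩
    have hA2 : A.map s = A' := by
      ext x
      constructor
      · rintro ⟨_, ⟨y, hy, rfl⟩, rfl⟩
        exact ⟨σ y, conj_mem_OE σ hy, (map_mul σ _ _).symm⟩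
      · rintro ⟨y, hy, rfl⟩
        refine ⟨ϖE * σ y, ⟨σ y, conj_mem_OE σ hy, rfl⟩, ?_⟩
        change σ (ϖE * σ y) = σ ϖE * y
        rw [map_mul, h.conj_conj]
    have := AddSubgroup.relIndex_map_map_of_injective A (OEadd F E) hs
    rwa [hO, hA2] at this
  rw [hB] at h1
  have h2 := AddSubgroup.relIndex_mul_relIndex (A'.map (AddMonoidHom.mulLeft (ϖE : E))) A
    (OEadd F E) (AddSubgroup.map_mono hle') hle
  rw [h1, hA, AddSubgroup.relIndex_map_map_of_injective _ _ hinj, hconj, ← hA, ← sq] at h2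
  exact (Nat.pow_left_injective (n := 2) (by norm_num)) h2

end Index

/-! ### Gauss sums of quadratic functions on finite abelian groups -/

section Gauss

open ComplexConjugate

variable {A : Type*} [AddCommGroup A] [Fintype A]

/-- A function `f` of absolute value one on a finite abelian group that is quadratic: its
polarization is the pairing `β`, which is nondegenerate. -/
structure IsGaussFun (f : A → ℂ) (β : A → AddChar A ℂ) : Prop where
  mul_conj : ∀ y, f y * conj (f y) = 1
  map_zero : f 0 = 1
  map_add : ∀ y y', f (y + y') = f y * f y' * β y y'
  nondeg : ∀ y, (∀ y', β y y' = 1) → y = 0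

variable {f : A → ℂ} {β : A → AddChar A ℂ}

/-- The absolute value of a Gauss sum is the square root of the order of the group. -/
theorem IsGaussFun.sum_mul_conj (hf : IsGaussFun f β) :
    (∑ y, f y) * conj (∑ y, f y) = Fintype.card A := by
  classical
  rw [map_sum, Finset.sum_mul_sum, Finset.sum_comm]
  have h1 : ∀ y', ∑ y, f y * conj (f y') = ∑ y, f y * β y y' := by
    intro y'
    rw [← Equiv.sum_comp (Equiv.addRight y') (fun y => f y * conj (f y'))]
    refine Finset.sum_congr rfl fun y _ => ?_
    rw [Equiv.coe_addRight, hf.map_add]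
    linear_combination f y * β y y' * hf.mul_conj y'
  simp_rw [h1]
  rw [Finset.sum_comm]
  simp_rw [← Finset.mul_sum, AddChar.sum_eq_ite]
  rw [Finset.sum_eq_single 0]
  · rw [hf.map_zero, if_pos, one_mul]
    ext y'
    have := hf.map_add 0 y'
    rw [zero_add, hf.map_zero, one_mul] at this
    have h0 : f y' ≠ 0 := left_ne_zero_of_mul_eq_one (hf.mul_conj y')
    rw [AddChar.zero_apply]
    exact (mul_left_cancel₀ h0 (by rw [← this, mul_one]))
  · intro y _ hy
    rw [if_neg, mul_zero]
    intro h0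
    exact hy (hf.nondeg y fun y' => by rw [h0, AddChar.zero_apply])
  · simp

/-- If the quadratic function vanishes on two complementary subgroups (the images of `ε` and
`1 - ε`), then its Gauss sum is the positive square root of the order of the group. -/
theorem IsGaussFun.sum_eq_of_idempotent (hf : IsGaussFun f β) (ε : A →+ A)
    (h1 : ∀ y, f (ε y) = 1) (h2 : ∀ y, f (y - ε y) = 1) :
    ∃ n : ℕ, ∑ y, f y = n ∧ n ^ 2 = Fintype.card A := by
  classical
  have hcard : (Fintype.card A : ℂ) ≠ 0 := Nat.cast_ne_zero.2 Fintype.card_ne_zero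
  have key : ∃ n : ℕ, ∑ y, f y = n := by
    -- averaging over the translations by `ε a` shows that the sum is a natural number
    have e1 : (Fintype.card A : ℂ) * ∑ y, f y = ∑ a : A, ∑ y, f (y + ε a) := by
      have : ∀ a : A, ∑ y, f (y + ε a) = ∑ y, f y := fun a =>
        Equiv.sum_comp (Equiv.addRight (ε a)) f
      simp_rw [this, Finset.sum_const, nsmul_eq_mul]
      rfl
    have e2 : ∀ y, ∑ a, f (y + ε a) =
        if (β (y - ε y)).compAddMonoidHom ε = 0 then (Fintype.card A : ℂ) else 0 := by
      intro y
      rw [← AddChar.sum_eq_ite, ← Equiv.sum_comp (Equiv.subRight y)]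
      refine Finset.sum_congr rfl fun a _ => ?_
      have e : y + ε ((Equiv.subRight y) a) = (y - ε y) + ε a := by
        simp only [Equiv.subRight_apply, map_sub]; abel
      rw [e, hf.map_add, h1, h2, one_mul, one_mul]
      rfl
    refine ⟨∑ y : A, if (β (y - ε y)).compAddMonoidHom ε = 0 then 1 else 0, ?_⟩
    apply mul_left_cancel₀ hcard
    rw [e1, Finset.sum_comm]
    simp_rw [e2]
    rw [Nat.cast_sum, Finset.mul_sum]
    refine Finset.sum_congr rfl fun y _ => ?_
    split_ifs <;> simp
  obtain ⟨n, hn⟩ := key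
  refine ⟨n, hn, ?_⟩
  have := hf.sum_mul_conj
  rw [hn, Complex.conj_natCast] at this
  rw [sq]
  exact_mod_cast this

/-- The rational integers are integrally closed, so that `n` divides `m` in `ℤ` as soon as it does
so among the algebraic integers. -/
theorem int_dvd_of_isIntegral {α : ℂ} (hα : IsIntegral ℤ α) {n m : ℤ} (hn : n ≠ 0)
    (h : (m : ℂ) = n * α) : n ∣ m := by
  have h1 : α = algebraMap ℚ ℂ ((m : ℚ) / n) := by
    have : (n : ℂ) ≠ 0 := Int.cast_ne_zero.2 hn
    simp only [eq_ratCast, Rat.cast_div, Rat.cast_intCast]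
    field_simp
    rw [h]; ring
  rw [h1, isIntegral_algebraMap_iff (algebraMap ℚ ℂ).injective] at hα
  obtain ⟨k, hk⟩ := IsIntegrallyClosed.isIntegral_iff.1 hα
  refine ⟨k, ?_⟩
  have h2 : (n : ℚ) ≠ 0 := Int.cast_ne_zero.2 hn
  rw [eq_div_iff h2] at hk
  simp only [eq_intCast] at hk
  exact_mod_cast (by rw [← hk]; ring : (m : ℚ) = n * k)

/-- A sum over a set on which a permutation of order `n` acts freely, leaving the summand
invariant, is divisible by `n`. -/
theorem exists_sum_eq_mul_of_free {f : A → ℂ} (hint : ∀ y, IsIntegral ℤ (f y)) (j : Equiv.Perm A)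
    {n : ℕ} (hn : 0 < n) (hj : ∀ y, (j ^ n) y = y) (hfj : ∀ y, f (j y) = f y) (S : Finset A)
    (hS : ∀ y ∈ S, j y ∈ S) (hfree : ∀ y ∈ S, ∀ i, 0 < i → i < n → (j ^ i) y ≠ y) :
    ∃ α : ℂ, IsIntegral ℤ α ∧ ∑ y ∈ S, f y = n * α := by
  classical
  induction hk : S.card using Nat.strong_induction_on generalizing S with
  | _ k ih =>
  rcases S.eq_empty_or_nonempty with rfl | ⟨y, hy⟩
  · exact ⟨0, isIntegral_zero, by simp⟩
  have hpow : ∀ i, (j ^ i) y ∈ S := by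
    intro i
    induction i with
    | zero => simpa using hy
    | succ i ih' => rw [pow_succ']; exact hS _ ih'
  have hfpow : ∀ i, f ((j ^ i) y) = f y := by
    intro i
    induction i with
    | zero => simp
    | succ i ih' => rw [pow_succ', Equiv.Perm.mul_apply, hfj, ih']
  -- The orbit of `y` has `n` elements and contributes `n f(y)`; it is removed from `S`.
  set O := (Finset.range n).image (fun i => (j ^ i) y) with hO
  have hinj : Set.InjOn (fun i => (j ^ i) y) (Finset.range n : Set ℕ) := by
    have key : ∀ a b, a < n → b < n → a < b → (j ^ a) y ≠ (j ^ b) y := by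
      intro a b ha hb hab he
      obtain ⟨d, rfl⟩ := Nat.exists_eq_add_of_lt hab
      rw [add_assoc, pow_add, Equiv.Perm.mul_apply] at he
      exact hfree y hy (d + 1) (by omega) (by omega) ((j ^ a).injective he).symm
    intro a ha b hb hab
    rcases lt_trichotomy a b with h | h | h
    · exact absurd hab (key a b (by simpa using ha) (by simpa using hb) h)
    · exact h
    · exact absurd hab.symm (key b a (by simpa using hb) (by simpa using ha) h)
  have hOS : O ⊆ S := by
    intro z hz
    obtain ⟨i, -, rfl⟩ := Finset.mem_image.1 hz
    exact hpow i
  have hsumO : ∑ z ∈ O, f z = n * f y := by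
    rw [hO, Finset.sum_image hinj]
    simp [hfpow]
  have hyO : y ∈ O := Finset.mem_image.2 ⟨0, by simpa using hn, by simp⟩
  have hjO : ∀ z, j z ∈ O → z ∈ O := by
    intro z hz
    obtain ⟨i, hi, hiz⟩ := Finset.mem_image.1 hz
    rcases Nat.eq_zero_or_pos i with rfl | h0
    · refine Finset.mem_image.2 ⟨n - 1, by simpa using hn, ?_⟩
      apply j.injective
      change (j * j ^ (n - 1)) y = j z
      rw [← pow_succ', Nat.sub_add_cancel hn, hj, ← hiz]
      rfl
    · refine Finset.mem_image.2 ⟨i - 1, by simp at hi ⊢; omega, ?_⟩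
      apply j.injective
      change (j * j ^ (i - 1)) y = j z
      rw [← pow_succ', Nat.sub_add_cancel h0]
      exact hiz
  obtain ⟨α, hα, hα'⟩ := ih (S \ O).card (by
      rw [← hk]
      apply Finset.card_lt_card
      exact Finset.sdiff_ssubset hOS ⟨y, hyO⟩) (S \ O)
    (fun z hz => by
      rw [Finset.mem_sdiff] at hz ⊢
      exact ⟨hS z hz.1, fun hc => hz.2 (hjO z hc)⟩)
    (fun z hz => hfree z (Finset.mem_sdiff.1 hz).1) rfl
  refine ⟨α + f y, hα.add (hint y), ?_⟩
  rw [← Finset.sum_sdiff hOS, hα', hsumO]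
  ring

/-- A real Gauss sum on a group of order `q ^ l` that is `1` modulo `q + 1` is `(-q) ^ (l / 2)`. -/
theorem IsGaussFun.sum_eq_of_perm (hf : IsGaussFun f β) (hint : ∀ y, IsIntegral ℤ (f y))
    {q l : ℕ} (hq : 1 < q) (hcard : Fintype.card A = q ^ l)
    (c : A ≃ A) (hc : ∀ y, f (c y) = conj (f y))
    (j : Equiv.Perm A) (hj : ∀ y, (j ^ (q + 1)) y = y) (hfj : ∀ y, f (j y) = f y) (hj0 : j 0 = 0)
    (hfree : ∀ y, y ≠ 0 → ∀ i, 0 < i → i < q + 1 → (j ^ i) y ≠ y) :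
    ∃ k : ℕ, l = 2 * k ∧ ∑ y, f y = (-q : ℂ) ^ k := by
  classical
  set g := ∑ y, f y with hg
  -- `g` is real with `g² = q ^ l`, so that `g = ± q ^ k` once `l = 2 k`; the congruence `g ≡ 1`
  -- modulo `q + 1`, where `q ≡ -1`, forces `l` to be even and fixes the sign
  have hreal : conj g = g := by
    rw [hg, map_sum, ← Equiv.sum_comp c f]
    exact Finset.sum_congr rfl fun y _ => (hc y).symm
  have hsq : g * g = (q : ℂ) ^ l := by
    have := hf.sum_mul_conj
    rw [← hg, hreal, hcard] at this
    exact_mod_cast this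
  obtain ⟨α, hα, hα'⟩ := exists_sum_eq_mul_of_free hint j (Nat.succ_pos q) hj hfj
    (Finset.univ.erase 0)
    (fun y hy => by
      simp only [Finset.mem_erase, Finset.mem_univ, and_true] at hy ⊢
      intro h0
      exact hy (j.injective (by rw [h0, hj0])))
    (fun y hy => hfree y (by simpa using hy))
  have hg1 : g = 1 + ((q : ℂ) + 1) * α := by
    rw [hg, ← Finset.add_sum_erase _ _ (Finset.mem_univ (0 : A)), hα', hf.map_zero]
    push_cast; ring
  have hq1 : ((q : ℤ) + 1) ≠ 0 := by positivity
  have hmod : ∀ k : ℕ, ((q : ℤ) + 1) ∣ (q : ℤ) ^ k - (-1) ^ k := by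
    intro k
    have := sub_dvd_pow_sub_pow (q : ℤ) (-1) k
    rwa [sub_neg_eq_add] at this
  have hd : ((q : ℤ) + 1) ∣ (q : ℤ) ^ l - 1 := by
    apply int_dvd_of_isIntegral (α := α * (2 + ((q + 1 : ℕ) : ℂ) * α)) _ hq1
    · push_cast
      rw [← hsq, hg1]; ring
    · refine hα.mul (IsIntegral.add ?_ (IsIntegral.mul ?_ hα))
      · exact_mod_cast isIntegral_algebraMap (R := ℤ) (A := ℂ) (x := 2)
      · exact_mod_cast isIntegral_algebraMap (R := ℤ) (A := ℂ) (x := ((q + 1 : ℕ) : ℤ))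
  have hsmall : ¬ ((q : ℤ) + 1) ∣ 2 := by
    intro h2
    have := Int.le_of_dvd (by norm_num) h2
    omega
  rcases Nat.even_or_odd l with hl | hl
  swap
  · exfalso
    apply hsmall
    have := dvd_sub hd (hmod l)
    rw [hl.neg_one_pow] at this
    have e : (q : ℤ) ^ l - 1 - (q ^ l - -1) = -2 := by ring
    rw [e] at this
    exact (Int.dvd_neg).1 this
  · obtain ⟨k, hk⟩ := hl
    refine ⟨k, by omega, ?_⟩
    have hpm : g = (q : ℂ) ^ k ∨ g = -(q : ℂ) ^ k := by
      apply mul_self_eq_mul_self_iff.1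
      rw [hsq, hk, pow_add]
    have hsign : ∀ s : ℤ, g = s * (q : ℂ) ^ k → ((q : ℤ) + 1) ∣ s * (q : ℤ) ^ k - 1 := by
      intro s hs
      apply int_dvd_of_isIntegral hα hq1
      push_cast
      rw [← hs, hg1]; ring
    have hsign' : ∀ s : ℤ, g = s * (q : ℂ) ^ k → ((q : ℤ) + 1) ∣ s * (-1) ^ k - 1 := by
      intro s hs
      have := dvd_sub (hsign s hs) (Dvd.dvd.mul_left (hmod k) s)
      have e : s * (q : ℤ) ^ k - 1 - s * ((q : ℤ) ^ k - (-1) ^ k) = s * (-1) ^ k - 1 := by ring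
      rwa [e] at this
    rw [neg_pow]
    rcases neg_one_pow_eq_or ℤ k with he | he
    · have he' : (-1 : ℂ) ^ k = 1 := by exact_mod_cast congrArg (Int.cast (R := ℂ)) he
      rcases hpm with h1 | h1
      · rw [h1, he', one_mul]
      · exfalso
        have := hsign' (-1) (by rw [h1]; push_cast; ring)
        rw [he] at this
        apply hsmall
        have e : (-1 : ℤ) * 1 - 1 = -2 := by norm_num
        rw [e] at this
        exact (Int.dvd_neg).1 this
    · have he' : (-1 : ℂ) ^ k = -1 := by exact_mod_cast congrArg (Int.cast (R := ℂ)) he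
      rcases hpm with h1 | h1
      · exfalso
        have := hsign' 1 (by rw [h1]; push_cast; ring)
        rw [he] at this
        apply hsmall
        have e : (1 : ℤ) * -1 - 1 = -2 := by norm_num
        rw [e] at this
        exact (Int.dvd_neg).1 this
      · rw [h1, he']; ring

end Gauss

/-! ### Integral matrices -/

section IntegralMatrices

variable {F : Type*} [Field F] [ValuativeRel F] {E : Type*} [CommRing E] [Algebra F E]
variable {ι κ lam : Type*}

/-- An integral matrix, viewed as a matrix with entries in `E`. -/
def up (y : Matrix κ ι (OE F E)) : Matrix κ ι E := y.map (algebraMap (OE F E) E)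

variable (F) in
/-- All entries of the matrix lie in `O_E`. -/
def IsInt (M : Matrix κ ι E) : Prop := ∀ k i, M k i ∈ OE F E

@[simp] theorem up_apply (y : Matrix κ ι (OE F E)) (k : κ) (i : ι) : up y k i = (y k i : E) := rfl

theorem up_mul [Fintype ι] (x : Matrix κ ι (OE F E)) (y : Matrix ι lam (OE F E)) :
    up (x * y) = up x * up y := Matrix.map_mul

theorem up_add (x y : Matrix κ ι (OE F E)) : up (x + y) = up x + up y := by
  ext; simp

theorem up_sub (x y : Matrix κ ι (OE F E)) : up (x - y) = up x - up y := by
  ext; simp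

theorem up_neg (x : Matrix κ ι (OE F E)) : up (-x) = -up x := by
  ext; simp

theorem up_zero : up (0 : Matrix κ ι (OE F E)) = 0 := by
  ext; simp

theorem up_one [DecidableEq ι] : up (1 : Matrix ι ι (OE F E)) = 1 := by
  ext i j; rw [up_apply, Matrix.one_apply, Matrix.one_apply]; split_ifs <;> rfl

theorem up_injective : Function.Injective (up : Matrix κ ι (OE F E) → Matrix κ ι E) := by
  intro x y hxy
  ext i j
  exact congrFun (congrFun hxy i) j

theorem isInt_up (y : Matrix κ ι (OE F E)) : IsInt F (up y) := fun k i => (y k i).2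

theorem isInt_iff {M : Matrix κ ι E} : IsInt F M ↔ ∃ y : Matrix κ ι (OE F E), up y = M :=
  ⟨fun h => ⟨Matrix.of fun k i => ⟨M k i, h k i⟩, rfl⟩, by rintro ⟨y, rfl⟩; exact isInt_up y⟩

theorem IsInt.mul [Fintype ι] {M : Matrix κ ι E} {N : Matrix ι lam E} (hM : IsInt F M)
    (hN : IsInt F N) : IsInt F (M * N) := by
  intro k i
  rw [Matrix.mul_apply]
  exact sum_mem fun j _ => mul_mem (hM k j) (hN j i)

theorem IsInt.add {M N : Matrix κ ι E} (hM : IsInt F M) (hN : IsInt F N) : IsInt F (M + N) :=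
  fun k i => add_mem (hM k i) (hN k i)

theorem IsInt.neg {M : Matrix κ ι E} (hM : IsInt F M) : IsInt F (-M) :=
  fun k i => neg_mem (hM k i)

theorem isInt_zero : IsInt F (0 : Matrix κ ι E) := fun _ _ => zero_mem _

theorem isInt_one [DecidableEq ι] : IsInt F (1 : Matrix ι ι E) := by
  rw [← up_one (F := F)]; exact isInt_up _

theorem IsInt.smul {M : Matrix κ ι E} (hM : IsInt F M) {c : E} (hc : c ∈ OE F E) :
    IsInt F (c • M) := fun k i => mul_mem hc (hM k i)

theorem isInt_fromBlocks {κ' ι' : Type*} {a : Matrix κ ι E} {b : Matrix κ ι' E} {c : Matrix κ' ι E}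
    {d : Matrix κ' ι' E} :
    IsInt F (Matrix.fromBlocks a b c d) ↔ IsInt F a ∧ IsInt F b ∧ IsInt F c ∧ IsInt F d := by
  constructor
  · intro h
    exact ⟨fun i j => h (Sum.inl i) (Sum.inl j), fun i j => h (Sum.inl i) (Sum.inr j),
      fun i j => h (Sum.inr i) (Sum.inl j), fun i j => h (Sum.inr i) (Sum.inr j)⟩
  · rintro ⟨ha, hb, hc, hd⟩ (i | i) (j | j)
    · exact ha i j
    · exact hb i j
    · exact hc i j
    · exact hd i j

/-- The conjugate transpose of a rectangular matrix with respect to the involution `σ`. -/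
def cT (σ : E ≃ₐ[F] E) (M : Matrix κ ι E) : Matrix ι κ E := (M.map σ).transpose

variable (σ : E ≃ₐ[F] E)

@[simp] theorem cT_apply (M : Matrix κ ι E) (i : ι) (k : κ) : cT σ M i k = σ (M k i) := rfl

theorem cT_mul [Fintype ι] (M : Matrix κ ι E) (N : Matrix ι lam E) :
    cT σ (M * N) = cT σ N * cT σ M := by
  ext i j
  simp only [cT_apply, Matrix.mul_apply, map_sum, map_mul]
  exact Finset.sum_congr rfl fun _ _ => mul_comm _ _

theorem cT_add (M N : Matrix κ ι E) : cT σ (M + N) = cT σ M + cT σ N := by ext; simp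

theorem cT_zero : cT σ (0 : Matrix κ ι E) = 0 := by ext; simp

theorem cT_one [DecidableEq ι] : cT σ (1 : Matrix ι ι E) = 1 := by
  ext i j
  rw [cT_apply, Matrix.one_apply, Matrix.one_apply]
  simp only [eq_comm (a := j)]
  split_ifs <;> simp

variable {σ} in
theorem IsInt.cT {M : Matrix κ ι E} (hM : IsInt F M) : IsInt F (cT σ M) :=
  fun i k => IsIntegral.map ((σ : E →ₐ[F] E).restrictScalars 𝒪[F]) (hM k i)

theorem cT_fromBlocks {κ' ι' : Type*} (a : Matrix κ ι E) (b : Matrix κ ι' E) (c : Matrix κ' ι E)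
    (d : Matrix κ' ι' E) : cT σ (Matrix.fromBlocks a b c d) =
      Matrix.fromBlocks (cT σ a) (cT σ c) (cT σ b) (cT σ d) := by
  ext (i | i) (j | j) <;> rfl

theorem trace_cT [Fintype ι] (M : Matrix ι ι E) : (cT σ M).trace = σ M.trace := by
  simp [Matrix.trace]

end IntegralMatrices

/-! ### The index `μ` -/

section FiniteModules

variable {F : Type*} [Field F] [ValuativeRel F] [TopologicalSpace F] [IsNonarchimedeanLocalField F]

/-- The order of a finitely generated `O_F`-module of finite length is a power of `q`. -/
theorem exists_card_eq_pow {ϖ : 𝒪[F]} (hϖ : 𝓂[F] = Ideal.span {ϖ}) (n : ℕ) :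
    ∀ (M : Type _) [AddCommGroup M] [Module 𝒪[F] M] [Module.Finite 𝒪[F] M],
      (∀ x : M, ϖ ^ n • x = 0) → ∃ j, Nat.card M = q F ^ j := by
  induction n with
  | zero =>
    intro M _ _ _ hM
    have : Subsingleton M := ⟨fun x y => by
      have hx := hM x; have hy := hM y
      rw [pow_zero, one_smul] at hx hy
      rw [hx, hy]⟩
    exact ⟨0, by simp⟩
  | succ n ih =>
    intro M _ _ _ hM
    -- `N` is killed by `ϖ ^ n`, and `M / N` is a vector space over the residue field
    set N : Submodule 𝒪[F] M := 𝓂[F] • ⊤ with hN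
    obtain ⟨j, hj⟩ := ih N (by
      rintro ⟨x, hx⟩
      rw [hN, hϖ, Submodule.ideal_span_singleton_smul] at hx
      obtain ⟨z, -, rfl⟩ := hx
      apply Subtype.ext
      change ϖ ^ n • ϖ • z = 0
      rw [smul_smul, ← pow_succ]
      exact hM z)
    have hk : ∃ k, Nat.card (M ⧸ N) = q F ^ k := by
      let _ : Field (𝒪[F] ⧸ 𝓂[F]) := Ideal.Quotient.field _
      have _ : Module.Finite (𝒪[F] ⧸ 𝓂[F]) (M ⧸ 𝓂[F] • (⊤ : Submodule 𝒪[F] M)) :=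
        Module.Finite.of_restrictScalars_finite 𝒪[F] _ _
      exact ⟨_, Module.natCard_eq_pow_finrank (K := 𝒪[F] ⧸ 𝓂[F])
        (V := M ⧸ 𝓂[F] • (⊤ : Submodule 𝒪[F] M))⟩
    obtain ⟨k, hk⟩ := hk
    refine ⟨k + j, ?_⟩
    rw [AddSubgroup.card_eq_card_quotient_mul_card_addSubgroup N.toAddSubgroup, pow_add]
    exact congrArg₂ _ hk hj

end FiniteModules

section Index

variable {F : Type*} [Field F] [ValuativeRel F] [TopologicalSpace F] [IsNonarchimedeanLocalField F]
  [CharZero F] {E : Type*} [CommRing E] [Algebra F E] [IsReduced E] {σ : E ≃ₐ[F] E}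
variable {ι κ : Type*} [Fintype ι] [Fintype κ] [DecidableEq ι] [DecidableEq κ]

theorem coe_smul_OE (c : 𝒪[F]) (x : OE F E) : ((c • x : OE F E) : E) = algebraMap F E c * x := by
  rw [Algebra.smul_def]; rfl

variable (F) in
/-- The integral column vectors that `z` maps to integral vectors. -/
def colKer (z : Matrix ι ι E) : Submodule 𝒪[F] (ι → OE F E) where
  carrier := {x | ∀ i, z.mulVec (fun j => (x j : E)) i ∈ OE F E}
  add_mem' := by
    intro a b ha hb i
    have : z.mulVec (fun j => ((a + b) j : E)) i =
        z.mulVec (fun j => (a j : E)) i + z.mulVec (fun j => (b j : E)) i := by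
      rw [← Pi.add_apply, ← Matrix.mulVec_add]; rfl
    rw [this]
    exact add_mem (ha i) (hb i)
  zero_mem' := by
    intro i
    have : z.mulVec (fun j => ((0 : ι → OE F E) j : E)) i = 0 := by
      simp [Matrix.mulVec, dotProduct]
    rw [this]
    exact zero_mem _
  smul_mem' := by
    intro c x hx i
    have : z.mulVec (fun j => ((c • x) j : E)) i =
        algebraMap F E c * z.mulVec (fun j => (x j : E)) i := by
      simp only [Matrix.mulVec, dotProduct, Finset.mul_sum]
      refine Finset.sum_congr rfl fun j _ => ?_
      rw [Pi.smul_apply, coe_smul_OE]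
      ring
    rw [this]
    exact mul_mem (algebraMap_mem_OE c.2) (hx i)

theorem mem_colKer {z : Matrix ι ι E} {x : ι → OE F E} :
    x ∈ colKer F z ↔ ∀ i, z.mulVec (fun j => (x j : E)) i ∈ OE F E := Iff.rfl

variable (F) in
/-- The index of `colKer z` in `O_E^n`; it is the square of `μ(z)`. -/
def idx (z : Matrix ι ι E) : ℕ := (colKer F z).toAddSubgroup.index

/-- The inclusion of `O_E^n` into `E^n`. -/
def upVec : (ι → OE F E) →+ (ι → E) where
  toFun x := fun j => x j
  map_zero' := rfl
  map_add' _ _ := rfl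

/-- By the second isomorphism theorem `(z O_E^n + O_E^n) / O_E^n` is `O_E^n / colKer z`. -/
theorem mu_eq (z : Matrix ι ι E) : mu F z = Real.sqrt (idx F z) := by
  rw [mu, AddSubgroup.relIndex_sup_right, ← AddSubgroup.relIndex_comap]
  congr 2
  have h1 : (⊤ : AddSubgroup (ι → OE F E)).map upVec = stdLattice F E ι := by
    ext x
    constructor
    · rintro ⟨y, -, rfl⟩ i
      exact (y i).2
    · intro hx
      exact ⟨fun i => ⟨x i, hx i⟩, trivial, rfl⟩
  rw [← h1, ← AddSubgroup.relIndex_comap, AddSubgroup.relIndex_top_right, h1]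
  rfl

theorem IsQuadConj.finite_OE (h : IsQuadConj σ) : Module.Finite 𝒪[F] (OE F E) := by
  obtain ⟨ω, hω⟩ := h.exists_isIntBasis
  refine ⟨Submodule.fg_def.2 ⟨{1, ⟨ω, hω.mem⟩}, Set.toFinite _, ?_⟩⟩
  rw [eq_top_iff]
  rintro ⟨x, hx⟩ -
  obtain ⟨a, b, rfl⟩ := hω.rep x
  have hab := (hω.mem_iff a b).1 hx
  rw [Submodule.mem_span_pair]
  refine ⟨⟨a, hab.1⟩, ⟨b, hab.2⟩, Subtype.ext ?_⟩
  rw [Subalgebra.coe_add, coe_smul_OE, coe_smul_OE, Subalgebra.coe_one, mul_one]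

/-- A common denominator for the entries of a matrix. -/
theorem IsQuadConj.exists_pow_isInt (h : IsQuadConj σ) {ϖ : F} (hϖ : ord F ϖ = 1)
    (z : Matrix κ ι E) : ∃ n : ℕ, IsInt F (algebraMap F E (ϖ ^ n) • z) := by
  choose n hn using fun k i => h.exists_pow_mul_mem_OE hϖ (z k i)
  refine ⟨∑ k, ∑ i, n k i, fun k i => ?_⟩
  rw [Matrix.smul_apply, smul_eq_mul]
  apply hn
  calc n k i ≤ ∑ i, n k i := Finset.single_le_sum (fun _ _ => Nat.zero_le _) (Finset.mem_univ i)
    _ ≤ _ := Finset.single_le_sum (f := fun k => ∑ i, n k i) (fun _ _ => Nat.zero_le _)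
      (Finset.mem_univ k)

/-- The quotient of `O_E^n` by `colKer z` is a finitely generated `O_F`-module killed by a power of
`ϖ`. -/
theorem IsQuadConj.exists_idx_eq (h : IsQuadConj σ) (z : Matrix ι ι E) :
    ∃ j, idx F z = q F ^ j := by
  obtain ⟨ϖ, hϖ⟩ := exists_uniformizer F
  obtain ⟨n, hn⟩ := h.exists_pow_isInt hϖ z
  have := h.finite_OE
  apply exists_card_eq_pow (max_eq_span hϖ (uniformizer_mem hϖ)) n
    ((ι → OE F E) ⧸ (colKer F z))
  intro x
  obtain ⟨x, rfl⟩ := Submodule.Quotient.mk_surjective _ x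
  rw [← Submodule.Quotient.mk_smul, Submodule.Quotient.mk_eq_zero, mem_colKer]
  intro i
  have e : z.mulVec (fun j => (((⟨ϖ, uniformizer_mem hϖ⟩ : 𝒪[F]) ^ n • x) j : E)) i =
      (algebraMap F E (ϖ ^ n) • z).mulVec (fun j => (x j : E)) i := by
    rw [Matrix.smul_mulVec]
    simp only [Pi.smul_apply, Matrix.mulVec, dotProduct, smul_eq_mul, Finset.mul_sum]
    refine Finset.sum_congr rfl fun j _ => ?_
    rw [coe_smul_OE]
    change z i j * (algebraMap F E (ϖ ^ n) * (x j : E)) = _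
    ring
  rw [e]
  exact sum_mem fun j _ => mul_mem (hn i j) (x j).2

theorem IsQuadConj.idx_ne_zero (h : IsQuadConj σ) (z : Matrix ι ι E) : idx F z ≠ 0 := by
  obtain ⟨j, hj⟩ := h.exists_idx_eq z
  rw [hj]
  exact pow_ne_zero _ (by have := one_lt_q (F := F); omega)

theorem idx_add_int (z w : Matrix ι ι E) (hw : IsInt F w) : idx F (z + w) = idx F z := by
  rw [idx, idx]
  congr 1
  ext x
  change (∀ i, _) ↔ (∀ i, _)
  refine forall_congr' fun i => ?_
  rw [Matrix.add_mulVec, Pi.add_apply]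
  have hx : w.mulVec (fun j => (x j : E)) i ∈ OE F E :=
    sum_mem fun j _ => mul_mem (hw i j) (x j).2
  exact ⟨fun hh => by simpa using sub_mem hh hx, fun hh => add_mem hh hx⟩

theorem mulVec_up_mem {U V : Matrix ι ι (OE F E)} (hVU : V * U = 1) (w : ι → E) :
    (∀ i, (up U).mulVec w i ∈ OE F E) ↔ ∀ i, w i ∈ OE F E := by
  have key : ∀ (U : Matrix ι ι (OE F E)) (w : ι → E), (∀ i, w i ∈ OE F E) →
      ∀ i, (up U).mulVec w i ∈ OE F E := fun U w hw i =>
    sum_mem fun j _ => mul_mem (U i j).2 (hw j)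
  refine ⟨fun hh => ?_, key U w⟩
  have := key V _ hh
  rwa [Matrix.mulVec_mulVec, ← up_mul, hVU, up_one, Matrix.one_mulVec] at this

/-- Left and right multiplication by unimodular matrices does not change the index. -/
theorem idx_mul_mul {U V V' : Matrix ι ι (OE F E)} (z : Matrix ι ι E) (hU : IsUnit U)
    (hV : V * V' = 1) : idx F (up U * z * up V) = idx F z := by
  obtain ⟨⟨U, U', hU1, hU2⟩, rfl⟩ := hU
  have hV' : V' * V = 1 := mul_eq_one_comm.1 hV
  let e : (ι → OE F E) ≃+ (ι → OE F E) :=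
    { toFun := V.mulVec
      invFun := V'.mulVec
      left_inv := fun x => by rw [Matrix.mulVec_mulVec, hV', Matrix.one_mulVec]
      right_inv := fun x => by rw [Matrix.mulVec_mulVec, hV, Matrix.one_mulVec]
      map_add' := Matrix.mulVec_add V }
  have he : (colKer F (up U * z * up V)).toAddSubgroup =
      (colKer F z).toAddSubgroup.comap (e : (ι → OE F E) →+ (ι → OE F E)) := by
    ext x
    change (∀ i, _) ↔ (∀ i, _)
    have e1 : (fun j => ((e x) j : E)) = (up V).mulVec (fun j => (x j : E)) := by
      ext i
      change ((V.mulVec x i : OE F E) : E) = _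
      simp [Matrix.mulVec, dotProduct]
    have e2 : (up U * z * up V).mulVec (fun j => (x j : E)) =
        (up U).mulVec (z.mulVec (fun j => ((e x) j : E))) := by
      rw [e1, Matrix.mulVec_mulVec, Matrix.mulVec_mulVec, Matrix.mul_assoc]
    rw [e2]
    exact mulVec_up_mem hU2 _
  rw [idx, he, AddSubgroup.index_comap_of_surjective _ e.surjective, idx]

theorem idx_reindex (e : ι ≃ κ) (z : Matrix ι ι E) : idx F (Matrix.reindex e e z) = idx F z := by
  let f : (κ → OE F E) ≃+ (ι → OE F E) :=
    { toFun := fun x => x ∘ e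
      invFun := fun x => x ∘ e.symm
      left_inv := fun x => by ext; simp
      right_inv := fun x => by ext; simp
      map_add' := fun _ _ => rfl }
  have he : (colKer F (Matrix.reindex e e z)).toAddSubgroup =
      (colKer F z).toAddSubgroup.comap (f : (κ → OE F E) →+ (ι → OE F E)) := by
    ext x
    change (∀ i, _) ↔ (∀ i, _)
    rw [← e.forall_congr_right]
    refine forall_congr' fun i => ?_
    have : (Matrix.reindex e e z).mulVec (fun j => (x j : E)) (e i) =
        z.mulVec (fun j => ((f x) j : E)) i := by
      simp only [Matrix.mulVec, dotProduct, Matrix.reindex_apply, Matrix.submatrix_apply,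
        Equiv.symm_apply_apply]
      rw [← e.sum_comp]
      simp [f]
    rw [this]
    exact Iff.rfl
  rw [idx, he, AddSubgroup.index_comap_of_surjective _ f.surjective, idx]

theorem idx_fromBlocks (a : Matrix κ κ E) (d : Matrix ι ι E) :
    idx F (Matrix.fromBlocks a 0 0 d) = idx F a * idx F d := by
  let f : ((κ ⊕ ι) → OE F E) ≃+ (κ → OE F E) × (ι → OE F E) :=
    { Equiv.sumArrowEquivProdArrow κ ι (OE F E) with map_add' := fun _ _ => rfl }
  have he : (colKer F (Matrix.fromBlocks a 0 0 d)).toAddSubgroup =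
      ((colKer F a).toAddSubgroup.prod (colKer F d).toAddSubgroup).comap
        (f : ((κ ⊕ ι) → OE F E) →+ (κ → OE F E) × (ι → OE F E)) := by
    ext x
    change (∀ i, _) ↔ (∀ i, _) ∧ (∀ i, _)
    rw [Sum.forall]
    refine and_congr (forall_congr' fun i => ?_) (forall_congr' fun i => ?_)
    · have : (Matrix.fromBlocks a 0 0 d).mulVec (fun j => (x j : E)) (Sum.inl i) =
          a.mulVec (fun j => ((f x).1 j : E)) i := by
        simp [Matrix.mulVec, dotProduct, f]
        rfl
      rw [this]
      exact Iff.rfl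
    · have : (Matrix.fromBlocks a 0 0 d).mulVec (fun j => (x j : E)) (Sum.inr i) =
          d.mulVec (fun j => ((f x).2 j : E)) i := by
        simp [Matrix.mulVec, dotProduct, f]
        rfl
      rw [this]
      exact Iff.rfl
  rw [idx, he, AddSubgroup.index_comap_of_surjective _ f.surjective, AddSubgroup.index_prod, idx,
    idx]

/-- The index of `colKer z` annihilates the quotient, so that it is a denominator for `z`. -/
theorem isInt_idx_smul (z : Matrix ι ι E) : IsInt F ((idx F z) • z) := by
  intro i j
  have h1 : idx F z • (Pi.single j (1 : OE F E) : ι → OE F E) ∈ (colKer F z).toAddSubgroup :=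
    AddSubgroup.nsmul_index_mem _ _
  have h2 := (mem_colKer.1 h1) i
  have e : z.mulVec (fun k => ((idx F z • (Pi.single j (1 : OE F E) : ι → OE F E)) k : E)) i =
      (idx F z • z) i j := by
    have e1 : (fun k => ((idx F z • (Pi.single j (1 : OE F E) : ι → OE F E)) k : E)) =
        idx F z • (Pi.single j (1 : E) : ι → E) := by
      ext k
      by_cases hk : k = j
      · subst hk; simp
      · simp [hk]
    rw [e1, Matrix.mulVec_smul, Pi.smul_apply, Matrix.mulVec_single_one]
    rfl
  rwa [e] at h2

end Index

/-! ### The summands of the Siegel series -/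

section Terms

variable {F : Type*} [Field F] [ValuativeRel F] [TopologicalSpace F] [IsNonarchimedeanLocalField F]
  [CharZero F] {E : Type*} [CommRing E] [Algebra F E] [IsReduced E] {σ : E ≃ₐ[F] E}
variable {ι κ : Type*} [Fintype ι] [Fintype κ] [DecidableEq ι] [DecidableEq κ]

theorem mem_Her {A : Matrix ι ι E} : A ∈ Her σ ι ↔ cT σ A = A := Iff.rfl

theorem mem_HerInt {A : Her σ ι} : A ∈ HerInt σ ι ↔ IsInt F (A : Matrix ι ι E) := Iff.rfl

theorem conj_trace_mul {A B : Matrix ι ι E} (hA : A ∈ Her σ ι) (hB : B ∈ Her σ ι) :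
    σ (A * B).trace = (A * B).trace := by
  rw [← trace_cT, cT_mul, mem_Her.1 hA, mem_Her.1 hB, Matrix.trace_mul_comm]

variable (F) in
/-- The value at `z` of the additive character attached to `B`. -/
def trChar (ψ : AddChar F Circle) (B z : Matrix ι ι E) : ℂ := (ψ (toBase F (B * z).trace) : ℂ)

theorem IsQuadConj.trChar_add (h : IsQuadConj σ) (ψ : AddChar F Circle) {B z w : Matrix ι ι E}
    (hB : B ∈ Her σ ι) (hz : z ∈ Her σ ι) (hw : w ∈ Her σ ι) :
    trChar F ψ B (z + w) = trChar F ψ B z * trChar F ψ B w := by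
  rw [trChar, Matrix.mul_add, Matrix.trace_add, h.toBase_add (conj_trace_mul hB hz)
    (conj_trace_mul hB hw), AddChar.map_add_eq_mul, Circle.coe_mul]
  rfl

theorem norm_trChar (ψ : AddChar F Circle) (B z : Matrix ι ι E) : ‖trChar F ψ B z‖ = 1 :=
  Circle.norm_coe _

theorem IsUnramifiedChar.eq_one {ψ : AddChar F Circle} (hψ : IsUnramifiedChar ψ) {x : F}
    (hx : x ∈ 𝒪[F]) : ψ x = 1 := by
  simpa using (hψ x).2 hx 1 (one_mem _)

theorem IsQuadConj.trChar_of_isInt (h : IsQuadConj σ) {ψ : AddChar F Circle}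
    (hψ : IsUnramifiedChar ψ) {B z : Matrix ι ι E} (hB : IsSemiIntegral σ B) (hz : z ∈ Her σ ι)
    (hz' : IsInt F z) : trChar F ψ B z = 1 := by
  obtain ⟨a, ha⟩ := hB.2 ⟨⟨z, hz⟩, hz'⟩
  change (B * z).trace = _ at ha
  rw [trChar, ha, h.toBase_algebraMap, hψ.eq_one a.2]
  rfl

theorem mu_add_int (z w : Matrix ι ι E) (hw : IsInt F w) : mu F (z + w) = mu F z := by
  rw [mu_eq, mu_eq, idx_add_int _ _ hw]

theorem IsQuadConj.mu_pos (h : IsQuadConj σ) (z : Matrix ι ι E) : 0 < mu F z := by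
  rw [mu_eq, Real.sqrt_pos]
  exact_mod_cast Nat.pos_of_ne_zero (h.idx_ne_zero z)

/-- For semi-integral `B` the summand does not depend on the representative. -/
theorem IsQuadConj.siegelTerm_mk (h : IsQuadConj σ) {ψ : AddChar F Circle}
    (hψ : IsUnramifiedChar ψ) {B : Matrix ι ι E} (hB : IsSemiIntegral σ B) (s : ℂ) (z : Her σ ι) :
    siegelTerm σ ψ B s (QuotientAddGroup.mk z) =
      trChar F ψ B z * (mu F (z : Matrix ι ι E) : ℂ) ^ (-s) := by
  obtain ⟨n, hn⟩ := QuotientAddGroup.mk_out_eq_add (HerInt σ ι) z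
  have hn' : (Quotient.out (QuotientAddGroup.mk z : Her σ ι ⧸ HerInt σ ι) : Her σ ι) = z + n := hn
  rw [siegelTerm, hn', AddSubgroup.coe_add, mu_add_int _ _ n.2]
  change trChar F ψ B _ * _ = _
  rw [h.trChar_add ψ hB.1 z.2 n.1.2, h.trChar_of_isInt hψ hB n.1.2 n.2, mul_one]

theorem IsQuadConj.norm_siegelTerm (h : IsQuadConj σ) (ψ : AddChar F Circle) (B : Matrix ι ι E)
    (s : ℂ) (z : Her σ ι ⧸ HerInt σ ι) : ‖siegelTerm σ ψ B s z‖ =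
      mu F ((Quotient.out z : Her σ ι) : Matrix ι ι E) ^ (-s.re) := by
  rw [siegelTerm, norm_mul, Circle.norm_coe, one_mul,
    Complex.norm_cpow_eq_rpow_re_of_pos (h.mu_pos _), Complex.neg_re]

end Terms

/-! ### Absolute convergence -/

section Torsion

/-- The number of elements killed by `n ^ j` grows at most exponentially with `j`. -/
theorem card_torsion_le {G : Type*} [AddCommGroup G] (n : ℕ) [Finite {x : G // n • x = 0}] (j : ℕ) :
    Finite {x : G // n ^ j • x = 0} ∧
      Nat.card {x : G // n ^ j • x = 0} ≤ Nat.card {x : G // n • x = 0} ^ j := by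
  classical
  induction j with
  | zero =>
    have : Subsingleton {x : G // n ^ 0 • x = 0} := ⟨by
      rintro ⟨x, hx⟩ ⟨y, hy⟩
      simp only [pow_zero, one_smul] at hx hy
      simp [hx, hy]⟩
    exact ⟨inferInstance, (Finite.card_le_one_iff_subsingleton.2 this).trans (pow_zero _).ge⟩
  | succ j ih =>
    obtain ⟨hfin, hcard⟩ := ih
    let T := {x : G // n ^ (j + 1) • x = 0}
    let f : T → {x : G // n ^ j • x = 0} := fun x => ⟨n • x.1, by
      rw [smul_smul, ← pow_succ]; exact x.2⟩
    -- a section of multiplication by `n`, used to send `x` to `n x` and to an element killed by `n`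
    let s : {x : G // n ^ j • x = 0} → G := fun y =>
      if hy : ∃ x : T, f x = y then (hy.choose : T).1 else 0
    have hs : ∀ x : T, n • s (f x) = n • x.1 := by
      intro x
      have hx : ∃ x' : T, f x' = f x := ⟨x, rfl⟩
      have h1 : s (f x) = (hx.choose : T).1 := dif_pos hx
      rw [h1]
      exact congrArg Subtype.val hx.choose_spec
    let g : T → {x : G // n ^ j • x = 0} × {x : G // n • x = 0} := fun x =>
      (f x, ⟨x.1 - s (f x), by rw [smul_sub, hs, sub_self]⟩)
    have hg : Function.Injective g := by
      intro x y hxy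
      have h1 : f x = f y := congrArg Prod.fst hxy
      have h2 : x.1 - s (f x) = y.1 - s (f y) := congrArg (fun p => (p.2 : G)) hxy
      rw [h1] at h2
      exact Subtype.ext (sub_left_injective h2)
    have hfinT : Finite T := Finite.of_injective g hg
    refine ⟨hfinT, (Nat.card_le_card_of_injective g hg).trans ?_⟩
    rw [Nat.card_prod, pow_succ]
    exact Nat.mul_le_mul_right _ hcard

end Torsion

section Summability

variable {F : Type*} [Field F] [ValuativeRel F] [TopologicalSpace F] [IsNonarchimedeanLocalField F]
  [CharZero F] {E : Type*} [CommRing E] [Algebra F E] [IsReduced E] {σ : E ≃ₐ[F] E}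
variable {ι κ : Type*} [Fintype ι] [Fintype κ] [DecidableEq ι] [DecidableEq κ]

theorem q_cast_ne_zero : ((q F : ℕ) : F) ≠ 0 :=
  Nat.cast_ne_zero.2 (by have := one_lt_q (F := F); omega)

/-- A class killed by `q` is determined by the integral matrix `q z` modulo `q`. -/
theorem IsQuadConj.finite_q_torsion (h : IsQuadConj σ) :
    Finite {x : Her σ ι ⧸ HerInt σ ι // q F • x = 0} := by
  set z₀ : Matrix ι ι E := Matrix.diagonal fun _ => algebraMap F E ((q F : F)⁻¹) with hz₀
  have hfin : Finite ((ι → OE F E) ⧸ (colKer F z₀).toAddSubgroup) := by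
    have := h.idx_ne_zero z₀
    rw [idx, AddSubgroup.index] at this
    exact Nat.finite_of_card_ne_zero this
  have hint : ∀ x : {x : Her σ ι ⧸ HerInt σ ι // q F • x = 0},
      IsInt F (q F • ((Quotient.out x.1 : Her σ ι) : Matrix ι ι E)) := by
    rintro ⟨x, hx⟩
    have h1 : (QuotientAddGroup.mk (q F • (Quotient.out x : Her σ ι)) : Her σ ι ⧸ HerInt σ ι) =
        0 := by
      rw [QuotientAddGroup.mk_nsmul, ← hx]
      congr 1
      exact Quotient.out_eq' x
    exact (QuotientAddGroup.eq_zero_iff _).1 h1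
  let f : {x : Her σ ι ⧸ HerInt σ ι // q F • x = 0} →
      ι → (ι → OE F E) ⧸ (colKer F z₀).toAddSubgroup := fun x i =>
    QuotientAddGroup.mk fun j => ⟨_, hint x i j⟩
  refine Finite.of_injective f ?_
  intro x y hxy
  apply Subtype.ext
  rw [← Quotient.out_eq' x.1, ← Quotient.out_eq' y.1]
  refine (QuotientAddGroup.eq).2 ?_
  intro i j
  have h1 := (QuotientAddGroup.eq).1 (congrFun hxy i)
  have h2 := (mem_colKer.1 h1) j
  rw [hz₀, Matrix.mulVec_diagonal] at h2
  convert h2 using 1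
  change -((Quotient.out x.1 : Her σ ι) : Matrix ι ι E) i j +
    ((Quotient.out y.1 : Her σ ι) : Matrix ι ι E) i j = algebraMap F E (q F : F)⁻¹ *
      (-(q F • ((Quotient.out x.1 : Her σ ι) : Matrix ι ι E) i j) +
      (q F • ((Quotient.out y.1 : Her σ ι) : Matrix ι ι E) i j))
  have e : algebraMap F E (q F : F)⁻¹ * (q F : E) = 1 := by
    rw [← map_natCast (algebraMap F E), ← map_mul, inv_mul_cancel₀ q_cast_ne_zero, map_one]
  rw [nsmul_eq_mul, nsmul_eq_mul]
  linear_combination (((Quotient.out x.1 : Her σ ι) : Matrix ι ι E) i j -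
    ((Quotient.out y.1 : Her σ ι) : Matrix ι ι E) i j) * e

/-- The Siegel series converges absolutely in a right half-plane that depends only on the size. -/
theorem IsQuadConj.exists_summable (h : IsQuadConj σ) (ι : Type*) [Fintype ι] [DecidableEq ι] :
    ∃ s₀ : ℝ, 0 ≤ s₀ ∧ ∀ (ψ : AddChar F Circle) (B : Matrix ι ι E) (s : ℂ), s₀ < s.re →
      Summable (siegelTerm σ ψ B s) := by
  have hfin := h.finite_q_torsion (ι := ι)
  set C := Nat.card {x : Her σ ι ⧸ HerInt σ ι // q F • x = 0} with hC
  have hq := one_lt_q (F := F)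
  have hq0 : (0 : ℝ) < q F := by positivity
  refine ⟨2 * C, by positivity, fun ψ B s hs => ?_⟩
  rw [← summable_norm_iff]
  simp_rw [h.norm_siegelTerm]
  choose φ hφ using fun z : Her σ ι ⧸ HerInt σ ι =>
    h.exists_idx_eq ((Quotient.out z : Her σ ι) : Matrix ι ι E)
  have hterm : ∀ z : Her σ ι ⧸ HerInt σ ι,
      mu F ((Quotient.out z : Her σ ι) : Matrix ι ι E) ^ (-s.re) =
        ((q F : ℝ) ^ (-(s.re / 2))) ^ φ z := by
    intro z
    rw [mu_eq, hφ, Real.sqrt_eq_rpow, ← Real.rpow_mul (by positivity), Nat.cast_pow,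
      ← Real.rpow_natCast, ← Real.rpow_mul hq0.le, ← Real.rpow_natCast, ← Real.rpow_mul hq0.le]
    congr 1
    ring
  set ρ : ℝ := (q F : ℝ) ^ (-(s.re / 2)) with hρ
  have hρ0 : 0 ≤ ρ := by positivity
  -- A class of index `q ^ j` is killed by `q ^ j`, so that there are at most `C ^ j` of them; each
  -- contributes `ρ ^ j`.
  have hkill : ∀ (j : ℕ) (z : Her σ ι ⧸ HerInt σ ι), φ z = j → (q F) ^ j • z = 0 := by
    rintro j z rfl
    rw [← Quotient.out_eq' z]
    have h1 := isInt_idx_smul (F := F) ((Quotient.out z : Her σ ι) : Matrix ι ι E)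
    rw [hφ] at h1
    have h2 : (q F ^ φ z) • (Quotient.out z : Her σ ι) ∈ HerInt σ ι := h1
    have h3 := (QuotientAddGroup.eq_zero_iff _).2 h2
    rw [QuotientAddGroup.mk_nsmul] at h3
    convert h3 using 2
    rw [Quotient.out_eq']
  have hC1 : (C : ℝ) * ρ < 1 := by
    have h1 : (C : ℝ) ≤ (q F : ℝ) ^ (C : ℝ) := by
      rw [Real.rpow_natCast]
      exact_mod_cast (Nat.lt_pow_self hq).le
    calc (C : ℝ) * ρ ≤ (q F : ℝ) ^ (C : ℝ) * ρ := mul_le_mul_of_nonneg_right h1 hρ0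
      _ = (q F : ℝ) ^ ((C : ℝ) + -(s.re / 2)) := by rw [hρ, Real.rpow_add hq0]
      _ < 1 := Real.rpow_lt_one_of_one_lt_of_neg (by exact_mod_cast hq) (by linarith)
  rw [← (Equiv.sigmaFiberEquiv φ).summable_iff]
  have hfib : ∀ j, Finite {z // φ z = j} ∧ Nat.card {z // φ z = j} ≤ C ^ j := by
    intro j
    obtain ⟨h1, h2⟩ := card_torsion_le (G := Her σ ι ⧸ HerInt σ ι) (q F) j
    have hinj : Function.Injective
        (fun z : {z // φ z = j} => (⟨z.1, hkill j z.1 z.2⟩ :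
          {x : Her σ ι ⧸ HerInt σ ι // (q F) ^ j • x = 0})) := by
      intro x y hxy
      exact Subtype.ext (congrArg (fun p => p.1) hxy)
    exact ⟨Finite.of_injective _ hinj, (Nat.card_le_card_of_injective _ hinj).trans h2⟩
  rw [summable_sigma_of_nonneg (fun x => by
    simp only [Function.comp]
    exact Real.rpow_nonneg (h.mu_pos _).le _)]
  constructor
  · intro j
    have := (hfib j).1
    exact Summable.of_finite
  · refine Summable.of_nonneg_of_le (fun j => tsum_nonneg fun x => Real.rpow_nonneg (h.mu_pos _).le _)
      (fun j => ?_) (summable_geometric_of_lt_one (by positivity) hC1)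
    have := (hfib j).1
    let _ : Fintype {z // φ z = j} := Fintype.ofFinite _
    rw [tsum_fintype]
    have h1 : ∀ x : {z // φ z = j},
        ((fun z : Her σ ι ⧸ HerInt σ ι => mu F ((Quotient.out z : Her σ ι) : Matrix ι ι E) ^ (-s.re))
          ∘ (Equiv.sigmaFiberEquiv φ)) ⟨j, x⟩ = ρ ^ j := by
      intro x
      simp only [Function.comp, Equiv.sigmaFiberEquiv, Equiv.coe_fn_mk]
      rw [hterm, x.2]
    rw [Finset.sum_congr rfl fun x _ => h1 x, Finset.sum_const, Finset.card_univ, nsmul_eq_mul,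
      mul_pow]
    apply mul_le_mul_of_nonneg_right _ (by positivity)
    rw [← Nat.card_eq_fintype_card]
    exact_mod_cast (hfib j).2

end Summability

/-! ### Uniqueness and invariance of the polynomial part -/

section PolynomialPart

variable {F : Type*} [Field F] [ValuativeRel F] [TopologicalSpace F] [IsNonarchimedeanLocalField F]
  [CharZero F] {E : Type*} [CommRing E] [Algebra F E] [IsReduced E] {σ : E ≃ₐ[F] E}
variable {ι κ : Type*} [Fintype ι] [Fintype κ] [DecidableEq ι] [DecidableEq κ]
  {ψ : AddChar F Circle}

variable (F E) in
theorem norm_xi_le : ‖xi F E‖ ≤ 1 := by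
  rw [xi]
  split_ifs <;> simp

theorem q_pos : (0 : ℝ) < q F := by
  have := one_lt_q (F := F)
  exact_mod_cast (by omega : 0 < q F)

theorem norm_q_cpow (s : ℂ) : ‖(q F : ℂ) ^ s‖ = (q F : ℝ) ^ s.re := by
  rw [← Complex.ofReal_natCast, Complex.norm_cpow_eq_rpow_re_of_pos q_pos]

variable (F E) in
/-- Each factor `1 - c q ^ z` with `|c| ≤ 1` and `Re z < 0` is nonzero. -/
theorem eulerFactor_ne_zero (n : ℕ) (s : ℂ) (hs : 2 * (n : ℝ) < s.re) : eulerFactor F E n s ≠ 0 := by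
  have key : ∀ (c z : ℂ), ‖c‖ ≤ 1 → z.re < 0 → 1 - c * (q F : ℂ) ^ z ≠ 0 := by
    intro c z hc hz h0
    have h1 : ‖c * (q F : ℂ) ^ z‖ < 1 := by
      rw [norm_mul, norm_q_cpow]
      have h2 : (q F : ℝ) ^ z.re < 1 :=
        Real.rpow_lt_one_of_one_lt_of_neg (by exact_mod_cast one_lt_q (F := F)) hz
      have h3 : 0 ≤ (q F : ℝ) ^ z.re := Real.rpow_nonneg q_pos.le _
      nlinarith [norm_nonneg c]
    rw [← sub_eq_zero.1 h0, norm_one] at h1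
    exact lt_irrefl _ h1
  rw [eulerFactor]
  refine mul_ne_zero (Finset.prod_ne_zero_iff.2 fun i hi => ?_)
    (Finset.prod_ne_zero_iff.2 fun i hi => ?_)
  · have hi' : (i : ℝ) ≤ n := by
      have := Finset.mem_range.1 hi
      exact_mod_cast (by omega : i ≤ n)
    have := key 1 (2 * (i : ℂ) - s) (by simp) (by simp; linarith)
    rwa [one_mul] at this
  · have hi' : (i : ℝ) ≤ n := by
      have := (Finset.mem_Icc.1 hi).2
      exact_mod_cast (by omega : i ≤ n)
    exact key _ _ (norm_xi_le F E) (by simp; linarith)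

theorem q_pow_neg_injective : Function.Injective fun n : ℕ => (q F : ℂ) ^ (-(n : ℂ)) := by
  intro a b hab
  have hq := one_lt_q (F := F)
  simp only [Complex.cpow_neg, Complex.cpow_natCast, inv_inj] at hab
  exact Nat.pow_right_injective (a := q F) hq (by exact_mod_cast hab)

/-- A polynomial is determined by its values at `q ^ (-s)` for `s` in a right half-plane. -/
theorem eq_of_eval_eq {P Q : ℂ[X]} {N : ℝ} (hPQ : ∀ s : ℂ, N < s.re →
    P.eval ((q F : ℂ) ^ (-s)) = Q.eval ((q F : ℂ) ^ (-s))) : P = Q := by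
  obtain ⟨n, hn⟩ := exists_nat_gt N
  have hinf := Set.infinite_of_injective_forall_mem
    (f := fun k : ℕ => (q F : ℂ) ^ (-((n + k : ℕ) : ℂ)))
    (s := {x | P.eval x = Q.eval x})
    (fun a b hab => by simpa using q_pow_neg_injective (F := F) hab)
    (fun k => hPQ _ (by rw [Complex.natCast_re]; push_cast; linarith [Nat.cast_nonneg (α := ℝ) k]))
  exact Polynomial.eq_of_infinite_eval_eq P Q hinf

/-- For `Re s` large the Euler factor is nonzero and can be cancelled. -/
theorem IsSiegelPolynomial.unique {B : Matrix ι ι E} {P Q : ℂ[X]}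
    (hP : IsSiegelPolynomial σ ψ B P) (hQ : IsSiegelPolynomial σ ψ B Q) : P = Q := by
  obtain ⟨s₁, h1⟩ := hP
  obtain ⟨s₂, h2⟩ := hQ
  refine eq_of_eval_eq (F := F) (N := max (max s₁ s₂) (2 * (Fintype.card ι : ℝ))) fun s hs => ?_
  rw [max_lt_iff, max_lt_iff] at hs
  have h3 := (h1 s hs.1.1).2.symm.trans (h2 s hs.1.2).2
  exact mul_right_cancel₀ (eulerFactor_ne_zero F E _ s hs.2) h3

theorem siegelPoly_eq_of {B : Matrix ι ι E} {P : ℂ[X]} (hB : IsSemiIntegral σ B)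
    (hP : IsSiegelPolynomial σ ψ B P) : siegelPoly σ ψ B = P := by
  have h : IsSemiIntegral σ B ∧ ∃ P, IsSiegelPolynomial σ ψ B P := ⟨hB, P, hP⟩
  rw [siegelPoly, dif_pos h]
  exact h.2.choose_spec.unique hP

theorem siegelPoly_eq_zero {B : Matrix ι ι E}
    (hB : ¬ (IsSemiIntegral σ B ∧ ∃ P, IsSiegelPolynomial σ ψ B P)) : siegelPoly σ ψ B = 0 := by
  rw [siegelPoly, dif_neg hB]

/-- If the polynomials admissible for `B` and for `B'` correspond to each other under `X ↦ c X`,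
then so do the chosen ones, also where both are zero by convention. -/
theorem siegelPoly_comp {B : Matrix ι ι E} {B' : Matrix κ κ E} (c : ℂ) (hc : c ≠ 0)
    (h1 : IsSemiIntegral σ B' ↔ IsSemiIntegral σ B)
    (h2 : IsSemiIntegral σ B → ∀ P : ℂ[X], IsSiegelPolynomial σ ψ B P ↔
      IsSiegelPolynomial σ ψ B' (P.comp (C c * X))) :
    siegelPoly σ ψ B' = (siegelPoly σ ψ B).comp (C c * X) := by
  by_cases hB : IsSemiIntegral σ B ∧ ∃ P, IsSiegelPolynomial σ ψ B P
  · obtain ⟨hB, P, hP⟩ := hB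
    rw [siegelPoly_eq_of hB hP, siegelPoly_eq_of (h1.2 hB) ((h2 hB P).1 hP)]
  · rw [siegelPoly_eq_zero hB, zero_comp, siegelPoly_eq_zero]
    rintro ⟨hB', P, hP⟩
    refine hB ⟨h1.1 hB', P.comp (C c⁻¹ * X), (h2 (h1.1 hB') _).2 ?_⟩
    rw [comp_assoc, mul_comp, C_comp, X_comp, ← mul_assoc, ← C_mul, inv_mul_cancel₀ hc, C_1, one_mul,
      comp_X]
    exact hP

/-- Two Hermitian matrices whose trace forms correspond under an index preserving isomorphism of the
integral structures have the same Siegel series. -/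
theorem IsQuadConj.siegelTerm_congr (h : IsQuadConj σ) (hψ : IsUnramifiedChar ψ)
    {B : Matrix ι ι E} {B' : Matrix κ κ E} (hB : B ∈ Her σ ι) (hB' : B' ∈ Her σ κ)
    (e : Her σ ι ≃+ Her σ κ) (hint : ∀ z, e z ∈ HerInt σ κ ↔ z ∈ HerInt σ ι)
    (hidx : ∀ z : Her σ ι, idx F (e z : Matrix κ κ E) = idx F (z : Matrix ι ι E))
    (htr : ∀ z : Her σ ι, (B' * (e z : Matrix κ κ E)).trace = (B * (z : Matrix ι ι E)).trace)
    (hcard : Fintype.card ι = Fintype.card κ) :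
    (IsSemiIntegral σ B' ↔ IsSemiIntegral σ B) ∧ (IsSemiIntegral σ B → ∀ P : ℂ[X],
      IsSiegelPolynomial σ ψ B P ↔ IsSiegelPolynomial σ ψ B' P) := by
  have hsemi : IsSemiIntegral σ B' ↔ IsSemiIntegral σ B := by
    constructor
    · rintro ⟨-, h2⟩
      refine ⟨hB, fun c => ?_⟩
      obtain ⟨a, ha⟩ := h2 ⟨e c, (hint c).2 c.2⟩
      exact ⟨a, (htr c).symm.trans ha⟩
    · rintro ⟨-, h2⟩
      refine ⟨hB', fun c => ?_⟩
      obtain ⟨a, ha⟩ := h2 ⟨e.symm c, (hint _).1 (by rw [e.apply_symm_apply]; exact c.2)⟩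
      refine ⟨a, ?_⟩
      rw [← ha, ← htr, e.apply_symm_apply]
  refine ⟨hsemi, fun hBs P => ?_⟩
  have hmap : (HerInt σ ι).map (e : Her σ ι →+ Her σ κ) = HerInt σ κ := by
    ext w
    constructor
    · rintro ⟨z, hz, rfl⟩
      exact (hint z).2 hz
    · intro hw
      exact ⟨e.symm w, (hint _).1 (by rw [e.apply_symm_apply]; exact hw), e.apply_symm_apply w⟩
  let Φ : Her σ ι ⧸ HerInt σ ι ≃+ Her σ κ ⧸ HerInt σ κ := QuotientAddGroup.congr _ _ e hmap
  have hterm : ∀ s z, siegelTerm σ ψ B' s (Φ z) = siegelTerm σ ψ B s z := by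
    intro s z
    obtain ⟨z, rfl⟩ := QuotientAddGroup.mk_surjective z
    have : Φ (QuotientAddGroup.mk z) = QuotientAddGroup.mk (e z) := rfl
    rw [this, h.siegelTerm_mk hψ (hsemi.2 hBs), h.siegelTerm_mk hψ hBs, trChar, trChar, htr, mu_eq,
      mu_eq, hidx]
  rw [IsSiegelPolynomial, IsSiegelPolynomial]
  refine exists_congr fun s₀ => forall_congr' fun s => forall_congr' fun _ => ?_
  have hfun : siegelTerm σ ψ B s = siegelTerm σ ψ B' s ∘ Φ.toEquiv := by
    funext z
    exact (hterm s z).symm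
  rw [siegelSeries, siegelSeries, hfun, Φ.toEquiv.summable_iff, hcard]
  have := Φ.toEquiv.tsum_eq (siegelTerm σ ψ B' s)
  rw [← this]
  rfl

theorem IsQuadConj.cT_cT (h : IsQuadConj σ) {ι κ : Type*} (M : Matrix κ ι E) :
    cT σ (cT σ M) = M := by
  ext i j
  exact h.conj_conj _

theorem IsQuadConj.conj_mem_Her (h : IsQuadConj σ) {z : Matrix ι ι E} (hz : z ∈ Her σ ι)
    (U : Matrix κ ι E) : U * z * cT σ U ∈ Her σ κ := by
  rw [mem_Her, cT_mul, cT_mul, h.cT_cT, mem_Her.1 hz, Matrix.mul_assoc]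

/-- The automorphism `z ↦ U z U^*` of the group of Hermitian matrices. -/
def IsQuadConj.herConj (h : IsQuadConj σ) {U V : Matrix ι ι E} (hUV : U * V = 1) :
    Her σ ι ≃+ Her σ ι where
  toFun z := ⟨U * z * cT σ U, h.conj_mem_Her z.2 U⟩
  invFun z := ⟨V * z * cT σ V, h.conj_mem_Her z.2 V⟩
  left_inv z := by
    have hVU := mul_eq_one_comm.1 hUV
    apply Subtype.ext
    change V * (U * z * cT σ U) * cT σ V = z
    calc V * (U * (z : Matrix ι ι E) * cT σ U) * cT σ V
        = (V * U) * z * (cT σ U * cT σ V) := by simp only [Matrix.mul_assoc]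
      _ = z := by rw [← cT_mul, hVU, cT_one, Matrix.one_mul, Matrix.mul_one]
  right_inv z := by
    apply Subtype.ext
    change U * (V * z * cT σ V) * cT σ U = z
    calc U * (V * (z : Matrix ι ι E) * cT σ V) * cT σ U
        = (U * V) * z * (cT σ V * cT σ U) := by simp only [Matrix.mul_assoc]
      _ = z := by rw [← cT_mul, hUV, cT_one, Matrix.one_mul, Matrix.mul_one]
  map_add' z w := by
    apply Subtype.ext
    change U * (z + w : Matrix ι ι E) * cT σ U = _
    rw [Matrix.mul_add, Matrix.add_mul]
    rfl

variable (σ) in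
/-- Renaming the rows and columns of Hermitian matrices. -/
def herReindex (e : ι ≃ κ) : Her σ ι ≃+ Her σ κ where
  toFun z := ⟨Matrix.reindex e e z, by
    ext i j
    exact congrFun (congrFun (mem_Her.1 z.2) (e.symm i)) (e.symm j)⟩
  invFun z := ⟨Matrix.reindex e.symm e.symm z, by
    ext i j
    exact congrFun (congrFun (mem_Her.1 z.2) (e i)) (e j)⟩
  left_inv z := by
    apply Subtype.ext
    ext i j
    simp
  right_inv z := by
    apply Subtype.ext
    ext i j
    simp
  map_add' z w := by
    apply Subtype.ext
    ext i j
    rfl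

theorem IsQuadConj.act_mem_Her (h : IsQuadConj σ) {A : Matrix ι ι E} (hA : A ∈ Her σ ι)
    (U : Matrix ι ι E) : act σ A U ∈ Her σ ι := by
  have := h.conj_mem_Her hA (cT σ U)
  rwa [h.cT_cT] at this

/-- The polynomial part of the Siegel series depends only on the unimodular equivalence class. -/
theorem IsQuadConj.siegelPoly_act (h : IsQuadConj σ) (hψ : IsUnramifiedChar ψ) {A : Matrix ι ι E}
    (hA : A ∈ Her σ ι) {U V : Matrix ι ι (OE F E)} (hUV : U * V = 1) :
    (IsSemiIntegral σ (act σ A (up U)) ↔ IsSemiIntegral σ A) ∧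
      siegelPoly σ ψ (act σ A (up U)) = siegelPoly σ ψ A := by
  have hUV' : up U * up V = 1 := by rw [← up_mul, hUV, up_one]
  have hVU' : up V * up U = 1 := mul_eq_one_comm.1 hUV'
  have hcU : ∃ W W' : Matrix ι ι (OE F E), up W = cT σ (up U) ∧ W * W' = 1 := by
    obtain ⟨W, hW⟩ := isInt_iff.1 (isInt_up U).cT
    obtain ⟨W', hW'⟩ := isInt_iff.1 (isInt_up V).cT
    refine ⟨W, W', hW, up_injective ?_⟩
    rw [up_mul, hW, hW', ← cT_mul, hVU', cT_one, up_one]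
  obtain ⟨W, W', hW, hWW'⟩ := hcU
  obtain ⟨h1, h2⟩ := h.siegelTerm_congr hψ (h.act_mem_Her hA (up U)) hA (h.herConj hUV')
    (fun z => by
      constructor
      · intro hz
        have := ((isInt_up V).mul (mem_HerInt.1 hz)).mul ((isInt_up V).cT (σ := σ))
        rw [mem_HerInt]
        have e := congrArg Subtype.val ((h.herConj hUV').symm_apply_apply z)
        rw [← e]
        exact this
      · intro hz
        exact ((isInt_up U).mul (mem_HerInt.1 hz)).mul (isInt_up U).cT)
    (fun z => by
      change idx F (up U * (z : Matrix ι ι E) * cT σ (up U)) = _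
      rw [← hW]
      exact idx_mul_mul _ (IsUnit.of_mul_eq_one _ hUV) hWW')
    (fun z => by
      change (A * (up U * (z : Matrix ι ι E) * cT σ (up U))).trace =
        (cT σ (up U) * A * up U * (z : Matrix ι ι E)).trace
      rw [← Matrix.mul_assoc, Matrix.trace_mul_comm]
      simp only [Matrix.mul_assoc]) rfl
  refine ⟨h1.symm, ?_⟩
  have := siegelPoly_comp (ψ := ψ) (B := act σ A (up U)) (B' := A) 1 one_ne_zero h1
    (fun hB P => by rw [C_1, one_mul, comp_X]; exact h2 hB P)
  rw [this, C_1, one_mul, comp_X]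

theorem IsQuadConj.siegelTerm_reindex (h : IsQuadConj σ) (hψ : IsUnramifiedChar ψ)
    {A : Matrix ι ι E} (hA : A ∈ Her σ ι) (e : ι ≃ κ) :
    (IsSemiIntegral σ (Matrix.reindex e e A) ↔ IsSemiIntegral σ A) ∧
      (IsSemiIntegral σ A → ∀ P : ℂ[X], IsSiegelPolynomial σ ψ A P ↔
        IsSiegelPolynomial σ ψ (Matrix.reindex e e A) P) :=
  h.siegelTerm_congr hψ hA (herReindex σ e ⟨A, hA⟩).2 (herReindex σ e)
    (fun z => by
      rw [mem_HerInt, mem_HerInt]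
      exact ⟨fun hz i j => by simpa [herReindex] using hz (e i) (e j), fun hz i j => hz _ _⟩)
    (fun z => idx_reindex e _)
    (fun z => by
      change (A.submatrix e.symm e.symm * (z : Matrix ι ι E).submatrix e.symm e.symm).trace = _
      rw [Matrix.submatrix_mul_equiv]
      simp only [Matrix.trace, Matrix.diag, Matrix.submatrix_apply]
      exact e.symm.sum_comp fun i => (A * (z : Matrix ι ι E)) i i)
    (Fintype.card_congr e)

end PolynomialPart

/-! ### The Gauss sums attached to a modular Hermitian matrix -/

section Pairing

variable {F : Type*} [Field F] [ValuativeRel F] [TopologicalSpace F] [IsNonarchimedeanLocalField F]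
  [CharZero F] {E : Type*} [CommRing E] [Algebra F E] [IsReduced E] {σ : E ≃ₐ[F] E}
variable {ι κ : Type*} [Fintype ι] [Fintype κ] [DecidableEq ι] [DecidableEq κ]
  {ψ : AddChar F Circle}

variable (F) in
/-- The lattice `O_E^k` is its own dual for the `F`-bilinear form `(w, v) ↦ tr_{E/F}(w Θ v)`. -/
def IsModular (Θ : Matrix κ κ E) : Prop :=
  ∀ v : κ → E, (∀ w : κ → E, (∀ k, w k ∈ OE F E) →
    Algebra.trace F E (w ⬝ᵥ Θ.mulVec v) ∈ 𝒪[F]) ↔ ∀ k, v k ∈ OE F E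

variable (σ) in
/-- The pairing `ψ(tr_{E/F} tr(Θ y b^*))` of two rectangular matrices. -/
def pair (ψ : AddChar F Circle) (Θ : Matrix κ κ E) (y b : Matrix κ ι E) : ℂ :=
  (ψ (Algebra.trace F E (Θ * y * cT σ b).trace) : ℂ)

theorem pair_add_left (Θ : Matrix κ κ E) (y y' b : Matrix κ ι E) :
    pair σ ψ Θ (y + y') b = pair σ ψ Θ y b * pair σ ψ Θ y' b := by
  simp only [pair]
  rw [Matrix.mul_add, Matrix.add_mul, Matrix.trace_add, map_add, AddChar.map_add_eq_mul,
    Circle.coe_mul]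

theorem pair_add_right (Θ : Matrix κ κ E) (y b b' : Matrix κ ι E) :
    pair σ ψ Θ y (b + b') = pair σ ψ Θ y b * pair σ ψ Θ y b' := by
  simp only [pair]
  rw [cT_add, Matrix.mul_add, Matrix.trace_add, map_add, AddChar.map_add_eq_mul,
    Circle.coe_mul]

theorem pair_ne_zero (Θ : Matrix κ κ E) (y b : Matrix κ ι E) : pair σ ψ Θ y b ≠ 0 :=
  Circle.coe_ne_zero _

theorem pair_zero_left (Θ : Matrix κ κ E) (b : Matrix κ ι E) : pair σ ψ Θ 0 b = 1 := by
  simp [pair]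

/-- The character of `Θ` on the Hermitian matrix `y b^* + b y^*` is the pairing of `y` and `b`. -/
theorem IsQuadConj.trChar_cross (h : IsQuadConj σ) {Θ : Matrix κ κ E} (hΘ : Θ ∈ Her σ κ)
    (y b : Matrix κ ι E) : trChar F ψ Θ (y * cT σ b + b * cT σ y) = pair σ ψ Θ y b := by
  rw [trChar, pair, Matrix.mul_add, Matrix.trace_add]
  have : (Θ * (b * cT σ y)).trace = σ (Θ * y * cT σ b).trace := by
    rw [← trace_cT, cT_mul, cT_mul, h.cT_cT, mem_Her.1 hΘ, Matrix.trace_mul_comm Θ]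
    simp only [Matrix.mul_assoc]
  rw [this, ← Matrix.mul_assoc, h.toBase_add_conj]

theorem IsQuadConj.cross_mem_Her (h : IsQuadConj σ) (y b : Matrix κ ι E) :
    y * cT σ b + b * cT σ y ∈ Her σ κ := by
  rw [mem_Her, cT_add, cT_mul, cT_mul, h.cT_cT, h.cT_cT, add_comm]

theorem IsQuadConj.conj_trace_pair (h : IsQuadConj σ) {Θ : Matrix κ κ E} (hΘ : Θ ∈ Her σ κ)
    (y b : Matrix κ ι E) : σ (Θ * y * cT σ b).trace =
      ∑ i, (fun k => σ (y k i)) ⬝ᵥ Θ.mulVec fun k => b k i := by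
  simp only [Matrix.trace, Matrix.diag, Matrix.mul_apply, cT_apply,
    dotProduct, Matrix.mulVec, map_sum, map_mul, Finset.mul_sum, Finset.sum_mul]
  rw [Finset.sum_comm]
  refine Finset.sum_congr rfl fun i _ => ?_
  rw [Finset.sum_comm]
  refine Finset.sum_congr rfl fun k _ => Finset.sum_congr rfl fun l _ => ?_
  have : σ (Θ l k) = Θ k l := congrFun (congrFun (mem_Her.1 hΘ) k) l
  rw [this, h.conj_conj]
  ring

/-- Integral matrices pair trivially with `b` exactly if `b` is integral. -/
theorem IsModular.pair_eq_one_iff {Θ : Matrix κ κ E} (hΘ : IsModular F Θ) (h : IsQuadConj σ)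
    (hψ : IsUnramifiedChar ψ) (hH : Θ ∈ Her σ κ) (b : Matrix κ ι E) :
    (∀ y : Matrix κ ι E, IsInt F y → pair σ ψ Θ y b = 1) ↔ IsInt F b := by
  constructor
  · intro hy k i
    revert k
    change ∀ k, (fun k => b k i) k ∈ OE F E
    rw [← hΘ]
    intro w hw
    rw [← hψ]
    intro x hx
    -- the matrix with `i`-th column `σ(x w)` and all other columns zero
    have h1 := hy (Matrix.of fun k j => if j = i then σ (algebraMap F E x * w k) else 0)
      (fun k j => by
        rw [Matrix.of_apply]
        split_ifs
        · exact conj_mem_OE σ (mul_mem (algebraMap_mem_OE hx) (hw k))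
        · exact zero_mem _)
    rw [pair, Circle.coe_eq_one, ← h.trace_conj, h.conj_trace_pair hH,
      Finset.sum_eq_single i (fun j _ hj => by simp [dotProduct, hj]) (by simp)] at h1
    rw [← h1, mul_comm, ← smul_eq_mul, ← map_smul]
    congr 2
    simp only [dotProduct, Matrix.of_apply, if_true, h.conj_conj, Algebra.smul_def, Finset.mul_sum,
      mul_assoc]
  · intro hb y hy
    rw [pair, ← h.trace_conj, h.conj_trace_pair hH, map_sum, hψ.eq_one (sum_mem fun i _ =>
      (hΘ _).2 (fun k => hb k i) _ fun k => conj_mem_OE σ (hy k i))]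
    rfl

/-- The integral `k × n` matrices `y` for which `y d` is integral. -/
def rowKer (F : Type*) [Field F] [ValuativeRel F] {E : Type*} [CommRing E] [Algebra F E]
    (κ : Type*) {ι : Type*} [Fintype ι] (d : Matrix ι ι E) :
    AddSubgroup (Matrix κ ι (OE F E)) where
  carrier := {y | IsInt F (up y * d)}
  add_mem' := by
    intro a b ha hb
    change IsInt F (up (a + b) * d)
    rw [up_add, Matrix.add_mul]
    exact ha.add hb
  zero_mem' := by
    change IsInt F (up 0 * d)
    rw [up_zero, Matrix.zero_mul]
    exact isInt_zero
  neg_mem' := by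
    intro a ha
    change IsInt F (up (-a) * d)
    rw [up_neg, Matrix.neg_mul]
    exact IsInt.neg ha

theorem mem_rowKer {d : Matrix ι ι E} {y : Matrix κ ι (OE F E)} :
    y ∈ rowKer F κ d ↔ IsInt F (up y * d) := Iff.rfl

/-- A matrix `y` lies in `rowKer d` exactly if the conjugate of each of its rows lies in `colKer d`.
-/
theorem IsQuadConj.index_rowKer (h : IsQuadConj σ) {d : Matrix ι ι E} (hd : d ∈ Her σ ι) :
    (rowKer F κ d).index = idx F d ^ Fintype.card κ := by
  let c : OE F E → OE F E := fun x => ⟨σ x, conj_mem_OE σ x.2⟩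
  have hc : ∀ x, c (c x) = x := fun x => Subtype.ext (h.conj_conj _)
  let f : Matrix κ ι (OE F E) ≃+ (κ → ι → OE F E) :=
    { toFun := fun y k j => c (y k j)
      invFun := fun y => Matrix.of fun k j => c (y k j)
      left_inv := fun y => by ext k j; exact congrArg Subtype.val (hc _)
      right_inv := fun y => by ext k j; exact congrArg Subtype.val (hc _)
      map_add' := fun y y' => by
        ext k j
        exact map_add σ _ _ }
  have he : rowKer F κ d =
      (AddSubgroup.pi Set.univ fun _ : κ => (colKer F d).toAddSubgroup).comap
        (f : Matrix κ ι (OE F E) →+ (κ → ι → OE F E)) := by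
    ext y
    rw [AddSubgroup.mem_comap, AddSubgroup.mem_pi]
    change (∀ k i, _) ↔ ∀ k, _ → ∀ i, _
    refine forall_congr' fun k => ?_
    simp only [Set.mem_univ, true_imp_iff]
    refine forall_congr' fun i => ?_
    rw [← h.conj_mem_OE_iff]
    have : σ ((up y * d) k i) = d.mulVec (fun j => ((f y k j : OE F E) : E)) i := by
      simp only [Matrix.mul_apply, Matrix.mulVec, dotProduct, map_sum, map_mul]
      refine Finset.sum_congr rfl fun j _ => ?_
      have : σ (d j i) = d i j := congrFun (congrFun (mem_Her.1 hd) i) j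
      rw [this, mul_comm]
      rfl
    rw [this]
    exact Iff.rfl
  rw [he, AddSubgroup.index_comap_of_surjective _ f.surjective, AddSubgroup.index_pi]
  rw [Finset.prod_const, Finset.card_univ]
  rfl

end Pairing

/-- A finite abelian group has as many characters as elements. -/
theorem surjective_of_injective_addChar {A : Type*} [AddCommGroup A] [Finite A]
    (β : A → AddChar A ℂ) (hβ : Function.Injective β) : Function.Surjective β := by
  let _ : Fintype A := Fintype.ofFinite A
  exact ((Fintype.bijective_iff_injective_and_card β).2 ⟨hβ, AddChar.card_eq.symm⟩).2

section GaussSums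

variable {F : Type*} [Field F] [ValuativeRel F] [TopologicalSpace F] [IsNonarchimedeanLocalField F]
  [CharZero F] {E : Type*} [CommRing E] [Algebra F E] [IsReduced E] {σ : E ≃ₐ[F] E}
variable {ι κ : Type*} [Fintype ι] [Fintype κ] [DecidableEq ι] [DecidableEq κ]
  {ψ : AddChar F Circle}

/-- The finite group on which the Gauss sum attached to `d` lives. -/
abbrev GaussGrp (F : Type*) [Field F] [ValuativeRel F] {E : Type*} [CommRing E] [Algebra F E]
    (κ : Type*) {ι : Type*} [Fintype ι] (d : Matrix ι ι E) : Type _ :=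
  Matrix κ ι (OE F E) ⧸ rowKer F κ d

variable (σ) in
/-- The quadratic function `y ↦ ψ(tr(Θ y d y^*))` on `GaussGrp F κ d`. -/
def gaussFun (ψ : AddChar F Circle) (Θ : Matrix κ κ E) (d : Matrix ι ι E)
    (α : GaussGrp F κ d) : ℂ :=
  trChar F ψ Θ (up (Quotient.out α) * d * cT σ (up (Quotient.out α)))

theorem pair_mul_her (Θ : Matrix κ κ E) {d : Matrix ι ι E} (hd : d ∈ Her σ ι) (y y' : Matrix κ ι E) :
    pair σ ψ Θ y (y' * d) = pair σ ψ Θ (y * d) y' := by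
  rw [pair, pair, cT_mul, mem_Her.1 hd]
  simp only [Matrix.mul_assoc]

theorem IsQuadConj.trChar_conj_add (h : IsQuadConj σ) {Θ : Matrix κ κ E} (hΘ : Θ ∈ Her σ κ)
    {d : Matrix ι ι E} (hd : d ∈ Her σ ι) (y y' : Matrix κ ι E) :
    trChar F ψ Θ ((y + y') * d * cT σ (y + y')) =
      trChar F ψ Θ (y * d * cT σ y) * trChar F ψ Θ (y' * d * cT σ y') *
        pair σ ψ Θ y (y' * d) := by
  have e : (y + y') * d * cT σ (y + y') = (y * d * cT σ y + y' * d * cT σ y') +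
      (y * cT σ (y' * d) + y' * d * cT σ y) := by
    rw [cT_mul, mem_Her.1 hd, cT_add]
    simp only [Matrix.add_mul, Matrix.mul_add, Matrix.mul_assoc]
    abel
  rw [e, h.trChar_add ψ hΘ (add_mem (h.conj_mem_Her hd y) (h.conj_mem_Her hd y'))
    (h.cross_mem_Her _ _), h.trChar_add ψ hΘ (h.conj_mem_Her hd y) (h.conj_mem_Her hd y'),
    h.trChar_cross hΘ]

variable (σ) in
/-- A semi-integral Hermitian matrix that is modular. -/
structure IsSelfDual (Θ : Matrix κ κ E) : Prop where
  semi : IsSemiIntegral σ Θ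
  modular : IsModular F Θ

variable {Θ : Matrix κ κ E} {d : Matrix ι ι E}

theorem mk_out_eq (y : Matrix κ ι (OE F E)) (d : Matrix ι ι E) :
    ∃ n ∈ rowKer F κ d, Quotient.out (QuotientAddGroup.mk y : GaussGrp F κ d) = y + n := by
  obtain ⟨n, hn⟩ := QuotientAddGroup.mk_out_eq_add (rowKer F κ d) y
  exact ⟨n.1, n.2, hn⟩

/-- Semi-integrality and modularity of `Θ` make the value independent of the representative. -/
theorem IsSelfDual.gaussFun_mk (hΘ : IsSelfDual σ Θ) (h : IsQuadConj σ) (hψ : IsUnramifiedChar ψ)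
    (hd : d ∈ Her σ ι) (y : Matrix κ ι (OE F E)) :
    gaussFun σ ψ Θ d (QuotientAddGroup.mk y) = trChar F ψ Θ (up y * d * cT σ (up y)) := by
  obtain ⟨n, hn, e⟩ := mk_out_eq (κ := κ) y d
  rw [gaussFun, e, up_add, h.trChar_conj_add hΘ.semi.1 hd,
    h.trChar_of_isInt hψ hΘ.semi (h.conj_mem_Her hd (up n))
      ((mem_rowKer.1 hn).mul (isInt_up n).cT),
    (hΘ.modular.pair_eq_one_iff h hψ hΘ.semi.1 _).2 (mem_rowKer.1 hn) _ (isInt_up y), mul_one,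
    mul_one]

theorem IsSelfDual.pair_out (hΘ : IsSelfDual σ Θ) (h : IsQuadConj σ) (hψ : IsUnramifiedChar ψ)
    (hd : d ∈ Her σ ι) (y y' : Matrix κ ι (OE F E)) :
    pair σ ψ Θ (up (Quotient.out (QuotientAddGroup.mk y : GaussGrp F κ d)))
      (up (Quotient.out (QuotientAddGroup.mk y' : GaussGrp F κ d)) * d) =
        pair σ ψ Θ (up y) (up y' * d) := by
  obtain ⟨n, hn, e⟩ := mk_out_eq (κ := κ) y d
  obtain ⟨n', hn', e'⟩ := mk_out_eq (κ := κ) y' d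
  have h1 : ∀ x : Matrix κ ι (OE F E), pair σ ψ Θ (up n) (up x * d) = 1 := fun x => by
    rw [pair_mul_her Θ hd]
    exact (hΘ.modular.pair_eq_one_iff h hψ hΘ.semi.1 _).2 (isInt_up x) _ (mem_rowKer.1 hn)
  rw [e, e', up_add y, pair_add_left, h1, mul_one, up_add, Matrix.add_mul, pair_add_right,
    (hΘ.modular.pair_eq_one_iff h hψ hΘ.semi.1 _).2 (mem_rowKer.1 hn') _ (isInt_up y), mul_one]

/-- The polarization of `gaussFun` as a family of characters. -/
def IsSelfDual.gaussPair (hΘ : IsSelfDual σ Θ) (h : IsQuadConj σ) (hψ : IsUnramifiedChar ψ)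
    (hd : d ∈ Her σ ι) (α : GaussGrp F κ d) : AddChar (GaussGrp F κ d) ℂ where
  toFun γ := pair σ ψ Θ (up (Quotient.out γ)) (up (Quotient.out α) * d)
  map_zero_eq_one' := by
    obtain ⟨y', rfl⟩ := QuotientAddGroup.mk_surjective α
    rw [← QuotientAddGroup.mk_zero, hΘ.pair_out h hψ hd, up_zero, pair_zero_left]
  map_add_eq_mul' γ γ' := by
    obtain ⟨y', rfl⟩ := QuotientAddGroup.mk_surjective α
    obtain ⟨y, rfl⟩ := QuotientAddGroup.mk_surjective γ
    obtain ⟨x, rfl⟩ := QuotientAddGroup.mk_surjective γ'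
    rw [← QuotientAddGroup.mk_add, hΘ.pair_out h hψ hd, hΘ.pair_out h hψ hd, hΘ.pair_out h hψ hd,
      up_add, pair_add_left]

theorem IsSelfDual.gaussPair_mk (hΘ : IsSelfDual σ Θ) (h : IsQuadConj σ) (hψ : IsUnramifiedChar ψ)
    (hd : d ∈ Her σ ι) (y y' : Matrix κ ι (OE F E)) :
    hΘ.gaussPair h hψ hd (QuotientAddGroup.mk y') (QuotientAddGroup.mk y) =
      pair σ ψ Θ (up y) (up y' * d) :=
  hΘ.pair_out h hψ hd y y'

theorem IsQuadConj.card_gaussGrp (h : IsQuadConj σ) (hd : d ∈ Her σ ι) :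
    Nat.card (GaussGrp F κ d) = idx F d ^ Fintype.card κ :=
  h.index_rowKer hd

theorem IsQuadConj.finite_gaussGrp (h : IsQuadConj σ) (hd : d ∈ Her σ ι) :
    Finite (GaussGrp F κ d) :=
  Nat.finite_of_card_ne_zero (by
    rw [h.card_gaussGrp hd]; exact pow_ne_zero _ (h.idx_ne_zero d))

/-- If `y d` and `y' d` define the same character, then their difference pairs trivially with all
integral matrices and is integral by modularity. -/
theorem IsSelfDual.gaussPair_injective (hΘ : IsSelfDual σ Θ) (h : IsQuadConj σ)
    (hψ : IsUnramifiedChar ψ) (hd : d ∈ Her σ ι) : Function.Injective (hΘ.gaussPair h hψ hd) := by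
  intro α α' hαα
  obtain ⟨y, rfl⟩ := QuotientAddGroup.mk_surjective α
  obtain ⟨y', rfl⟩ := QuotientAddGroup.mk_surjective α'
  rw [QuotientAddGroup.eq, mem_rowKer, up_add, up_neg,
    ← hΘ.modular.pair_eq_one_iff h hψ hΘ.semi.1]
  intro x hx
  obtain ⟨x, rfl⟩ := isInt_iff.1 hx
  have h1 : pair σ ψ Θ (up x) (up y * d) = pair σ ψ Θ (up x) (up y' * d) := by
    rw [← hΘ.gaussPair_mk h hψ hd, hαα, hΘ.gaussPair_mk h hψ hd]
  have h2 : up y' * d = up y * d + (-up y + up y') * d := by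
    rw [Matrix.add_mul, Matrix.neg_mul]; abel
  rw [h2, pair_add_right] at h1
  exact mul_left_cancel₀ (pair_ne_zero Θ (up x) (up y * d)) (by rw [← h1, mul_one])

theorem IsSelfDual.isGaussFun (hΘ : IsSelfDual σ Θ) (h : IsQuadConj σ)
    (hψ : IsUnramifiedChar ψ) (hd : d ∈ Her σ ι) [Fintype (GaussGrp F κ d)] :
    IsGaussFun (gaussFun σ ψ Θ d) (hΘ.gaussPair h hψ hd) where
  mul_conj α := by
    rw [gaussFun, Complex.mul_conj', norm_trChar]
    simp
  map_zero := by
    rw [← QuotientAddGroup.mk_zero, hΘ.gaussFun_mk h hψ hd, up_zero]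
    simp [trChar, Matrix.zero_mul, show toBase F (0 : E) = 0 by
      simpa using h.toBase_algebraMap 0]
  map_add α α' := by
    obtain ⟨y, rfl⟩ := QuotientAddGroup.mk_surjective α
    obtain ⟨y', rfl⟩ := QuotientAddGroup.mk_surjective α'
    rw [add_comm, ← QuotientAddGroup.mk_add, hΘ.gaussFun_mk h hψ hd, hΘ.gaussFun_mk h hψ hd,
      hΘ.gaussFun_mk h hψ hd, hΘ.gaussPair_mk h hψ hd, up_add, h.trChar_conj_add hΘ.semi.1 hd]
    ring
  nondeg α hα := by
    refine hΘ.gaussPair_injective h hψ hd ?_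
    ext α'
    rw [hα]
    obtain ⟨y, rfl⟩ := QuotientAddGroup.mk_surjective α'
    rw [← QuotientAddGroup.mk_zero, hΘ.gaussPair_mk h hψ hd, up_zero, Matrix.zero_mul, pair, cT_zero]
    simp

/-- If `b` pairs trivially with `rowKer d`, it is congruent to a matrix `y d` with `y` integral: the
characters of the finite group `GaussGrp F κ d` are all of the form `pair (· ) (y d)`. -/
theorem IsSelfDual.exists_isInt_sub (hΘ : IsSelfDual σ Θ) (h : IsQuadConj σ)
    (hψ : IsUnramifiedChar ψ) (hd : d ∈ Her σ ι) (b : Matrix κ ι E)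
    (hb : ∀ y ∈ rowKer F κ d, pair σ ψ Θ (up y) b = 1) :
    ∃ y : Matrix κ ι (OE F E), IsInt F (b - up y * d) := by
  have := h.finite_gaussGrp (κ := κ) hd
  have hout : ∀ y : Matrix κ ι (OE F E), pair σ ψ Θ
      (up (Quotient.out (QuotientAddGroup.mk y : GaussGrp F κ d))) b = pair σ ψ Θ (up y) b := by
    intro y
    obtain ⟨n, hn, e⟩ := mk_out_eq (κ := κ) y d
    rw [e, up_add, pair_add_left, hb n hn, mul_one]
  let χ : AddChar (GaussGrp F κ d) ℂ :=
    { toFun := fun γ => pair σ ψ Θ (up (Quotient.out γ)) b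
      map_zero_eq_one' := by
        rw [← QuotientAddGroup.mk_zero, hout, up_zero, pair_zero_left]
      map_add_eq_mul' := fun γ γ' => by
        obtain ⟨y, rfl⟩ := QuotientAddGroup.mk_surjective γ
        obtain ⟨x, rfl⟩ := QuotientAddGroup.mk_surjective γ'
        rw [← QuotientAddGroup.mk_add, hout, hout, hout, up_add, pair_add_left] }
  obtain ⟨α, hα⟩ := surjective_of_injective_addChar (A := GaussGrp F κ d) _ (hΘ.gaussPair_injective h hψ hd) χ
  obtain ⟨y, rfl⟩ := QuotientAddGroup.mk_surjective α
  refine ⟨y, ?_⟩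
  rw [← hΘ.modular.pair_eq_one_iff h hψ hΘ.semi.1]
  intro x hx
  obtain ⟨x, rfl⟩ := isInt_iff.1 hx
  have h1 : pair σ ψ Θ (up x) (up y * d) = pair σ ψ Θ (up x) b := by
    rw [← hΘ.gaussPair_mk h hψ hd, hα]
    exact hout x
  have h2 : b = up y * d + (b - up y * d) := by abel
  exact mul_left_cancel₀ (pair_ne_zero Θ (up x) (up y * d)) (by
    rw [← pair_add_right, ← h2, ← h1, mul_one])

end GaussSums

/-! ### The Siegel series of an orthogonal sum with a modular matrix -/

section Splitting

variable {F : Type*} [Field F] [ValuativeRel F] [TopologicalSpace F] [IsNonarchimedeanLocalField F]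
  [CharZero F] {E : Type*} [CommRing E] [Algebra F E] [IsReduced E] {σ : E ≃ₐ[F] E}
variable {ι κ : Type*} [Fintype ι] [Fintype κ] [DecidableEq ι] [DecidableEq κ]
  {ψ : AddChar F Circle}

/-- The integral rectangular matrices. -/
def MatInt (F : Type*) [Field F] [ValuativeRel F] (E : Type*) [CommRing E] [Algebra F E]
    (κ ι : Type*) : AddSubgroup (Matrix κ ι E) where
  carrier := {M | IsInt F M}
  add_mem' := IsInt.add
  zero_mem' := isInt_zero
  neg_mem' := IsInt.neg

theorem mem_MatInt {M : Matrix κ ι E} : M ∈ MatInt F E κ ι ↔ IsInt F M := Iff.rfl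

variable (σ) in
/-- A Hermitian matrix assembled from its blocks. -/
def blk (a : Matrix κ κ E) (b : Matrix κ ι E) (d : Matrix ι ι E) : Matrix (κ ⊕ ι) (κ ⊕ ι) E :=
  Matrix.fromBlocks a b (cT σ b) d

theorem IsQuadConj.blk_mem_Her (h : IsQuadConj σ) {a : Matrix κ κ E} (b : Matrix κ ι E)
    {d : Matrix ι ι E} (ha : a ∈ Her σ κ) (hd : d ∈ Her σ ι) : blk σ a b d ∈ Her σ (κ ⊕ ι) := by
  rw [mem_Her, blk, cT_fromBlocks, h.cT_cT, mem_Her.1 ha, mem_Her.1 hd]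

theorem blk_add (a a' : Matrix κ κ E) (b b' : Matrix κ ι E) (d d' : Matrix ι ι E) :
    blk σ (a + a') (b + b') (d + d') = blk σ a b d + blk σ a' b' d' := by
  rw [blk, blk, blk, cT_add, Matrix.fromBlocks_add]

theorem isInt_blk {a : Matrix κ κ E} {b : Matrix κ ι E} {d : Matrix ι ι E} :
    IsInt F (blk σ a b d) ↔ IsInt F a ∧ IsInt F b ∧ IsInt F d := by
  rw [blk, isInt_fromBlocks]
  exact ⟨fun hh => ⟨hh.1, hh.2.1, hh.2.2.2⟩, fun hh => ⟨hh.1, hh.2.1, hh.2.1.cT, hh.2.2⟩⟩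

/-- Block decomposition of Hermitian matrices. -/
def IsQuadConj.blkEquiv (h : IsQuadConj σ) (κ ι : Type*) [Fintype ι] [Fintype κ] [DecidableEq ι]
    [DecidableEq κ] : (Her σ ι × Matrix κ ι E) × Her σ κ ≃+ Her σ (κ ⊕ ι) where
  toFun p := ⟨blk σ p.2 p.1.2 p.1.1, h.blk_mem_Her _ p.2.2 p.1.1.2⟩
  invFun z := ((⟨(z : Matrix (κ ⊕ ι) (κ ⊕ ι) E).toBlocks₂₂, by
      ext i j; exact congrFun (congrFun (mem_Her.1 z.2) (Sum.inr i)) (Sum.inr j)⟩,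
    (z : Matrix (κ ⊕ ι) (κ ⊕ ι) E).toBlocks₁₂), ⟨(z : Matrix (κ ⊕ ι) (κ ⊕ ι) E).toBlocks₁₁, by
      ext i j; exact congrFun (congrFun (mem_Her.1 z.2) (Sum.inl i)) (Sum.inl j)⟩)
  left_inv p := rfl
  right_inv z := by
    apply Subtype.ext
    ext (i | i) (j | j)
    · rfl
    · rfl
    · exact congrFun (congrFun (mem_Her.1 z.2) (Sum.inr i)) (Sum.inl j)
    · rfl
  map_add' p p' := Subtype.ext (blk_add _ _ _ _ _ _)

/-- The classes of Hermitian matrices modulo the integral ones, in terms of blocks. -/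
def IsQuadConj.blkQuot (h : IsQuadConj σ) (κ ι : Type*) [Fintype ι] [Fintype κ] [DecidableEq ι]
    [DecidableEq κ] : ((Her σ ι ⧸ HerInt σ ι) × (Matrix κ ι E ⧸ MatInt F E κ ι)) ×
      (Her σ κ ⧸ HerInt σ κ) ≃ Her σ (κ ⊕ ι) ⧸ HerInt σ (κ ⊕ ι) :=
  (((QuotientAddGroup.prodEquiv (HerInt σ ι) (MatInt F E κ ι)).symm.prodCongr (Equiv.refl _)).trans
    (QuotientAddGroup.prodEquiv ((HerInt σ ι).prod (MatInt F E κ ι)) (HerInt σ κ)).symm).trans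
    (QuotientAddGroup.congr (((HerInt σ ι).prod (MatInt F E κ ι)).prod (HerInt σ κ))
      (HerInt σ (κ ⊕ ι)) (h.blkEquiv κ ι) (by
        ext z
        constructor
        · rintro ⟨⟨⟨d, b⟩, a⟩, ⟨⟨hd, hb⟩, ha⟩, rfl⟩
          exact isInt_blk.2 ⟨ha, hb, hd⟩
        · intro hz
          refine ⟨(h.blkEquiv κ ι).symm z, ?_, (h.blkEquiv κ ι).apply_symm_apply z⟩
          exact ⟨⟨fun i j => hz _ _, fun i j => hz _ _⟩, fun i j => hz _ _⟩)).toEquiv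

theorem IsQuadConj.blkQuot_mk (h : IsQuadConj σ) (a : Her σ κ) (b : Matrix κ ι E) (d : Her σ ι) :
    h.blkQuot κ ι ((QuotientAddGroup.mk d, QuotientAddGroup.mk b), QuotientAddGroup.mk a) =
      QuotientAddGroup.mk ⟨blk σ a b d, h.blk_mem_Her _ a.2 d.2⟩ := rfl

theorem trace_perp_mul_blk (Θ a : Matrix κ κ E) (B d : Matrix ι ι E) (b : Matrix κ ι E) :
    (perp Θ B * blk σ a b d).trace = (Θ * a).trace + (B * d).trace := by
  rw [perp, blk, Matrix.fromBlocks_multiply]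
  simp [Matrix.trace, Fintype.sum_sum_type]

theorem IsQuadConj.trChar_perp_blk (h : IsQuadConj σ) {Θ a : Matrix κ κ E} {B d : Matrix ι ι E}
    (b : Matrix κ ι E) (hΘ : Θ ∈ Her σ κ) (hB : B ∈ Her σ ι) (ha : a ∈ Her σ κ) (hd : d ∈ Her σ ι) :
    trChar F ψ (perp Θ B) (blk σ a b d) = trChar F ψ Θ a * trChar F ψ B d := by
  rw [trChar, trace_perp_mul_blk, h.toBase_add (conj_trace_mul hΘ ha) (conj_trace_mul hB hd),
    AddChar.map_add_eq_mul, Circle.coe_mul]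
  rfl

theorem IsQuadConj.perp_mem_Her (h : IsQuadConj σ) {Θ : Matrix κ κ E} {B : Matrix ι ι E}
    (hΘ : Θ ∈ Her σ κ) (hB : B ∈ Her σ ι) : perp Θ B ∈ Her σ (κ ⊕ ι) := by
  have := h.blk_mem_Her (0 : Matrix κ ι E) hΘ hB
  rwa [blk, cT_zero] at this

theorem IsQuadConj.isSemiIntegral_perp (h : IsQuadConj σ) {Θ : Matrix κ κ E} {B : Matrix ι ι E}
    (hΘ : IsSemiIntegral σ Θ) (hB : B ∈ Her σ ι) :
    IsSemiIntegral σ (perp Θ B) ↔ IsSemiIntegral σ B := by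
  constructor
  · intro hP
    refine ⟨hB, fun c => ?_⟩
    have h0 : (0 : Matrix κ κ E) ∈ Her σ κ := zero_mem _
    obtain ⟨x, hx⟩ := hP.2 ⟨⟨blk σ 0 (0 : Matrix κ ι E) (c : Her σ ι), h.blk_mem_Her 0 h0 c.1.2⟩,
      isInt_blk.2 ⟨isInt_zero, isInt_zero, c.2⟩⟩
    refine ⟨x, ?_⟩
    rw [← hx]
    change _ = (perp Θ B * blk σ 0 0 (c : Matrix ι ι E)).trace
    rw [trace_perp_mul_blk, Matrix.mul_zero, Matrix.trace_zero, zero_add]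
  · intro hB'
    refine ⟨h.perp_mem_Her hΘ.1 hB, fun c => ?_⟩
    obtain ⟨⟨⟨d, b⟩, a⟩, e⟩ : ∃ p, h.blkEquiv κ ι p = c := ⟨_, (h.blkEquiv κ ι).apply_symm_apply c⟩
    have e' : ((c : Her σ (κ ⊕ ι)) : Matrix (κ ⊕ ι) (κ ⊕ ι) E) = blk σ a b d :=
      (congrArg Subtype.val e).symm
    have hc := isInt_blk.1 (show IsInt F (blk σ (a : Matrix κ κ E) b d) from e' ▸ c.2)
    obtain ⟨x, hx⟩ := hΘ.2 ⟨a, hc.1⟩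
    obtain ⟨y, hy⟩ := hB'.2 ⟨d, hc.2.2⟩
    refine ⟨x + y, ?_⟩
    rw [e', trace_perp_mul_blk, hx, hy]
    simp

theorem up_fromBlocks {κ' ι' : Type*} (a : Matrix κ ι (OE F E)) (b : Matrix κ ι' (OE F E))
    (c : Matrix κ' ι (OE F E)) (d : Matrix κ' ι' (OE F E)) :
    up (Matrix.fromBlocks a b c d) = Matrix.fromBlocks (up a) (up b) (up c) (up d) :=
  Matrix.fromBlocks_map _ _ _ _ _

/-- Conjugation by the unipotent matrix with upper right block `y` does not change `μ`. -/
theorem mu_blk_translate (a : Matrix κ κ E) (b : Matrix κ ι E) {d : Matrix ι ι E}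
    (hd : d ∈ Her σ ι) (y : Matrix κ ι (OE F E)) :
    mu F (blk σ (a + (up y * cT σ b + b * cT σ (up y) + up y * d * cT σ (up y))) (b + up y * d) d) =
      mu F (blk σ a b d) := by
  obtain ⟨yc, hyc⟩ := isInt_iff.1 ((isInt_up y).cT (σ := σ))
  have hU : IsUnit (Matrix.fromBlocks 1 y 0 1 : Matrix (κ ⊕ ι) (κ ⊕ ι) (OE F E)) :=
    IsUnit.of_mul_eq_one (Matrix.fromBlocks 1 (-y) 0 1)
      (by simp [Matrix.fromBlocks_multiply])
  have hV : (Matrix.fromBlocks 1 0 yc 1 : Matrix (κ ⊕ ι) (κ ⊕ ι) (OE F E)) *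
      Matrix.fromBlocks 1 0 (-yc) 1 = 1 := by
    simp [Matrix.fromBlocks_multiply]
  have e1 : up (Matrix.fromBlocks 1 y 0 1 : Matrix (κ ⊕ ι) (κ ⊕ ι) (OE F E)) =
      Matrix.fromBlocks 1 (up y) 0 1 := by
    rw [up_fromBlocks, up_one, up_one, up_zero]
  have e2 : up (Matrix.fromBlocks 1 0 yc 1 : Matrix (κ ⊕ ι) (κ ⊕ ι) (OE F E)) =
      Matrix.fromBlocks 1 0 (cT σ (up y)) 1 := by
    rw [up_fromBlocks, up_one, up_one, up_zero, hyc]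
  have := idx_mul_mul (F := F) (blk σ a b d) hU hV
  rw [mu_eq, mu_eq, ← this, e1, e2]
  congr 3
  rw [blk, blk, Matrix.fromBlocks_multiply, Matrix.fromBlocks_multiply, cT_add, cT_mul,
    mem_Her.1 hd]
  simp only [Matrix.one_mul, Matrix.mul_one, Matrix.zero_mul, Matrix.mul_zero, zero_add,
    Matrix.add_mul]
  congr 1
  abel

theorem mu_blk_zero (a : Matrix κ κ E) (d : Matrix ι ι E) :
    mu F (blk σ a 0 d) = mu F a * mu F d := by
  rw [mu_eq, mu_eq, mu_eq, blk, cT_zero, idx_fromBlocks, Nat.cast_mul,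
    Real.sqrt_mul (Nat.cast_nonneg _)]

variable (σ) in
/-- The Gauss sum attached to the modular matrix `Θ` and to `d`. -/
def gaussSum (ψ : AddChar F Circle) (Θ : Matrix κ κ E) (d : Matrix ι ι E) : ℂ :=
  ∑' α, gaussFun σ ψ Θ d α

section Identity

variable {Θ : Matrix κ κ E} {B d : Matrix ι ι E}

/-- The partial sum of the Siegel series of `Θ ⊥ B` over the upper left blocks. -/
def IsQuadConj.innerSum (h : IsQuadConj σ) (ψ : AddChar F Circle) (Θ : Matrix κ κ E)
    (B : Matrix ι ι E) (s : ℂ)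
    (x : (Her σ ι ⧸ HerInt σ ι) × (Matrix κ ι E ⧸ MatInt F E κ ι)) : ℂ :=
  ∑' p, siegelTerm σ ψ (perp Θ B) s (h.blkQuot κ ι (x, p))

theorem IsSelfDual.siegelTerm_blkQuot (hΘ : IsSelfDual σ Θ) (h : IsQuadConj σ)
    (hψ : IsUnramifiedChar ψ) (hB : IsSemiIntegral σ B) (s : ℂ) (a : Her σ κ) (b : Matrix κ ι E)
    (d : Her σ ι) : siegelTerm σ ψ (perp Θ B) s (h.blkQuot κ ι
        ((QuotientAddGroup.mk d, QuotientAddGroup.mk b), QuotientAddGroup.mk a)) =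
      trChar F ψ Θ a * trChar F ψ B d * (mu F (blk σ (a : Matrix κ κ E) b d) : ℂ) ^ (-s) := by
  rw [h.blkQuot_mk, h.siegelTerm_mk hψ ((h.isSemiIntegral_perp hΘ.semi hB.1).2 hB),
    h.trChar_perp_blk b hΘ.semi.1 hB.1 a.2 d.2]

/-- The unipotent conjugation that carries `b` to `b + y d` also translates the upper left block,
which multiplies the inner sum by a value of the character of `Θ`. -/
theorem IsSelfDual.innerSum_translate (hΘ : IsSelfDual σ Θ) (h : IsQuadConj σ)
    (hψ : IsUnramifiedChar ψ) (hB : IsSemiIntegral σ B) (s : ℂ) (b : Matrix κ ι E) (d : Her σ ι)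
    (y : Matrix κ ι (OE F E)) :
    h.innerSum ψ Θ B s (QuotientAddGroup.mk d, QuotientAddGroup.mk (b + up y * (d : Matrix ι ι E))) =
      trChar F ψ Θ (up y * cT σ b + b * cT σ (up y) + up y * (d : Matrix ι ι E) * cT σ (up y)) *
        h.innerSum ψ Θ B s (QuotientAddGroup.mk d, QuotientAddGroup.mk b) := by
  have hw : up y * cT σ b + b * cT σ (up y) + up y * (d : Matrix ι ι E) * cT σ (up y) ∈ Her σ κ :=
    add_mem (h.cross_mem_Her _ _) (h.conj_mem_Her d.2 _)
  set w := up y * cT σ b + b * cT σ (up y) + up y * (d : Matrix ι ι E) * cT σ (up y) with hw'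
  rw [IsQuadConj.innerSum, IsQuadConj.innerSum, ← tsum_mul_left,
    ← (Equiv.addRight (QuotientAddGroup.mk ⟨w, hw⟩ : Her σ κ ⧸ HerInt σ κ)).tsum_eq]
  refine tsum_congr fun p => ?_
  obtain ⟨a, rfl⟩ := QuotientAddGroup.mk_surjective p
  change siegelTerm σ ψ (perp Θ B) s (h.blkQuot κ ι ((QuotientAddGroup.mk d, _),
    QuotientAddGroup.mk (a + ⟨w, hw⟩))) = _
  rw [hΘ.siegelTerm_blkQuot h hψ hB,
    hΘ.siegelTerm_blkQuot h hψ hB, AddSubgroup.coe_add, mu_blk_translate _ _ d.2,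
    h.trChar_add ψ hΘ.semi.1 a.2 hw]
  ring

/-- Over `b = 0` the index is multiplicative and the inner sum factors. -/
theorem IsSelfDual.innerSum_zero (hΘ : IsSelfDual σ Θ) (h : IsQuadConj σ)
    (hψ : IsUnramifiedChar ψ) (hB : IsSemiIntegral σ B) (s : ℂ) (d : Her σ ι) :
    h.innerSum ψ Θ B s (QuotientAddGroup.mk d, QuotientAddGroup.mk 0) =
      siegelTerm σ ψ B s (QuotientAddGroup.mk d) * siegelSeries σ ψ Θ s := by
  rw [IsQuadConj.innerSum, siegelSeries, ← tsum_mul_left]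
  refine tsum_congr fun p => ?_
  obtain ⟨a, rfl⟩ := QuotientAddGroup.mk_surjective p
  rw [hΘ.siegelTerm_blkQuot h hψ hB, h.siegelTerm_mk hψ hB, h.siegelTerm_mk hψ hΘ.semi,
    mu_blk_zero, Complex.ofReal_mul,
    Complex.mul_cpow_ofReal_nonneg (h.mu_pos _).le (h.mu_pos _).le]
  ring

/-- The sum over the off-diagonal blocks is supported on the classes of the matrices `y d` with `y`
integral, and it becomes a Gauss sum. -/
theorem IsSelfDual.tsum_innerSum (hΘ : IsSelfDual σ Θ) (h : IsQuadConj σ)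
    (hψ : IsUnramifiedChar ψ) (hB : IsSemiIntegral σ B) (s : ℂ) (d : Her σ ι) :
    ∑' β, h.innerSum ψ Θ B s (QuotientAddGroup.mk d, β) =
      gaussSum σ ψ Θ (d : Matrix ι ι E) *
        (siegelTerm σ ψ B s (QuotientAddGroup.mk d) * siegelSeries σ ψ Θ s) := by
  let j : GaussGrp F κ (d : Matrix ι ι E) → Matrix κ ι E ⧸ MatInt F E κ ι := fun α =>
    QuotientAddGroup.mk (up (Quotient.out α) * (d : Matrix ι ι E))
  have hj : ∀ y : Matrix κ ι (OE F E), j (QuotientAddGroup.mk y) =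
      QuotientAddGroup.mk (up y * (d : Matrix ι ι E)) := by
    intro y
    obtain ⟨n, hn, e⟩ := mk_out_eq (κ := κ) y (d : Matrix ι ι E)
    change QuotientAddGroup.mk (up (Quotient.out _) * _) = _
    rw [e, up_add, Matrix.add_mul, eq_comm, QuotientAddGroup.eq, neg_add_cancel_left]
    exact hn
  have hinj : Function.Injective j := by
    intro α α' hα
    obtain ⟨y, rfl⟩ := QuotientAddGroup.mk_surjective α
    obtain ⟨y', rfl⟩ := QuotientAddGroup.mk_surjective α'
    rw [hj, hj, QuotientAddGroup.eq] at hα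
    rw [QuotientAddGroup.eq, mem_rowKer, up_add, up_neg, Matrix.add_mul, Matrix.neg_mul]
    exact hα
  have hsupp : Function.support (fun β => h.innerSum ψ Θ B s (QuotientAddGroup.mk d, β)) ⊆
      Set.range j := by
    intro β hβ
    obtain ⟨b, rfl⟩ := QuotientAddGroup.mk_surjective β
    rw [Function.mem_support] at hβ
    -- If `y d` is integral, `b` and `b + y d` are the same class; where the inner sum does not
    -- vanish, `b` therefore pairs trivially with `y`.
    obtain ⟨y, hy⟩ := hΘ.exists_isInt_sub h hψ d.2 b (by
      intro y hy
      have h1 := hΘ.innerSum_translate h hψ hB s b d y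
      have h2 : (QuotientAddGroup.mk (b + up y * (d : Matrix ι ι E)) : Matrix κ ι E ⧸ MatInt F E κ ι) =
          QuotientAddGroup.mk b := by
        rw [eq_comm, QuotientAddGroup.eq, neg_add_cancel_left]
        exact hy
      rw [h2, h.trChar_add ψ hΘ.semi.1 (h.cross_mem_Her _ _) (h.conj_mem_Her d.2 _),
        h.trChar_cross hΘ.semi.1, h.trChar_of_isInt hψ hΘ.semi (h.conj_mem_Her d.2 _)
        ((mem_rowKer.1 hy).mul (isInt_up y).cT), mul_one] at h1
      exact (mul_right_cancel₀ hβ (by rw [one_mul]; exact h1)).symm)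
    refine ⟨QuotientAddGroup.mk y, ?_⟩
    rw [hj, QuotientAddGroup.eq, neg_add_eq_sub]
    exact hy
  rw [← hinj.tsum_eq hsupp, gaussSum, ← tsum_mul_right]
  refine tsum_congr fun α => ?_
  rw [← hΘ.innerSum_zero h hψ hB]
  have h1 := hΘ.innerSum_translate h hψ hB s 0 d (Quotient.out α)
  rw [zero_add, cT_zero, Matrix.mul_zero, Matrix.zero_mul, add_zero, zero_add] at h1
  exact h1

/-- If the Gauss sums of `Θ` shift the exponent of `μ(d)` from `-s` to `-s'`, then the Siegel series
of `Θ ⊥ B` at `s` is the product of those of `Θ` at `s` and of `B` at `s'`. -/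
theorem IsSelfDual.siegelSeries_perp (hΘ : IsSelfDual σ Θ) (h : IsQuadConj σ)
    (hψ : IsUnramifiedChar ψ) (hB : IsSemiIntegral σ B) {s s' : ℂ}
    (hs : Summable (siegelTerm σ ψ (perp Θ B) s))
    (hgauss : ∀ d ∈ Her σ ι, gaussSum σ ψ Θ d * (mu F d : ℂ) ^ (-s) = (mu F d : ℂ) ^ (-s')) :
    siegelSeries σ ψ (perp Θ B) s = siegelSeries σ ψ Θ s * siegelSeries σ ψ B s' := by
  have hs1 : Summable (siegelTerm σ ψ (perp Θ B) s ∘ h.blkQuot κ ι) :=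
    (Equiv.summable_iff (h.blkQuot κ ι)).2 hs
  have hs2 : Summable (h.innerSum ψ Θ B s) := hs1.prod
  calc siegelSeries σ ψ (perp Θ B) s
      = ∑' p, (siegelTerm σ ψ (perp Θ B) s ∘ h.blkQuot κ ι) p :=
        ((h.blkQuot κ ι).tsum_eq _).symm
    _ = ∑' x, h.innerSum ψ Θ B s x := hs1.tsum_prod
    _ = ∑' δ, ∑' β, h.innerSum ψ Θ B s (δ, β) := hs2.tsum_prod
    _ = ∑' δ, siegelSeries σ ψ Θ s * siegelTerm σ ψ B s' δ := by
        refine tsum_congr fun δ => ?_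
        obtain ⟨d, rfl⟩ := QuotientAddGroup.mk_surjective δ
        rw [hΘ.tsum_innerSum h hψ hB, h.siegelTerm_mk hψ hB, h.siegelTerm_mk hψ hB,
          ← hgauss d d.2]
        ring
    _ = siegelSeries σ ψ Θ s * siegelSeries σ ψ B s' := tsum_mul_left

end Identity

end Splitting

/-! ### Evaluation of the Gauss sums -/

section GaussValues

variable {F : Type*} [Field F] [ValuativeRel F] [TopologicalSpace F] [IsNonarchimedeanLocalField F]
  [CharZero F] {E : Type*} [CommRing E] [Algebra F E] [IsReduced E] {σ : E ≃ₐ[F] E}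
variable {ι κ : Type*} [Fintype ι] [Fintype κ] [DecidableEq ι] [DecidableEq κ]
  {ψ : AddChar F Circle} {Θ : Matrix κ κ E} {d : Matrix ι ι E}

/-- Left multiplication by an integral matrix on `GaussGrp F κ d`. -/
def gaussMul (ε : Matrix κ κ (OE F E)) (d : Matrix ι ι E) : GaussGrp F κ d →+ GaussGrp F κ d :=
  QuotientAddGroup.map _ _
    { toFun := fun y => ε * y
      map_zero' := Matrix.mul_zero _
      map_add' := Matrix.mul_add _ } (by
    intro y hy
    change IsInt F (up (ε * y) * d)
    rw [up_mul, Matrix.mul_assoc]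
    exact (isInt_up ε).mul hy)

theorem gaussMul_mk (ε : Matrix κ κ (OE F E)) (d : Matrix ι ι E) (y : Matrix κ ι (OE F E)) :
    gaussMul ε d (QuotientAddGroup.mk y) = QuotientAddGroup.mk (ε * y) := rfl

theorem gaussMul_gaussMul (ε ε' : Matrix κ κ (OE F E)) (d : Matrix ι ι E) (α : GaussGrp F κ d) :
    gaussMul ε d (gaussMul ε' d α) = gaussMul (ε * ε') d α := by
  obtain ⟨y, rfl⟩ := QuotientAddGroup.mk_surjective α
  rw [gaussMul_mk, gaussMul_mk, gaussMul_mk, Matrix.mul_assoc]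

theorem gaussMul_one (d : Matrix ι ι E) (α : GaussGrp F κ d) : gaussMul 1 d α = α := by
  obtain ⟨y, rfl⟩ := QuotientAddGroup.mk_surjective α
  rw [gaussMul_mk, Matrix.one_mul]

theorem trace_conj_mul (ε : Matrix κ κ E) (Θ : Matrix κ κ E) (d : Matrix ι ι E) (y : Matrix κ ι E) :
    (Θ * ((ε * y) * d * cT σ (ε * y))).trace = (cT σ ε * Θ * ε * (y * d * cT σ y)).trace := by
  have e : Θ * ((ε * y) * d * cT σ (ε * y)) = (Θ * ε * (y * d * cT σ y)) * cT σ ε := by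
    rw [cT_mul]
    simp only [Matrix.mul_assoc]
  rw [e, Matrix.trace_mul_comm]
  simp only [Matrix.mul_assoc]

theorem IsQuadConj.trChar_zero (h : IsQuadConj σ) (z : Matrix κ κ E) : trChar F ψ 0 z = 1 := by
  have : toBase F (0 : E) = 0 := by simpa using h.toBase_algebraMap 0
  simp [trChar, this]

/-- If an integral idempotent splits the Hermitian space of `Θ` into two isotropic subspaces, then
all its Gauss sums are positive. -/
theorem IsSelfDual.gaussSum_of_idempotent (hΘ : IsSelfDual σ Θ) (h : IsQuadConj σ)
    (hψ : IsUnramifiedChar ψ) (hd : d ∈ Her σ ι) (ε : Matrix κ κ (OE F E))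
    (h1 : cT σ (up ε) * Θ * up ε = 0) (h2 : cT σ (1 - up ε) * Θ * (1 - up ε) = 0) :
    gaussSum σ ψ Θ d = (mu F d : ℂ) ^ Fintype.card κ := by
  have := h.finite_gaussGrp (κ := κ) hd
  let _ : Fintype (GaussGrp F κ d) := Fintype.ofFinite _
  obtain ⟨n, hn, hn2⟩ := (hΘ.isGaussFun h hψ hd).sum_eq_of_idempotent (gaussMul ε d)
    (fun α => by
      obtain ⟨y, rfl⟩ := QuotientAddGroup.mk_surjective α
      rw [gaussMul_mk, hΘ.gaussFun_mk h hψ hd, trChar, up_mul, trace_conj_mul, h1]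
      exact h.trChar_zero _)
    (fun α => by
      obtain ⟨y, rfl⟩ := QuotientAddGroup.mk_surjective α
      rw [gaussMul_mk, ← QuotientAddGroup.mk_sub, hΘ.gaussFun_mk h hψ hd, trChar]
      have e : up (y - ε * y) = (1 - up ε) * up y := by
        rw [up_sub, up_mul, Matrix.sub_mul, Matrix.one_mul]
      rw [e, trace_conj_mul, h2]
      exact h.trChar_zero _)
  rw [gaussSum, tsum_fintype, hn]
  rw [← Nat.card_eq_fintype_card, h.card_gaussGrp hd] at hn2
  have h3 : (n : ℝ) = mu F d ^ Fintype.card κ := by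
    rw [mu_eq]
    have h4 : ((n : ℝ)) ^ 2 = (Real.sqrt (idx F d) ^ Fintype.card κ) ^ 2 := by
      rw [← pow_mul, mul_comm, pow_mul, Real.sq_sqrt (Nat.cast_nonneg _)]
      exact_mod_cast hn2
    exact (pow_left_inj₀ (Nat.cast_nonneg _) (by positivity) two_ne_zero).1 h4
  exact_mod_cast congrArg (fun x : ℝ => (x : ℂ)) h3

theorem up_smul {ι κ : Type*} (c : OE F E) (y : Matrix κ ι (OE F E)) : up (c • y) = (c : E) • up y := by
  ext; rfl

theorem IsQuadConj.trChar_nsmul (h : IsQuadConj σ) (hΘ : Θ ∈ Her σ κ) {z : Matrix κ κ E}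
    (hz : z ∈ Her σ κ) (n : ℕ) : trChar F ψ Θ (n • z) = trChar F ψ Θ z ^ n := by
  induction n with
  | zero =>
    have : toBase F (0 : E) = 0 := by simpa using h.toBase_algebraMap 0
    simp [trChar, this]
  | succ n ih => rw [succ_nsmul, h.trChar_add ψ hΘ (nsmul_mem hz n) hz, ih, pow_succ]

/-- The values are roots of unity. -/
theorem IsSelfDual.isIntegral_gaussFun (hΘ : IsSelfDual σ Θ) (h : IsQuadConj σ)
    (hψ : IsUnramifiedChar ψ) (hd : d ∈ Her σ ι) (α : GaussGrp F κ d) :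
    IsIntegral ℤ (gaussFun σ ψ Θ d α) := by
  have hz := h.conj_mem_Her hd (up (Quotient.out α))
  have h1 : gaussFun σ ψ Θ d α ^ idx F d = 1 := by
    rw [gaussFun, ← h.trChar_nsmul hΘ.semi.1 hz]
    refine h.trChar_of_isInt hψ hΘ.semi (nsmul_mem hz _) ?_
    rw [← Matrix.smul_mul, ← Matrix.mul_smul]
    exact ((isInt_up _).mul (isInt_idx_smul d)).mul (isInt_up _).cT
  refine IsIntegral.of_pow (Nat.pos_of_ne_zero (h.idx_ne_zero d)) ?_
  rw [h1]
  exact isIntegral_one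

theorem trace_smul_conj_mul (c : E) (Θ : Matrix κ κ E) (d : Matrix ι ι E) (y : Matrix κ ι E) :
    (Θ * ((c • y) * d * cT σ (c • y))).trace = (c * σ c) * (Θ * (y * d * cT σ y)).trace := by
  have : cT σ (c • y) = σ c • cT σ y := by ext; simp
  rw [this]
  simp only [Matrix.smul_mul, Matrix.mul_smul, Matrix.trace_smul, smul_smul, smul_eq_mul]
  ring

/-- Multiplication by an integral scalar on `GaussGrp F κ d`. -/
def gaussScal (c : OE F E) (d : Matrix ι ι E) : GaussGrp F κ d →+ GaussGrp F κ d :=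
  gaussMul (c • (1 : Matrix κ κ (OE F E))) d

theorem gaussScal_mk (c : OE F E) (d : Matrix ι ι E) (y : Matrix κ ι (OE F E)) :
    gaussScal c d (QuotientAddGroup.mk y) = QuotientAddGroup.mk (c • y) := by
  rw [gaussScal, gaussMul_mk, Matrix.smul_mul, Matrix.one_mul]

theorem gaussScal_gaussScal (a b : OE F E) (d : Matrix ι ι E) (x : GaussGrp F κ d) :
    gaussScal a d (gaussScal b d x) = gaussScal (a * b) d x := by
  rw [gaussScal, gaussScal, gaussScal, gaussMul_gaussMul, Matrix.smul_mul, Matrix.one_mul, smul_smul]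

theorem gaussScal_one (d : Matrix ι ι E) (x : GaussGrp F κ d) : gaussScal 1 d x = x := by
  rw [gaussScal, one_smul, gaussMul_one]

theorem iterate_gaussScal (z : OE F E) (d : Matrix ι ι E) (n : ℕ) (x : GaussGrp F κ d) :
    (gaussScal z d)^[n] x = gaussScal (z ^ n) d x := by
  induction n with
  | zero => rw [pow_zero, gaussScal_one]; rfl
  | succ n ih => rw [Function.iterate_succ_apply', ih, gaussScal_gaussScal, pow_succ']

/-- The permutation of `GaussGrp F κ d` given by a scalar that acts invertibly. -/
def gaussPerm (a b : OE F E) (d : Matrix ι ι E) (hab : ∀ x : GaussGrp F κ d,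
    gaussScal (a * b) d x = x) : Equiv.Perm (GaussGrp F κ d) where
  toFun := gaussScal a d
  invFun := gaussScal b d
  left_inv x := by rw [gaussScal_gaussScal, mul_comm, hab]
  right_inv x := by rw [gaussScal_gaussScal, hab]

theorem gaussPerm_pow (a b : OE F E) (d : Matrix ι ι E) (hab : ∀ x : GaussGrp F κ d,
    gaussScal (a * b) d x = x) (n : ℕ) (x : GaussGrp F κ d) :
    (gaussPerm a b d hab ^ n) x = gaussScal (a ^ n) d x := by
  rw [← iterate_gaussScal, ← Equiv.Perm.iterate_eq_pow]
  rfl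

/-- Scalars that are congruent modulo an annihilator of `d` act in the same way. -/
theorem gaussScal_congr {c : E} (hc : IsInt F (c • d)) {u v : OE F E} {w : E} (hw : w ∈ OE F E)
    (huv : (u : E) - v = c * w) (x : GaussGrp F κ d) : gaussScal u d x = gaussScal v d x := by
  obtain ⟨y, rfl⟩ := QuotientAddGroup.mk_surjective x
  rw [gaussScal_mk, gaussScal_mk, eq_comm, QuotientAddGroup.eq, neg_add_eq_sub, mem_rowKer, up_sub,
    up_smul, up_smul, ← sub_smul, huv, mul_comm, mul_smul, Matrix.smul_mul, Matrix.smul_mul,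
    ← Matrix.mul_smul]
  exact ((isInt_up y).mul hc).smul hw

theorem IsSelfDual.gaussFun_scal (hΘ : IsSelfDual σ Θ) (h : IsQuadConj σ)
    (hψ : IsUnramifiedChar ψ) (hd : d ∈ Her σ ι) (a : OE F E) (y : Matrix κ ι (OE F E)) :
    gaussFun σ ψ Θ d (gaussScal a d (QuotientAddGroup.mk y)) =
      (ψ (toBase F (((a : E) * σ a) * (Θ * (up y * d * cT σ (up y))).trace)) : ℂ) := by
  rw [gaussScal_mk, hΘ.gaussFun_mk h hψ hd, up_smul, trChar, trace_smul_conj_mul]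

/-- A scalar of norm `-1` changes the quadratic function into its complex conjugate. -/
theorem IsSelfDual.gaussFun_scal_neg (hΘ : IsSelfDual σ Θ) (h : IsQuadConj σ)
    (hψ : IsUnramifiedChar ψ) (hd : d ∈ Her σ ι) {a : OE F E} (ha : (a : E) * σ a = -1)
    (x : GaussGrp F κ d) : gaussFun σ ψ Θ d (gaussScal a d x) =
      (starRingEnd ℂ) (gaussFun σ ψ Θ d x) := by
  obtain ⟨y, rfl⟩ := QuotientAddGroup.mk_surjective x
  have hσtr : σ (Θ * (up y * d * cT σ (up y))).trace = (Θ * (up y * d * cT σ (up y))).trace :=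
    conj_trace_mul hΘ.semi.1 (h.conj_mem_Her hd _)
  rw [hΘ.gaussFun_scal h hψ hd, hΘ.gaussFun_mk h hψ hd, trChar, ← Circle.coe_inv_eq_conj,
    ← AddChar.map_neg_eq_inv, ha, neg_one_mul]
  congr 2
  apply h.algebraMap_injective
  rw [map_neg, h.algebraMap_toBase hσtr, h.algebraMap_toBase (by rw [map_neg, hσtr])]

/-- A scalar whose norm is sufficiently close to `1` preserves the quadratic function. -/
theorem IsSelfDual.gaussFun_scal_one (hΘ : IsSelfDual σ Θ) (h : IsQuadConj σ)
    (hψ : IsUnramifiedChar ψ) (hd : d ∈ Her σ ι) {c c' : F} (hc : IsInt F (algebraMap F E c • d))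
    (hc' : c' ∈ 𝒪[F]) {a : OE F E} (ha : (a : E) * σ a = 1 + algebraMap F E (c * c'))
    (x : GaussGrp F κ d) : gaussFun σ ψ Θ d (gaussScal a d x) = gaussFun σ ψ Θ d x := by
  obtain ⟨y, rfl⟩ := QuotientAddGroup.mk_surjective x
  have hint : IsInt F (algebraMap F E (c * c') • (up y * d * cT σ (up y))) := by
    have := (((isInt_up y).mul hc).mul ((isInt_up y).cT (σ := σ))).smul (algebraMap_mem_OE hc')
    rwa [Matrix.mul_smul, Matrix.smul_mul, smul_smul, mul_comm, ← map_mul] at this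
  have hher : algebraMap F E (c * c') • (up y * d * cT σ (up y)) ∈ Her σ κ := by
    rw [mem_Her]
    ext i j
    have := congrFun (congrFun (mem_Her.1 (h.conj_mem_Her hd (up y))) i) j
    rw [cT_apply] at this
    rw [cT_apply, Matrix.smul_apply, Matrix.smul_apply, smul_eq_mul, smul_eq_mul, map_mul, this,
      AlgEquiv.commutes]
  rw [hΘ.gaussFun_scal h hψ hd, hΘ.gaussFun_mk h hψ hd, ← mul_one (trChar F ψ Θ _),
    ← h.trChar_of_isInt hψ hΘ.semi hher hint,
    ← h.trChar_add ψ hΘ.semi.1 (h.conj_mem_Her hd _) hher, trChar, Matrix.mul_add,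
    Matrix.trace_add, Matrix.mul_smul, Matrix.trace_smul, smul_eq_mul, ha, add_mul, one_mul]

/-- In the inert case the Gauss sums of a unimodular Hermitian form alternate in sign: they are
real because `-1` is a norm of a unit, and they are congruent to `1` modulo `q + 1` because a unit
of norm close to `1` acts on the nonzero elements with orbits of length `q + 1`. -/
theorem IsSelfDual.gaussSum_of_isInert (hΘ : IsSelfDual σ Θ) (h : IsQuadConj σ)
    (hψ : IsUnramifiedChar ψ) (hin : IsInert F E) (hd : d ∈ Her σ ι) {l : ℕ}
    (hl : idx F d ^ Fintype.card κ = q F ^ l) :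
    ∃ k : ℕ, l = 2 * k ∧ gaussSum σ ψ Θ d = (-q F : ℂ) ^ k := by
  have := h.finite_gaussGrp (κ := κ) hd
  let _ : Fintype (GaussGrp F κ d) := Fintype.ofFinite _
  obtain ⟨ϖ, hϖ⟩ := exists_uniformizer F
  obtain ⟨M, hM⟩ := h.exists_pow_isInt hϖ d
  obtain ⟨α, hα, hαα⟩ := h.exists_norm_eq_neg_one (fun hram => hram.2 hin.2)
  obtain ⟨ζ, hζ, ⟨c, hc, hζc⟩, ⟨c', hc', hζc'⟩, hζfree⟩ := h.exists_norm_one_unit hin hϖ M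
  lift α to OE F E using hα
  lift ζ to OE F E using hζ
  have hN : (ζ : E) * σ ζ = 1 + algebraMap F E (ϖ ^ M * c) := by
    rw [← h.algebraMap_norm, ← hζc, ← map_one (algebraMap F E), ← map_add, add_sub_cancel]
  have hαb : ∀ x : GaussGrp F κ d,
      gaussScal (α * ⟨-σ α, neg_mem (conj_mem_OE σ α.2)⟩) d x = x := fun x => by
    have : α * ⟨-σ α, neg_mem (conj_mem_OE σ α.2)⟩ = 1 := Subtype.ext (by
      change (α : E) * -σ α = 1
      rw [mul_neg, hαα, neg_neg])
    rw [this, gaussScal_one]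
  have hζq : ∀ x : GaussGrp F κ d, gaussScal (ζ ^ (q F + 1)) d x = x := fun x => by
    rw [gaussScal_congr hM hc' (v := 1) hζc', gaussScal_one]
  have hζb : ∀ x : GaussGrp F κ d, gaussScal (ζ * ζ ^ q F) d x = x := fun x => by
    rw [← pow_succ', hζq]
  have hfree : ∀ x : GaussGrp F κ d, x ≠ 0 → ∀ i, 0 < i → i < q F + 1 →
      (gaussPerm ζ (ζ ^ q F) d hζb ^ i) x ≠ x := by
    intro x hx i hi hiq hix
    obtain ⟨y, rfl⟩ := QuotientAddGroup.mk_surjective x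
    rw [gaussPerm_pow] at hix
    obtain ⟨v, hv, hv1⟩ := hζfree i hi hiq
    apply hx
    have e : (⟨v, hv⟩ : OE F E) * (ζ ^ i - 1) = 1 := Subtype.ext (by
      rw [mul_comm]; exact hv1)
    have h0 : gaussScal (ζ ^ i - 1) d (QuotientAddGroup.mk y : GaussGrp F κ d) = 0 := by
      have e1 : (ζ ^ i - 1) • y = ζ ^ i • y - y := by
        ext k j
        simp [sub_mul]
      rw [gaussScal_mk, e1, QuotientAddGroup.mk_sub, ← gaussScal_mk, hix, sub_self]
    rw [← gaussScal_one d (QuotientAddGroup.mk y), ← e, ← gaussScal_gaussScal, h0, map_zero]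
  have hcard : Fintype.card (GaussGrp F κ d) = q F ^ l := by
    rw [← Nat.card_eq_fintype_card, h.card_gaussGrp hd, hl]
  obtain ⟨k, hk, hsum⟩ := (hΘ.isGaussFun h hψ hd).sum_eq_of_perm
    (hΘ.isIntegral_gaussFun h hψ hd) one_lt_q hcard (gaussPerm α _ d hαb)
    (hΘ.gaussFun_scal_neg h hψ hd hαα) (gaussPerm ζ _ d hζb)
    (fun x => by rw [gaussPerm_pow, hζq]) (hΘ.gaussFun_scal_one h hψ hd hM hc hN)
    (map_zero (gaussScal ζ d)) hfree
  exact ⟨k, hk, by rw [gaussSum, tsum_fintype, hsum]⟩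

end GaussValues

/-! ### The Siegel series of the modular matrices of size one and two -/

section Translate

/-- If the function obtained from `f` by replacing `f 0` by `b` is multiplied by a constant `c ≠ 1`
under a translation, then its sum vanishes and so the sum of `f` is `f 0 - b`. -/
theorem tsum_eq_of_translate {G : Type*} [AddCommGroup G] [DecidableEq G] {f : G → ℂ}
    (hf : Summable f) (g : G) {c b : ℂ} (hc : c ≠ 1)
    (hfc : ∀ z, Function.update f 0 b (z + g) = c * Function.update f 0 b z) :
    ∑' z, f z = f 0 - b := by
  have h1 := hf.hasSum.update 0 b
  set S := b - f 0 + ∑' z, f z with hS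
  have h2 : S = c * S := by
    rw [← h1.tsum_eq, ← tsum_mul_left, ← (Equiv.addRight g).tsum_eq]
    exact tsum_congr hfc
  have h3 : (1 - c) * S = 0 := by linear_combination h2
  rcases mul_eq_zero.1 h3 with h4 | h4
  · exact absurd (by linear_combination -h4) hc
  · linear_combination h4

end Translate

section SmallForms

variable {F : Type*} [Field F] [ValuativeRel F] [TopologicalSpace F] [IsNonarchimedeanLocalField F]
  [CharZero F] {E : Type*} [CommRing E] [Algebra F E] [IsReduced E] {σ : E ≃ₐ[F] E}
  {ψ : AddChar F Circle}

/-- A matrix of size one. -/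
def sc (x : E) : Matrix Unit Unit E := Matrix.of fun _ _ => x

@[simp] theorem sc_apply (x : E) (i j : Unit) : sc x i j = x := rfl

theorem sc_eta (M : Matrix Unit Unit E) : sc (M () ()) = M := by ext; rfl

theorem sc_add (x y : E) : sc (x + y) = sc x + sc y := by ext; rfl

theorem sc_zero : sc (0 : E) = 0 := by ext; rfl

theorem sc_one : sc (1 : E) = 1 := by ext; rfl

theorem sc_mul (x y : E) : sc (x * y) = sc x * sc y := by
  ext; simp [Matrix.mul_apply]

theorem cT_sc (x : E) : cT σ (sc x) = sc (σ x) := by ext; rfl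

theorem trace_sc (x : E) : (sc x).trace = x := by simp [Matrix.trace]

theorem isInt_sc {x : E} : IsInt F (sc x) ↔ x ∈ OE F E := ⟨fun hx => hx () (), fun hx _ _ => hx⟩

theorem exists_up_eq_sc {x : E} (hx : x ∈ OE F E) :
    ∃ y : Matrix Unit Unit (OE F E), up y = sc x := isInt_iff.1 (isInt_sc.2 hx)

theorem idx_of_isInt {ι : Type*} [Fintype ι] [DecidableEq ι] {z : Matrix ι ι E} (hz : IsInt F z) :
    idx F z = 1 := by
  rw [idx, AddSubgroup.index_eq_one, eq_top_iff]
  intro x _ i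
  exact sum_mem fun j _ => mul_mem (hz i j) (x j).2

theorem mu_of_isInt {ι : Type*} [Fintype ι] [DecidableEq ι] {z : Matrix ι ι E} (hz : IsInt F z) :
    mu F z = 1 := by
  rw [mu_eq, idx_of_isInt hz, Nat.cast_one, Real.sqrt_one]

theorem IsQuadConj.siegelTerm_zero {ι : Type*} [Fintype ι] [DecidableEq ι] (h : IsQuadConj σ)
    (hψ : IsUnramifiedChar ψ) {B : Matrix ι ι E} (hB : IsSemiIntegral σ B) (s : ℂ) :
    siegelTerm σ ψ B s 0 = 1 := by
  rw [← QuotientAddGroup.mk_zero, h.siegelTerm_mk hψ hB]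
  change trChar F ψ B (0 : Matrix ι ι E) * (mu F (0 : Matrix ι ι E) : ℂ) ^ (-s) = 1
  rw [h.trChar_of_isInt hψ hB (zero_mem _) isInt_zero, mu_of_isInt isInt_zero]
  simp

/-- For `w = p⁻¹` the integral `x` with `w x` integral form the ideal generated by `p`. -/
theorem idx_sc_of_mul_eq_one {w p : E} (hwp : w * p = 1) :
    idx F (sc w) = ((OEadd F E).map (AddMonoidHom.mulLeft p)).relIndex (OEadd F E) := by
  let e : (Unit → OE F E) ≃+ OEadd F E :=
    { toFun := fun x => ⟨x (), (x ()).2⟩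
      invFun := fun x _ => ⟨x.1, x.2⟩
      left_inv := fun x => rfl
      right_inv := fun x => rfl
      map_add' := fun _ _ => rfl }
  have he : (colKer F (sc w)).toAddSubgroup =
      (((OEadd F E).map (AddMonoidHom.mulLeft p)).addSubgroupOf (OEadd F E)).comap
        (e : (Unit → OE F E) →+ OEadd F E) := by
    ext x
    change (∀ i, _) ↔ ∃ y, _
    have h1 : ∀ i, (sc w).mulVec (fun j => (x j : E)) i = w * x () := fun i => by
      simp [Matrix.mulVec, dotProduct]
    simp only [h1]
    constructor
    · intro hx
      refine ⟨w * x (), hx (), ?_⟩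
      change p * (w * x ()) = x ()
      linear_combination (x () : E) * hwp
    · rintro ⟨y, hy, hyx⟩ i
      have hyx' : p * y = x () := hyx
      rw [← hyx', ← mul_assoc, hwp, one_mul]
      exact hy
  rw [idx, he, AddSubgroup.index_comap_of_surjective _ e.surjective, AddSubgroup.relIndex]

theorem mem_Her_sc {x : E} : sc x ∈ Her σ Unit ↔ σ x = x := by
  rw [mem_Her, cT_sc]
  exact ⟨fun hx => congrFun (congrFun hx ()) (), fun hx => by rw [hx]⟩

theorem IsQuadConj.exists_eq_sc (h : IsQuadConj σ) (z : Her σ Unit) :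
    ∃ a : F, (z : Matrix Unit Unit E) = sc (algebraMap F E a) := by
  have h1 := z.2
  rw [← sc_eta (z : Matrix Unit Unit E), mem_Her_sc] at h1
  obtain ⟨a, ha⟩ := h.exists_of_conj_eq h1
  exact ⟨a, by rw [ha, sc_eta]⟩

theorem isModular_one (hD : IsDualGen F (1 : E)) : IsModular F (1 : Matrix Unit Unit E) := by
  intro v
  rw [Matrix.one_mulVec]
  simp only [dotProduct, Finset.univ_unique, Finset.sum_singleton]
  constructor
  · intro hv k
    exact (hD (v k)).1 fun y hy => by
      have := hv (fun _ => y) fun _ => hy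
      rwa [one_mul, mul_comm]
  · intro hv w hw
    have := (hD (v ())).2 (hv ()) (w ()) (hw ())
    rwa [one_mul, mul_comm] at this

theorem IsQuadConj.isSelfDual_one (h : IsQuadConj σ) (hram : ¬ IsRamified F E) :
    IsSelfDual σ (1 : Matrix Unit Unit E) := by
  refine ⟨⟨?_, fun c => ?_⟩, isModular_one (isDualGen_one h hram)⟩
  · rw [mem_Her, cT_one]
  · obtain ⟨a, ha⟩ := h.exists_eq_sc (c : Her σ Unit)
    have hc : IsInt F ((c : Her σ Unit) : Matrix Unit Unit E) := c.2
    rw [ha, isInt_sc, h.algebraMap_mem_OE_iff] at hc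
    exact ⟨⟨a, hc⟩, by rw [ha, Matrix.one_mul, trace_sc]⟩

/-- Translating a non-integral element by a less singular one multiplies it by a unit. -/
theorem IsQuadConj.exists_unit_add (h : IsQuadConj σ) {ϖ a y : F} (hϖ : ord F ϖ = 1)
    (ha : ϖ * a ∉ 𝒪[F]) (hy : y ∈ 𝒪[F]) :
    ∃ α ∈ OE F E, ∃ v ∈ OE F E, α * v = 1 ∧ algebraMap F E (a + ϖ⁻¹ * y) =
      algebraMap F E a * α := by
  have hϖ0 := ord_eq_one_ne_zero hϖ
  have ha0 : a ≠ 0 := by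
    rintro rfl
    exact ha (by rw [mul_zero]; exact zero_mem _)
  have h1 : ord F (ϖ * a) < 0 := by
    by_contra hlt
    exact ha ((ord_nonneg_iff (mul_ne_zero hϖ0 ha0)).1 (not_lt.1 hlt))
  rw [ord_mul hϖ0 ha0, hϖ] at h1
  have ht : (ϖ ^ 2 * a)⁻¹ ∈ 𝒪[F] := by
    refine (ord_nonneg_iff (inv_ne_zero (mul_ne_zero (pow_ne_zero 2 hϖ0) ha0))).1 ?_
    rw [ord_inv, ord_mul (pow_ne_zero 2 hϖ0) ha0, ord_pow hϖ0, hϖ]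
    push_cast
    omega
  obtain ⟨v, hv, hv1⟩ := h.exists_inv_one_add hϖ (algebraMap_mem_OE (E := E) (mul_mem ht hy))
  refine ⟨_, add_mem (one_mem _) (mul_mem (algebraMap_mem_OE (uniformizer_mem hϖ))
    (algebraMap_mem_OE (mul_mem ht hy))), v, hv, hv1, ?_⟩
  rw [← map_mul, ← map_one (algebraMap F E), ← map_add, ← map_mul]
  congr 1
  field_simp

theorem idx_sc_mul {x α v : E} (hα : α ∈ OE F E) (hv : v ∈ OE F E) (hαv : α * v = 1) :
    idx F (sc (x * α)) = idx F (sc x) := by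
  obtain ⟨V, hV⟩ := exists_up_eq_sc hα
  obtain ⟨V', hV'⟩ := exists_up_eq_sc hv
  have := idx_mul_mul (F := F) (sc x) (isUnit_one (M := Matrix Unit Unit (OE F E)))
    (V := V) (V' := V') (up_injective (by rw [up_mul, hV, hV', ← sc_mul, hαv, sc_one, up_one]))
  rw [← this, up_one, Matrix.one_mul, hV, sc_mul]

theorem IsUnramifiedChar.exists_ne_one {ψ : AddChar F Circle} (hψ : IsUnramifiedChar ψ) {y : F}
    (hy : y ∉ 𝒪[F]) : ∃ x ∈ 𝒪[F], ψ (y * x) ≠ 1 := by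
  by_contra hcon
  push Not at hcon
  exact hy ((hψ y).1 hcon)

theorem inv_uniformizer_not_mem {ϖ : F} (hϖ : ord F ϖ = 1) : ϖ⁻¹ ∉ 𝒪[F] := by
  intro hm
  have := (ord_nonneg_iff (inv_ne_zero (ord_eq_one_ne_zero hϖ))).2 hm
  rw [ord_inv, hϖ] at this
  omega

/-- Away from `0`, the index is unchanged under translation by `ϖ⁻¹ y`. Giving the class `0` the
value `q ^ (-s)`, which is that of the other classes in `ϖ⁻¹ O_F`, makes this hold throughout, and
only the correction `1 - q ^ (-s)` at `0` is left. -/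
theorem IsQuadConj.siegelSeries_one (h : IsQuadConj σ) (hψ : IsUnramifiedChar ψ)
    (hram : ¬ IsRamified F E) {s : ℂ}
    (hs : Summable (siegelTerm σ ψ (1 : Matrix Unit Unit E) s)) :
    siegelSeries σ ψ (1 : Matrix Unit Unit E) s = 1 - (q F : ℂ) ^ (-s) := by
  classical
  obtain ⟨ϖ, hϖ⟩ := exists_uniformizer F
  have hϖ0 := ord_eq_one_ne_zero hϖ
  have hD := h.isSelfDual_one hram
  obtain ⟨y, hy, hψy⟩ := hψ.exists_ne_one (inv_uniformizer_not_mem hϖ)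
  have hmk : ∀ a : F, sc (algebraMap F E a) ∈ Her σ Unit := fun a =>
    mem_Her_sc.2 (σ.commutes a)
  have htr : ∀ a : F, trChar F ψ (1 : Matrix Unit Unit E) (sc (algebraMap F E a)) = ψ a := fun a => by
    rw [trChar, Matrix.one_mul, trace_sc, h.toBase_algebraMap]
  -- the modified summand, without the character
  let M : F → ℂ := fun a => if ϖ * a ∈ 𝒪[F] then (q F : ℂ) ^ (-s)
    else (mu F (sc (algebraMap F E a)) : ℂ) ^ (-s)
  have hM : ∀ a, M (a + ϖ⁻¹ * y) = M a := by
    intro a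
    have h1 : ϖ * (a + ϖ⁻¹ * y) = ϖ * a + y := by field_simp
    by_cases ha : ϖ * a ∈ 𝒪[F]
    · have h2 : ϖ * (a + ϖ⁻¹ * y) ∈ 𝒪[F] := h1 ▸ add_mem ha hy
      simp only [M, if_pos ha, if_pos h2]
    · have h2 : ϖ * (a + ϖ⁻¹ * y) ∉ 𝒪[F] := fun h2 => ha (by
        have := sub_mem (h1 ▸ h2) hy
        rwa [add_sub_cancel_right] at this)
      simp only [M, if_neg ha, if_neg h2]
      obtain ⟨α, hα, v, hv, hαv, e⟩ := h.exists_unit_add hϖ ha hy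
      rw [mu_eq, mu_eq, e, idx_sc_mul hα hv hαv]
  have hf : ∀ a : F, Function.update (siegelTerm σ ψ (1 : Matrix Unit Unit E) s) 0
      ((q F : ℂ) ^ (-s)) (QuotientAddGroup.mk ⟨_, hmk a⟩) = ψ a * M a := by
    intro a
    by_cases ha : a ∈ 𝒪[F]
    · have h0 : (QuotientAddGroup.mk ⟨_, hmk a⟩ : Her σ Unit ⧸ HerInt σ Unit) = 0 :=
        (QuotientAddGroup.eq_zero_iff _).2 (isInt_sc.2 (algebraMap_mem_OE ha))
      rw [h0, Function.update_self, hψ.eq_one ha]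
      simp only [M, if_pos (mul_mem (uniformizer_mem hϖ) ha)]
      simp
    · have h0 : (QuotientAddGroup.mk ⟨_, hmk a⟩ : Her σ Unit ⧸ HerInt σ Unit) ≠ 0 := fun h0 =>
        ha (h.algebraMap_mem_OE_iff.1 (isInt_sc.1 ((QuotientAddGroup.eq_zero_iff _).1 h0)))
      rw [Function.update_of_ne h0, h.siegelTerm_mk hψ hD.semi, htr]
      congr 1
      by_cases ha' : ϖ * a ∈ 𝒪[F]
      · simp only [M, if_pos ha']
        have ha0 : a ≠ 0 := fun h0 => ha (h0 ▸ zero_mem _)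
        have h1 := (ord_nonneg_iff (mul_ne_zero hϖ0 ha0)).2 ha'
        have h2 : ord F a < 0 := by
          by_contra hlt
          exact ha ((ord_nonneg_iff ha0).1 (not_lt.1 hlt))
        rw [ord_mul hϖ0 ha0, hϖ] at h1
        have h3 : ord F a⁻¹ = 1 := by rw [ord_inv]; omega
        rw [mu_eq, idx_sc_of_mul_eq_one (p := algebraMap F E a⁻¹)
          (by rw [← map_mul, mul_inv_cancel₀ ha0, map_one]), h.relIndex_uniformizer h3, Nat.cast_pow,
          Real.sqrt_sq (Nat.cast_nonneg _), Complex.ofReal_natCast]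
      · simp only [M, if_neg ha']
  rw [siegelSeries, tsum_eq_of_translate hs (QuotientAddGroup.mk ⟨_, hmk (ϖ⁻¹ * y)⟩)
    (c := ψ (ϖ⁻¹ * y)) (b := (q F : ℂ) ^ (-s)) (fun hc => hψy (Circle.coe_eq_one.1 hc))]
  · congr 1
    exact h.siegelTerm_zero hψ hD.semi s
  · intro z
    obtain ⟨⟨z, hz⟩, rfl⟩ := QuotientAddGroup.mk_surjective z
    obtain ⟨a, ha⟩ := h.exists_eq_sc ⟨z, hz⟩
    obtain rfl : z = sc (algebraMap F E a) := ha
    have e : (⟨sc (algebraMap F E a), hz⟩ : Her σ Unit) + ⟨_, hmk (ϖ⁻¹ * y)⟩ =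
        ⟨_, hmk (a + ϖ⁻¹ * y)⟩ := Subtype.ext (by
      change sc _ + sc _ = sc _
      rw [map_add, sc_add])
    rw [← QuotientAddGroup.mk_add, e, hf, hf, hM, AddChar.map_add_eq_mul, Circle.coe_mul]
    ring

end SmallForms

section Plane

variable {F : Type*} [Field F] [ValuativeRel F] [TopologicalSpace F] [IsNonarchimedeanLocalField F]
  [CharZero F] {E : Type*} [CommRing E] [Algebra F E] [IsReduced E] {σ : E ≃ₐ[F] E}
  {ψ : AddChar F Circle} {θ : E}

variable (σ) in
/-- The hyperbolic plane with rows `(0, θ)` and `(σ(θ), 0)`. -/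
def plane (θ : E) : Matrix (Unit ⊕ Unit) (Unit ⊕ Unit) E := blk σ 0 (sc θ) 0

theorem IsQuadConj.plane_mem_Her (h : IsQuadConj σ) (θ : E) : plane σ θ ∈ Her σ (Unit ⊕ Unit) :=
  h.blk_mem_Her _ (zero_mem _) (zero_mem _)

theorem IsQuadConj.toBase_trace_plane (h : IsQuadConj σ) (θ b : E) (a d : Matrix Unit Unit E) :
    (plane σ θ * blk σ a (sc b) d).trace = algebraMap F E (Algebra.trace F E (θ * σ b)) := by
  rw [h.algebraMap_trace, plane, blk, blk, Matrix.fromBlocks_multiply, cT_sc, cT_sc]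
  simp only [Matrix.zero_mul, zero_add, add_zero, ← sc_mul, map_mul, h.conj_conj]
  simp [Matrix.trace, Fintype.sum_sum_type]

theorem IsQuadConj.trChar_plane (h : IsQuadConj σ) (θ b : E) (a d : Matrix Unit Unit E) :
    trChar F ψ (plane σ θ) (blk σ a (sc b) d) = ψ (Algebra.trace F E (θ * σ b)) := by
  rw [trChar, h.toBase_trace_plane, h.toBase_algebraMap]

/-- The two isotropic lines of the plane are dual to each other under `Tr(θ x y)`. -/
theorem IsQuadConj.isSelfDual_plane (h : IsQuadConj σ) (hθ : IsDualGen F θ) :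
    IsSelfDual σ (plane σ θ) := by
  refine ⟨⟨h.plane_mem_Her θ, fun c => ?_⟩, fun v => ?_⟩
  · obtain ⟨⟨⟨d, b⟩, a⟩, e⟩ : ∃ p, h.blkEquiv Unit Unit p = c :=
      ⟨_, (h.blkEquiv Unit Unit).apply_symm_apply c⟩
    have e' : ((c : Her σ (Unit ⊕ Unit)) : Matrix (Unit ⊕ Unit) (Unit ⊕ Unit) E) =
      blk σ a (sc (b () ())) d := by rw [sc_eta]; exact (congrArg Subtype.val e).symm
    have hc := isInt_blk.1 (show IsInt F (blk σ (a : Matrix Unit Unit E) (sc (b () ())) d) from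
      e' ▸ c.2)
    have := (hθ 1).2 (one_mem _) _ (conj_mem_OE σ (isInt_sc.1 hc.2.1))
    rw [mul_one] at this
    exact ⟨⟨_, this⟩, by rw [e', h.toBase_trace_plane]⟩
  · have key : ∀ w : Unit ⊕ Unit → E, w ⬝ᵥ (plane σ θ).mulVec v =
        θ * v (Sum.inr ()) * w (Sum.inl ()) + σ (θ * σ (v (Sum.inl ())) * σ (w (Sum.inr ()))) := by
      intro w
      rw [map_mul, map_mul, h.conj_conj, h.conj_conj]
      simp only [dotProduct, Matrix.mulVec, Fintype.sum_sum_type, Finset.univ_unique,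
        Finset.sum_singleton, plane, blk, Matrix.fromBlocks_apply₁₁, Matrix.fromBlocks_apply₁₂,
        Matrix.fromBlocks_apply₂₁, Matrix.fromBlocks_apply₂₂, Matrix.zero_apply, cT_apply, sc_apply]
      simp only [PUnit.default_eq_unit]
      ring
    simp only [key, map_add, h.trace_conj]
    constructor
    · intro hv
      rintro (k | k)
      · rw [← h.conj_mem_OE_iff, ← hθ]
        intro y hy
        have := hv (Sum.elim 0 fun _ => σ y) (by
          rintro (k | k)
          · exact zero_mem _
          · exact conj_mem_OE σ hy)
        simpa [h.conj_conj] using this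
      · rw [← hθ]
        intro y hy
        have := hv (Sum.elim (fun _ => y) 0) (by
          rintro (k | k)
          · exact hy
          · exact zero_mem _)
        simpa using this
    · intro hv w hw
      exact add_mem ((hθ _).2 (hv _) _ (hw _))
        ((hθ _).2 (conj_mem_OE σ (hv _)) _ (conj_mem_OE σ (hw _)))

theorem IsQuadConj.norm_ne_zero (h : IsQuadConj σ) (hE : IsField E) {x : E} (hx : x ≠ 0) :
    Algebra.norm F x ≠ 0 := by
  obtain ⟨y, hy⟩ := hE.mul_inv_cancel hx
  have := h.nontrivial
  exact h.isUnit_iff.1 (IsUnit.of_mul_eq_one y hy)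

theorem IsQuadConj.mem_OE_iff_ord (h : IsQuadConj σ) (hE : IsField E) {x : E} (hx : x ≠ 0) :
    x ∈ OE F E ↔ 0 ≤ ord F (Algebra.norm F x) := by
  rw [ord_nonneg_iff (h.norm_ne_zero hE hx)]
  exact ⟨h.norm_mem, h.mem_OE_of_norm hE⟩

/-- Translating an element of `E` by a less singular one multiplies it by a unit. -/
theorem IsQuadConj.exists_unit_add_ramified (h : IsQuadConj σ) (hram : IsRamified F E) {ϖE : Eˣ}
    (hϖE : ord F (Algebra.norm F (ϖE : E)) = 1) {w y : E} (hw : (ϖE : E) * w ∉ OE F E)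
    (hy : y ∈ OE F E) : ∃ α ∈ OE F E, ∃ v ∈ OE F E, α * v = 1 ∧
      w + (ϖE⁻¹ : Eˣ) * y = w * α := by
  have hE := hram.1
  have := h.nontrivial
  have hw0 : w ≠ 0 := by
    rintro rfl
    exact hw (by rw [mul_zero]; exact zero_mem _)
  obtain ⟨wi, hwi⟩ := hE.mul_inv_cancel hw0
  have hwi0 : wi ≠ 0 := right_ne_zero_of_mul_eq_one hwi
  have hp0 : ((ϖE⁻¹ : Eˣ) : E) ≠ 0 := (ϖE⁻¹).ne_zero
  have := hE.isDomain
  rw [h.mem_OE_iff_ord hE (mul_ne_zero ϖE.ne_zero hw0), map_mul,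
    ord_mul (h.norm_ne_zero hE ϖE.ne_zero) (h.norm_ne_zero hE hw0), hϖE] at hw
  have hN : ord F (Algebra.norm F wi) = -ord F (Algebra.norm F w) := by
    have h1 := congrArg (fun x => ord F (Algebra.norm F x)) hwi
    simp only [map_mul, map_one, ord_one] at h1
    rw [ord_mul (h.norm_ne_zero hE hw0) (h.norm_ne_zero hE hwi0)] at h1
    omega
  have hNp : ord F (Algebra.norm F ((ϖE⁻¹ : Eˣ) : E)) = -1 := by
    have h1 := congrArg (fun x => ord F (Algebra.norm F x)) ϖE.mul_inv
    simp only [map_mul, map_one, ord_one] at h1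
    rw [ord_mul (h.norm_ne_zero hE ϖE.ne_zero) (h.norm_ne_zero hE hp0)] at h1
    omega
  set p : E := ((ϖE⁻¹ : Eˣ) : E) with hp
  have ht : p * p * wi ∈ OE F E := by
    rw [h.mem_OE_iff_ord hE (mul_ne_zero (mul_ne_zero hp0 hp0) hwi0), map_mul, map_mul,
      ord_mul (mul_ne_zero (h.norm_ne_zero hE hp0) (h.norm_ne_zero hE hp0))
      (h.norm_ne_zero hE hwi0), ord_mul (h.norm_ne_zero hE hp0) (h.norm_ne_zero hE hp0), hN, hNp]
    omega
  obtain ⟨hm, hrad⟩ := h.prime_mem_radical (ϖ := Algebra.norm F (ϖE : E)) (ϖE := ϖE) (π := ϖE)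
    ⟨hϖE, fun _ => rfl, fun hn => absurd hram hn⟩ (Or.inl rfl)
  obtain ⟨v, hv, hv1⟩ := hrad _ (mul_mem ht hy)
  refine ⟨_, add_mem (one_mem _) (mul_mem hm (mul_mem ht hy)), v, hv, hv1, ?_⟩
  linear_combination -(ϖE : E) * p * p * y * hwi - p * y * ϖE.mul_inv

/-- Rescaling one basis vector by a unit does not change `μ`. -/
theorem mu_blk_unit (a b : E) {α v : E} (hα : α ∈ OE F E) (hv : v ∈ OE F E) (hαv : α * v = 1) :
    mu F (blk σ (sc a) (sc (b * α)) 0) = mu F (blk σ (sc a) (sc b) 0) := by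
  have key : ∀ α v : E, α ∈ OE F E → v ∈ OE F E → α * v = 1 →
      ∃ V V' : Matrix (Unit ⊕ Unit) (Unit ⊕ Unit) (OE F E), V * V' = 1 ∧
        up V = Matrix.fromBlocks 1 0 0 (sc α) := by
    intro α v hα hv hαv
    obtain ⟨V, hV⟩ := exists_up_eq_sc hα
    obtain ⟨V', hV'⟩ := exists_up_eq_sc hv
    have hVV : V * V' = 1 := up_injective (by rw [up_mul, hV, hV', ← sc_mul, hαv, sc_one, up_one])
    refine ⟨Matrix.fromBlocks 1 0 0 V, Matrix.fromBlocks 1 0 0 V', ?_, ?_⟩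
    · rw [Matrix.fromBlocks_multiply]
      simp [hVV]
    · rw [up_fromBlocks, up_one, up_zero, hV]
  obtain ⟨V, V', hVV, hV⟩ := key α v hα hv hαv
  obtain ⟨U, U', hUU, hU⟩ := key (σ α) (σ v) (conj_mem_OE σ hα) (conj_mem_OE σ hv)
    (by rw [← map_mul, hαv, map_one])
  rw [mu_eq, mu_eq, ← idx_mul_mul (blk σ (sc a) (sc b) 0) (IsUnit.of_mul_eq_one _ hUU) hVV, hU, hV,
    blk, blk, Matrix.fromBlocks_multiply, Matrix.fromBlocks_multiply]
  simp only [Matrix.one_mul, Matrix.mul_one, Matrix.zero_mul, Matrix.mul_zero, zero_add,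
    add_zero, cT_sc, ← sc_mul, map_mul, mul_comm (σ b)]

/-- If the diagonal entry `a` is not integral and `b` has at most a simple pole, then row and column
operations with the integral entry `t = -b / a` clear `b` and leave an integral lower right entry.
-/
theorem IsQuadConj.mu_blk_dominant (h : IsQuadConj σ) (hE : IsField E) {ϖE : Eˣ}
    (hϖE : ord F (Algebra.norm F (ϖE : E)) = 1) {a : F} (ha : a ∉ 𝒪[F]) {b : E}
    (hb : (ϖE : E) * b ∈ OE F E) :
    mu F (blk σ (sc (algebraMap F E a)) (sc b) 0) = mu F (sc (algebraMap F E a)) := by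
  have := h.nontrivial
  have ha0 : a ≠ 0 := by
    rintro rfl
    exact ha (zero_mem _)
  have hord : ord F a < 0 := by
    by_contra hlt
    exact ha ((ord_nonneg_iff ha0).1 (not_lt.1 hlt))
  set t : E := -(algebraMap F E a⁻¹ * b) with ht
  have hat : algebraMap F E a * t = -b := by
    rw [ht, mul_neg, ← mul_assoc, ← map_mul, mul_inv_cancel₀ ha0, map_one, one_mul]
  have hai0 : algebraMap F E a⁻¹ ≠ 0 := by
    rw [Ne, map_eq_zero_iff _ h.algebraMap_injective]
    exact inv_ne_zero ha0
  have hNb : b ≠ 0 → -1 ≤ ord F (Algebra.norm F b) := by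
    intro hb0
    have := hE.isDomain
    rw [h.mem_OE_iff_ord hE (mul_ne_zero ϖE.ne_zero hb0), map_mul,
      ord_mul (h.norm_ne_zero hE ϖE.ne_zero) (h.norm_ne_zero hE hb0), hϖE] at hb
    omega
  have hNa : ord F (Algebra.norm F (algebraMap F E a⁻¹)) = -(2 * ord F a) := by
    rw [h.norm_algebraMap, ord_pow (inv_ne_zero ha0), ord_inv]
    push_cast
    ring
  have htm : t ∈ OE F E := by
    rw [ht]
    by_cases hb0 : b = 0
    · rw [hb0, mul_zero, neg_zero]; exact zero_mem _
    have := hE.isDomain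
    refine neg_mem ?_
    rw [h.mem_OE_iff_ord hE (mul_ne_zero hai0 hb0), map_mul, ord_mul (h.norm_ne_zero hE hai0)
      (h.norm_ne_zero hE hb0), hNa]
    have := hNb hb0
    omega
  have htb : σ t * b ∈ OE F E := by
    rw [ht, map_neg, map_mul, AlgEquiv.commutes]
    by_cases hb0 : b = 0
    · rw [hb0, mul_zero]; exact zero_mem _
    have := hE.isDomain
    have hσb : σ b ≠ 0 := by rwa [Ne, map_eq_zero_iff _ σ.injective]
    rw [neg_mul]
    refine neg_mem ?_
    rw [h.mem_OE_iff_ord hE (mul_ne_zero (mul_ne_zero hai0 hσb) hb0), map_mul, map_mul, h.norm_conj,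
      ord_mul (mul_ne_zero (h.norm_ne_zero hE hai0) (h.norm_ne_zero hE hb0))
      (h.norm_ne_zero hE hb0), ord_mul (h.norm_ne_zero hE hai0)
      (h.norm_ne_zero hE hb0), hNa]
    have := hNb hb0
    omega
  obtain ⟨T, hT⟩ := exists_up_eq_sc htm
  obtain ⟨T', hT'⟩ := exists_up_eq_sc (conj_mem_OE σ htm)
  have hU : (Matrix.fromBlocks 1 0 T' 1 : Matrix (Unit ⊕ Unit) (Unit ⊕ Unit) (OE F E)) *
      Matrix.fromBlocks 1 0 (-T') 1 = 1 := by simp [Matrix.fromBlocks_multiply]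
  have hV : (Matrix.fromBlocks 1 T 0 1 : Matrix (Unit ⊕ Unit) (Unit ⊕ Unit) (OE F E)) *
      Matrix.fromBlocks 1 (-T) 0 1 = 1 := by simp [Matrix.fromBlocks_multiply]
  have hσat : algebraMap F E a * σ t = -σ b := by
    have := congrArg σ hat
    rwa [map_mul, AlgEquiv.commutes, map_neg σ b] at this
  have e1 : σ t * algebraMap F E a + σ b = 0 := by linear_combination hσat
  have e2 : algebraMap F E a * t + b = 0 := by linear_combination hat
  have e3 := idx_mul_mul (F := F) (blk σ (sc (algebraMap F E a)) (sc b) 0)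
    (IsUnit.of_mul_eq_one _ hU) hV
  rw [up_fromBlocks, up_fromBlocks, up_one, up_zero, hT, hT', blk, Matrix.fromBlocks_multiply,
    Matrix.fromBlocks_multiply, cT_sc] at e3
  simp only [Matrix.one_mul, Matrix.mul_one, Matrix.mul_zero, zero_add,
    add_zero, ← sc_mul, ← sc_add, e1, e2, sc_zero, zero_mul] at e3
  rw [mu_eq, mu_eq, blk, cT_sc, ← e3, idx_fromBlocks, idx_of_isInt (isInt_sc.2 htb), mul_one]

/-- If `a` is integral and `b` has a simple pole, exchanging the columns gives the diagonal matrix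
with entries `b` and `σ(b)`, each of index `q`. -/
theorem IsQuadConj.mu_blk_antidiag (h : IsQuadConj σ) (hram : IsRamified F E) {ϖE : Eˣ}
    (hϖE : ord F (Algebra.norm F (ϖE : E)) = 1) {a : E} (ha : a ∈ OE F E) {b : E}
    (hb : b ∉ OE F E) (hb' : (ϖE : E) * b ∈ OE F E) :
    mu F (blk σ (sc a) (sc b) 0) = q F := by
  have hE := hram.1
  have := h.nontrivial
  have hdom := hE.isDomain
  have hb0 : b ≠ 0 := by
    rintro rfl
    exact hb (zero_mem _)
  rw [h.mem_OE_iff_ord hE hb0] at hb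
  rw [h.mem_OE_iff_ord hE (mul_ne_zero ϖE.ne_zero hb0), map_mul,
    ord_mul (h.norm_ne_zero hE ϖE.ne_zero) (h.norm_ne_zero hE hb0), hϖE] at hb'
  have hidx : ∀ b : E, b ≠ 0 → ord F (Algebra.norm F b) = -1 → idx F (sc b) = q F := by
    intro b hb0 hNb
    obtain ⟨p, hp⟩ := hE.mul_inv_cancel hb0
    have hp0 : p ≠ 0 := right_ne_zero_of_mul_eq_one hp
    have hNp : ord F (Algebra.norm F p) = 1 := by
      have h1 := congrArg (fun x => ord F (Algebra.norm F x)) hp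
      simp only [map_mul, map_one, ord_one] at h1
      rw [ord_mul (h.norm_ne_zero hE hb0) (h.norm_ne_zero hE hp0)] at h1
      omega
    rw [idx_sc_of_mul_eq_one hp]
    exact h.relIndex_ramified hram (ϖE := ⟨p, b, by rw [mul_comm]; exact hp, hp⟩) hNp
  have hsw : (Matrix.fromBlocks 0 1 1 0 : Matrix (Unit ⊕ Unit) (Unit ⊕ Unit) (OE F E)) *
      Matrix.fromBlocks 0 1 1 0 = 1 := by simp [Matrix.fromBlocks_multiply]
  have hadd : blk σ (sc a) (sc b) 0 = blk σ 0 (sc b) 0 + blk σ (sc a) 0 0 := by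
    rw [← blk_add, zero_add, add_zero, add_zero]
  have e3 := idx_mul_mul (F := F) (blk σ 0 (sc b) 0) isUnit_one hsw
  rw [hadd, mu_add_int _ _ (isInt_blk.2 ⟨isInt_sc.2 ha, isInt_zero, isInt_zero⟩), mu_eq, ← e3,
    up_one, up_fromBlocks, up_one, up_zero, Matrix.one_mul, blk, Matrix.fromBlocks_multiply, cT_sc]
  simp only [Matrix.mul_one, Matrix.mul_zero, zero_add, add_zero]
  have hσb : σ b ≠ 0 := by rwa [Ne, map_eq_zero_iff _ σ.injective]
  rw [idx_fromBlocks, hidx b hb0 (by omega), hidx (σ b) hσb (by rw [h.norm_conj]; omega), Nat.cast_mul,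
    Real.sqrt_mul_self (Nat.cast_nonneg _)]

end Plane

section PlaneSeries

variable {F : Type*} [Field F] [ValuativeRel F] [TopologicalSpace F] [IsNonarchimedeanLocalField F]
  [CharZero F] {E : Type*} [CommRing E] [Algebra F E] [IsReduced E] {σ : E ≃ₐ[F] E}
  {ψ : AddChar F Circle} {θ : E}

theorem IsQuadConj.siegelTerm_plane (h : IsQuadConj σ) (hψ : IsUnramifiedChar ψ)
    (hθ : IsDualGen F θ) (s : ℂ) (a d : Her σ Unit) (b : E) :
    siegelTerm σ ψ (plane σ θ) s (h.blkQuot Unit Unit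
        ((QuotientAddGroup.mk d, QuotientAddGroup.mk (sc b)), QuotientAddGroup.mk a)) =
      ψ (Algebra.trace F E (θ * σ b)) *
        (mu F (blk σ (a : Matrix Unit Unit E) (sc b) d) : ℂ) ^ (-s) := by
  rw [h.blkQuot_mk, h.siegelTerm_mk hψ (h.isSelfDual_plane hθ).semi, h.trChar_plane]

/-- Only integral `x` pair trivially with `O_E` under `ψ(tr_{E/F}(θ x y))`. -/
theorem IsDualGen.exists_ne_one (hθ : IsDualGen F θ) (hψ : IsUnramifiedChar ψ) {x : E}
    (hx : x ∉ OE F E) : ∃ y ∈ OE F E, ψ (Algebra.trace F E (θ * x * y)) ≠ 1 := by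
  by_contra hcon
  push Not at hcon
  refine hx ((hθ x).1 fun y hy => ?_)
  rw [← hψ]
  intro c hc
  rw [← hcon _ (mul_mem (algebraMap_mem_OE hc) hy), mul_comm, ← smul_eq_mul, ← map_smul,
    Algebra.smul_def]
  congr 2
  ring

/-- The sum over the lower right block vanishes unless that block is integral. -/
theorem IsQuadConj.sum_plane_eq_zero (h : IsQuadConj σ) (hψ : IsUnramifiedChar ψ)
    (hθ : IsDualGen F θ) (s : ℂ) (d : Her σ Unit) (hd : d ∉ HerInt σ Unit) :
    ∑' β, ∑' p, siegelTerm σ ψ (plane σ θ) s (h.blkQuot Unit Unit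
      ((QuotientAddGroup.mk d, β), p)) = 0 := by
  obtain ⟨d₀, hd₀⟩ := h.exists_eq_sc d
  have hd1 : algebraMap F E d₀ ∉ OE F E := fun hm => hd (by
    rw [mem_HerInt, hd₀, isInt_sc]; exact hm)
  obtain ⟨y, hy, hψy⟩ := hθ.exists_ne_one hψ hd1
  obtain ⟨Y, hY⟩ := exists_up_eq_sc (conj_mem_OE σ hy)
  set I : (Matrix Unit Unit E ⧸ MatInt F E Unit Unit) → ℂ := fun β =>
    ∑' p, siegelTerm σ ψ (plane σ θ) s (h.blkQuot Unit Unit ((QuotientAddGroup.mk d, β), p)) with hI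
  have htr : ∀ β, I (β + QuotientAddGroup.mk (sc (σ y * algebraMap F E d₀))) =
      ψ (Algebra.trace F E (θ * algebraMap F E d₀ * y)) * I β := by
    intro β
    obtain ⟨b, rfl⟩ := QuotientAddGroup.mk_surjective β
    obtain ⟨b, rfl⟩ : ∃ x, sc x = b := ⟨_, sc_eta b⟩
    have hw : up Y * cT σ (sc b) + sc b * cT σ (up Y) + up Y * d * cT σ (up Y) ∈ Her σ Unit :=
      add_mem (h.cross_mem_Her _ _) (h.conj_mem_Her d.2 _)
    rw [hI]
    dsimp only
    rw [← tsum_mul_left,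
      ← (Equiv.addRight (QuotientAddGroup.mk ⟨_, hw⟩ : Her σ Unit ⧸ HerInt σ Unit)).tsum_eq]
    refine tsum_congr fun p => ?_
    obtain ⟨a, rfl⟩ := QuotientAddGroup.mk_surjective p
    rw [← QuotientAddGroup.mk_add, ← sc_add]
    change siegelTerm σ ψ (plane σ θ) s (h.blkQuot Unit Unit ((QuotientAddGroup.mk d, _),
      QuotientAddGroup.mk (a + ⟨_, hw⟩))) = _
    have e : sc (b + σ y * algebraMap F E d₀) = sc b + up Y * (d : Matrix Unit Unit E) := by
      rw [hY, hd₀, ← sc_mul, sc_add]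
    rw [h.siegelTerm_plane hψ hθ, h.siegelTerm_plane hψ hθ, AddSubgroup.coe_add, e,
      mu_blk_translate _ _ d.2, map_add, mul_add, map_add, AddChar.map_add_eq_mul, Circle.coe_mul,
      map_mul σ, h.conj_conj, AlgEquiv.commutes]
    have e2 : θ * (y * algebraMap F E d₀) = θ * algebraMap F E d₀ * y := by ring
    rw [e2]
    ring
  have h1 : ∑' β, I β = ψ (Algebra.trace F E (θ * algebraMap F E d₀ * y)) * ∑' β, I β := by
    rw [← tsum_mul_left, ← (Equiv.addRight _).tsum_eq]
    exact tsum_congr htr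
  by_contra hne
  exact hψy (Circle.coe_eq_one.1 (mul_right_cancel₀ hne (by rw [one_mul]; exact h1.symm)))

/-- The Siegel series of the modular hyperbolic plane in the ramified case. Only integral lower
right blocks contribute; over these, the class `0` is given the value `q ^ (-s)` and the
off-diagonal entry is translated by `ϖ_E⁻¹ σ(y)`, as for size one. -/
theorem IsQuadConj.siegelSeries_plane (h : IsQuadConj σ) (hψ : IsUnramifiedChar ψ)
    (hram : IsRamified F E) {ϖE : Eˣ} (hϖE : ord F (Algebra.norm F (ϖE : E)) = 1)
    (hθ : IsDualGen F θ) {s : ℂ} (hs : Summable (siegelTerm σ ψ (plane σ θ) s)) :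
    siegelSeries σ ψ (plane σ θ) s = 1 - (q F : ℂ) ^ (-s) := by
  classical
  have hE := hram.1
  have hdom := hE.isDomain
  set e := (Equiv.prodAssoc (Her σ Unit ⧸ HerInt σ Unit) (Matrix Unit Unit E ⧸ MatInt F E Unit Unit)
    (Her σ Unit ⧸ HerInt σ Unit)).symm.trans (h.blkQuot Unit Unit) with he
  have hs1 : Summable (siegelTerm σ ψ (plane σ θ) s ∘ e) := (Equiv.summable_iff e).2 hs
  have hs2 : Summable fun x => siegelTerm σ ψ (plane σ θ) s (e (0, x)) := hs1.prod_factor 0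
  have hpi : ((ϖE⁻¹ : Eˣ) : E) ∉ OE F E := by
    rw [h.mem_OE_iff_ord hE (ϖE⁻¹).ne_zero]
    have h1 := congrArg (fun x => ord F (Algebra.norm F x)) ϖE.mul_inv
    simp only [map_mul, map_one, ord_one] at h1
    rw [ord_mul (h.norm_ne_zero hE ϖE.ne_zero) (h.norm_ne_zero hE (ϖE⁻¹).ne_zero), hϖE] at h1
    omega
  obtain ⟨y, hy, hψy⟩ := hθ.exists_ne_one hψ (mt h.conj_mem_OE_iff.1 hpi)
  have hϖm : (ϖE : E) ∈ OE F E := h.mem_OE_of_norm hE (uniformizer_mem hϖE)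
  set g : E := (ϖE⁻¹ : Eˣ) * σ y with hg
  have hψg : ψ (Algebra.trace F E (θ * σ g)) ≠ 1 := by
    rwa [hg, map_mul σ, h.conj_conj, ← mul_assoc]
  have hmk : ∀ a : F, sc (algebraMap F E a) ∈ Her σ Unit := fun a => mem_Her_sc.2 (σ.commutes a)
  -- the modified summand, without the character
  let M : F → E → ℂ := fun a b => if a ∈ 𝒪[F] ∧ (ϖE : E) * b ∈ OE F E then (q F : ℂ) ^ (-s)
    else (mu F (blk σ (sc (algebraMap F E a)) (sc b) 0) : ℂ) ^ (-s)
  have hM : ∀ a b, M a (b + g) = M a b := by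
    intro a b
    have h1 : (ϖE : E) * (b + g) = ϖE * b + σ y := by
      rw [hg, mul_add, ← mul_assoc, Units.mul_inv, one_mul]
    have h2 : (ϖE : E) * (b + g) ∈ OE F E ↔ (ϖE : E) * b ∈ OE F E := by
      rw [h1]
      exact add_mem_cancel_right (conj_mem_OE σ hy)
    simp only [M, h2]
    split_ifs with h3
    · rfl
    · congr 2
      by_cases h4 : (ϖE : E) * b ∈ OE F E
      · have ha : a ∉ 𝒪[F] := fun ha => h3 ⟨ha, h4⟩
        rw [h.mu_blk_dominant hE hϖE ha h4, h.mu_blk_dominant hE hϖE ha (h2.2 h4)]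
      · obtain ⟨α, hα, v, hv, hαv, e⟩ := h.exists_unit_add_ramified hram hϖE h4 (conj_mem_OE σ hy)
        rw [hg, e, mu_blk_unit _ _ hα hv hαv]
  have hf : ∀ (a : F) (b : E), Function.update (fun x => siegelTerm σ ψ (plane σ θ) s (e (0, x))) 0
      ((q F : ℂ) ^ (-s)) (QuotientAddGroup.mk (sc b), QuotientAddGroup.mk ⟨_, hmk a⟩) =
        ψ (Algebra.trace F E (θ * σ b)) * M a b := by
    intro a b
    have h0 : ((QuotientAddGroup.mk (sc b), QuotientAddGroup.mk ⟨_, hmk a⟩) :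
        (Matrix Unit Unit E ⧸ MatInt F E Unit Unit) × (Her σ Unit ⧸ HerInt σ Unit)) = 0 ↔
        b ∈ OE F E ∧ a ∈ 𝒪[F] := by
      rw [Prod.mk_eq_zero, QuotientAddGroup.eq_zero_iff, QuotientAddGroup.eq_zero_iff, mem_MatInt,
        mem_HerInt, isInt_sc, isInt_sc, h.algebraMap_mem_OE_iff]
    by_cases hab : b ∈ OE F E ∧ a ∈ 𝒪[F]
    · have htr : Algebra.trace F E (θ * σ b) ∈ 𝒪[F] := by
        have := (hθ 1).2 (one_mem _) _ (conj_mem_OE σ hab.1)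
        rwa [mul_one] at this
      rw [h0.2 hab, Function.update_self, hψ.eq_one htr]
      simp only [M, if_pos (show a ∈ 𝒪[F] ∧ (ϖE : E) * b ∈ OE F E from
        ⟨hab.2, mul_mem hϖm hab.1⟩)]
      simp
    · rw [Function.update_of_ne (mt h0.1 hab)]
      change siegelTerm σ ψ (plane σ θ) s (h.blkQuot Unit Unit
        ((QuotientAddGroup.mk 0, QuotientAddGroup.mk (sc b)), QuotientAddGroup.mk ⟨_, hmk a⟩)) = _
      rw [h.siegelTerm_plane hψ hθ]
      congr 1
      change (mu F (blk σ (sc (algebraMap F E a)) (sc b) 0) : ℂ) ^ (-s) = _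
      by_cases h3 : a ∈ 𝒪[F] ∧ (ϖE : E) * b ∈ OE F E
      · simp only [M, if_pos h3]
        rw [h.mu_blk_antidiag hram hϖE (algebraMap_mem_OE h3.1) (fun hb => hab ⟨hb, h3.1⟩) h3.2,
          Complex.ofReal_natCast]
      · simp only [M, if_neg h3]
  calc siegelSeries σ ψ (plane σ θ) s
      = ∑' p, (siegelTerm σ ψ (plane σ θ) s ∘ e) p := (e.tsum_eq _).symm
    _ = ∑' δ, ∑' x, siegelTerm σ ψ (plane σ θ) s (e (δ, x)) := hs1.tsum_prod
    _ = ∑' x, siegelTerm σ ψ (plane σ θ) s (e (0, x)) := by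
        refine tsum_eq_single 0 fun δ hδ => ?_
        obtain ⟨d, rfl⟩ := QuotientAddGroup.mk_surjective δ
        refine (hs1.prod_factor (QuotientAddGroup.mk d)).tsum_prod.trans ?_
        exact h.sum_plane_eq_zero hψ hθ s d fun hd => hδ ((QuotientAddGroup.eq_zero_iff _).2 hd)
    _ = 1 - (q F : ℂ) ^ (-s) := by
        rw [tsum_eq_of_translate hs2 (QuotientAddGroup.mk (sc g), QuotientAddGroup.mk 0)
          (c := ψ (Algebra.trace F E (θ * σ g))) (b := (q F : ℂ) ^ (-s))
          (fun hc => hψg (Circle.coe_eq_one.1 hc))]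
        · congr 1
          have he0 : e (0, 0) = 0 := (QuotientAddGroup.eq_zero_iff _).2
            (isInt_blk.2 ⟨isInt_zero, isInt_zero, isInt_zero⟩)
          refine Eq.trans ?_ (h.siegelTerm_zero hψ (h.isSelfDual_plane hθ).semi s)
          rw [← he0]
        · rintro ⟨β, p⟩
          obtain ⟨b, rfl⟩ := QuotientAddGroup.mk_surjective β
          obtain ⟨b, rfl⟩ : ∃ x, sc x = b := ⟨_, sc_eta b⟩
          obtain ⟨⟨z, hz⟩, rfl⟩ := QuotientAddGroup.mk_surjective p
          obtain ⟨a, ha⟩ := h.exists_eq_sc ⟨z, hz⟩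
          obtain rfl : z = sc (algebraMap F E a) := ha
          rw [Prod.mk_add_mk, ← QuotientAddGroup.mk_add, ← QuotientAddGroup.mk_add, add_zero,
            ← sc_add, hf, hf, hM, map_add, mul_add, map_add, AddChar.map_add_eq_mul, Circle.coe_mul]
          ring

end PlaneSeries

/-! ### The polynomial part of the Siegel series of an orthogonal sum -/

section Polynomials

variable {F : Type*} [Field F] [ValuativeRel F] [TopologicalSpace F] [IsNonarchimedeanLocalField F]
  [CharZero F] {E : Type*} [CommRing E] [Algebra F E] [IsReduced E] {σ : E ≃ₐ[F] E}
variable {ι κ : Type*} [Fintype ι] [Fintype κ] [DecidableEq ι] [DecidableEq κ]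
  {ψ : AddChar F Circle} {Θ : Matrix κ κ E} {B : Matrix ι ι E}

/-- If the Gauss sums of `Θ` amount to a shift of `s` by `δ`, then the polynomials of `B` and of
`Θ ⊥ B` differ by a scaling of the variable. -/
theorem IsSelfDual.isSiegelPolynomial_perp (hΘ : IsSelfDual σ Θ) (h : IsQuadConj σ)
    (hψ : IsUnramifiedChar ψ) (hB : IsSemiIntegral σ B) {δ c : ℂ}
    (hδ : ∀ s, (q F : ℂ) ^ (-(s - δ)) = c * (q F : ℂ) ^ (-s))
    (hgauss : ∀ s, ∀ d ∈ Her σ ι,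
      gaussSum σ ψ Θ d * (mu F d : ℂ) ^ (-s) = (mu F d : ℂ) ^ (-(s - δ)))
    (hser : ∀ s, Summable (siegelTerm σ ψ Θ s) → siegelSeries σ ψ Θ s = 1 - (q F : ℂ) ^ (-s))
    (heul : ∀ s, eulerFactor F E (Fintype.card (κ ⊕ ι)) s =
      (1 - (q F : ℂ) ^ (-s)) * eulerFactor F E (Fintype.card ι) (s - δ)) (P : ℂ[X]) :
    IsSiegelPolynomial σ ψ B P ↔ IsSiegelPolynomial σ ψ (perp Θ B) (P.comp (C c * X)) := by
  obtain ⟨s₁, hs₁, h1⟩ := h.exists_summable κ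
  obtain ⟨s₂, hs₂, h2⟩ := h.exists_summable (κ ⊕ ι)
  obtain ⟨s₃, hs₃, h3⟩ := h.exists_summable ι
  have key : ∀ s : ℂ, s₁ < s.re → s₂ < s.re → siegelSeries σ ψ (perp Θ B) s =
      (1 - (q F : ℂ) ^ (-s)) * siegelSeries σ ψ B (s - δ) := by
    intro s hs hs'
    rw [hΘ.siegelSeries_perp h hψ hB (h2 ψ _ s hs') (hgauss s), hser s (h1 ψ _ s hs)]
  have hev : ∀ s, (P.comp (C c * X)).eval ((q F : ℂ) ^ (-s)) = P.eval ((q F : ℂ) ^ (-(s - δ))) := by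
    intro s
    rw [eval_comp, eval_mul, eval_C, eval_X, hδ]
  constructor
  · rintro ⟨s₀, h0⟩
    refine ⟨max (max s₁ s₂) (s₀ + δ.re), fun s hs => ?_⟩
    rw [max_lt_iff, max_lt_iff] at hs
    refine ⟨h2 ψ _ s hs.1.2, ?_⟩
    rw [key s hs.1.1 hs.1.2, (h0 (s - δ) (by rw [Complex.sub_re]; linarith)).2, hev, heul]
    ring
  · rintro ⟨s₀, h0⟩
    refine ⟨max (max (max s₁ s₂) s₀ - δ.re) s₃, fun s' hs' => ?_⟩
    rw [max_lt_iff] at hs'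
    have hs : max (max s₁ s₂) s₀ < (s' + δ).re := by rw [Complex.add_re]; linarith
    rw [max_lt_iff, max_lt_iff] at hs
    refine ⟨h3 ψ _ s' hs'.2, ?_⟩
    have h4 := (h0 _ hs.2).2
    rw [key _ hs.1.1 hs.1.2, hev, heul, add_sub_cancel_right] at h4
    have hne : 1 - (q F : ℂ) ^ (-(s' + δ)) ≠ 0 := by
      intro h5
      have h6 : ‖(q F : ℂ) ^ (-(s' + δ))‖ < 1 := by
        rw [norm_q_cpow]
        refine Real.rpow_lt_one_of_one_lt_of_neg (by exact_mod_cast one_lt_q (F := F)) ?_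
        rw [Complex.neg_re]
        linarith [hs.1.1]
      rw [← sub_eq_zero.1 h5, norm_one] at h6
      exact lt_irrefl _ h6
    exact mul_left_cancel₀ hne (by rw [h4]; ring)

theorem q_ne_zero : (q F : ℂ) ≠ 0 := by
  have := one_lt_q (F := F)
  exact_mod_cast (by omega : q F ≠ 0)

theorem Icc_prod_eq (k : ℕ) (f : ℕ → ℂ) :
    ∏ i ∈ Finset.Icc 1 k, f i = ∏ i ∈ Finset.range k, f (i + 1) := by
  rw [Finset.range_eq_Ico, Finset.prod_Ico_add' f 0 k 1]
  refine Finset.prod_congr ?_ fun _ _ => rfl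
  ext i
  simp only [Finset.mem_Icc, Finset.mem_Ico]
  omega

/-- Since `ξ² = 1`, shifting `s` by `δ` exchanges the two products of the Euler factor. -/
theorem eulerFactor_succ (hξ : xi F E ^ 2 = 1) {δ : ℂ}
    (hδ : ∀ s, (q F : ℂ) ^ (-(s - δ)) = xi F E * q F * (q F : ℂ) ^ (-s)) (n : ℕ) (s : ℂ) :
    eulerFactor F E (1 + n) s = (1 - (q F : ℂ) ^ (-s)) * eulerFactor F E n (s - δ) := by
  have hpow : ∀ z w : ℂ, (q F : ℂ) ^ (z + w) = (q F : ℂ) ^ z * (q F : ℂ) ^ w := fun z w =>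
    Complex.cpow_add z w q_ne_zero
  have h1 : ∀ z : ℂ, (q F : ℂ) ^ (z - (s - δ)) = xi F E * (q F : ℂ) ^ (z + 1 - s) := by
    intro z
    rw [sub_eq_add_neg z, hpow, hδ, sub_eq_add_neg, hpow, hpow, Complex.cpow_one]
    ring
  rw [eulerFactor, eulerFactor, Icc_prod_eq, Icc_prod_eq,
    show (1 + n + 1) / 2 = n / 2 + 1 by omega, show (1 + n) / 2 = (n + 1) / 2 by omega,
    Finset.prod_range_succ']
  have h2 : ∏ i ∈ Finset.range (n / 2), (1 - (q F : ℂ) ^ (2 * ((i + 1 : ℕ) : ℂ) - s)) =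
      ∏ i ∈ Finset.range (n / 2),
        (1 - xi F E * (q F : ℂ) ^ (2 * ((i + 1 : ℕ) : ℂ) - 1 - (s - δ))) := by
    refine Finset.prod_congr rfl fun i _ => ?_
    rw [h1, sub_add_cancel, ← mul_assoc, ← sq, hξ, one_mul]
  have h3 : ∏ i ∈ Finset.range ((n + 1) / 2),
      (1 - xi F E * (q F : ℂ) ^ (2 * ((i + 1 : ℕ) : ℂ) - 1 - s)) =
        ∏ i ∈ Finset.range ((n + 1) / 2), (1 - (q F : ℂ) ^ (2 * (i : ℂ) - (s - δ))) := by
    refine Finset.prod_congr rfl fun i _ => ?_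
    rw [h1]
    congr 3
    push_cast
    ring
  rw [h2, h3, Nat.cast_zero, mul_zero, zero_sub]
  ring

/-- For `ξ = 0` only the first product of the Euler factor is left. -/
theorem eulerFactor_add_two (hξ : xi F E = 0) (n : ℕ) (s : ℂ) :
    eulerFactor F E (2 + n) s = (1 - (q F : ℂ) ^ (-s)) * eulerFactor F E n (s - 2) := by
  rw [eulerFactor, eulerFactor, hξ, show (2 + n + 1) / 2 = (n + 1) / 2 + 1 by omega,
    Finset.prod_range_succ']
  simp only [zero_mul, sub_zero, Finset.prod_const_one, mul_one, Nat.cast_zero, mul_zero, zero_sub]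
  rw [mul_comm]
  congr 1
  refine Finset.prod_congr rfl fun i _ => ?_
  congr 2
  push_cast
  ring

theorem IsQuadConj.xi_sq (h : IsQuadConj σ) (hram : ¬ IsRamified F E) : xi F E ^ 2 = 1 := by
  rcases isInert_or_not_isField hram with hin | hE
  · rw [xi_of_isInert hin]; norm_num
  · rw [h.xi_of_not_isField hE]; norm_num

theorem mu_pow_mul (h : IsQuadConj σ) (d : Matrix ι ι E) (k : ℕ) (s : ℂ) :
    (mu F d : ℂ) ^ k * (mu F d : ℂ) ^ (-s) = (mu F d : ℂ) ^ (-(s - k)) := by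
  have hne : (mu F d : ℂ) ≠ 0 := by exact_mod_cast (h.mu_pos d).ne'
  rw [← Complex.cpow_natCast, ← Complex.cpow_add _ _ hne]
  congr 1
  ring

/-- The shift in the unramified case: `q^{δ} = ξ q`. -/
theorem IsQuadConj.exists_shift (h : IsQuadConj σ) (hψ : IsUnramifiedChar ψ)
    (hram : ¬ IsRamified F E) :
    ∃ δ : ℂ, (∀ s, (q F : ℂ) ^ (-(s - δ)) = xi F E * q F * (q F : ℂ) ^ (-s)) ∧
      ∀ (ι : Type _) [Fintype ι] [DecidableEq ι] (s : ℂ), ∀ d ∈ Her σ ι,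
        gaussSum σ ψ (1 : Matrix Unit Unit E) d * (mu F d : ℂ) ^ (-s) =
          (mu F d : ℂ) ^ (-(s - δ)) := by
  have hD := h.isSelfDual_one hram
  rcases isInert_or_not_isField hram with hin | hE
  · have hlog : Complex.log (q F) ≠ 0 := by
      rw [← Complex.natCast_log, Complex.ofReal_ne_zero]
      exact (Real.log_pos (by exact_mod_cast one_lt_q (F := F))).ne'
    -- in the inert case `q ^ δ = -q`
    set δ : ℂ := 1 + Real.pi * Complex.I / Complex.log (q F) with hδ
    have hq : (q F : ℂ) ^ δ = -q F := by
      rw [hδ, Complex.cpow_add _ _ q_ne_zero, Complex.cpow_one,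
        Complex.cpow_def_of_ne_zero q_ne_zero, mul_div_cancel₀ _ hlog, Complex.exp_pi_mul_I]
      ring
    have hs : ∀ s, (q F : ℂ) ^ (-(s - δ)) = -q F * (q F : ℂ) ^ (-s) := fun s => by
      rw [neg_sub, sub_eq_add_neg, Complex.cpow_add _ _ q_ne_zero, hq]
    refine ⟨δ, fun s => by rw [hs, xi_of_isInert hin, neg_one_mul], fun ι _ _ s d hd => ?_⟩
    obtain ⟨l, hl⟩ := h.exists_idx_eq d
    obtain ⟨k, rfl, hk⟩ := hD.gaussSum_of_isInert h hψ hin hd (l := l) (by simpa using hl)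
    have hmu : (mu F d : ℂ) = (q F : ℂ) ^ k := by
      rw [mu_eq, hl, mul_comm, pow_mul, Nat.cast_pow, Real.sqrt_sq (Nat.cast_nonneg _)]
      push_cast
      rfl
    rw [hk, hmu, ← Complex.natCast_cpow_natCast_mul, ← Complex.natCast_cpow_natCast_mul,
      Complex.cpow_nat_mul, Complex.cpow_nat_mul, hs, mul_pow]
  · obtain ⟨e, he, hσe⟩ := h.exists_idempotent hE
    obtain ⟨ε, hε⟩ := exists_up_eq_sc (h.mem_OE_idempotent he hσe)
    refine ⟨1, fun s => ?_, fun ι _ _ s d hd => ?_⟩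
    · rw [h.xi_of_not_isField hE, one_mul, neg_sub, sub_eq_add_neg,
        Complex.cpow_add _ _ q_ne_zero, Complex.cpow_one]
    · rw [hD.gaussSum_of_idempotent h hψ hd ε]
      · have := mu_pow_mul h d 1 s
        rw [Nat.cast_one] at this
        exact this
      · rw [hε, cT_sc, Matrix.mul_one, ← sc_mul, hσe, ← sc_zero]
        congr 1
        linear_combination -he
      · have e1 : (1 : Matrix Unit Unit E) - sc e = sc (1 - e) := by ext; simp
        rw [hε, e1, cT_sc, Matrix.mul_one, ← sc_mul, map_sub, map_one, hσe, ← sc_zero]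
        congr 1
        linear_combination -he

/-- The plane is the sum of two isotropic lines, so that its Gauss sums are positive. -/
theorem IsQuadConj.gaussSum_plane (h : IsQuadConj σ) (hψ : IsUnramifiedChar ψ) {θ : E}
    (hθ : IsDualGen F θ) {d : Matrix ι ι E} (hd : d ∈ Her σ ι) :
    gaussSum σ ψ (plane σ θ) d = (mu F d : ℂ) ^ 2 := by
  have e0 : up (Matrix.fromBlocks 1 0 0 0 : Matrix (Unit ⊕ Unit) (Unit ⊕ Unit) (OE F E)) =
      Matrix.fromBlocks 1 0 0 0 := by
    rw [up_fromBlocks, up_one, up_zero]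
  have e1 : (1 : Matrix (Unit ⊕ Unit) (Unit ⊕ Unit) E) - Matrix.fromBlocks 1 0 0 0 =
      Matrix.fromBlocks 0 0 0 1 := by
    ext (i | i) (j | j) <;> simp
  rw [(h.isSelfDual_plane hθ).gaussSum_of_idempotent h hψ hd (Matrix.fromBlocks 1 0 0 0)]
  · simp
  · rw [e0, cT_fromBlocks, plane, blk, Matrix.fromBlocks_multiply, Matrix.fromBlocks_multiply]
    simp [cT_zero, cT_one]
  · rw [e0, e1, cT_fromBlocks, plane, blk, Matrix.fromBlocks_multiply, Matrix.fromBlocks_multiply]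
    simp [cT_zero, cT_one]

theorem IsQuadConj.isSiegelPolynomial_perp_one (h : IsQuadConj σ) (hψ : IsUnramifiedChar ψ)
    (hram : ¬ IsRamified F E) (hB : IsSemiIntegral σ B) (P : ℂ[X]) :
    IsSiegelPolynomial σ ψ B P ↔ IsSiegelPolynomial σ ψ (perp (1 : Matrix Unit Unit E) B)
      (P.comp (C (xi F E * q F) * X)) := by
  obtain ⟨δ, hδ, hg⟩ := h.exists_shift hψ hram
  exact (h.isSelfDual_one hram).isSiegelPolynomial_perp h hψ hB hδ (hg ι)
    (fun s hs => h.siegelSeries_one hψ hram hs)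
    (fun s => by
      rw [Fintype.card_sum, Fintype.card_unit]
      exact eulerFactor_succ (h.xi_sq hram) hδ _ s) P

theorem IsQuadConj.isSiegelPolynomial_perp_plane (h : IsQuadConj σ) (hψ : IsUnramifiedChar ψ)
    (hram : IsRamified F E) {ϖE : Eˣ} (hϖE : ord F (Algebra.norm F (ϖE : E)) = 1) {θ : E}
    (hθ : IsDualGen F θ) (hB : IsSemiIntegral σ B) (P : ℂ[X]) :
    IsSiegelPolynomial σ ψ B P ↔ IsSiegelPolynomial σ ψ (perp (plane σ θ) B)
      (P.comp (C ((q F : ℂ) ^ 2) * X)) :=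
  (h.isSelfDual_plane hθ).isSiegelPolynomial_perp h hψ hB (δ := 2)
    (fun s => by
      rw [neg_sub, sub_eq_add_neg, Complex.cpow_add _ _ q_ne_zero]
      norm_cast)
    (fun s d hd => by
      rw [h.gaussSum_plane hψ hθ hd]
      exact_mod_cast mu_pow_mul h d 2 s)
    (fun s hs => h.siegelSeries_plane hψ hram hϖE hθ hs)
    (fun s => by
      rw [Fintype.card_sum]
      exact eulerFactor_add_two (xi_of_isRamified hram) _ s) P

end Polynomials

/-! ### The matrices `Θ_k` -/

section Thetas

variable {F : Type*} [Field F] [ValuativeRel F] [TopologicalSpace F] [IsNonarchimedeanLocalField F]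
  [CharZero F] {E : Type*} [CommRing E] [Algebra F E] [IsReduced E] {σ : E ≃ₐ[F] E}
variable {ι κ lam : Type*} [Fintype ι] [Fintype κ] [DecidableEq ι] [DecidableEq κ] [Fintype lam]
  [DecidableEq lam] {ψ : AddChar F Circle} {Θ : Matrix κ κ E} {B : Matrix ι ι E}

theorem reindex_perp_perp {lam' : Type*} (e : κ ⊕ lam ≃ lam') (A : Matrix κ κ E)
    (T : Matrix lam lam E) (B : Matrix ι ι E) :
    Matrix.reindex ((Equiv.sumAssoc κ lam ι).symm.trans (Equiv.sumCongr e (Equiv.refl ι)))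
      ((Equiv.sumAssoc κ lam ι).symm.trans (Equiv.sumCongr e (Equiv.refl ι)))
      (perp A (perp T B)) = perp (Matrix.reindex e e (perp A T)) B := by
  ext (i | i) (j | j)
  · obtain ⟨i | i, rfl⟩ := e.surjective i <;> obtain ⟨j | j, rfl⟩ := e.surjective j <;>
      simp [perp]
  · obtain ⟨i | i, rfl⟩ := e.surjective i <;> simp [perp]
  · obtain ⟨j | j, rfl⟩ := e.surjective j <;> simp [perp]
  · simp [perp]

theorem reindex_eq_perp_empty (T : Matrix (Fin 0) (Fin 0) E) (B : Matrix ι ι E) :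
    Matrix.reindex (Equiv.emptySum (Fin 0) ι).symm (Equiv.emptySum (Fin 0) ι).symm B =
      perp T B := by
  ext (i | i) (j | j)
  · exact i.elim0
  · exact i.elim0
  · exact j.elim0
  · simp [perp]

variable (F) in
/-- The relation between the Siegel series of `B` and `B'` that results from splitting off modular
forms. -/
def IsScaled (σ : E ≃ₐ[F] E) (ψ : AddChar F Circle) (c : ℂ) (B : Matrix ι ι E) (B' : Matrix κ κ E) :
    Prop :=
  (IsSemiIntegral σ B' ↔ IsSemiIntegral σ B) ∧ (IsSemiIntegral σ B → ∀ P : ℂ[X],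
    IsSiegelPolynomial σ ψ B P ↔ IsSiegelPolynomial σ ψ B' (P.comp (C c * X)))

theorem IsScaled.trans {c c' : ℂ} {B : Matrix ι ι E} {B' : Matrix κ κ E} {B'' : Matrix lam lam E}
    (h1 : IsScaled F σ ψ c B B') (h2 : IsScaled F σ ψ c' B' B'') :
    IsScaled F σ ψ (c * c') B B'' := by
  refine ⟨h2.1.trans h1.1, fun hB P => ?_⟩
  rw [h1.2 hB, h2.2 (h1.1.2 hB), comp_assoc, mul_comp, C_comp, X_comp, ← mul_assoc, ← C_mul]

theorem IsQuadConj.isScaled_reindex (h : IsQuadConj σ) (hψ : IsUnramifiedChar ψ)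
    (hB : B ∈ Her σ ι) (e : ι ≃ κ) : IsScaled F σ ψ 1 B (Matrix.reindex e e B) := by
  obtain ⟨h1, h2⟩ := h.siegelTerm_reindex hψ hB e
  refine ⟨h1, fun hB P => ?_⟩
  rw [C_1, one_mul, comp_X]
  exact h2 hB P

theorem IsScaled.siegelPoly_eq {c : ℂ} (hc : c ≠ 0) {B : Matrix ι ι E} {B' : Matrix κ κ E}
    (h1 : IsScaled F σ ψ c B B') : siegelPoly σ ψ B' = (siegelPoly σ ψ B).comp (C c * X) :=
  siegelPoly_comp c hc h1.1 h1.2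

/-- Each of the `k` coordinates scales the variable by `ξ q`. -/
theorem IsQuadConj.isScaled_perp_one (h : IsQuadConj σ) (hψ : IsUnramifiedChar ψ)
    (hram : ¬ IsRamified F E) (hB : B ∈ Her σ ι) (k : ℕ) :
    IsScaled F σ ψ ((xi F E * q F) ^ k) B (perp (1 : Matrix (Fin k) (Fin k) E) B) := by
  have hone : ∀ k : ℕ, (1 : Matrix (Fin k) (Fin k) E) ∈ Her σ (Fin k) := fun k => by
    rw [mem_Her, cT_one]
  induction k with
  | zero =>
    rw [pow_zero, ← reindex_eq_perp_empty]
    exact h.isScaled_reindex hψ hB _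
  | succ k ih =>
    have h1 : IsScaled F σ ψ (xi F E * q F) (perp (1 : Matrix (Fin k) (Fin k) E) B)
        (perp (1 : Matrix Unit Unit E) (perp (1 : Matrix (Fin k) (Fin k) E) B)) :=
      ⟨h.isSemiIntegral_perp (h.isSelfDual_one hram).semi (h.perp_mem_Her (hone k) hB),
        fun hP P => h.isSiegelPolynomial_perp_one hψ hram hP P⟩
    let e : Unit ⊕ Fin k ≃ Fin (k + 1) := Fintype.equivOfCardEq (by simp [add_comm])
    have h2 := h.isScaled_reindex hψ (h.perp_mem_Her (h.isSelfDual_one hram).semi.1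
      (h.perp_mem_Her (hone k) hB)) ((Equiv.sumAssoc Unit (Fin k) ι).symm.trans
        (Equiv.sumCongr e (Equiv.refl ι)))
    have h3 := (ih.trans h1).trans h2
    rw [reindex_perp_perp, mul_one, ← pow_succ] at h3
    have e1 : Matrix.reindex e e (perp (1 : Matrix Unit Unit E) (1 : Matrix (Fin k) (Fin k) E)) =
        1 := by
      rw [perp, Matrix.fromBlocks_one, Matrix.reindex_apply, Matrix.submatrix_one_equiv]
    rwa [e1] at h3

/-- The bijection that places a plane after `k` coordinates. -/
def planeEquiv (k : ℕ) : (Unit ⊕ Unit) ⊕ Fin k ≃ Fin (k + 2) :=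
  (Equiv.sumComm _ _).trans ((Equiv.sumCongr (Equiv.refl (Fin k))
    { toFun := Sum.elim (fun _ => (0 : Fin 2)) fun _ => 1
      invFun := fun i => if i = 0 then Sum.inl () else Sum.inr ()
      left_inv := by rintro (i | i) <;> simp
      right_inv := by intro i; fin_cases i <;> simp }).trans finSumFinEquiv)

theorem planeEquiv_inl_inl (k : ℕ) (i : Unit) :
    planeEquiv k (Sum.inl (Sum.inl i)) = Fin.natAdd k 0 := rfl

theorem planeEquiv_inl_inr (k : ℕ) (i : Unit) :
    planeEquiv k (Sum.inl (Sum.inr i)) = Fin.natAdd k 1 := rfl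

theorem planeEquiv_inr (k : ℕ) (i : Fin k) : planeEquiv k (Sum.inr i) = Fin.castAdd 2 i := rfl

theorem Theta_of_not_isRamified (hram : ¬ IsRamified F E) (ϖE : Eˣ) (k : ℕ) :
    Theta σ ϖE k = 1 := by rw [Theta, if_neg hram]

/-- `Θ_{k+2}` is `Θ_k` with one more modular hyperbolic plane. -/
theorem Theta_add_two (hram : IsRamified F E) (ϖE : Eˣ) {k : ℕ} (hk : Even k) :
    Matrix.reindex (planeEquiv k) (planeEquiv k)
      (perp (plane σ ((ϖE⁻¹ ^ 𝔣 F E : Eˣ) : E)) (Theta σ ϖE k)) = Theta σ ϖE (k + 2) := by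
  have hk2 := Nat.even_iff.1 hk
  have hk3 : (k + 1) % 2 = 1 := by omega
  set θ := ((ϖE⁻¹ ^ 𝔣 F E : Eˣ) : E)
  obtain ⟨g, hg⟩ : ∃ g : ℕ → ℕ → E, g = fun a b =>
      if a % 2 = 0 ∧ b = a + 1 then θ else if b % 2 = 0 ∧ a = b + 1 then σ θ else 0 := ⟨_, rfl⟩
  have hT : ∀ k (i j : Fin k), Theta σ ϖE k i j = g i j := by
    intro k i j
    rw [Theta, if_pos hram, Matrix.of_apply, hg]
  have g1 : ∀ a b, a % 2 = 0 → b = a + 1 → g a b = θ := fun a b h1 h2 => by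
    rw [hg]; exact if_pos ⟨h1, h2⟩
  have g2 : ∀ a b, b % 2 = 0 → a = b + 1 → g a b = σ θ := fun a b h1 h2 => by
    rw [hg]; exact (if_neg (by omega)).trans (if_pos ⟨h1, h2⟩)
  have g0 : ∀ a b, ¬ (a % 2 = 0 ∧ b = a + 1) → ¬ (b % 2 = 0 ∧ a = b + 1) → g a b = 0 :=
    fun a b h1 h2 => by rw [hg]; exact (if_neg h1).trans (if_neg h2)
  ext i j
  obtain ⟨i, rfl⟩ := (planeEquiv k).surjective i
  obtain ⟨j, rfl⟩ := (planeEquiv k).surjective j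
  rw [Matrix.reindex_apply, Matrix.submatrix_apply, Equiv.symm_apply_apply, Equiv.symm_apply_apply,
    hT]
  rcases i with (i | i) | i <;> rcases j with (j | j) | j <;>
    simp only [planeEquiv_inl_inl, planeEquiv_inl_inr, planeEquiv_inr, Fin.val_natAdd,
      Fin.val_castAdd, Fin.val_zero, Fin.val_one, perp, Matrix.fromBlocks_apply₁₁,
      Matrix.fromBlocks_apply₁₂, Matrix.fromBlocks_apply₂₁, Matrix.fromBlocks_apply₂₂, plane, blk,
      Matrix.zero_apply, sc_apply, cT_apply, hT]
  · rw [g0 _ _ (by omega) (by omega)]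
  · rw [g1 _ _ (by omega) (by omega)]
  · rw [g0 _ _ (by omega) (by omega)]
  · rw [g2 _ _ (by omega) (by omega)]
  · rw [g0 _ _ (by omega) (by omega)]
  · rw [g0 _ _ (by omega) (by omega)]
  · rw [g0 _ _ (by omega) (by omega)]
  · rw [g0 _ _ (by omega) (by omega)]

end Thetas

/-! ### Splitting off `Θ_k` from the Siegel series -/

section ThetaSplit

variable {F : Type*} [Field F] [ValuativeRel F] [TopologicalSpace F] [IsNonarchimedeanLocalField F]
  [CharZero F] {E : Type*} [CommRing E] [Algebra F E] [IsReduced E] {σ : E ≃ₐ[F] E}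
variable {ι κ lam : Type*} [Fintype ι] [Fintype κ] [DecidableEq ι] [DecidableEq κ] [Fintype lam]
  [DecidableEq lam] {ψ : AddChar F Circle} {Θ : Matrix κ κ E} {B : Matrix ι ι E}

theorem IsModular.perp {Θ' : Matrix lam lam E} (h1 : IsModular F Θ) (h2 : IsModular F Θ') :
    IsModular F (perp Θ Θ') := by
  intro v
  have key : ∀ w : κ ⊕ lam → E, w ⬝ᵥ (HermSiegel.perp Θ Θ').mulVec v =
      (w ∘ Sum.inl) ⬝ᵥ Θ.mulVec (v ∘ Sum.inl) + (w ∘ Sum.inr) ⬝ᵥ Θ'.mulVec (v ∘ Sum.inr) := by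
    intro w
    rw [HermSiegel.perp, Matrix.fromBlocks_mulVec, dotProduct, Fintype.sum_sum_type]
    simp [dotProduct]
  constructor
  · intro hv
    have hl := (h1 (v ∘ Sum.inl)).1 fun w hw => by
      have := hv (Sum.elim w 0) (by rintro (i | i); exacts [hw i, zero_mem _])
      rw [key] at this
      simpa using this
    have hr := (h2 (v ∘ Sum.inr)).1 fun w hw => by
      have := hv (Sum.elim 0 w) (by rintro (i | i); exacts [zero_mem _, hw i])
      rw [key] at this
      simpa using this
    rintro (i | i)
    exacts [hl i, hr i]
  · intro hv w hw
    rw [key, map_add]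
    exact add_mem ((h1 _).2 (fun k => hv _) _ fun k => hw _)
      ((h2 _).2 (fun k => hv _) _ fun k => hw _)

theorem IsModular.reindex (h1 : IsModular F Θ) (e : κ ≃ lam) :
    IsModular F (Matrix.reindex e e Θ) := by
  intro v
  have key : ∀ w : lam → E, w ⬝ᵥ (Matrix.reindex e e Θ).mulVec v =
      (w ∘ e) ⬝ᵥ Θ.mulVec (v ∘ e) := by
    intro w
    rw [dotProduct, dotProduct, ← e.sum_comp]
    refine Finset.sum_congr rfl fun k _ => ?_
    rw [Matrix.mulVec, Matrix.mulVec, dotProduct, dotProduct, ← e.sum_comp]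
    simp
  have h2 := h1 (v ∘ e)
  constructor
  · intro hv k
    obtain ⟨k, rfl⟩ := e.surjective k
    refine h2.1 (fun w hw => ?_) k
    have := hv (w ∘ e.symm) fun k => hw _
    rw [key] at this
    convert this using 4
    ext k; simp
  · intro hv w hw
    rw [key]
    exact h2.2 (fun k => hv _) _ fun k => hw _

theorem IsSelfDual.perp {Θ' : Matrix lam lam E} (h : IsQuadConj σ) (h1 : IsSelfDual σ Θ)
    (h2 : IsSelfDual σ Θ') : IsSelfDual σ (perp Θ Θ') :=
  ⟨(h.isSemiIntegral_perp h1.semi h2.semi.1).2 h2.semi, h1.modular.perp h2.modular⟩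

theorem IsSelfDual.reindex (h : IsQuadConj σ) (hψ : IsUnramifiedChar ψ) (h1 : IsSelfDual σ Θ)
    (e : κ ≃ lam) : IsSelfDual σ (Matrix.reindex e e Θ) :=
  ⟨(h.siegelTerm_reindex hψ h1.semi.1 e).1.2 h1.semi, h1.modular.reindex e⟩

theorem isSelfDual_fin_zero (T : Matrix (Fin 0) (Fin 0) E) : IsSelfDual σ T :=
  ⟨⟨by ext i; exact i.elim0, fun C => ⟨0, by simp [Matrix.trace]⟩⟩, fun v =>
    ⟨fun _ k => k.elim0, fun _ w _ => by simp [dotProduct]⟩⟩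

/-- The equivalence used to add one coordinate in front. -/
def lineEquiv (k : ℕ) : Unit ⊕ Fin k ≃ Fin (k + 1) := Fintype.equivOfCardEq (by simp [add_comm])

theorem one_add_one_reindex (k : ℕ) : Matrix.reindex (lineEquiv k) (lineEquiv k)
    (perp (1 : Matrix Unit Unit E) (1 : Matrix (Fin k) (Fin k) E)) = 1 := by
  rw [perp, Matrix.fromBlocks_one, Matrix.reindex_apply, Matrix.submatrix_one_equiv]

/-- The `Θ_k` are orthogonal sums of modular lines or planes. -/
theorem IsQuadConj.isSelfDual_Theta (h : IsQuadConj σ) (hψ : IsUnramifiedChar ψ) {ϖE : Eˣ}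
    (hϖE : IsRamified F E → ord F (Algebra.norm F (ϖE : E)) = 1) {k : ℕ}
    (hk : IsRamified F E → Even k) : IsSelfDual σ (Theta σ ϖE k) := by
  by_cases hram : IsRamified F E
  · obtain ⟨j, rfl⟩ := (hk hram).two_dvd
    clear hk
    induction j with
    | zero => exact isSelfDual_fin_zero _
    | succ j ih =>
      rw [mul_add, mul_one, ← Theta_add_two hram ϖE (even_two_mul j)]
      exact ((h.isSelfDual_plane (isDualGen_ramified h hram (hϖE hram))).perp h ih).reindex h hψ _
  · rw [Theta_of_not_isRamified hram]
    clear hk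
    induction k with
    | zero => exact isSelfDual_fin_zero _
    | succ k ih =>
      rw [← one_add_one_reindex]
      exact ((h.isSelfDual_one hram).perp h ih).reindex h hψ _

/-- Since `ξ = ξ̂²` in the unramified cases and `ξ̂ = 1` in the ramified case, a single formula
covers the modular lines and planes. -/
theorem IsQuadConj.isScaled_perp_Theta (h : IsQuadConj σ) (hψ : IsUnramifiedChar ψ) {ϖE : Eˣ}
    (hϖE : IsRamified F E → ord F (Algebra.norm F (ϖE : E)) = 1) {k : ℕ}
    (hk : IsRamified F E → Even k) (hB : B ∈ Her σ ι) :
    IsScaled F σ ψ ((xiHat F E ^ 2 * q F) ^ k) B (perp (Theta σ ϖE k) B) := by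
  by_cases hram : IsRamified F E
  · obtain ⟨j, rfl⟩ := (hk hram).two_dvd
    rw [xiHat_of_isRamified hram, one_pow, one_mul]
    clear hk
    induction j with
    | zero =>
      rw [mul_zero, pow_zero, ← reindex_eq_perp_empty]
      exact h.isScaled_reindex hψ hB _
    | succ j ih =>
      have hT := (h.isSelfDual_Theta hψ hϖE fun _ => even_two_mul j).semi
      have hP := h.isSelfDual_plane (isDualGen_ramified h hram (hϖE hram))
      have hTB := h.perp_mem_Her hT.1 hB
      have h1 : IsScaled F σ ψ ((q F : ℂ) ^ 2) (perp (Theta σ ϖE (2 * j)) B) _ :=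
        ⟨h.isSemiIntegral_perp hP.semi hTB, fun hS P => h.isSiegelPolynomial_perp_plane hψ hram
          (hϖE hram) (isDualGen_ramified h hram (hϖE hram)) hS P⟩
      have h2 := h.isScaled_reindex hψ (h.perp_mem_Her hP.semi.1 hTB)
        ((Equiv.sumAssoc _ _ ι).symm.trans
          (Equiv.sumCongr (planeEquiv (2 * j)) (Equiv.refl ι)))
      have h3 := (ih.trans h1).trans h2
      rw [reindex_perp_perp, Theta_add_two hram ϖE (even_two_mul j), mul_one, ← pow_add] at h3
      exact h3
  · rw [Theta_of_not_isRamified hram, ← h.xi_eq_xiHat_sq hram]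
    exact h.isScaled_perp_one hψ hram hB k

theorem conj_det {A : Matrix ι ι E} (hA : A ∈ Her σ ι) :
    σ A.det = A.det := by
  have h1 : (σ : E →+* E) A.det = _ := RingHom.map_det (σ : E →+* E) A
  have h2 : (RingHom.mapMatrix (σ : E →+* E) A) = A.transpose := by
    ext i j
    exact congrFun (congrFun (mem_Her.1 hA) j) i
  rw [h2, Matrix.det_transpose] at h1
  exact h1

theorem det_plane (θ : E) : (plane σ θ).det = -(θ * σ θ) := by
  rw [← Matrix.det_reindex_self
    ((Equiv.sumEmpty (Unit ⊕ Unit) (Fin 0)).symm.trans (planeEquiv 0)), Matrix.det_fin_two]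
  change 0 * 0 - θ * σ θ = _
  ring

/-- The determinant of `Θ_k` has order `-𝔣 ⌊k / 2⌋`, each plane contributing `-N(ϖ_E) ^ (-𝔣)`. -/
theorem IsQuadConj.exists_det_Theta (h : IsQuadConj σ) {ϖE : Eˣ}
    (hϖE : IsRamified F E → ord F (Algebra.norm F (ϖE : E)) = 1) {k : ℕ}
    (hk : IsRamified F E → Even k) :
    ∃ a : F, a ≠ 0 ∧ (Theta σ ϖE k).det = algebraMap F E a ∧
      ord F a = -((𝔣 F E : ℤ) * ((k / 2 : ℕ) : ℤ)) := by
  by_cases hram : IsRamified F E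
  · obtain ⟨j, rfl⟩ := (hk hram).two_dvd
    clear hk
    induction j with
    | zero => exact ⟨1, one_ne_zero, by simp, by simp [ord_one]⟩
    | succ j ih =>
      obtain ⟨a, ha0, ha, hao⟩ := ih
      have hN : Algebra.norm F (((ϖE⁻¹ ^ 𝔣 F E : Eˣ) : E)) ≠ 0 :=
        norm_ne_zero_of_isUnit (Units.isUnit _)
      refine ⟨-Algebra.norm F (((ϖE⁻¹ ^ 𝔣 F E : Eˣ) : E)) * a,
        mul_ne_zero (neg_ne_zero.2 hN) ha0, ?_, ?_⟩
      · rw [mul_add, mul_one, ← Theta_add_two hram ϖE (even_two_mul j), Matrix.det_reindex_self,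
          perp, Matrix.det_fromBlocks_zero₂₁, ha, map_mul, map_neg, h.algebraMap_norm]
        congr 1
        exact det_plane _
      · have hu : Algebra.norm F ((ϖE⁻¹ : Eˣ) : E) = (Algebra.norm F (ϖE : E))⁻¹ := by
          refine eq_inv_of_mul_eq_one_left ?_
          rw [← map_mul, Units.inv_mul, map_one]
        rw [ord_mul (neg_ne_zero.2 hN) ha0, ord_neg, hao, Units.val_pow_eq_pow_val, map_pow, hu,
          ord_pow (inv_ne_zero (norm_ne_zero_of_isUnit (Units.isUnit _))), ord_inv, hϖE hram,
          show 2 * (j + 1) / 2 = j + 1 by omega, show 2 * j / 2 = j by omega]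
        push_cast; ring
  · rw [Theta_of_not_isRamified hram, f_eq_zero h hram]
    exact ⟨1, one_ne_zero, by simp, by simp [ord_one]⟩

/-- The discriminant of `Θ_k` cancels the change of the exponent of `𝔇`. -/
theorem IsQuadConj.eB_perp_Theta (h : IsQuadConj σ) {ϖE : Eˣ}
    (hϖE : IsRamified F E → ord F (Algebra.norm F (ϖE : E)) = 1) {k : ℕ}
    (hk : IsRamified F E → Even k) (hB : B ∈ Her σ ι) (hdet : B.det ≠ 0) :
    eB F (perp (Theta σ ϖE k) B) = eB F B := by
  obtain ⟨a, ha0, ha, hao⟩ := h.exists_det_Theta hϖE hk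
  have hb := h.algebraMap_toBase (conj_det hB)
  have hb0 : toBase F B.det ≠ 0 := by
    intro h0; rw [h0, map_zero] at hb; exact hdet hb.symm
  have h1 : (perp (Theta σ ϖE k) B).det = algebraMap F E (a * toBase F B.det) := by
    rw [perp, Matrix.det_fromBlocks_zero₂₁, ha, map_mul, hb]
  rw [eB, eB, h1, h.toBase_algebraMap, ord_mul ha0 hb0, hao, Fintype.card_sum, Fintype.card_fin]
  by_cases hram : IsRamified F E
  · obtain ⟨j, rfl⟩ := (hk hram).two_dvd
    rw [show (2 * j + Fintype.card ι) / 2 = j + Fintype.card ι / 2 by omega,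
      show 2 * j / 2 = j by omega]
    push_cast; ring
  · rw [f_eq_zero h hram]; simp

/-- Splitting off `Θ_k` changes `F̃` by a rescaling of the variable. -/
theorem IsQuadConj.Ftilde_perp (h : IsQuadConj σ) (hψ : IsUnramifiedChar ψ) {ϖE : Eˣ}
    (hϖE : IsRamified F E → ord F (Algebra.norm F (ϖE : E)) = 1) {k : ℕ}
    (hk : IsRamified F E → Even k) (hB : B ∈ Her σ ι) (hdet : B.det ≠ 0) {X : ℂ} :
    Ftilde σ ψ (perp (Theta σ ϖE k) B) X =
      (xiHat F E ^ k) ^ eB F B * Ftilde σ ψ B (xiHat F E ^ k * X) := by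
  have hq := q_ne_zero (F := F)
  have hx : xiHat F E ^ k ≠ 0 := pow_ne_zero _ xiHat_ne_zero
  rw [Ftilde, Ftilde, h.eB_perp_Theta hϖE hk hB hdet, mul_zpow, ← mul_assoc, ← mul_assoc,
    ← zpow_add₀ hx, add_neg_cancel, zpow_zero, one_mul,
    (h.isScaled_perp_Theta hψ hϖE hk hB).siegelPoly_eq
      (pow_ne_zero _ (mul_ne_zero (pow_ne_zero _ xiHat_ne_zero) hq)), eval_comp]
  congr 2
  rw [eval_mul, eval_C, eval_X, Fintype.card_sum, Fintype.card_fin]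
  rw [Nat.cast_add, neg_add, zpow_add₀ hq, zpow_neg, zpow_natCast, mul_pow]
  field_simp
  ring

end ThetaSplit

/-! ### Unimodular rows over semilocal rings -/

section Completion

open TensorProduct Module

variable {R : Type*} [CommRing R] {κ ν : Type*} [Fintype κ] [Fintype ν] [DecidableEq κ]
  [DecidableEq ν]

/-- A split surjection decomposes its source. -/
def splitEquiv (P : (ν → R) →ₗ[R] (κ → R)) (Q : (κ → R) →ₗ[R] (ν → R))
    (hPQ : ∀ y, P (Q y) = y) : (ν → R) ≃ₗ[R] (κ → R) × LinearMap.ker P where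
  toFun x := (P x, ⟨x - Q (P x), by rw [LinearMap.mem_ker, map_sub, hPQ, sub_self]⟩)
  map_add' x y := by
    ext1
    · exact map_add P x y
    · apply Subtype.ext
      change x + y - Q (P (x + y)) = (x - Q (P x)) + (y - Q (P y))
      rw [map_add, map_add]; abel
  map_smul' c x := by
    ext1
    · exact map_smul P c x
    · apply Subtype.ext
      change c • x - Q (P (c • x)) = c • (x - Q (P x))
      rw [map_smul, map_smul, smul_sub]
  invFun p := Q p.1 + p.2
  left_inv x := by
    change Q (P x) + (x - Q (P x)) = x
    abel
  right_inv p := by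
    have h1 : P (Q p.1 + p.2) = p.1 := by
      rw [map_add, hPQ, LinearMap.mem_ker.1 p.2.2, add_zero]
    ext1
    · exact h1
    · apply Subtype.ext
      change Q p.1 + p.2 - Q (P (Q p.1 + p.2)) = p.2
      rw [h1]; abel

/-- Over a semilocal ring a unimodular system of rows is part of an invertible matrix, because the
kernel of the corresponding split surjection is free. -/
theorem exists_completion [Finite (MaximalSpectrum R)] {P : Matrix κ ν R} {Q : Matrix ν κ R}
    (hPQ : P * Q = 1) (f : κ ↪ ν) :
    ∃ V U : Matrix ν ν R, V * U = 1 ∧ ∀ a, V (f a) = P a := by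
  classical
  have hPQ' : ∀ y, Matrix.toLin' P (Matrix.toLin' Q y) = y := fun y => by
    rw [← Matrix.toLin'_mul_apply, hPQ, Matrix.toLin'_one, LinearMap.id_apply]
  set N := LinearMap.ker (Matrix.toLin' P)
  set e := splitEquiv _ _ hPQ'
  have hfin : Module.Finite R N :=
    Module.Finite.of_surjective ((LinearMap.snd R (κ → R) N).comp e.toLinearMap)
      (Prod.snd_surjective.comp e.surjective)
  have hproj : Module.Projective R N :=
    Module.Projective.of_split (e.symm.toLinearMap.comp (LinearMap.inr R (κ → R) N))
      ((LinearMap.snd R (κ → R) N).comp e.toLinearMap) (by ext x; simp)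
  let C := {j : ν // j ∉ Set.range f}
  let s : κ ⊕ C ≃ ν := (Equiv.sumCongr (Equiv.ofInjective f f.injective) (Equiv.refl C)).trans
    (Equiv.Set.sumCompl (Set.range f))
  have hcard : Fintype.card ν = Fintype.card κ + Fintype.card C := by
    rw [← Fintype.card_sum]; exact (Fintype.card_congr s).symm
  -- the kernel `N` is finite projective, of rank `#ν - #κ` at every maximal ideal, hence free
  have hb : Nonempty (Basis (Fin (Fintype.card C)) R N) := by
    refine nonempty_basis_of_flat_of_finrank_eq R N _ fun M => ?_
    have : Nontrivial R := (Ideal.Quotient.mk M.asIdeal).domain_nontrivial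
    let := Ideal.Quotient.field M.asIdeal
    have e1 := (e.baseChange R (R ⧸ M.asIdeal) _ _).trans
      (TensorProduct.prodRight R (R ⧸ M.asIdeal) (R ⧸ M.asIdeal) (κ → R) N)
    have h1 := e1.finrank_eq
    rw [finrank_prod, finrank_baseChange, finrank_baseChange, finrank_fintype_fun_eq_card,
      finrank_fintype_fun_eq_card] at h1
    omega
  obtain ⟨b⟩ := hb
  let b' := b.reindex (Fintype.equivFin C).symm
  have hs : ∀ a, s (Sum.inl a) = f a := fun a => rfl
  -- the coordinates `f a` of `L` are those of `P`, the others are coordinates on the kernel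
  let L : (ν → R) ≃ₗ[R] (ν → R) := e.trans (((LinearEquiv.refl R (κ → R)).prodCongr b'.equivFun).trans
    ((LinearEquiv.sumArrowLequivProdArrow κ C R R).symm.trans (LinearEquiv.funCongrLeft R R s.symm)))
  have hL : ∀ x a, L x (f a) = Matrix.toLin' P x a := by
    intro x a
    rw [← hs]
    simp [L, LinearEquiv.funCongrLeft_apply, LinearMap.funLeft_apply, e, splitEquiv]
  refine ⟨LinearMap.toMatrix' L.toLinearMap, LinearMap.toMatrix' L.symm.toLinearMap, ?_, ?_⟩
  · rw [← LinearMap.toMatrix'_comp, LinearEquiv.comp_coe, LinearEquiv.symm_trans_self]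
    exact LinearMap.toMatrix'_id
  · intro a
    ext j
    rw [LinearMap.toMatrix'_apply, LinearEquiv.coe_coe, hL, Matrix.toLin'_apply,
      Matrix.mulVec_single_one, Matrix.col_apply]

end Completion

/-! ### Cosets and the summands of `G̃` -/

section Cosets

variable {F : Type*} [Field F] [ValuativeRel F] [TopologicalSpace F] [IsNonarchimedeanLocalField F]
  [CharZero F] {E : Type*} [CommRing E] [Algebra F E] [IsReduced E] {σ : E ≃ₐ[F] E}
variable {ι κ : Type*} [Fintype ι] [Fintype κ] [DecidableEq ι] [DecidableEq κ]
  {ψ : AddChar F Circle} {A B : Matrix ι ι E}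

theorem mem_K_iff {W : Matrix.GeneralLinearGroup ι E} : W ∈ K F E ι ↔
    IsInt F (W : Matrix ι ι E) ∧ IsInt F ((W⁻¹ : Matrix.GeneralLinearGroup ι E) : Matrix ι ι E) := by
  constructor
  · rintro ⟨U, rfl⟩
    refine ⟨isInt_up (U : Matrix ι ι (OE F E)), ?_⟩
    rw [← map_inv]
    exact isInt_up ((U⁻¹ : Matrix.GeneralLinearGroup ι (OE F E)) : Matrix ι ι (OE F E))
  · rintro ⟨h1, h2⟩
    obtain ⟨y, hy⟩ := isInt_iff.1 h1
    obtain ⟨z, hz⟩ := isInt_iff.1 h2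
    have hyz : y * z = 1 := by
      apply up_injective
      rw [up_mul, hy, hz, up_one, ← Units.val_mul, mul_inv_cancel, Units.val_one]
    exact ⟨⟨y, z, hyz, mul_eq_one_comm.1 hyz⟩, Units.ext hy⟩

/-- The element of `GL(E)` given by a pair of inverse integral matrices lies in `K`. -/
theorem exists_mem_K {y z : Matrix ι ι (OE F E)} (hyz : y * z = 1) :
    ∃ U ∈ K F E ι, (U : Matrix ι ι E) = up y ∧
      ((U⁻¹ : Matrix.GeneralLinearGroup ι E) : Matrix ι ι E) = up z := by
  have h1 : up y * up z = 1 := by rw [← up_mul, hyz, up_one]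
  refine ⟨⟨up y, up z, h1, mul_eq_one_comm.1 h1⟩, ?_, rfl, rfl⟩
  exact mem_K_iff.2 ⟨isInt_up _, isInt_up _⟩

theorem det_act (A U : Matrix ι ι E) : (act σ A U).det = σ U.det * U.det * A.det := by
  have h1 : (adj σ U).det = σ U.det := by
    rw [adj, Matrix.det_transpose]
    exact (RingHom.map_det (σ : E →+* E) U).symm
  rw [act, Matrix.det_mul, Matrix.det_mul, h1]; ring

theorem IsInt.det_mem {M : Matrix ι ι E} (hM : IsInt F M) : M.det ∈ OE F E := by
  obtain ⟨y, rfl⟩ := isInt_iff.1 hM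
  have := (RingHom.map_det (algebraMap (OE F E) E) y).symm
  change Matrix.det (up y) = _ at this
  rw [this]
  exact y.det.2

theorem IsQuadConj.ord_norm_det_K (h : IsQuadConj σ) {U : Matrix.GeneralLinearGroup ι E}
    (hU : U ∈ K F E ι) : ord F (Algebra.norm F (U : Matrix ι ι E).det) = 0 := by
  obtain ⟨h1, h2⟩ := mem_K_iff.1 hU
  refine h.ord_norm_eq_zero h1.det_mem h2.det_mem ?_
  rw [← Matrix.det_mul, ← Units.val_mul, mul_inv_cancel, Units.val_one, Matrix.det_one]

theorem IsQuadConj.eB_act (h : IsQuadConj σ) (hA : A ∈ Her σ ι) (hdet : A.det ≠ 0)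
    (U : Matrix.GeneralLinearGroup ι E) :
    eB F (act σ A (U : Matrix ι ι E)) =
      ord F (Algebra.norm F (U : Matrix ι ι E).det) + eB F A := by
  have hb := h.algebraMap_toBase (conj_det hA)
  have hb0 : toBase F A.det ≠ 0 := by
    intro h0; rw [h0, map_zero] at hb; exact hdet hb.symm
  have hN : Algebra.norm F (U : Matrix ι ι E).det ≠ 0 := by
    refine norm_ne_zero_of_isUnit ?_
    exact (Matrix.isUnit_iff_isUnit_det _).1 U.isUnit
  have h1 : (act σ A (U : Matrix ι ι E)).det =
      algebraMap F E (Algebra.norm F (U : Matrix ι ι E).det * toBase F A.det) := by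
    rw [det_act, map_mul, hb, h.algebraMap_norm, mul_comm (σ _)]
  rw [eB, eB, h1, h.toBase_algebraMap, ord_mul hN hb0]
  ring

/-- `F̃` is invariant under unimodular substitutions. -/
theorem IsQuadConj.Ftilde_act_K (h : IsQuadConj σ) (hψ : IsUnramifiedChar ψ) (hA : A ∈ Her σ ι)
    (hdet : A.det ≠ 0) {U : Matrix.GeneralLinearGroup ι E} (hU : U ∈ K F E ι) (X : ℂ) :
    Ftilde σ ψ (act σ A (U : Matrix ι ι E)) X = Ftilde σ ψ A X := by
  rw [Ftilde, Ftilde, h.eB_act hA hdet, h.ord_norm_det_K hU, zero_add]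
  obtain ⟨u, rfl⟩ := hU
  have h1 := (h.siegelPoly_act hψ hA (u.mul_inv : (u : Matrix ι ι (OE F E)) * _ = 1)).2
  change _ * Polynomial.eval _ (siegelPoly σ ψ (act σ A (up (u : Matrix ι ι (OE F E))))) = _
  rw [h1]

theorem act_act (A U V : Matrix ι ι E) : act σ (act σ A U) V = act σ A (U * V) := by
  have h1 : adj σ (U * V) = adj σ V * adj σ U := cT_mul σ U V
  rw [act, act, act, h1]
  simp only [Matrix.mul_assoc]

variable (F) in
/-- The part of the summand of `G̃` that depends on the coset. -/
def gTerm (σ : E ≃ₐ[F] E) (ψ : AddChar F Circle) (A : Matrix ι ι E) (X t : ℂ)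
    (W : Matrix.GeneralLinearGroup ι E) : ℂ :=
  t ^ ord F (Algebra.norm F (W : Matrix ι ι E).det) *
    Ftilde σ ψ (act σ A ((W⁻¹ : Matrix.GeneralLinearGroup ι E) : Matrix ι ι E)) X

theorem det_act_ne_zero (hdet : A.det ≠ 0) (U : Matrix.GeneralLinearGroup ι E) :
    (act σ A (U : Matrix ι ι E)).det ≠ 0 := by
  have hU : IsUnit (U : Matrix ι ι E).det := (Matrix.isUnit_iff_isUnit_det _).1 U.isUnit
  rw [det_act]
  exact fun h0 => hdet (((hU.map σ).mul hU).mul_right_eq_zero.1 h0)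

theorem IsQuadConj.gTerm_mul (h : IsQuadConj σ) (hψ : IsUnramifiedChar ψ) (hA : A ∈ Her σ ι)
    (hdet : A.det ≠ 0) {U : Matrix.GeneralLinearGroup ι E} (hU : U ∈ K F E ι)
    (W : Matrix.GeneralLinearGroup ι E) (X t : ℂ) :
    gTerm F σ ψ A X t (U * W) = gTerm F σ ψ A X t W := by
  have hUd := (Matrix.isUnit_iff_isUnit_det _).1 U.isUnit
  have hWd := (Matrix.isUnit_iff_isUnit_det _).1 W.isUnit
  rw [gTerm, gTerm, Units.val_mul, Matrix.det_mul, map_mul,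
    ord_mul (norm_ne_zero_of_isUnit hUd) (norm_ne_zero_of_isUnit hWd), h.ord_norm_det_K hU,
    zero_add, mul_inv_rev, Units.val_mul, ← act_act,
    h.Ftilde_act_K hψ (h.act_mem_Her hA _) (det_act_ne_zero hdet _) (inv_mem hU)]

/-- The value at the chosen representative of a coset is the value at any representative. -/
theorem IsQuadConj.gTerm_out (h : IsQuadConj σ) (hψ : IsUnramifiedChar ψ) (hA : A ∈ Her σ ι)
    (hdet : A.det ≠ 0) (W : Matrix.GeneralLinearGroup ι E) (X t : ℂ) :
    gTerm F σ ψ A X t (Quotient.out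
      (Quotient.mk (QuotientGroup.rightRel (K F E ι)) W)) = gTerm F σ ψ A X t W := by
  have h1 := Quotient.mk_out (s := QuotientGroup.rightRel (K F E ι)) W
  have h2 := QuotientGroup.rightRel_apply.1 h1
  set W' := Quotient.out (Quotient.mk (QuotientGroup.rightRel (K F E ι)) W)
  have h3 := h.gTerm_mul hψ hA hdet h2 W' X t
  rw [inv_mul_cancel_right] at h3
  exact h3.symm

theorem Gtilde_eq (π : Eˣ) (A : Matrix ι ι E) (X t : ℂ) : Gtilde σ ψ π A X t =
    ∑ i ∈ Finset.range (Fintype.card ι + 1), ∑ᶠ c ∈ cosets F ι π i,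
      ((-1) ^ i * (qE F E : ℂ) ^ (i * (i - 1) / 2)) * gTerm F σ ψ A X t (Quotient.out c) := by
  simp only [Gtilde, gTerm, mul_assoc]

theorem cosets_eq_empty (π : Eˣ) {i : ℕ} (hi : Fintype.card ι < i) : cosets F ι π i = ∅ := by
  rw [cosets, Set.image_eq_empty, Set.eq_empty_iff_forall_notMem]
  rintro W ⟨s, hs, -⟩
  have := s.card_le_univ
  omega

/-- The matrix `1 ⊥ W`. -/
def onePerp (κ : Type*) [Fintype κ] [DecidableEq κ] (W : Matrix.GeneralLinearGroup ι E) :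
    Matrix.GeneralLinearGroup (κ ⊕ ι) E where
  val := perp 1 (W : Matrix ι ι E)
  inv := perp 1 ((W⁻¹ : Matrix.GeneralLinearGroup ι E) : Matrix ι ι E)
  val_inv := by
    rw [perp, perp, Matrix.fromBlocks_multiply, ← Units.val_mul, mul_inv_cancel]
    simp
  inv_val := by
    rw [perp, perp, Matrix.fromBlocks_multiply, ← Units.val_mul, inv_mul_cancel]
    simp

theorem onePerp_val (W : Matrix.GeneralLinearGroup ι E) :
    ((onePerp κ W : Matrix.GeneralLinearGroup (κ ⊕ ι) E) : Matrix (κ ⊕ ι) (κ ⊕ ι) E) =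
      perp 1 (W : Matrix ι ι E) := rfl

theorem onePerp_inv (W : Matrix.GeneralLinearGroup ι E) :
    (((onePerp κ W)⁻¹ : Matrix.GeneralLinearGroup (κ ⊕ ι) E) : Matrix (κ ⊕ ι) (κ ⊕ ι) E) =
      perp 1 ((W⁻¹ : Matrix.GeneralLinearGroup ι E) : Matrix ι ι E) := rfl

theorem onePerp_mul (W W' : Matrix.GeneralLinearGroup ι E) :
    onePerp κ (W * W') = onePerp κ W * onePerp κ W' := by
  ext1
  rw [Units.val_mul, onePerp_val, onePerp_val, onePerp_val, Units.val_mul, perp, perp, perp,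
    Matrix.fromBlocks_multiply]
  simp

theorem onePerp_mul_inv (W W' : Matrix.GeneralLinearGroup ι E) :
    onePerp κ W * (onePerp κ W')⁻¹ = onePerp κ (W * W'⁻¹) := by
  rw [onePerp_mul]
  congr 1

theorem isInt_perp_one {M : Matrix ι ι E} :
    IsInt F (perp (1 : Matrix κ κ E) M) ↔ IsInt F M := by
  rw [perp, isInt_fromBlocks]
  exact ⟨fun h => h.2.2.2, fun h => ⟨isInt_one, isInt_zero, isInt_zero, h⟩⟩

theorem onePerp_mem_K {W : Matrix.GeneralLinearGroup ι E} :
    onePerp κ W ∈ K F E (κ ⊕ ι) ↔ W ∈ K F E ι := by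
  rw [mem_K_iff, mem_K_iff, onePerp_val, onePerp_inv, isInt_perp_one, isInt_perp_one]

theorem mk_onePerp_eq_iff {W W' : Matrix.GeneralLinearGroup ι E} :
    Quotient.mk (QuotientGroup.rightRel (K F E (κ ⊕ ι))) (onePerp κ W) =
      Quotient.mk _ (onePerp κ W') ↔
    Quotient.mk (QuotientGroup.rightRel (K F E ι)) W = Quotient.mk _ W' := by
  rw [Quotient.eq, Quotient.eq]
  change QuotientGroup.rightRel _ _ _ ↔ QuotientGroup.rightRel _ _ _
  rw [QuotientGroup.rightRel_apply, QuotientGroup.rightRel_apply, onePerp_mul_inv, onePerp_mem_K]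

theorem act_perp_onePerp_inv {Θ : Matrix κ κ E} (W : Matrix.GeneralLinearGroup ι E) :
    act σ (perp Θ B)
      (((onePerp κ W)⁻¹ : Matrix.GeneralLinearGroup (κ ⊕ ι) E) : Matrix (κ ⊕ ι) (κ ⊕ ι) E) =
    perp Θ (act σ B ((W⁻¹ : Matrix.GeneralLinearGroup ι E) : Matrix ι ι E)) := by
  have h1 : adj σ (perp (1 : Matrix κ κ E)
      ((W⁻¹ : Matrix.GeneralLinearGroup ι E) : Matrix ι ι E)) =
      perp 1 (adj σ ((W⁻¹ : Matrix.GeneralLinearGroup ι E) : Matrix ι ι E)) := by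
    change cT σ (Matrix.fromBlocks _ _ _ _) = _
    rw [cT_fromBlocks, cT_one, cT_zero, cT_zero]; rfl
  rw [onePerp_inv, act, h1, perp, perp, perp, Matrix.fromBlocks_multiply,
    Matrix.fromBlocks_multiply]
  simp [act, perp]

end Cosets

/-! ### Cancellation of elementary divisors -/

section Cancel

variable {R : Type*} [CommRing R] {κ ι : Type*} [Fintype κ] [Fintype ι] [DecidableEq κ]
  [DecidableEq ι]

/-- The determinant is congruent to `1` modulo `p`. -/
theorem isUnit_det_one_add {p : R} (hp : ∀ x : R, IsUnit (1 + p * x)) (M : Matrix ι ι R) :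
    IsUnit (1 + p • M).det := by
  have h1 : (Ideal.Quotient.mk (Ideal.span {p})) (1 + p • M).det = 1 := by
    rw [RingHom.map_det, ← Matrix.det_one (n := ι)]
    congr 1
    ext i j
    have h2 : (Ideal.Quotient.mk (Ideal.span {p})) p = 0 :=
      Ideal.Quotient.eq_zero_iff_mem.2 (Ideal.mem_span_singleton_self p)
    rw [RingHom.mapMatrix_apply, Matrix.map_apply, Matrix.add_apply, Matrix.smul_apply, map_add,
      smul_eq_mul, map_mul, h2, zero_mul, add_zero, Matrix.one_apply, Matrix.one_apply]
    split_ifs <;> simp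
  rw [← map_one (Ideal.Quotient.mk (Ideal.span {p})), Ideal.Quotient.eq,
    Ideal.mem_span_singleton] at h1
  obtain ⟨x, hx⟩ := h1
  rw [sub_eq_iff_eq_add'.1 hx]
  exact hp x

theorem det_diagonal_ite (s : Finset ι) (p : R) :
    (Matrix.diagonal fun j => if j ∈ s then p else 1).det = p ^ s.card := by
  rw [Matrix.det_diagonal, Finset.prod_ite_mem, Finset.univ_inter, Finset.prod_const]

/-- Cancellation for elementary divisors that are `1` or `p`, where `p` lies in the radical of a
semilocal ring: if `1 ⊥ w` has this type, then so does `w`, with the same number of divisors `p`.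
The rows of `n` with the divisor `p` remain unimodular after the first columns, which vanish modulo
`p`, are deleted; a completion of these rows to an invertible matrix brings `w` to diagonal form. -/
theorem exists_diagonal_of_perp [Nontrivial R] [Finite (MaximalSpectrum R)] {p : R}
    (hp : ∀ x : R, IsUnit (1 + p * x)) (hp0 : p ∈ nonZeroDivisors R) {s : Finset (κ ⊕ ι)}
    {u n v : Matrix (κ ⊕ ι) (κ ⊕ ι) R} (hnu : n * u = 1) (hv : IsUnit v.det) {w : Matrix ι ι R}
    (hw : n * Matrix.fromBlocks 1 0 0 w =
      Matrix.diagonal (fun j => if j ∈ s then p else 1) * v) :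
    ∃ s' : Finset ι, s'.card = s.card ∧ ∃ n' u' v' : Matrix ι ι R, n' * u' = 1 ∧ IsUnit v'.det ∧
      n' * w = Matrix.diagonal (fun j => if j ∈ s' then p else 1) * v' := by
  classical
  have hinl : ∀ (a : s) (k : κ), n a (Sum.inl k) = p * v a (Sum.inl k) := by
    intro a k
    have h1 := congrFun (congrFun hw a) (Sum.inl k)
    rw [Matrix.diagonal_mul, if_pos a.2, Matrix.mul_apply, Fintype.sum_sum_type] at h1
    rw [← h1]
    simp [Matrix.one_apply]
  have hinr : ∀ (a : s) (j : ι), ∑ k, n a (Sum.inr k) * w k j = p * v a (Sum.inr j) := by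
    intro a j
    have h1 := congrFun (congrFun hw a) (Sum.inr j)
    rw [Matrix.diagonal_mul, if_pos a.2, Matrix.mul_apply, Fintype.sum_sum_type] at h1
    rw [← h1]
    simp
  let P : Matrix s ι R := Matrix.of fun a j => n a (Sum.inr j)
  let Q : Matrix ι s R := Matrix.of fun j a => u (Sum.inr j) a
  -- Restricted to the rows with the divisor `p`, `n u = 1` says that `P Q` is `1` up to the
  -- contribution of the first columns, which is divisible by `p`.
  have hPQ : P * Q = 1 + p • -(Matrix.of fun (a b : s) =>
      ∑ k : κ, v a (Sum.inl k) * u (Sum.inl k) b) := by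
    ext a b
    have h1 := congrFun (congrFun hnu a) b
    rw [Matrix.mul_apply, Fintype.sum_sum_type] at h1
    rw [Matrix.add_apply, Matrix.smul_apply, Matrix.neg_apply, Matrix.of_apply, smul_eq_mul,
      mul_neg, ← sub_eq_add_neg, eq_sub_iff_add_eq, Finset.mul_sum, Matrix.mul_apply]
    have h2 : (1 : Matrix s s R) a b = (1 : Matrix (κ ⊕ ι) (κ ⊕ ι) R) a b := by
      by_cases hab : a = b
      · rw [hab, Matrix.one_apply_eq, Matrix.one_apply_eq]
      · rw [Matrix.one_apply_ne hab, Matrix.one_apply_ne fun h => hab (Subtype.ext h)]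
    rw [h2, ← h1, add_comm]
    congr 1
    refine Finset.sum_congr rfl fun k _ => ?_
    rw [hinl]; ring
  have hdet : IsUnit (P * Q).det := by rw [hPQ]; exact isUnit_det_one_add hp _
  have hPQ1 : P * (Q * (P * Q)⁻¹) = 1 := by
    rw [← Matrix.mul_assoc, Matrix.mul_nonsing_inv _ hdet]
  have hcard : Fintype.card s ≤ Fintype.card ι := by
    refine card_le_of_surjective R (Matrix.toLin' P) fun y => ⟨(Q * (P * Q)⁻¹).mulVec y, ?_⟩
    rw [Matrix.toLin'_apply, Matrix.mulVec_mulVec, hPQ1, Matrix.one_mulVec]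
  obtain ⟨f⟩ := Function.Embedding.nonempty_of_card_le hcard
  obtain ⟨n', u', hnu', hf⟩ := exists_completion hPQ1 f
  let s' : Finset ι := Finset.univ.map f
  have hs' : s'.card = s.card := by rw [Finset.card_map, Finset.card_univ, Fintype.card_coe]
  have hmem : ∀ j, j ∈ s' ↔ ∃ a, f a = j := fun j => by simp [s']
  -- the rows of `n' w` with index in `s'`, divided by `p`, and the remaining rows of `n' w`
  let v' : Matrix ι ι R := Matrix.of fun j k =>
    if hj : ∃ a, f a = j then v hj.choose (Sum.inr k) else (n' * w) j k
  have hv1 : ∀ j k (hj : ∃ a, f a = j), v' j k = v hj.choose (Sum.inr k) := fun j k hj => dif_pos hj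
  have hv2 : ∀ j k, (¬ ∃ a, f a = j) → v' j k = (n' * w) j k := fun j k hj => dif_neg hj
  have hw' : n' * w = Matrix.diagonal (fun j => if j ∈ s' then p else 1) * v' := by
    ext j k
    rw [Matrix.diagonal_mul]
    by_cases hj : ∃ a, f a = j
    · rw [if_pos ((hmem j).2 hj), hv1 j k hj, ← hinr, Matrix.mul_apply]
      refine Finset.sum_congr rfl fun l _ => ?_
      congr 1
      have h1 := congrFun (hf hj.choose) l
      rwa [hj.choose_spec] at h1
    · rw [if_neg (fun h => hj ((hmem j).1 h)), hv2 j k hj, one_mul]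
  refine ⟨s', hs', n', u', v', hnu', ?_, hw'⟩
  -- both sides have the determinant of `w` up to units, so that `v'` is invertible
  have d1 := congrArg Matrix.det hw
  have d2 := congrArg Matrix.det hw'
  have d3 := congrArg Matrix.det hnu
  rw [Matrix.det_mul, Matrix.det_fromBlocks_zero₂₁, Matrix.det_one, one_mul, Matrix.det_mul,
    det_diagonal_ite] at d1
  rw [Matrix.det_mul, Matrix.det_mul, det_diagonal_ite, hs'] at d2
  rw [Matrix.det_mul, Matrix.det_one] at d3
  have hn' : IsUnit n'.det := by
    refine IsUnit.of_mul_eq_one u'.det ?_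
    rw [← Matrix.det_mul, hnu', Matrix.det_one]
  have d4 : v'.det = n'.det * (u.det * v.det) := by
    refine mul_cancel_left_mem_nonZeroDivisors (pow_mem hp0 s.card) |>.1 ?_
    rw [← d2]
    linear_combination n'.det * u.det * d1 - n'.det * w.det * d3
  rw [d4]
  exact hn'.mul ((IsUnit.of_mul_eq_one _ ((mul_comm _ _).trans d3)).mul hv)

end Cancel

/-! ### Reduction of the cosets -/

section Reduction

variable {F : Type*} [Field F] [ValuativeRel F] [TopologicalSpace F] [IsNonarchimedeanLocalField F]
  [CharZero F] {E : Type*} [CommRing E] [Algebra F E] [IsReduced E] {σ : E ≃ₐ[F] E}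
variable {ι κ : Type*} [Fintype ι] [Fintype κ] [DecidableEq ι] [DecidableEq κ]
  {ψ : AddChar F Circle} {A B : Matrix ι ι E} {Θ : Matrix κ κ E}

/-- A semi-integral matrix takes values in the inverse different on integral vectors. -/
theorem IsQuadConj.trace_sesq_mem (h : IsQuadConj σ) (hA : IsSemiIntegral σ A) {u v : ι → E}
    (hu : ∀ i, u i ∈ OE F E) (hv : ∀ i, v i ∈ OE F E) :
    Algebra.trace F E ((fun i => σ (u i)) ⬝ᵥ A.mulVec v) ∈ 𝒪[F] := by
  have key : ∀ u v : ι → E, (A * Matrix.vecMulVec v fun i => σ (u i)).trace =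
      (fun i => σ (u i)) ⬝ᵥ A.mulVec v := by
    intro u v
    rw [Matrix.mul_vecMulVec, Matrix.trace_vecMulVec, dotProduct_comm]
  have hconj : σ ((fun i => σ (u i)) ⬝ᵥ A.mulVec v) = (fun i => σ (v i)) ⬝ᵥ A.mulVec u := by
    simp only [dotProduct, Matrix.mulVec, map_sum, map_mul, h.conj_conj, Finset.mul_sum]
    rw [Finset.sum_comm]
    refine Finset.sum_congr rfl fun i _ => Finset.sum_congr rfl fun j _ => ?_
    have : σ (A j i) = A i j := congrFun (congrFun (mem_Her.1 hA.1) i) j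
    rw [this]; ring
  let C : Matrix ι ι E := (Matrix.vecMulVec v fun i => σ (u i)) + Matrix.vecMulVec u fun i => σ (v i)
  have hC : C ∈ Her σ ι := by
    rw [mem_Her]
    ext i j
    simp only [C, cT_apply, Matrix.add_apply, Matrix.vecMulVec_apply, map_add, map_mul, h.conj_conj]
    ring
  have hCi : (⟨C, hC⟩ : Her σ ι) ∈ HerInt σ ι := fun i j =>
    add_mem (mul_mem (hv i) (conj_mem_OE σ (hu j))) (mul_mem (hu i) (conj_mem_OE σ (hv j)))
  obtain ⟨a, ha⟩ := hA.2 ⟨_, hCi⟩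
  have h1 : (A * C).trace = algebraMap F E (Algebra.trace F E
      ((fun i => σ (u i)) ⬝ᵥ A.mulVec v)) := by
    rw [h.algebraMap_trace, hconj, ← key, ← key, ← Matrix.trace_add, ← Matrix.mul_add]
  rw [h.algebraMap_injective (h1.symm.trans ha)]
  exact a.2

/-- If `(Θ ⊥ B)[W⁻¹]` is semi-integral, `W` is integral and `Θ` is modular, then the rows of `W⁻¹`
that belong to `Θ` are integral. -/
theorem IsQuadConj.row_mem (h : IsQuadConj σ) (hΘ : IsModular F Θ)
    {W : Matrix.GeneralLinearGroup (κ ⊕ ι) E}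
    (hW : IsInt F (W : Matrix (κ ⊕ ι) (κ ⊕ ι) E))
    (hS : IsSemiIntegral σ (act σ (perp Θ B)
      ((W⁻¹ : Matrix.GeneralLinearGroup (κ ⊕ ι) E) : Matrix (κ ⊕ ι) (κ ⊕ ι) E))) (a : κ)
    (j : κ ⊕ ι) :
    ((W⁻¹ : Matrix.GeneralLinearGroup (κ ⊕ ι) E) : Matrix (κ ⊕ ι) (κ ⊕ ι) E) (Sum.inl a) j ∈
      OE F E := by
  set Y := ((W⁻¹ : Matrix.GeneralLinearGroup (κ ⊕ ι) E) : Matrix (κ ⊕ ι) (κ ⊕ ι) E) with hY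
  have hYW : Y * (W : Matrix (κ ⊕ ι) (κ ⊕ ι) E) = 1 := by
    rw [hY, ← Units.val_mul, inv_mul_cancel, Units.val_one]
  refine (hΘ fun a => Y (Sum.inl a) j).1 (fun w hw => ?_) a
  -- The vector `W w'` is integral; pairing it with the `j`-th unit vector under `(Θ ⊥ B)[W⁻¹]`
  -- gives `w Θ` times the `j`-th column of the upper rows of `W⁻¹`.
  set w' : κ ⊕ ι → E := Sum.elim (fun k => σ (w k)) 0 with hw'
  have hw'i : ∀ i, w' i ∈ OE F E := by
    rintro (i | i)
    exacts [conj_mem_OE σ (hw i), zero_mem _]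
  set u := (W : Matrix (κ ⊕ ι) (κ ⊕ ι) E).mulVec w' with hu
  have hui : ∀ i, u i ∈ OE F E := fun i => sum_mem fun k _ => mul_mem (hW i k) (hw'i k)
  have h1 := h.trace_sesq_mem hS hui (v := Pi.single j 1) (fun i => by
    rw [Pi.single_apply]; split_ifs; exacts [one_mem _, zero_mem _])
  have h2 : Matrix.vecMul (fun i => σ (u i)) (adj σ Y) = Sum.elim w 0 := by
    have e1 : Matrix.vecMul (fun i => σ (u i)) (adj σ Y) = fun i => σ (Y.mulVec u i) := by
      ext i
      simp [Matrix.vecMul, Matrix.mulVec, dotProduct, adj, mul_comm]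
    rw [e1, hu, Matrix.mulVec_mulVec, hYW, Matrix.one_mulVec]
    ext (i | i)
    · exact h.conj_conj _
    · exact map_zero σ
  have h3 : (fun i => σ (u i)) ⬝ᵥ (act σ (perp Θ B) Y).mulVec (Pi.single j 1) =
      w ⬝ᵥ Θ.mulVec fun a => Y (Sum.inl a) j := by
    rw [act, ← Matrix.mulVec_mulVec, ← Matrix.mulVec_mulVec, Matrix.dotProduct_mulVec, h2,
      Matrix.mulVec_single_one, perp, Matrix.fromBlocks_mulVec, dotProduct, Fintype.sum_sum_type]
    simp [dotProduct]
    rfl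
  rwa [h3] at h1

theorem isInt_diagonal {π : E} (hπ : π ∈ OE F E) (s : Finset ι) :
    IsInt F (Matrix.diagonal fun j => if j ∈ s then π else 1) := by
  intro i j
  rw [Matrix.diagonal_apply]
  split_ifs
  exacts [hπ, one_mem _, zero_mem _]

theorem isInt_of_mem_D {π : Eˣ} (hπ : (π : E) ∈ OE F E) {i : ℕ}
    {W : Matrix.GeneralLinearGroup ι E} (hW : W ∈ D F ι π i) : IsInt F (W : Matrix ι ι E) := by
  obtain ⟨s, -, U, hU, V, hV, h1⟩ := hW
  rw [h1]
  exact ((mem_K_iff.1 hU).1.mul (isInt_diagonal hπ s)).mul (mem_K_iff.1 hV).1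

theorem mul_mem_D {π : Eˣ} {i : ℕ} {U W : Matrix.GeneralLinearGroup ι E} (hU : U ∈ K F E ι)
    (hW : W ∈ D F ι π i) : U * W ∈ D F ι π i := by
  obtain ⟨s, hs, U', hU', V, hV, h1⟩ := hW
  refine ⟨s, hs, U * U', mul_mem hU hU', V, hV, ?_⟩
  rw [Units.val_mul, h1, Units.val_mul]
  simp only [Matrix.mul_assoc]

/-- A coset that contributes to `G̃(Θ ⊥ B)` is represented by a matrix `1 ⊥ W'`. -/
theorem IsQuadConj.exists_mul_eq_onePerp (h : IsQuadConj σ) (hΘ : IsModular F Θ)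
    {W : Matrix.GeneralLinearGroup (κ ⊕ ι) E}
    (hW : IsInt F (W : Matrix (κ ⊕ ι) (κ ⊕ ι) E))
    (hS : IsSemiIntegral σ (act σ (perp Θ B)
      ((W⁻¹ : Matrix.GeneralLinearGroup (κ ⊕ ι) E) : Matrix (κ ⊕ ι) (κ ⊕ ι) E))) :
    ∃ U ∈ K F E (κ ⊕ ι), ∃ W' : Matrix.GeneralLinearGroup ι E, U * W = onePerp κ W' := by
  have := h.finite_maximalSpectrum
  have hrow := h.row_mem hΘ hW hS
  set Y := ((W⁻¹ : Matrix.GeneralLinearGroup (κ ⊕ ι) E) : Matrix (κ ⊕ ι) (κ ⊕ ι) E) with hY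
  have hYW : Y * (W : Matrix (κ ⊕ ι) (κ ⊕ ι) E) = 1 := by
    rw [hY, ← Units.val_mul, inv_mul_cancel, Units.val_one]
  obtain ⟨w, hw⟩ := isInt_iff.1 hW
  let P : Matrix κ (κ ⊕ ι) (OE F E) := Matrix.of fun a j => ⟨Y (Sum.inl a) j, hrow a j⟩
  have hPw : ∀ a j, (P * w) a j = (1 : Matrix (κ ⊕ ι) (κ ⊕ ι) (OE F E)) (Sum.inl a) j := by
    intro a j
    apply Subtype.ext
    have h1 := congrFun (congrFun hYW (Sum.inl a)) j
    rw [← up_one (F := F), up_apply] at h1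
    rw [← h1, ← hw, Matrix.mul_apply, Matrix.mul_apply, AddSubmonoidClass.coe_finsetSum]
    rfl
  -- the upper rows `P` of `W⁻¹` are unimodular because `P W = (1 0)`
  have hPQ : P * w.submatrix id Sum.inl = 1 := by
    ext1 a b
    have h1 : (P * w.submatrix id Sum.inl) a b = (P * w) a (Sum.inl b) := rfl
    rw [h1, hPw]
    by_cases hab : a = b
    · rw [hab, Matrix.one_apply_eq, Matrix.one_apply_eq]
    · rw [Matrix.one_apply_ne hab, Matrix.one_apply_ne fun h => hab (Sum.inl_injective h)]
  obtain ⟨V, V', hVV, hV⟩ := exists_completion hPQ Function.Embedding.inl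
  have hVw : V * w = Matrix.fromBlocks 1 0 (V * w).toBlocks₂₁ (V * w).toBlocks₂₂ := by
    ext1 (a | a) j
    · have e1 : (V * w) (Sum.inl a) j = (P * w) a j := by
        rw [Matrix.mul_apply, Matrix.mul_apply, ← hV a]; rfl
      rw [e1, hPw]
      rcases j with j | j <;> simp [Matrix.one_apply]
    · rcases j with j | j <;> rfl
  set Z := (V * w).toBlocks₂₁
  set w' := (V * w).toBlocks₂₂
  -- `V W` is block lower triangular; a further integral row operation clears the block `Z`
  have hT : Matrix.fromBlocks (1 : Matrix κ κ (OE F E)) 0 (-Z) (1 : Matrix ι ι (OE F E)) *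
      Matrix.fromBlocks 1 0 Z 1 = 1 := by
    rw [Matrix.fromBlocks_multiply]; simp
  obtain ⟨U, hU, hU1, -⟩ := exists_mem_K (F := F) (E := E)
    (y := Matrix.fromBlocks (1 : Matrix κ κ (OE F E)) 0 (-Z) (1 : Matrix ι ι (OE F E)) * V)
    (z := V' * Matrix.fromBlocks 1 0 Z 1)
    (by rw [Matrix.mul_assoc, ← Matrix.mul_assoc V, hVV, Matrix.one_mul, hT])
  have hUW : ((U * W : Matrix.GeneralLinearGroup (κ ⊕ ι) E) : Matrix (κ ⊕ ι) (κ ⊕ ι) E) =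
      perp 1 (up w') := by
    rw [Units.val_mul, hU1, ← hw, ← up_mul, Matrix.mul_assoc, hVw, Matrix.fromBlocks_multiply,
      up_fromBlocks]
    simp [up_one, up_zero, perp]
  have hdet : IsUnit (up w').det := by
    have h1 := (Matrix.isUnit_iff_isUnit_det _).1 (U * W).isUnit
    rwa [hUW, perp, Matrix.det_fromBlocks_zero₂₁, Matrix.det_one, one_mul] at h1
  exact ⟨U, hU, Matrix.GeneralLinearGroup.mk'' (up w') hdet, Units.ext hUW⟩

theorem up_diagonal (p : OE F E) (s : Finset ι) :
    up (Matrix.diagonal fun j => if j ∈ s then p else 1) =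
      Matrix.diagonal fun j => if j ∈ s then (p : E) else 1 := by
  ext i j
  rw [up_apply, Matrix.diagonal_apply, Matrix.diagonal_apply]
  split_ifs <;> rfl

/-- The double coset of `1 ⊥ W` determines that of `W` by cancellation of elementary divisors. -/
theorem IsQuadConj.onePerp_mem_D (h : IsQuadConj σ) {π : Eˣ} (hπ : (π : E) ∈ OE F E)
    (hrad : ∀ x ∈ OE F E, ∃ v ∈ OE F E, (1 + π * x) * v = 1) {i : ℕ}
    {W : Matrix.GeneralLinearGroup ι E} : onePerp κ W ∈ D F (κ ⊕ ι) π i ↔ W ∈ D F ι π i := by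
  classical
  constructor
  · intro hD
    have := h.finite_maximalSpectrum
    have := h.nontrivial
    obtain ⟨w, hw⟩ := isInt_iff.1 (isInt_perp_one.1 (isInt_of_mem_D hπ hD))
    obtain ⟨s, hs, _, ⟨u, rfl⟩, _, ⟨v, rfl⟩, h1⟩ := hD
    let p : OE F E := ⟨π, hπ⟩
    have hp : ∀ x : OE F E, IsUnit (1 + p * x) := by
      intro x
      obtain ⟨y, hy, hxy⟩ := hrad x x.2
      exact IsUnit.of_mul_eq_one ⟨y, hy⟩ (Subtype.ext hxy)
    have hp0 : p ∈ nonZeroDivisors (OE F E) := by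
      rw [mem_nonZeroDivisors_iff_right]
      intro x hx
      exact Subtype.ext (π.isUnit.mul_left_eq_zero.1 (congrArg Subtype.val hx))
    have hvd : IsUnit (v : Matrix (κ ⊕ ι) (κ ⊕ ι) (OE F E)).det :=
      (Matrix.isUnit_iff_isUnit_det _).1 v.isUnit
    have h2 : Matrix.fromBlocks 1 0 0 w = (u : Matrix (κ ⊕ ι) (κ ⊕ ι) (OE F E)) *
        (Matrix.diagonal fun j => if j ∈ s then p else 1) *
          (v : Matrix (κ ⊕ ι) (κ ⊕ ι) (OE F E)) := by
      apply up_injective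
      rw [up_mul, up_mul, up_diagonal, up_fromBlocks, hw, up_one, up_zero, up_zero]
      exact h1
    have hnu : ((u⁻¹ : Matrix.GeneralLinearGroup (κ ⊕ ι) (OE F E)) :
        Matrix (κ ⊕ ι) (κ ⊕ ι) (OE F E)) * u = 1 := u.inv_mul
    obtain ⟨s', hs', n', u', v', hnu', hv', hw'⟩ :=
      exists_diagonal_of_perp (s := s) hp hp0 hnu hvd (w := w) (by
        rw [h2, ← Matrix.mul_assoc, ← Matrix.mul_assoc, hnu, Matrix.one_mul])
    have hun' : u' * n' = 1 := mul_eq_one_comm.1 hnu'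
    obtain ⟨U, hU, hU1, -⟩ := exists_mem_K (F := F) (E := E) hun'
    obtain ⟨V, hV, hV1, -⟩ := exists_mem_K (F := F) (E := E) (Matrix.mul_nonsing_inv v' hv')
    refine ⟨s', hs'.trans hs, U, hU, V, hV, ?_⟩
    have h3 : w = u' * (Matrix.diagonal fun j => if j ∈ s' then p else 1) * v' := by
      rw [Matrix.mul_assoc, ← hw', ← Matrix.mul_assoc, hun', Matrix.one_mul]
    rw [hU1, hV1, ← hw, h3, up_mul, up_mul, up_diagonal]
  · rintro ⟨s, hs, U, hU, V, hV, h1⟩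
    refine ⟨s.map Function.Embedding.inr, by rw [Finset.card_map, hs], onePerp κ U,
      onePerp_mem_K.2 hU, onePerp κ V, onePerp_mem_K.2 hV, ?_⟩
    have h2 : (Matrix.diagonal fun j : κ ⊕ ι =>
        if j ∈ s.map Function.Embedding.inr then (π : E) else 1) =
        Matrix.fromBlocks 1 0 0 (Matrix.diagonal fun j => if j ∈ s then (π : E) else 1) := by
      rw [← Matrix.diagonal_one, Matrix.fromBlocks_diagonal]
      congr 1
      ext (j | j) <;> simp
    rw [h2, onePerp_val, onePerp_val, onePerp_val, h1, perp, perp, perp,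
      Matrix.fromBlocks_multiply, Matrix.fromBlocks_multiply]
    simp

end Reduction

/-! ### Splitting off `Θ_k` from `G̃` -/

section GtildeSplit

variable {F : Type*} [Field F] [ValuativeRel F] [TopologicalSpace F] [IsNonarchimedeanLocalField F]
  [CharZero F] {E : Type*} [CommRing E] [Algebra F E] [IsReduced E] {σ : E ≃ₐ[F] E}
variable {ι κ : Type*} [Fintype ι] [Fintype κ] [DecidableEq ι] [DecidableEq κ]
  {ψ : AddChar F Circle} {A B : Matrix ι ι E} {Θ : Matrix κ κ E}

/-- On the double coset `D_i` the order of the norm of the determinant is constant. -/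
theorem IsQuadConj.ord_norm_det_D (h : IsQuadConj σ) {π : Eˣ} {i : ℕ}
    {W : Matrix.GeneralLinearGroup ι E} (hW : W ∈ D F ι π i) :
    ord F (Algebra.norm F (W : Matrix ι ι E).det) = i * ord F (Algebra.norm F (π : E)) := by
  obtain ⟨s, hs, U, hU, V, hV, h1⟩ := hW
  have hUd := norm_ne_zero_of_isUnit (F := F) ((Matrix.isUnit_iff_isUnit_det _).1 U.isUnit)
  have hVd := norm_ne_zero_of_isUnit (F := F) ((Matrix.isUnit_iff_isUnit_det _).1 V.isUnit)
  have hπ := norm_ne_zero_of_isUnit (F := F) π.isUnit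
  rw [h1, Matrix.det_mul, Matrix.det_mul, det_diagonal_ite, map_mul, map_mul, map_pow,
    ord_mul (mul_ne_zero hUd (pow_ne_zero _ hπ)) hVd, ord_mul hUd (pow_ne_zero _ hπ),
    h.ord_norm_det_K hU, h.ord_norm_det_K hV, ord_pow hπ, hs]
  ring

theorem out_mem_D {π : Eˣ} {i : ℕ} {c : Quotient (QuotientGroup.rightRel (K F E ι))}
    (hc : c ∈ cosets F ι π i) : Quotient.out c ∈ D F ι π i := by
  obtain ⟨W, hW, rfl⟩ := hc
  have h1 := Quotient.mk_out (s := QuotientGroup.rightRel (K F E ι)) W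
  have h2 := mul_mem_D (inv_mem (QuotientGroup.rightRel_apply.1 h1)) hW
  rwa [mul_inv_rev, inv_inv, inv_mul_cancel_right] at h2

theorem isSemiIntegral_of_gTerm_ne_zero {W : Matrix.GeneralLinearGroup ι E} {X t : ℂ}
    (hW : gTerm F σ ψ A X t W ≠ 0) : IsSemiIntegral σ
      (act σ A ((W⁻¹ : Matrix.GeneralLinearGroup ι E) : Matrix ι ι E)) := by
  by_contra hn
  apply hW
  rw [gTerm, Ftilde, siegelPoly_eq_zero fun h1 => hn h1.1, eval_zero, mul_zero, mul_zero]

/-- The sum over the cosets for `Θ ⊥ B` reduces to the cosets of the matrices `1 ⊥ W`. -/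
theorem IsQuadConj.finsum_cosets_perp (h : IsQuadConj σ) (hψ : IsUnramifiedChar ψ)
    (hΘ : IsModular F Θ) (hA : perp Θ B ∈ Her σ (κ ⊕ ι)) (hdet : (perp Θ B).det ≠ 0) {π : Eˣ}
    (hπ : (π : E) ∈ OE F E) (hrad : ∀ x ∈ OE F E, ∃ v ∈ OE F E, (1 + π * x) * v = 1) (i : ℕ)
    (X t a : ℂ) :
    ∑ᶠ c ∈ cosets F (κ ⊕ ι) π i, a * gTerm F σ ψ (perp Θ B) X t (Quotient.out c) =
      ∑ᶠ c ∈ cosets F ι π i, a * gTerm F σ ψ (perp Θ B) X t (onePerp κ (Quotient.out c)) := by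
  let φ : Quotient (QuotientGroup.rightRel (K F E ι)) →
      Quotient (QuotientGroup.rightRel (K F E (κ ⊕ ι))) :=
    fun c => Quotient.mk _ (onePerp κ (Quotient.out c))
  have hφ : ∀ W, φ (Quotient.mk _ W) = Quotient.mk _ (onePerp κ W) := fun W =>
    mk_onePerp_eq_iff.2 (Quotient.out_eq _)
  have hinj : Function.Injective φ := by
    intro c c' hc
    have := mk_onePerp_eq_iff.1 hc
    rwa [Quotient.out_eq, Quotient.out_eq] at this
  have h1 : ∀ c, a * gTerm F σ ψ (perp Θ B) X t (onePerp κ (Quotient.out c)) =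
      a * gTerm F σ ψ (perp Θ B) X t (Quotient.out (φ c)) := fun c => by
    rw [h.gTerm_out hψ hA hdet]
  simp only [h1]
  rw [← finsum_mem_image (f := fun c => a * gTerm F σ ψ (perp Θ B) X t (Quotient.out c))
    hinj.injOn]
  -- a coset outside the image contributes zero
  apply finsum_mem_inter_support_eq
  ext c
  refine and_congr_left fun hc => ?_
  constructor
  · rintro ⟨W, hW, rfl⟩
    have hc' := right_ne_zero_of_mul (Function.mem_support.1 hc)
    rw [h.gTerm_out hψ hA hdet] at hc'
    obtain ⟨U, hU, W', hW'⟩ := h.exists_mul_eq_onePerp hΘ (isInt_of_mem_D hπ hW)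
      (isSemiIntegral_of_gTerm_ne_zero hc')
    have hD : onePerp κ W' ∈ D F (κ ⊕ ι) π i := hW' ▸ mul_mem_D hU hW
    refine ⟨Quotient.mk _ W', ⟨W', (h.onePerp_mem_D hπ hrad).1 hD, rfl⟩, ?_⟩
    rw [hφ, Quotient.eq]
    change QuotientGroup.rightRel _ _ _
    rw [QuotientGroup.rightRel_apply, ← hW', mul_inv_rev, mul_inv_cancel_left]
    exact inv_mem hU
  · rintro ⟨_, ⟨W', hW', rfl⟩, rfl⟩
    exact ⟨_, (h.onePerp_mem_D hπ hrad).2 hW', (hφ W').symm⟩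

/-- The rescaling of `F̃` involves `ord det (B[W⁻¹])`, the sum of `ord det B` and `ord N(det W⁻¹)`;
the latter is absorbed into the rescaling of `t`. -/
theorem IsQuadConj.gTerm_onePerp (h : IsQuadConj σ) (hψ : IsUnramifiedChar ψ) {ϖ : F} {ϖE : Eˣ}
    (hϖ : ArePrimeElements F ϖ ϖE) {π : Eˣ} (hπ : π = ϖE ∨ (π : E) = algebraMap F E ϖ) {k : ℕ}
    (hk : IsRamified F E → Even k) (hB : B ∈ Her σ ι) (hdet : B.det ≠ 0) {i : ℕ}
    {W : Matrix.GeneralLinearGroup ι E} (hW : W ∈ D F ι π i) (X t : ℂ) :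
    gTerm F σ ψ (perp (Theta σ ϖE k) B) X t (onePerp (Fin k) W) =
      gTerm F σ ψ B (xiHat F E ^ k * X) (xiHat F E ^ k * t) W *
        xiHat F E ^ ((k : ℤ) * ord F (toBase F B.det)) := by
  have hϖE : IsRamified F E → ord F (Algebra.norm F (ϖE : E)) = 1 := fun hr => by
    rw [hϖ.2.1 hr, hϖ.1]
  have hd := det_act_ne_zero (σ := σ) hdet W⁻¹
  rw [gTerm, gTerm, act_perp_onePerp_inv, onePerp_val, perp, Matrix.det_fromBlocks_zero₂₁,
    Matrix.det_one, one_mul, h.Ftilde_perp hψ hϖE hk (h.act_mem_Her hB _) hd, h.eB_act hB hdet]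
  by_cases hram : IsRamified F E
  · simp [xiHat_of_isRamified hram]
  · have hξ : xiHat F E ^ 4 = 1 := by
      have := h.xi_sq hram
      rwa [h.xi_eq_xiHat_sq hram, ← pow_mul] at this
    have hπϖ : (π : E) = algebraMap F E ϖ := by
      rcases hπ with rfl | hπ
      exacts [hϖ.2.2 hram, hπ]
    -- Since `ξ̂ ^ 4 = 1` and `ord N(det W) = 2 i`, the exponents `-2 i` and `2 i` give the same
    -- factor.
    have ho : ord F (Algebra.norm F (W : Matrix ι ι E).det) = 2 * i := by
      rw [h.ord_norm_det_D hW, hπϖ, h.norm_algebraMap, ord_pow (ord_eq_one_ne_zero hϖ.1), hϖ.1]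
      push_cast; ring
    have ho' : ord F (Algebra.norm F ((W⁻¹ : Matrix.GeneralLinearGroup ι E) : Matrix ι ι E).det) =
        -(2 * i) := by
      have hW0 := norm_ne_zero_of_isUnit (F := F) ((Matrix.isUnit_iff_isUnit_det _).1 W.isUnit)
      have hW1 := norm_ne_zero_of_isUnit (F := F) ((Matrix.isUnit_iff_isUnit_det _).1 W⁻¹.isUnit)
      have e := ord_mul hW0 hW1
      rw [← map_mul, ← Matrix.det_mul, ← Units.val_mul, mul_inv_cancel, Units.val_one,
        Matrix.det_one, map_one, ord_one, ho] at e
      omega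
    have hx : xiHat F E ^ k ≠ 0 := pow_ne_zero _ xiHat_ne_zero
    have key : (xiHat F E ^ k) ^ (-(2 * i : ℤ)) = (xiHat F E ^ k) ^ (2 * i : ℤ) := by
      rw [zpow_neg]
      refine (eq_inv_of_mul_eq_one_left ?_).symm
      rw [← zpow_add₀ hx, ← zpow_natCast, ← zpow_mul,
        show (k : ℤ) * (2 * i + 2 * i) = (4 : ℕ) * (k * i) by push_cast; ring, zpow_mul,
        zpow_natCast, hξ, one_zpow]
    have e : xiHat F E ^ ((k : ℤ) * ord F (toBase F B.det)) =
        (xiHat F E ^ k) ^ ord F (toBase F B.det) := by rw [zpow_mul, zpow_natCast]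
    rw [ho, ho', zpow_add₀ hx, key, mul_zpow, eB, f_eq_zero h hram, e]
    simp only [Nat.cast_zero, zero_mul, zero_add]
    ring

/-- Splitting off `Θ_k` from the argument of `G̃`. -/
theorem IsQuadConj.Gtilde_perp_Theta (h : IsQuadConj σ) (hψ : IsUnramifiedChar ψ) {ϖ : F} {ϖE : Eˣ}
    (hϖ : ArePrimeElements F ϖ ϖE) {π : Eˣ} (hπ : π = ϖE ∨ (π : E) = algebraMap F E ϖ) {k : ℕ}
    (hk : IsRamified F E → Even k) (hB : B ∈ Her σ ι) (hdet : B.det ≠ 0) (X t : ℂ) :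
    Gtilde σ ψ π (perp (Theta σ ϖE k) B) X t =
      Gtilde σ ψ π B (xiHat F E ^ k * X) (xiHat F E ^ k * t) *
        xiHat F E ^ ((k : ℤ) * ord F (toBase F B.det)) := by
  have hϖE : IsRamified F E → ord F (Algebra.norm F (ϖE : E)) = 1 := fun hr => by
    rw [hϖ.2.1 hr, hϖ.1]
  have hΘ := h.isSelfDual_Theta hψ hϖE hk
  have hd : (perp (Theta σ ϖE k) B).det ≠ 0 := by
    obtain ⟨a, ha, hdΘ, -⟩ := h.exists_det_Theta hϖE hk
    rw [perp, Matrix.det_fromBlocks_zero₂₁, hdΘ]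
    exact fun h0 => hdet (((isUnit_iff_ne_zero.2 ha).map (algebraMap F E)).mul_right_eq_zero.1 h0)
  obtain ⟨hπ1, hrad⟩ := h.prime_mem_radical hϖ hπ
  rw [Gtilde_eq, Gtilde_eq, Finset.sum_mul, Fintype.card_sum]
  have hsub : Finset.range (Fintype.card ι + 1) ⊆
      Finset.range (Fintype.card (Fin k) + Fintype.card ι + 1) := by
    intro i hi
    rw [Finset.mem_range] at *
    omega
  simp only [h.finsum_cosets_perp hψ hΘ.modular (h.perp_mem_Her hΘ.semi.1 hB) hd hπ1 hrad]
  rw [← Finset.sum_subset hsub]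
  · refine Finset.sum_congr rfl fun i _ => ?_
    rw [finsum_mem_mul]
    refine finsum_mem_congr rfl fun c hc => ?_
    rw [h.gTerm_onePerp hψ hϖ hπ hk hB hdet (out_mem_D hc)]
    ring
  -- the larger values of `i` contribute nothing on either side
  · intro i _ hi
    rw [cosets_eq_empty π (by rw [Finset.mem_range] at hi; omega), finsum_mem_empty]

theorem IsStar.mem_Her (hB : IsStar σ B) : B ∈ Her σ ι := by
  rcases hB with ⟨-, a, -, A', hA', rfl⟩ | ⟨-, hB, -⟩
  · rw [HermSiegel.mem_Her]
    ext i j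
    have h1 : σ (A' j i) = A' i j := congrFun (congrFun (HermSiegel.mem_Her.1 hA'.1) i) j
    rw [cT_apply, Matrix.smul_apply, Matrix.smul_apply, map_smul, h1]
  · exact hB

end GtildeSplit

end

end HermSiegel

theorem mainTheorem8
    {F : Type*} [Field F] [ValuativeRel F] [TopologicalSpace F] [IsNonarchimedeanLocalField F]
    [CharZero F]
    {E : Type*} [CommRing E] [IsReduced E] [Algebra F E] (hE : Module.finrank F E = 2)
    (σ : E ≃ₐ[F] E) (hσ : σ ≠ AlgEquiv.refl)
    (ψ : AddChar F Circle) (hψ : HermSiegel.IsUnramifiedChar ψ)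
    (ϖ : F) (ϖE : Eˣ) (hϖ : HermSiegel.ArePrimeElements F ϖ ϖE)
    (π : Eˣ) (hπ : π = ϖE ∨ (π : E) = algebraMap F E ϖ)
    (m r : ℕ) (hr : 0 < r) (hrm : r ≤ m)
    (hcase : (HermSiegel.IsRamified F E ∧ Even (m - r)) ∨ ¬ HermSiegel.IsRamified F E)
    (B : Matrix (Fin r) (Fin r) E) (hB : HermSiegel.IsStar σ B) (hdet : B.det ≠ 0)
    (X t : ℂ) (hX : X ≠ 0) :
    HermSiegel.Gtilde σ ψ π (HermSiegel.perp (HermSiegel.Theta σ ϖE (m - r)) B) X t =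
      HermSiegel.Gtilde σ ψ π B
          (HermSiegel.xiHat F E ^ (m - r) * X) (HermSiegel.xiHat F E ^ (m - r) * t) *
        HermSiegel.xiHat F E ^
          (((m - r : ℕ) : ℤ) * HermSiegel.ord F (HermSiegel.toBase F B.det)) := by
  have h : HermSiegel.IsQuadConj σ := ⟨hE, hσ⟩
  have hk : HermSiegel.IsRamified F E → Even (m - r) := fun hram =>
    hcase.elim And.right fun hn => absurd hram hn
  exact h.Gtilde_perp_Theta hψ hϖ hπ hk hB.mem_Her hdet X t
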